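/- **Setting.** Let $0<s<1$, $\gamma\ge 0$, $\mathbb T^3=(\mathbb R/2\pi\mathbb Z)^3$, $\langle\cdot\rangle=(1+|\cdot|^2)^{1/2}$; $k\in\mathbb Z^3$, $\eta\in\mathbb R^3$ are the dual variables of $x\in\mathbb T^3$, $v\in\mathbb R^3$, $\mathcal F_x$ is the partial Fourier transform in $x$, and $\langle D_x\rangle^r$, $\langle D_v\rangle^r$ are the Fourier multipliers with symbols $\langle k\rangle^r$, $\langle\eta\rangle^r$. With $\Delta_{\mathbb S^2}=\sum_{j\ne k}(v_j\partial_{v_k}-v_k\partial_{v_j})^2$ put $$|||h|||_{L^2_x}^2=\|\langle D_v\rangle^s\langle v\rangle^{\gamma/2}h\|_{L^2_{x,v}}^2+\|(-\Delta_{\mathbb S^2})^{s/2}\langle v\rangle^{\gamma/2}h\|_{L^2_{x,v}}^2 .$$ Let $\chi\in C_c^\infty(\mathbb R;[0,1])$ with $\chi=1$ on $[-1,1]$ and $\operatorname{supp}\chi\subset[-2,2]$, and for $k\in\mathbb Z^3$ let $$\psi_k(v,\eta)=\frac{2\langle v\rangle^{\frac{\gamma}{1+2s}}\,k\cdot\eta}{\langle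 k\rangle^{\frac{2+2s}{1+2s}}}\;\chi\!\left(\frac{\langle v\rangle^{\frac{\gamma}{1+2s}}\langle\eta\rangle}{\langle k\rangle^{\frac1{1+2s}}}\right).$$ The Wick quantization of a symbol $q$ is $$q^{\rm Wick}f(v)=\int_{\mathbb R^3}\!\int_{\mathbb R^3}e^{i(v-\tilde v)\cdot\eta}A_q\big(\tfrac{v+\tilde v}2,\eta\big)f(\tilde v)\,d\eta\,d\tilde v,\qquad A_q=\frac1{8\pi^6}\,q*e^{-|v|^2-|\eta|^2}.$$ **Proposition (weighted hypoelliptic estimate in $x$).** There are a bounded linear operator $P$ on $L^2(\mathbb T^3\times\mathbb R^3)$, given by $\mathcal F_x(Ph)(k,\cdot)=\psi_k^{\rm Wick}\,\mathcal F_xh(k,\cdot)$ for all $k\in\mathbb Z^3$, and a constant $C$, depending only on $s$, $\gamma$ and $\chi$, such that $$\|Ph\|_{L^2_{x,v}}\le C\|h\|_{L^2_{x,v}},\qquad |||Ph|||_{L^2_x}\le C|||h|||_{L^2_x}\qquad\text{for all }h\in L^2_{x,v},$$ and, for every $T>0$ and every $h=h(t,x,v)$ as specified below, $$\int_0^T\big\|\langle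 v\rangle^{\frac{\gamma}{2(1+2s)}}\langle D_x\rangle^{\frac{s}{1+2s}}h\big\|_{L^2_{x,v}}^2dt\le C\Big(\sup_{0\le t\le T}\|h\|_{L^2_{x,v}}\Big)^2+C\int_0^T|||h|||_{L^2_x}^2dt+\int_0^T\big|\big((\partial_t+v\cdot\partial_x)h,\,Ph\big)_{L^2_{x,v}}\big|dt .$$ Here $h:[0,T]\to L^2(\mathbb T^3\times\mathbb R^3)$ is strongly measurable on $(0,T)$ and, for some $w\in\mathbb R$, writing $N_w(u)=|||u|||_{L^2_x}+\|\langle v\rangle^wu\|_{L^2_{x,v}}$, one has $\int_0^TN_w(h)^2dt<\infty$, and $(\partial_t+v\cdot\partial_x)h=F$ in the sense of distributions on $(0,T)\times\mathbb T^3\times\mathbb R^3$. For a.e. $t$, $F(t)$ is an antilinear functional $u\mapsto(F(t),u)_{L^2_{x,v}}$ on $\{u\in L^2_{x,v}:N_w(u)<\infty\}$, measurable in $t$ for each fixed $u$, with $|(F(t),u)|\le m_0(t)\|u\|_{L^2_{x,v}}+m_1(t)N_w(u)$ for some $m_0\in L^1(0,T)$ and $m_1\in L^2(0,T)$. In particular,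 $F\in L^1(0,T;L^2_{x,v})$ is allowed, and then $(F,Ph)_{L^2_{x,v}}$ is the usual inner product. -/

import Mathlib

open MeasureTheory Set
open scoped ENNReal NNReal FourierTransform ContDiff

namespace KineticHypo

noncomputable section

/-! ### The phase space `𝕋³ × ℝ³` -/

instance twoPiPos : Fact ((0 : ℝ) < 2 * Real.pi) := ⟨Real.two_pi_pos⟩

/-- The torus `𝕋³ = (ℝ / 2πℤ)³` (dual group `ℤ³`), with Lebesgue measure. -/
abbrev Torus : Type := Fin 3 → AddCircle (2 * Real.pi)

/-- The velocity space `ℝ³`. -/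
abbrev Vel : Type := EuclideanSpace ℝ (Fin 3)

/-- `L²(ℝ³)`. -/
abbrev L2v : Type := Lp ℂ 2 (volume : Measure Vel)

/-- `L²(𝕋³ × ℝ³)`. -/
abbrev L2xv : Type := Lp ℂ 2 (volume : Measure (Torus × Vel))

/-- The Japanese bracket `⟨v⟩ = (1 + |v|²)^{1/2}` on `ℝ³`. -/
def jb (v : Vel) : ℝ := Real.sqrt (1 + ‖v‖ ^ 2)

/-- An integer frequency `k ∈ ℤ³` as a vector of `ℝ³`. -/
def freq (k : Fin 3 → ℤ) : Vel := WithLp.toLp 2 fun j => (k j : ℝ)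

/-! ### The triple norm -/

/-- `‖⟨D_v⟩^s f‖²` in `L²(ℝ³)`, computed by Plancherel's theorem. Mathlib's unitary Fourier
transform has the phase `e^{-2πi v·ξ}`, so that the dual variable is `η = 2πξ`.
The value is `∞` if `f` is not in `L²`. -/
def sobolevSq (s : ℝ) (f : Vel → ℂ) : ℝ≥0∞ :=
  open Classical in
  if hf : MemLp f 2 (volume : Measure Vel) then
    ∫⁻ ξ : Vel, ENNReal.ofReal (jb ((2 * Real.pi) • ξ) ^ (2 * s)) *
      ‖(𝓕 (hf.toLp f) : L2v) ξ‖ₑ ^ 2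
  else ⊤

/-- The rotation field `v_j ∂_{v_k} - v_k ∂_{v_j}` applied to `φ`. -/
def rotField (j k : Fin 3) (φ : Vel → ℂ) (v : Vel) : ℂ :=
  (v j : ℂ) * fderiv ℝ φ v (EuclideanSpace.single k 1) -
    (v k : ℂ) * fderiv ℝ φ v (EuclideanSpace.single j 1)

/-- `Δ_{𝕊²} = ∑_{j ≠ k} (v_j ∂_{v_k} - v_k ∂_{v_j})²` (sum over ordered pairs). -/
def sphLaplacian (φ : Vel → ℂ) (v : Vel) : ℂ :=
  ∑ j : Fin 3, ∑ k : Fin 3, if j ≠ k then rotField j k (rotField j k φ) v else 0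

/-- The eigenspace of the self-adjoint operator `-Δ_{𝕊²}` on `L²(ℝ³)` for `lam`: all `u ∈ L²(ℝ³)`
with `-Δ_{𝕊²} u = lam u` in the sense of distributions, i.e. `u` orthogonal to
`Δ_{𝕊²} φ + lam φ` for every test function `φ ∈ C_c^∞(ℝ³)`. -/
def sphEigenspace (lam : ℝ≥0) : Submodule ℂ L2v :=
  (Submodule.span ℂ {g : L2v | ∃ φ : Vel → ℂ, ContDiff ℝ ∞ φ ∧ HasCompactSupport φ ∧
    (g : Vel → ℂ) =ᵐ[volume] fun v => sphLaplacian φ v + (lam : ℂ) * φ v})ᗮ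

instance (lam : ℝ≥0) : (sphEigenspace lam).HasOrthogonalProjection := by
  unfold sphEigenspace
  infer_instance

/-- `‖(-Δ_{𝕊²})^{s/2} f‖²` in `L²(ℝ³)`, for `s > 0`, by the spectral theorem:
`-Δ_{𝕊²}` has pure point spectrum, so this is the sum over all eigenvalues `lam` of `lam^s` times
the squared norm of the spectral projection of `f` (numbers `lam` that are not eigenvalues
contribute `0`). The value is `∞` if `f` is not in `L²`. -/
def sphSq (s : ℝ) (f : Vel → ℂ) : ℝ≥0∞ :=
  open Classical in
  if hf : MemLp f 2 (volume : Measure Vel) then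
    ∑' lam : ℝ≥0, (lam : ℝ≥0∞) ^ s * ‖(sphEigenspace lam).starProjection (hf.toLp f)‖ₑ ^ 2
  else ⊤

/-- The square of the triple norm of a function of `v`:
`‖⟨D_v⟩^s ⟨v⟩^{γ/2} f‖² + ‖(-Δ_{𝕊²})^{s/2} ⟨v⟩^{γ/2} f‖²`. -/
def tripleSq (s γ : ℝ) (f : Vel → ℂ) : ℝ≥0∞ :=
  sobolevSq s (fun v => ((jb v ^ (γ / 2) : ℝ) : ℂ) * f v) +
    sphSq s (fun v => ((jb v ^ (γ / 2) : ℝ) : ℂ) * f v)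

/-- The triple norm on `𝕋³ × ℝ³`: the square root of the integral over `x` of the squared triple
norm of `u(x, ·)`. It may be `∞`. -/
def tripleNorm (s γ : ℝ) (u : L2xv) : ℝ≥0∞ :=
  (∫⁻ x : Torus, tripleSq s γ fun v => u (x, v)) ^ (1 / 2 : ℝ)

/-! ### Fourier series in `x` and weighted norms -/

/-- The partial Fourier transform in `x`, unitarily normalized:
`(F_x u)(k, v) = (2π)^{-3/2} ∫_{𝕋³} e^{-i k·x} u(x, v) dx`. -/
def fourierX (u : Torus × Vel → ℂ) (k : Fin 3 → ℤ) (v : Vel) : ℂ :=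
  (((2 * Real.pi) ^ (-(3 / 2) : ℝ) : ℝ) : ℂ) *
    ∫ x : Torus, (∏ j : Fin 3, fourier (-(k j)) (x j)) * u (x, v)

/-- `‖⟨v⟩^a ⟨D_x⟩^r u‖²` in `L²(𝕋³ × ℝ³)`, by Parseval's theorem in `x`. -/
def weightDxSq (a r : ℝ) (u : Torus × Vel → ℂ) : ℝ≥0∞ :=
  ∑' k : Fin 3 → ℤ, ENNReal.ofReal (jb (freq k) ^ (2 * r)) *
    ∫⁻ v : Vel, ENNReal.ofReal (jb v ^ (2 * a)) * ‖fourierX u k v‖ₑ ^ 2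

/-- `‖⟨v⟩^w u‖` in `L²(𝕋³ × ℝ³)`. -/
def weightNorm (w : ℝ) (u : Torus × Vel → ℂ) : ℝ≥0∞ :=
  (∫⁻ z : Torus × Vel, ENNReal.ofReal (jb z.2 ^ (2 * w)) * ‖u z‖ₑ ^ 2) ^ (1 / 2 : ℝ)

/-! ### Wick quantization -/

/-- The symbol
`ψ_k(v, η) = 2 ⟨v⟩^{γ/(1+2s)} (k·η) ⟨k⟩^{-(2+2s)/(1+2s)} χ(⟨v⟩^{γ/(1+2s)} ⟨η⟩ ⟨k⟩^{-1/(1+2s)})`. -/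
def psi (s γ : ℝ) (χ : ℝ → ℝ) (k : Fin 3 → ℤ) (v η : Vel) : ℝ :=
  2 * jb v ^ (γ / (1 + 2 * s)) * inner ℝ (freq k) η /
      jb (freq k) ^ ((2 + 2 * s) / (1 + 2 * s)) *
    χ (jb v ^ (γ / (1 + 2 * s)) * jb η / jb (freq k) ^ (1 / (1 + 2 * s)))

/-- The Weyl symbol of the Wick quantization of `q`:
`A_q = (8π⁶)⁻¹ q * e^{-|v|² - |η|²}`. -/
def wickSymbol (q : Vel → Vel → ℝ) (v η : Vel) : ℝ :=
  1 / (8 * Real.pi ^ 6) *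
    ∫ p : Vel × Vel, q (v - p.1) (η - p.2) * Real.exp (-‖p.1‖ ^ 2 - ‖p.2‖ ^ 2)

/-- The Wick quantization
`q^Wick f(v) = ∫∫ e^{i (v - v')·η} A_q((v + v')/2, η) f(v') dη dv'`. -/
def wick (q : Vel → Vel → ℝ) (f : Vel → ℂ) (v : Vel) : ℂ :=
  ∫ v' : Vel, (∫ η : Vel, Complex.exp (Complex.I * (inner ℝ (v - v') η : ℝ)) *
    (wickSymbol q ((1 / 2 : ℝ) • (v + v')) η : ℂ)) * f v'

/-! ### The transport equation -/

/-- `(∂_t + v·∂_x) φ (t, x, v)`, as the derivative along the free flow. -/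
def transport (φ : ℝ × Torus × Vel → ℂ) (p : ℝ × Torus × Vel) : ℂ :=
  deriv (fun τ : ℝ => φ (p.1 + τ,
    (fun j => p.2.1 j + ((τ * p.2.2 j : ℝ) : AddCircle (2 * Real.pi))), p.2.2)) 0

/-- Test functions: `φ ∈ C_c^∞((0, T) × 𝕋³ × ℝ³)`. Smoothness is that of the lift to
`ℝ × ℝ³ × ℝ³` that is `2π`-periodic in `x`. -/
structure IsTest (T : ℝ) (φ : ℝ × Torus × Vel → ℂ) : Prop where
  smooth : ContDiff ℝ ∞ fun p : ℝ × (Fin 3 → ℝ) × Vel =>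
    φ (p.1, (fun j => (p.2.1 j : AddCircle (2 * Real.pi))), p.2.2)
  compact : HasCompactSupport φ
  support : tsupport φ ⊆ {p | p.1 ∈ Ioo 0 T}

/-- `(∂_t + v·∂_x) h = F` on `(0, T) × 𝕋³ × ℝ³` in the sense of distributions, where `F t` is
an antilinear functional, standing for `u ↦ (F(t), u)_{L²_{x,v}}`. It needs to be bounded only on
the space of those `u` for which the triple norm and `‖⟨v⟩^w u‖` are finite (outside of that space
the values of `F t` play no role), with a bound that is integrable in time against `h`.
The case where `F` takes its values in `L²` is the one with `F t u = (F(t), u)_{L²_{x,v}}`, an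
honest inner product. -/
structure IsTransportSolution (s γ w T : ℝ) (h : ℝ → L2xv)
    (F : ℝ → L2xv →ₗ⋆[ℂ] ℂ) : Prop where
  meas : AEStronglyMeasurable h (volume.restrict (Ioo 0 T))
  energy : (∫⁻ t in Ioo 0 T, (tripleNorm s γ (h t) + weightNorm w (h t)) ^ 2) < ⊤
  source_meas : ∀ u : L2xv, tripleNorm s γ u < ⊤ → weightNorm w u < ⊤ →
    AEMeasurable (fun t => F t u) (volume.restrict (Ioo 0 T))
  source_bound : ∃ m₀ m₁ : ℝ → ℝ≥0,
    AEMeasurable m₀ (volume.restrict (Ioo 0 T)) ∧ AEMeasurable m₁ (volume.restrict (Ioo 0 T)) ∧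
    (∫⁻ t in Ioo 0 T, (m₀ t : ℝ≥0∞)) < ⊤ ∧ (∫⁻ t in Ioo 0 T, (m₁ t : ℝ≥0∞) ^ 2) < ⊤ ∧
    ∀ᵐ t ∂(volume.restrict (Ioo 0 T)), ∀ u : L2xv,
      tripleNorm s γ u < ⊤ → weightNorm w u < ⊤ →
      ‖F t u‖ₑ ≤ m₀ t * ‖u‖ₑ + m₁ t * (tripleNorm s γ u + weightNorm w u)
  equation : ∀ (φ : ℝ × Torus × Vel → ℂ) (Φ : ℝ → L2xv), IsTest T φ →
    (∀ t, (Φ t : Torus × Vel → ℂ) =ᵐ[volume] fun z => φ (t, z)) →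
    (∫ t in Ioo 0 T, F t (Φ t)) =
      -(∫ t in Ioo 0 T, ∫ z : Torus × Vel, h t z * (starRingEnd ℂ) (transport φ (t, z)))

end

end KineticHypo

open KineticHypo

namespace KineticHypo

open Real hiding continuous_exp continuous_rpow_const exp_sum one_rpow rpow_add_le_add_rpow rpow_one tsum_le_of_sum_range_le
open ENNReal hiding coe_smul continuous_exp continuous_ofReal exp_log log log_le_log log_rpow measurable_ofReal mul_pos ofReal_sub ofReal_zero one_le_rpow one_lt_two rpow_add rpow_le_rpow rpow_le_rpow_of_exponent_le rpow_mul rpow_natCast rpow_neg rpow_neg_one rpow_sub rpow_zero sub_sub_cancel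
open Complex hiding algHom_ext contDiff_exp cos cos_zero exp exp_add exp_log exp_nat_mul exp_zero ext hasDerivAt_cos hasDerivAt_sin log log_mul norm_ofNat ofReal_add ofReal_mul ofReal_one ofReal_pow sin sin_sq_add_cos_sq sin_zero sqrt
open _root_.Finset hiding Icc Icc_subset_Icc Iic Ioc Ioi Ioo Ioo_subset_Icc_self Ioo_subset_Ioc_self coe_add coe_one coe_smul ext inter_self left_mem_Icc left_mem_uIcc mem_Ioi mem_union mem_univ range right_mem_Icc right_mem_uIcc uIcc uIcc_of_le union_subset univ
open ContinuousLinearMap hiding add ext norm_fst_le norm_snd_le proj single zero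
open Submodule hiding add coe_add coe_smul ext mul smul zero
open Filter hiding map_le_iff_le_comap mem_bot
open MvPolynomial hiding coe_add coe_one coe_smul ext funext funext_iff indicator
open EuclideanSpace
local notation "ofR" => ENNReal.ofReal
local notation "conj" => starRingEnd ℂ
local notation "ℤ³" => Fin 3 → ℤ
local notation "Ph" => Vel × Vel
local notation:max "volT" T:max => volume.restrict (Ioo (0 : ℝ) T)
variable {s γ T Q R A M w C ε S K a b t δ A₁ A₂ A' B : ℝ} {f g u u' φ : Vel → ℂ} {m m' m₁ m₂ m₁'
  m₂' : Vel → Vel → ℝ} {q q' : Ph → ℂ} {j k : Fin 3} {h : ℝ → L2xv} {F : ℝ → L2xv →ₗ⋆[ℂ] ℂ} {ρ χ : ℝ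
  → ℝ} {r c : ℝ → ℂ} {Y : Ph} {l n : ℕ} {ι : Type*}
local notation "pos!" => by positivity
local notation "volV" => (volume : Measure Vel)
local notation:max "jbC" v:max w:max => ((jb v ^ (w : ℝ) : ℝ) : ℂ)
variable {E H : Type*} [NormedAddCommGroup E] [NormedAddCommGroup H] [InnerProductSpace ℂ H]
local notation:max "eI" x:max y:max => cexp (I * (inner ℝ x y : ℝ))
local notation:max "eN" x:max y:max => cexp (-I * (inner ℝ x y : ℝ))
local notation "inn" => inner ℂ
local notation "num!" => by norm_num
local notation "lin!" => by linarith

noncomputable section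

/-! ### Squared norms and multiplication operators on `L²` -/

section L2

variable {α : Type*} [MeasurableSpace α] {μ : Measure α}

lemma integral_ext [NormedSpace ℝ E] {f g : α → E} (h : ∀ x, f x = g x) :
    ∫ x, f x ∂μ = ∫ x, g x ∂μ := congrArg _ (funext h)

lemma eLpNorm_two_sq (f : α → E) : eLpNorm f 2 μ ^ 2 = ∫⁻ a, ‖f a‖ₑ ^ 2 ∂μ := by
  rw [eLpNorm_eq_lintegral_rpow_enorm_toReal num! num!]
  rw [← ENNReal.rpow_natCast, ← ENNReal.rpow_mul]; norm_num

lemma enorm_sq_eq_lintegral (f : Lp E 2 μ) : ‖f‖ₑ ^ 2 = ∫⁻ a, ‖f a‖ₑ ^ 2 ∂μ := by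
  rw [Lp.enorm_def, eLpNorm_two_sq]

lemma memLp_two_of_lintegral {f : α → E}
    (hf : AEStronglyMeasurable f μ) (h : ∫⁻ a, ‖f a‖ₑ ^ 2 ∂μ < ⊤) : MemLp f 2 μ :=
  ⟨hf, by simpa [← eLpNorm_two_sq, ENNReal.pow_lt_top_iff] using h⟩

lemma lintegral_lt_top_of_memLp {f : α → E} (h : MemLp f 2 μ) : ∫⁻ a, ‖f a‖ₑ ^ 2 ∂μ < ⊤ := by
  rw [← eLpNorm_two_sq]; exact pow_lt_top h.2

lemma enorm_sq_toLp {f : α → E} (h : MemLp f 2 μ) : ‖h.toLp f‖ₑ ^ 2 = ∫⁻ a, ‖f a‖ₑ ^ 2 ∂μ := by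
  rw [Lp.enorm_toLp, eLpNorm_two_sq]

lemma ofReal_norm_sq (x : E) : ofR (‖x‖ ^ 2) = ‖x‖ₑ ^ 2 := by
  rw [ofReal_pow (norm_nonneg _), ofReal_norm]

lemma enorm_le_of_sq_le {a b : ℝ≥0∞} (h : a ^ 2 ≤ b ^ 2) : a ≤ b :=
  (ENNReal.pow_le_pow_left_iff two_ne_zero).1 h

lemma norm_le_of_lintegral_le {E F : Type*} [NormedAddCommGroup E] [NormedAddCommGroup F]
    {x : E} {y : F} (hC : 0 ≤ C) (h : ‖x‖ₑ ^ 2 ≤ ofR (C ^ 2) * ‖y‖ₑ ^ 2) :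
    ‖x‖ ≤ C * ‖y‖ := by
  rw [← ofReal_norm_sq, ← ofReal_norm_sq, ← ofReal_mul pos!,
    ofReal_le_ofReal_iff pos!, ← mul_pow] at h
  exact (pow_le_pow_iff_left₀ (norm_nonneg _) pos! num!).1 h

lemma lintegral_le_of_norm_le {E F : Type*} [NormedAddCommGroup E] [NormedAddCommGroup F]
    {x : E} {y : F} (hC : 0 ≤ C) (h : ‖x‖ ≤ C * ‖y‖) :
    ‖x‖ₑ ^ 2 ≤ ofR (C ^ 2) * ‖y‖ₑ ^ 2 := by
  rw [← ofReal_norm_sq, ← ofReal_norm_sq, ← ofReal_mul pos!, ← mul_pow]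
  exact ofReal_le_ofReal (by gcongr)

lemma inner_eq_integral (f g : Lp ℂ 2 μ) : inn f g = ∫ a, conj (f a) * g a ∂μ := by
  rw [MeasureTheory.L2.inner_def]; exact integral_ext fun a => by simp [mul_comm]

lemma memLp_mul_bdd {q f : α → ℂ} (hq : AEStronglyMeasurable q μ)
    (hC : ∀ a, ‖q a‖ ≤ C) (hf : MemLp f 2 μ) : MemLp (fun a => q a * f a) 2 μ :=
  hf.of_le_mul (c := C) (hq.mul hf.1) (.of_forall fun a => by rw [norm_mul]; gcongr; exact hC a)

open Classical in
/-- Multiplication by a bounded measurable function on `L²` (zero if the function is not such). -/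
def mulOp (μ : Measure α) (q : α → ℂ) : Lp ℂ 2 μ →L[ℂ] Lp ℂ 2 μ :=
  if h : MemLp q ⊤ μ then (ContinuousLinearMap.mul ℂ ℂ).holderL μ ⊤ 2 2 h.toLp else 0

lemma coeFn_mulOp {q : α → ℂ} (hq : Measurable q) {C : ℝ} (hC : ∀ a, ‖q a‖ ≤ C) (f : Lp ℂ 2 μ) :
    mulOp μ q f =ᵐ[μ] fun a => q a * f a := by
  have h : MemLp q ⊤ μ := memLp_top_of_bound hq.aestronglyMeasurable C (.of_forall hC)
  rw [mulOp, dif_pos h]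
  filter_upwards [(ContinuousLinearMap.mul ℂ ℂ).coeFn_holder (r := 2) h.toLp f, h.coeFn_toLp]
    with a h1 h2
  rw [← h2]; exact h1

lemma mulOp_sub {q r : α → ℂ} (hq : Measurable q) (hr : Measurable r) {C D : ℝ}
    (hC : ∀ a, ‖q a‖ ≤ C) (hD : ∀ a, ‖r a‖ ≤ D) (f : Lp ℂ 2 μ) :
    mulOp μ (fun a => q a - r a) f = mulOp μ q f - mulOp μ r f := by
  ext1
  filter_upwards [coeFn_mulOp hq hC f, coeFn_mulOp hr hD f, Lp.coeFn_sub (mulOp μ q f) (mulOp μ r f),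
    coeFn_mulOp (q := fun a => q a - r a) (hq.sub hr)
      (fun a => (norm_sub_le _ _).trans (add_le_add (hC a) (hD a))) f] with a h1 h2 h3 h4
  rw [h3, h4, Pi.sub_apply, h1, h2, sub_mul]

lemma norm_mulOp_apply_le {q : α → ℂ} (hq : Measurable q) (hC : ∀ a, ‖q a‖ ≤ C) (f : Lp ℂ 2 μ) : ‖mulOp μ q f‖ ≤ C * ‖f‖ := by
  refine Lp.norm_le_mul_norm_of_ae_le_mul ?_; filter_upwards [coeFn_mulOp hq hC f] with a h1
  rw [h1, norm_mul]; gcongr; exact hC a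

lemma enorm_sq_mulOp {q : α → ℂ} (hq : Measurable q) (hC : ∀ a, ‖q a‖ ≤ C) (f : Lp ℂ 2 μ) :
    ‖mulOp μ q f‖ₑ ^ 2 = ∫⁻ a, ‖q a‖ₑ ^ 2 * ‖f a‖ₑ ^ 2 ∂μ := by
  rw [enorm_sq_eq_lintegral]; refine lintegral_congr_ae ?_
  filter_upwards [coeFn_mulOp hq hC f] with a h1; rw [h1, enorm_mul, mul_pow]

end L2

/-! ### Plancherel's theorem for functions in `L¹ ∩ L²` -/

lemma coeFn_fourier_toLp (h1 : Integrable f) (h2 : MemLp f 2 volume) :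
    (𝓕 (h2.toLp f) : L2v) =ᵐ[volume] 𝓕 f := by
  refine ae_eq_of_integral_contDiff_smul_eq ((Lp.memLp _).locallyIntegrable num!)
    (Continuous.locallyIntegrable ?_) fun g hg hgc => ?_
  · exact VectorFourier.fourierIntegral_continuous continuous_fourierChar
      (by exact continuous_inner) h1
  · have hg₁ : HasCompactSupport (ofRealCLM ∘ g) := hgc.comp_left rfl
    have hg₂ : ContDiff ℝ ∞ (ofRealCLM ∘ g) := by fun_prop
    set G := hg₁.toSchwartzMap hg₂; have hG x : G x = (g x : ℂ) := rfl
    have e1 := congrArg (fun T => T G) (Lp.fourier_toTemperedDistribution_eq (h2.toLp f))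
    simp only [TemperedDistribution.fourier_apply, Lp.toTemperedDistribution_apply] at e1
    have e2 : ∫ x, (𝓕 G) x • (h2.toLp f : L2v) x = ∫ x, (𝓕 G) x • f x :=
      integral_congr_ae (by filter_upwards [h2.coeFn_toLp] with x hx; rw [hx])
    have e3 := VectorFourier.integral_fourierIntegral_smul_eq_flip (μ := volV)
        (ν := volV) (L := innerₗ Vel)
        (e := fourierChar) (f := G) (g := f) continuous_fourierChar
      (by exact continuous_inner) G.integrable h1
    rw [flip_innerₗ] at e3; simp only [← coe_smul, ← hG]; rw [← e1, e2, SchwartzMap.fourier_coe]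
    exact e3

/-- The Fourier integral with the angular frequency normalization. -/
def expInt (f : Vel → ℂ) (ξ : Vel) : ℂ := ∫ v : Vel, eN v ξ * f v

lemma expInt_eq_fourier (f : Vel → ℂ) (ξ : Vel) : expInt f ξ = 𝓕 f ((2 * π)⁻¹ • ξ) := by
  rw [expInt, fourier_eq']; refine integral_ext fun v => ?_; simp only [smul_eq_mul]; congr 2
  rw [inner_smul_right]; push_cast; have : (π : ℂ) ≠ 0 := by exact_mod_cast pi_ne_zero
  field_simp

lemma lintegral_comp_smul_vel {F : Vel → ℝ≥0∞} {r : ℝ} (hr : 0 < r) :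
    ∫⁻ ξ : Vel, F (r⁻¹ • ξ) = ofR (r ^ 3) * ∫⁻ ξ : Vel, F ξ := by
  have hr' : (r⁻¹ : ℝ) ≠ 0 := (inv_pos.2 hr).ne'
  have h := (Homeomorph.smulOfNeZero (r⁻¹) hr').toMeasurableEquiv.measurableEmbedding.lintegral_map
    (μ := volV) F
  have h' : Measure.map (Homeomorph.smulOfNeZero (r⁻¹) hr').toMeasurableEquiv
    volV = ofR (r ^ 3) • volume := by
    have := Measure.map_addHaar_smul volV hr'
    rwa [finrank_euclideanSpace_fin, inv_pow, inv_inv, abs_of_pos pos!] at this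
  rw [h', lintegral_smul_measure, smul_eq_mul] at h; exact h.symm

lemma lintegral_expInt (h1 : Integrable f) (h2 : MemLp f 2 volume) :
    ∫⁻ ξ, ‖expInt f ξ‖ₑ ^ 2 = ofR ((2 * π) ^ 3) * ∫⁻ v, ‖f v‖ₑ ^ 2 := by
  simp_rw [expInt_eq_fourier]; rw [lintegral_comp_smul_vel (F := fun ξ => ‖𝓕 f ξ‖ₑ ^ 2) pos!]
  congr 1; rw [← enorm_sq_toLp h2]
  have : ‖h2.toLp f‖ₑ = ‖(𝓕 (h2.toLp f) : L2v)‖ₑ := by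
    rw [← ofReal_norm, ← ofReal_norm, Lp.norm_fourier_eq]
  rw [this, enorm_sq_eq_lintegral]; refine lintegral_congr_ae ?_
  filter_upwards [coeFn_fourier_toLp h1 h2] with x hx; rw [hx]

/-! ### Windowed Fourier transforms -/

/-- `L²` of the phase space `ℝ³ × ℝ³`. -/
abbrev L2p : Type := Lp ℂ 2 (volume : Measure Ph)

/-- A window `m(y, v)` dominated by `Γ(v - y)` with `‖Γ‖_{L²} ≤ A`. -/
structure IsWin (m : Vel → Vel → ℝ) (A : ℝ) : Prop where
  meas : Measurable fun p : Ph => m p.1 p.2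
  nonneg : 0 ≤ A
  dom : ∃ Γ : Vel → ℝ, Measurable Γ ∧ (∀ y v, |m y v| ≤ Γ (v - y)) ∧ ∫⁻ x, ‖Γ x‖ₑ ^ 2 ≤ ofR (A ^ 2)

/-- The windowed Fourier transform with window `m`. -/
def winFun (m : Vel → Vel → ℝ) (u : Vel → ℂ) (Y : Ph) : ℂ :=
  (((2 * π) ^ (-(3 / 2) : ℝ) : ℝ) : ℂ) * expInt (fun v => (m Y.1 v : ℂ) * u v) Y.2

lemma winFun_congr (m : Vel → Vel → ℝ) (h : u =ᵐ[volume] u') : winFun m u = winFun m u' := by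
  ext Y; simp only [winFun, expInt]; congr 1; refine integral_congr_ae ?_
  filter_upwards [h] with v hv; rw [hv]

lemma two_pi_rpow_sq : ‖(((2 * π) ^ (-(3 / 2) : ℝ) : ℝ) : ℂ)‖ₑ ^ 2 * ofR ((2 * π) ^ 3) = 1 := by
  rw [← ofReal_norm_sq, ← ofReal_mul pos!, norm_real, norm_eq_abs,
    sq_abs, ← rpow_natCast, ← rpow_natCast, ← rpow_mul pos!,
    ← rpow_add pos!]
  norm_num

namespace IsWin

variable {m : Vel → Vel → ℝ} {A : ℝ}

lemma meas_right (hm : IsWin m A) (y : Vel) : Measurable (m y) :=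
  hm.meas.comp (measurable_const.prodMk measurable_id)

lemma meas_left (hm : IsWin m A) (v : Vel) : Measurable fun y => m y v :=
  hm.meas.comp (measurable_id.prodMk measurable_const)

lemma lintegral_right (hm : IsWin m A) (y : Vel) : ∫⁻ v, ‖m y v‖ₑ ^ 2 ≤ ofR (A ^ 2) := by
  obtain ⟨Γ, hΓ, hd, hA⟩ := hm.dom
  refine le_trans (le_trans (lintegral_mono fun v => ?_)
    (lintegral_sub_right_eq_self (fun x => ‖Γ x‖ₑ ^ 2) y).le) hA
  gcongr; exact enorm_le_iff_norm_le.2 ((hd y v).trans (le_abs_self _))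

lemma lintegral_left (hm : IsWin m A) (v : Vel) : ∫⁻ y, ‖m y v‖ₑ ^ 2 ≤ ofR (A ^ 2) := by
  obtain ⟨Γ, hΓ, hd, hA⟩ := hm.dom
  refine le_trans (le_trans (lintegral_mono fun y => ?_)
    (lintegral_sub_left_eq_self (fun x => ‖Γ x‖ₑ ^ 2) v).le) hA
  gcongr; exact enorm_le_iff_norm_le.2 ((hd y v).trans (le_abs_self _))

lemma memLp_right (hm : IsWin m A) (y : Vel) : MemLp (fun v => (m y v : ℂ)) 2 volV := by
  refine memLp_two_of_lintegral (measurable_ofReal.comp (hm.meas_right y)).aestronglyMeasurable ?_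
  refine lt_of_le_of_lt (le_of_eq ?_) ((hm.lintegral_right y).trans_lt ofReal_lt_top)
  refine lintegral_congr fun v => ?_; rw [← ofReal_norm, ← ofReal_norm, norm_real]

lemma integrable (hm : IsWin m A) (y : Vel) (hu : MemLp u 2 volume) :
    Integrable fun v => (m y v : ℂ) * u v :=
  (hm.memLp_right y).integrable_mul hu

lemma integrable_exp (hm : IsWin m A) (y ξ : Vel) (hu : MemLp u 2 volume) :
    Integrable fun v : Vel => eN v ξ * ((m y v : ℂ) * u v) := by
  refine (hm.integrable y hu).bdd_mul (c := 1) (by fun_prop) (.of_forall fun v => ?_)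
  rw [norm_exp]; simp

end IsWin

lemma winFun_add (hm : IsWin m A) (hu : MemLp u 2 volume) (hu' : MemLp u' 2 volume) (Y : Ph) :
    winFun m (fun v => u v + u' v) Y = winFun m u Y + winFun m u' Y := by
  simp only [winFun, expInt, mul_add]
  rw [integral_add (hm.integrable_exp _ _ hu) (hm.integrable_exp _ _ hu'), mul_add]

lemma winFun_smul (m : Vel → Vel → ℝ) (c : ℂ) (u : Vel → ℂ) (Y : Ph) :
    winFun m (fun v => c * u v) Y = c * winFun m u Y := by
  simp only [winFun, expInt]; rw [mul_left_comm]; congr 1; rw [← integral_const_mul]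
  refine integral_ext fun v => ?_; ring_nf

lemma winFun_sub_win (hm : IsWin m A) (hm' : IsWin m' A') (hu : MemLp u 2 volume) (Y : Ph) :
    winFun (fun y v => m y v - m' y v) u Y = winFun m u Y - winFun m' u Y := by
  simp only [winFun, expInt]
  rw [← mul_sub, ← integral_sub (hm.integrable_exp _ _ hu) (hm'.integrable_exp _ _ hu)]; congr 1
  refine integral_ext fun v => ?_; push_cast; ring

lemma stronglyMeasurable_winFun (hm : IsWin m A) (u : L2v) : StronglyMeasurable (winFun m u) := by
  refine StronglyMeasurable.mul stronglyMeasurable_const ?_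
  refine StronglyMeasurable.integral_prod_right' (f := fun p : Ph × Vel =>
    eN p.2 p.1.2 * ((m p.1.1 p.2 : ℂ) * u p.2)) ?_
  refine StronglyMeasurable.mul (Continuous.stronglyMeasurable (by fun_prop)) ?_
  refine StronglyMeasurable.mul ?_ ((Lp.stronglyMeasurable u).comp_measurable measurable_snd)
  exact (measurable_ofReal.comp (hm.meas.comp
    ((measurable_fst.comp measurable_fst).prodMk measurable_snd))).stronglyMeasurable

/-- Weighted Plancherel identity for the windowed Fourier transform. -/
lemma lintegral_weight_winFun (hm : IsWin m A) (w : L2v) {W : Vel → ℝ≥0∞} (hW : Measurable W) :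
    ∫⁻ Y : Ph, W Y.1 * ‖winFun m w Y‖ₑ ^ 2 = ∫⁻ v, (∫⁻ y, W y * ‖m y v‖ₑ ^ 2) * ‖w v‖ₑ ^ 2 := by
  have hw : MemLp w 2 volume := Lp.memLp w
  have hwm : Measurable (w : Vel → ℂ) := (Lp.stronglyMeasurable w).measurable; have hmm := hm.meas
  have hms v : Measurable fun y => ‖m y v‖ₑ ^ 2 := (hm.meas_left v).enorm.pow_const 2
  have mj : Measurable fun p : Ph => ‖m p.1 p.2‖ₑ ^ 2 * ‖w p.2‖ₑ ^ 2 := by fun_prop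
  have fin : ∫⁻ y, ∫⁻ v, ‖m y v‖ₑ ^ 2 * ‖w v‖ₑ ^ 2 < ⊤ := by
    rw [lintegral_lintegral_swap mj.aemeasurable,
      lintegral_congr fun v => lintegral_mul_const (‖w v‖ₑ ^ 2) (hms v)]
    refine (lintegral_mono fun v => mul_le_mul_left (hm.lintegral_left v) _).trans_lt ?_
    rw [lintegral_const_mul' _ _ ofReal_ne_top]
    exact mul_lt_top ofReal_lt_top (lintegral_lt_top_of_memLp hw)
  have en y v : ‖(m y v : ℂ) * w v‖ₑ ^ 2 = ‖m y v‖ₑ ^ 2 * ‖w v‖ₑ ^ 2 := by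
    rw [enorm_mul, mul_pow, ← ofReal_norm ((m y v : ℂ)), norm_real, ofReal_norm]
  have key : ∀ᵐ y : Vel, ∫⁻ ξ, ‖winFun m w (y, ξ)‖ₑ ^ 2 = ∫⁻ v, ‖m y v‖ₑ ^ 2 * ‖w v‖ₑ ^ 2 := by
    filter_upwards [ae_lt_top mj.lintegral_prod_right' fin.ne] with y hy
    simp only [winFun, enorm_mul, mul_pow]
    rw [lintegral_const_mul' _ _ (by finiteness), lintegral_expInt (hm.integrable y hw)
      (memLp_two_of_lintegral (hm.integrable y hw).1 (by simpa only [en] using hy)), ← mul_assoc,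
      two_pi_rpow_sq, one_mul]
    exact lintegral_congr (en y)
  have mW : Measurable fun Y : Ph => W Y.1 * ‖winFun m w Y‖ₑ ^ 2 :=
    (hW.comp measurable_fst).mul ((stronglyMeasurable_winFun hm w).enorm.pow_const 2)
  rw [Measure.volume_eq_prod, lintegral_prod _ mW.aemeasurable]
  calc ∫⁻ y, ∫⁻ ξ, W y * ‖winFun m w (y, ξ)‖ₑ ^ 2
      = ∫⁻ y, ∫⁻ v, W y * ‖m y v‖ₑ ^ 2 * ‖w v‖ₑ ^ 2 := by
        refine lintegral_congr_ae ?_; filter_upwards [key] with y hy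
        rw [lintegral_const_mul, hy, ← lintegral_const_mul]
        · simp only [mul_assoc]
        · exact ((hm.meas_right y).enorm.pow_const 2).mul (hwm.enorm.pow_const 2)
        · exact ((stronglyMeasurable_winFun hm w).measurable.comp
            (measurable_const.prodMk measurable_id)).enorm.pow_const 2
    _ = ∫⁻ v, ∫⁻ y, W y * ‖m y v‖ₑ ^ 2 * ‖w v‖ₑ ^ 2 := by
        rw [lintegral_lintegral_swap]; exact Measurable.aemeasurable (by fun_prop)
    _ = _ := lintegral_congr fun v => lintegral_mul_const _ (hW.mul (hms v))

lemma lintegral_winFun_le (hm : IsWin m A) (u : L2v) :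
    ∫⁻ Y : Ph, ‖winFun m u Y‖ₑ ^ 2 ≤ ofR (A ^ 2) * ∫⁻ v, ‖u v‖ₑ ^ 2 := by
  have h := lintegral_weight_winFun hm u (W := 1) measurable_one
  simp only [Pi.one_apply, one_mul] at h; rw [h, ← lintegral_const_mul' _ _ ofReal_ne_top]
  exact lintegral_mono fun v => by gcongr; exact hm.lintegral_left v

lemma memLp_winFun (hm : IsWin m A) (u : L2v) : MemLp (winFun m u) 2 volume :=
  memLp_two_of_lintegral (stronglyMeasurable_winFun hm u).aestronglyMeasurable
    ((lintegral_winFun_le hm u).trans_lt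
      (mul_lt_top ofReal_lt_top (lintegral_lt_top_of_memLp (Lp.memLp u))))

open Classical in
/-- The windowed Fourier transform as a bounded operator. -/
def winOp (m : Vel → Vel → ℝ) : L2v →L[ℂ] L2p := if h : ∃ A, IsWin m A then LinearMap.mkContinuous
      { toFun := fun u => (memLp_winFun h.choose_spec u).toLp _, map_add' := fun f g => by
          rw [← MemLp.toLp_add]; refine MemLp.toLp_congr _ _ (.of_forall fun Y => ?_)
          rw [winFun_congr m (Lp.coeFn_add f g)]
          exact winFun_add h.choose_spec (Lp.memLp f) (Lp.memLp g) Y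
        map_smul' := fun c f => by
          rw [RingHom.id_apply, ← MemLp.toLp_const_smul]
          refine MemLp.toLp_congr _ _ (.of_forall fun Y => ?_)
          rw [winFun_congr m (Lp.coeFn_smul c f)]; exact winFun_smul m c f Y }
      h.choose (fun u => by
        refine norm_le_of_lintegral_le h.choose_spec.nonneg ?_
        change ‖(memLp_winFun h.choose_spec u).toLp _‖ₑ ^ 2 ≤ _
        rw [enorm_sq_toLp, enorm_sq_eq_lintegral]; exact lintegral_winFun_le h.choose_spec u)
  else 0

lemma coeFn_winOp (hm : IsWin m A) (u : L2v) : winOp m u =ᵐ[volume] winFun m u := by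
  have h : ∃ A, IsWin m A := ⟨A, hm⟩; rw [winOp, dif_pos h]
  exact (memLp_winFun h.choose_spec u).coeFn_toLp

lemma norm_winOp_apply_le (hm : IsWin m A) (u : L2v) : ‖winOp m u‖ ≤ A * ‖u‖ := by
  refine norm_le_of_lintegral_le hm.nonneg ?_; rw [enorm_sq_eq_lintegral, enorm_sq_eq_lintegral]
  refine le_trans (le_of_eq (lintegral_congr_ae ?_)) (lintegral_winFun_le hm u)
  filter_upwards [coeFn_winOp hm u] with Y hY; rw [hY]

lemma winOp_sub (hm : IsWin m A) (hm' : IsWin m' A')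
    (hd : IsWin (fun y v => m y v - m' y v) B) (u : L2v) :
    winOp (fun y v => m y v - m' y v) u = winOp m u - winOp m' u := by
  ext1
  filter_upwards [coeFn_winOp hm u, coeFn_winOp hm' u, coeFn_winOp hd u,
    Lp.coeFn_sub (winOp m u) (winOp m' u)] with Y h1 h2 h3 h4
  rw [h3, h4, Pi.sub_apply, h1, h2, winFun_sub_win hm hm' (Lp.memLp u)]

/-! ### Localization operators -/

/-- The operator `V_{m₁}^* q V_{m₂}`. -/
def locOp (m₁ : Vel → Vel → ℝ) (q : Ph → ℂ) (m₂ : Vel → Vel → ℝ) : L2v →L[ℂ] L2v :=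
  adjoint (winOp m₁) ∘L mulOp volume q ∘L winOp m₂

lemma inner_locOp (m₁ : Vel → Vel → ℝ) (q : Ph → ℂ) (m₂ : Vel → Vel → ℝ) (u f : L2v) :
    inn u (locOp m₁ q m₂ f) = inn (winOp m₁ u) (mulOp volume q (winOp m₂ f)) := by
  simp [locOp, adjoint_inner_right]

lemma inner_locOp_eq_integral (h₁ : IsWin m₁ A₁)
    (h₂ : IsWin m₂ A₂) (hq : Measurable q) (hQ : ∀ Y, ‖q Y‖ ≤ Q)
    (u f : L2v) :
    inn u (locOp m₁ q m₂ f) = ∫ Y, q Y * (conj (winFun m₁ u Y) * winFun m₂ f Y) := by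
  rw [inner_locOp, inner_eq_integral]; refine integral_congr_ae ?_
  filter_upwards [coeFn_winOp h₁ u, coeFn_winOp h₂ f,
    coeFn_mulOp hq hQ (winOp m₂ f)] with Y h1 h2 h3
  rw [h3, h1, h2]; ring

lemma norm_le_of_inner_le {x : H} (hC : 0 ≤ C) (h : ∀ u : H, ‖inn u x‖ ≤ C * ‖u‖) : ‖x‖ ≤ C := by
  have := h x; rw [inner_self_eq_norm_sq_to_K] at this
  simp only [coe_algebraMap, norm_pow, norm_real, norm_norm] at this; by_contra! hp
  nlinarith [norm_nonneg x]

lemma norm_locOp_apply_le (h₁ : IsWin m₁ A₁) (f : L2v) :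
    ‖locOp m₁ q m₂ f‖ ≤ A₁ * ‖mulOp volume q (winOp m₂ f)‖ := by
  refine norm_le_of_inner_le (mul_nonneg h₁.nonneg pos!) fun u => ?_; rw [inner_locOp]
  refine (norm_inner_le_norm _ _).trans ?_; have := norm_winOp_apply_le h₁ u; rw [mul_right_comm]
  gcongr

lemma norm_locOp_le (h₁ : IsWin m₁ A₁) (h₂ : IsWin m₂ A₂) (hq : Measurable q) (hQ : ∀ Y, ‖q Y‖ ≤ Q)
    (f : L2v) : ‖locOp m₁ q m₂ f‖ ≤ A₁ * Q * A₂ * ‖f‖ := by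
  have hQ0 : 0 ≤ Q := (norm_nonneg _).trans (hQ 0); have := h₁.nonneg; rw [mul_assoc, mul_assoc]
  refine (norm_locOp_apply_le h₁ f).trans ?_; gcongr
  exact (norm_mulOp_apply_le hq hQ _).trans (by gcongr; exact norm_winOp_apply_le h₂ f)

/-! ### Covariance under Euclidean motions -/

/-- The Euclidean motion `v ↦ L v + z`. -/
def motion (L : Vel ≃ₗᵢ[ℝ] Vel) (z : Vel) (v : Vel) : Vel := L v + z

lemma measurePreserving_motion (L : Vel ≃ₗᵢ[ℝ] Vel) (z : Vel) :
    MeasurePreserving (motion L z) volV volume :=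
  (measurePreserving_add_right volume z).comp L.measurePreserving

lemma measurableEmbedding_motion (L : Vel ≃ₗᵢ[ℝ] Vel) (z : Vel) :
    MeasurableEmbedding (motion L z) :=
  (Homeomorph.addRight z).measurableEmbedding.comp L.toHomeomorph.measurableEmbedding

/-- Composition with a Euclidean motion as an isometry of `L²`. -/
def motionOp (L : Vel ≃ₗᵢ[ℝ] Vel) (z : Vel) : L2v →ₗᵢ[ℂ] L2v :=
  Lp.compMeasurePreservingₗᵢ ℂ (motion L z) (measurePreserving_motion L z)

lemma coeFn_motionOp (L : Vel ≃ₗᵢ[ℝ] Vel) (z : Vel) (u : L2v) :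
    motionOp L z u =ᵐ[volume] fun v => u (motion L z v) :=
  Lp.coeFn_compMeasurePreserving u (measurePreserving_motion L z)

lemma motionOp_surjective (L : Vel ≃ₗᵢ[ℝ] Vel) (z : Vel) (u : L2v) : ∃ u', motionOp L z u' = u := by
  refine ⟨motionOp L.symm (-L.symm z) u, ?_⟩
  ext1
  have h := (measurePreserving_motion L z).quasiMeasurePreserving.ae
    (coeFn_motionOp L.symm (-L.symm z) u)
  filter_upwards [coeFn_motionOp L z (motionOp L.symm (-L.symm z) u), h] with v h1 h2; rw [h1, h2]
  simp [motion]

lemma winFun_motion (L : Vel ≃ₗᵢ[ℝ] Vel) (z : Vel)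
    (hm : ∀ y v, m' (motion L z y) (motion L z v) = m y v) (u : Vel → ℂ) (Y : Ph) :
    winFun m (fun v => u (motion L z v)) Y = eI z (L Y.2) *
        winFun m' u (motion L z Y.1, L Y.2) := by
  simp only [winFun, expInt]; rw [mul_left_comm]; congr 1
  have h := (measurePreserving_motion L z).integral_comp (measurableEmbedding_motion L z)
    (fun v => eN v (L Y.2) * ((m' (motion L z Y.1) v : ℂ) * u v))
  rw [← h, ← integral_const_mul]; refine integral_ext fun v => ?_; simp only [hm]
  rw [← mul_assoc (cexp _) (cexp _), ← Complex.exp_add]; congr 2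
  rw [motion, inner_add_left, L.inner_map_map]; push_cast; ring

lemma measurePreserving_motion_prod (L : Vel ≃ₗᵢ[ℝ] Vel) (z : Vel) :
    MeasurePreserving (fun Y : Ph => (motion L z Y.1, L Y.2)) volume volume :=
  (measurePreserving_motion L z).prod L.measurePreserving

lemma measurableEmbedding_motion_prod (L : Vel ≃ₗᵢ[ℝ] Vel) (z : Vel) :
    MeasurableEmbedding (fun Y : Ph => (motion L z Y.1, L Y.2)) :=
  (measurableEmbedding_motion L z).prodMap L.toHomeomorph.measurableEmbedding

section
variable (h₁ : IsWin m₁ A) (h₁' : IsWin m₁' A) (h₂ : IsWin m₂ A) (h₂' : IsWin m₂' A)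
  (hq : Measurable q) (hq' : Measurable q') (hQ : ∀ Y, ‖q Y‖ ≤ Q) (hQ' : ∀ Y, ‖q' Y‖ ≤ Q)
  (L : Vel ≃ₗᵢ[ℝ] Vel) (z : Vel)
include h₁ h₁' h₂ h₂' hq hq' hQ hQ'

lemma inner_locOp_motion (hm₁ : ∀ y v, m₁' (motion L z y) (motion L z v) = m₁ y v)
    (hm₂ : ∀ y v, m₂' (motion L z y) (motion L z v) = m₂ y v)
    (hqq : ∀ Y, q' (motion L z Y.1, L Y.2) = q Y) (u f : L2v) :
    inn (motionOp L z u) (locOp m₁ q m₂ (motionOp L z f)) = inn u (locOp m₁' q' m₂' f) := by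
  have h := (measurePreserving_motion_prod L z).integral_comp (measurableEmbedding_motion_prod L z)
    (fun Y => q' Y * (conj (winFun m₁' u Y) * winFun m₂' f Y))
  rw [inner_locOp_eq_integral h₁ h₂ hq hQ, inner_locOp_eq_integral h₁' h₂' hq' hQ', ← h]
  refine integral_ext fun Y => ?_; simp only [hqq]
  rw [winFun_congr m₁ (coeFn_motionOp L z u), winFun_congr m₂ (coeFn_motionOp L z f),
    winFun_motion L z hm₁, winFun_motion L z hm₂, map_mul]
  have : conj eI z (L Y.2) * eI z (L Y.2) = 1 := by rw [← exp_conj, ← Complex.exp_add]; simp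
  linear_combination (q Y * conj (winFun m₁' u (motion L z Y.1, L Y.2)) *
    winFun m₂' f (motion L z Y.1, L Y.2)) * this

variable (d₁ : IsWin (fun y v => m₁ y v - m₁' y v) δ) (d₂ : IsWin (fun y v => m₂ y v - m₂' y v) δ)
  (hd : ∀ Y, ‖q Y - q' Y‖ ≤ ε)
include d₁ d₂ hd

lemma norm_locOp_sub_le (f : L2v) :
    ‖locOp m₁ q m₂ f - locOp m₁' q' m₂' f‖ ≤ (2 * A * Q * δ + A ^ 2 * ε) * ‖f‖ := by
  have hA := h₁.nonneg; have hδ := d₁.nonneg; have hQ0 : 0 ≤ Q := (norm_nonneg _).trans (hQ 0)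
  have hε : 0 ≤ ε := (norm_nonneg _).trans (hd 0); refine norm_le_of_inner_le pos! fun u => ?_
  have key : inn u (locOp m₁ q m₂ f - locOp m₁' q' m₂' f) =
      inn (winOp (fun y v => m₁ y v - m₁' y v) u) (mulOp volume q (winOp m₂ f)) +
      inn (winOp m₁' u) (mulOp volume (fun Y => q Y - q' Y) (winOp m₂ f)) +
      inn (winOp m₁' u) (mulOp volume q' (winOp (fun y v => m₂ y v - m₂' y v) f)) := by
    rw [winOp_sub h₁ h₁' d₁, winOp_sub h₂ h₂' d₂, mulOp_sub hq hq' hQ hQ', map_sub,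
      inner_sub_right, inner_locOp, inner_locOp]
    simp only [inner_sub_left, inner_sub_right]; ring
  have b4 := norm_winOp_apply_le h₂ f; have hu := norm_winOp_apply_le h₁' u
  rw [key, show (2 * A * Q * δ + A ^ 2 * ε) * ‖f‖ * ‖u‖ = δ * ‖u‖ * (Q * (A * ‖f‖)) +
    A * ‖u‖ * (ε * (A * ‖f‖)) + A * ‖u‖ * (Q * (δ * ‖f‖)) by ring]
  refine norm_add₃_le.trans (add_le_add_three ?_ ?_ ?_) <;>
    refine (norm_inner_le_norm _ _).trans (mul_le_mul ?_ ?_ pos! pos!)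
  exacts [norm_winOp_apply_le d₁ u, (norm_mulOp_apply_le hq hQ _).trans (by gcongr), hu,
    (norm_mulOp_apply_le (hq.sub hq') hd _).trans (by gcongr), hu,
    (norm_mulOp_apply_le hq' hQ' _).trans (by gcongr; exact norm_winOp_apply_le d₂ f)]

lemma norm_motionOp_locOp_sub_le (hm₁ : ∀ y v, m₁' (motion L z y) (motion L z v) = m₁ y v)
    (hm₂ : ∀ y v, m₂' (motion L z y) (motion L z v) = m₂ y v)
    (hqq : ∀ Y, q' (motion L z Y.1, L Y.2) = q Y) (f : L2v) :
    ‖motionOp L z (locOp m₁ q m₂ f) - locOp m₁ q m₂ f‖ ≤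
      A * Q * A * ‖motionOp L z f - f‖ + (2 * A * Q * δ + A ^ 2 * ε) * ‖f‖ := by
  have hA := h₁.nonneg; have hδ := d₁.nonneg; have hQ0 : 0 ≤ Q := (norm_nonneg _).trans (hQ 0)
  have hε : 0 ≤ ε := (norm_nonneg _).trans (hd 0)
  have s1 : ‖motionOp L z (locOp m₁ q m₂ f) - locOp m₁ q m₂ (motionOp L z f)‖ ≤
      (2 * A * Q * δ + A ^ 2 * ε) * ‖f‖ := by
    refine norm_le_of_inner_le pos! fun u' => ?_; obtain ⟨u, rfl⟩ := motionOp_surjective L z u'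
    rw [inner_sub_right, LinearIsometry.inner_map_map,
      inner_locOp_motion h₁ h₁' h₂ h₂' hq hq' hQ hQ' L z hm₁ hm₂ hqq, ← inner_sub_right,
      LinearIsometry.norm_map, mul_comm]
    refine (norm_inner_le_norm _ _).trans ?_; gcongr
    exact norm_locOp_sub_le h₁ h₁' h₂ h₂' hq hq' hQ hQ' d₁ d₂ hd f
  have s2 := norm_locOp_le h₁ h₂ hq hQ (motionOp L z f - f); rw [map_sub] at s2
  exact (norm_sub_le_norm_sub_add_norm_sub _ _ _).trans lin!

end

/-! ### The weighted Gaussian windows -/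

lemma one_le_jb (v : Vel) : 1 ≤ jb v := by
  rw [jb]; exact one_le_sqrt.2 (by nlinarith [sq_nonneg ‖v‖])

lemma jb_pos (v : Vel) : 0 < jb v := zero_lt_one.trans_le (one_le_jb v)

lemma jb_sq (v : Vel) : jb v ^ 2 = 1 + ‖v‖ ^ 2 := sq_sqrt pos!

lemma norm_le_jb (v : Vel) : ‖v‖ ≤ jb v := le_sqrt_of_sq_le lin!

@[fun_prop]
lemma continuous_jb : Continuous jb := by unfold jb; fun_prop

lemma jb_add_le (v z : Vel) : jb (v + z) ≤ jb v * (1 + ‖z‖) := by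
  have hz := norm_nonneg z; refine sqrt_le_iff.2 ⟨by have := jb_pos v; positivity, ?_⟩
  rw [mul_pow, jb_sq]
  nlinarith [pow_le_pow_left₀ (norm_nonneg _) (norm_add_le v z) 2, sq_nonneg (‖v‖ * ‖z‖),
    mul_nonneg hz (sq_nonneg (‖v‖ - 1)), mul_nonneg hz (sq_nonneg ‖v‖)]

lemma log_jb_add_le (v z : Vel) : log (jb (v + z)) ≤ log (jb v) + ‖z‖ := by
  have h := jb_add_le v z; have := log_le_sub_one_of_pos (x := 1 + ‖z‖) pos!
  have := log_le_log (jb_pos _) h; rw [log_mul (jb_pos _).ne' pos!] at this; linarith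

lemma abs_log_jb_sub_le (v z : Vel) : |log (jb (v + z)) - log (jb v)| ≤ ‖z‖ := by
  have := log_jb_add_le (v + z) (-z); rw [add_neg_cancel_right, norm_neg] at this
  exact abs_sub_le_iff.2 ⟨by linarith [log_jb_add_le v z], by linarith⟩

/-- The `L²`-normalized Gaussian. -/
def gauss (x : Vel) : ℝ := π ^ (-(3 / 4) : ℝ) * exp (-‖x‖ ^ 2 / 2)

/-- The weighted window `⟨y⟩^w ⟨v⟩^{-w} g(v - y)`. -/
def wwin (w : ℝ) (y v : Vel) : ℝ := jb y ^ w * jb v ^ (-w) * gauss (v - y)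

/-- The exponent of the weighted window. -/
def wexp (w : ℝ) (y v : Vel) : ℝ := w * (log (jb y) - log (jb v)) - ‖v - y‖ ^ 2 / 2

lemma wwin_eq (w : ℝ) (y v : Vel) : wwin w y v = π ^ (-(3 / 4) : ℝ) * exp (wexp w y v) := by
  rw [wwin, gauss, wexp, rpow_def_of_pos (jb_pos y), rpow_def_of_pos (jb_pos v),
    mul_left_comm, ← exp_add, ← exp_add]
  congr 2; ring

lemma two_pi_rpow_le_one : (2 * π) ^ (-(3 / 2) : ℝ) ≤ 1 :=
  rpow_le_one_of_one_le_of_nonpos (by linarith [pi_gt_three]) num!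

lemma jb_rpow_mono (h : a ≤ b) (v : Vel) : jb v ^ a ≤ jb v ^ b :=
  rpow_le_rpow_of_exponent_le (one_le_jb v) h

lemma pi_rpow_le_one : π ^ (-(3 / 4) : ℝ) ≤ 1 :=
  rpow_le_one_of_one_le_of_nonpos (by linarith [pi_gt_three]) num!

/-- A Gaussian that dominates the weighted windows. -/
def domGauss (w : ℝ) (x : Vel) : ℝ := exp ((|w| + 1) ^ 2) * exp (-‖x‖ ^ 2 / 4)

@[fun_prop]
lemma continuous_domGauss (w : ℝ) : Continuous (domGauss w) := by unfold domGauss; fun_prop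

lemma one_add_mul_exp_wexp_le (w : ℝ) (y v : Vel) :
    (1 + ‖v - y‖) * exp (wexp w y v) ≤ domGauss w (v - y) := by
  have h1 := add_one_le_exp ‖v - y‖; rw [add_comm] at h1
  calc (1 + ‖v - y‖) * exp (wexp w y v) ≤ exp ‖v - y‖ * exp (wexp w y v) := by gcongr
    _ ≤ _ := by
      rw [domGauss, ← exp_add, ← exp_add, exp_le_exp, wexp]; have h2 := abs_log_jb_sub_le v (y - v)
      rw [add_sub_cancel, norm_sub_rev] at h2
      have h3 : w * (log (jb y) - log (jb v)) ≤ |w| * ‖v - y‖ := by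
        refine (le_abs_self _).trans ?_; rw [abs_mul]; gcongr
      nlinarith [sq_nonneg (‖v - y‖ / 2 - (|w| + 1)), abs_nonneg w]

lemma exp_wexp_le (w : ℝ) (y v : Vel) : exp (wexp w y v) ≤ domGauss w (v - y) := by
  refine le_trans ?_ (one_add_mul_exp_wexp_le w y v)
  nlinarith [exp_pos (wexp w y v), norm_nonneg (v - y)]

lemma abs_exp_sub_exp_le (a b : ℝ) :
    |exp a - exp b| ≤ |a - b| * exp a + |a - b| * exp b := by
  have key : ∀ a b : ℝ, exp a - exp b ≤ |a - b| * exp a := fun a b => by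
    have h1 := add_one_le_exp (b - a)
    have h2 : exp b = exp (b - a) * exp a := by rw [← exp_add]; ring_nf
    have h3 : a - b ≤ |a - b| := le_abs_self _; nlinarith [exp_pos a]
  have h2 := key b a; rw [abs_sub_comm b a] at h2
  have := mul_nonneg (abs_nonneg (a - b)) (exp_pos a).le
  have := mul_nonneg (abs_nonneg (a - b)) (exp_pos b).le
  exact abs_sub_le_iff.2 ⟨by linarith [key a b], by linarith⟩

lemma abs_wwin_le (w : ℝ) (y v : Vel) : |wwin w y v| ≤ domGauss w (v - y) := by
  rw [wwin_eq, abs_of_nonneg pos!]; refine le_trans ?_ (exp_wexp_le w y v); have := pi_rpow_le_one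
  nlinarith [exp_pos (wexp w y v)]

lemma abs_wwin_sub_le (w : ℝ) (y v a b : Vel) (ha : ‖a‖ ≤ 1) (hb : ‖b‖ ≤ 1) :
    |wwin w (y + a) (v + b) - wwin w y v| ≤ (‖a‖ + ‖b‖) * (3 * (|w| + 1)) *
      (domGauss w (v - y + (b - a)) + domGauss w (v - y)) := by
  set x := v - y; set c := b - a; have hx : v + b - (y + a) = x + c := by simp only [x, c]; abel
  have hc : ‖c‖ ≤ ‖a‖ + ‖b‖ := (norm_sub_le _ _).trans lin!
  have g1 := one_add_mul_exp_wexp_le w (y + a) (v + b); have g0 := one_add_mul_exp_wexp_le w y v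
  rw [hx] at g1
  have hd : |wexp w (y + a) (v + b) - wexp w y v| ≤ (‖a‖ + ‖b‖) * (|w| + 1) * (1 + ‖x‖) := by
    have e : wexp w (y + a) (v + b) - wexp w y v =
        w * ((log (jb (y + a)) - log (jb y)) - (log (jb (v + b)) - log (jb v)))
        - (‖x + c‖ ^ 2 - ‖x‖ ^ 2) / 2 := by
      simp only [wexp, hx]; ring
    rw [e]; have i1 := abs_log_jb_sub_le y a; have i2 := abs_log_jb_sub_le v b
    have i3 : |w * ((log (jb (y + a)) - log (jb y)) -
        (log (jb (v + b)) - log (jb v)))| ≤ |w| * (‖a‖ + ‖b‖) := by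
      rw [abs_mul]; gcongr; exact (abs_sub _ _).trans (add_le_add i1 i2)
    have i4 : |(‖x + c‖ ^ 2 - ‖x‖ ^ 2) / 2| ≤ (‖a‖ + ‖b‖) * (1 + ‖x‖) := by
      have j1 := norm_add_le x c; have j2 := norm_sub_norm_le x (-c)
      rw [sub_neg_eq_add, norm_neg] at j2
      have j3 : |‖x + c‖ - ‖x‖| ≤ ‖c‖ := abs_sub_le_iff.2 ⟨by linarith, by linarith⟩
      have j4 : (‖x + c‖ ^ 2 - ‖x‖ ^ 2) / 2 = (‖x + c‖ - ‖x‖) * ((‖x + c‖ + ‖x‖) / 2) := by ring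
      rw [j4, abs_mul, abs_of_nonneg (a := (‖x + c‖ + ‖x‖) / 2) pos!]
      have : (‖x + c‖ + ‖x‖) / 2 ≤ 1 + ‖x‖ := by linarith
      gcongr; linarith
    have : 0 ≤ |w| * (‖a‖ + ‖b‖) * ‖x‖ := by positivity
    exact (abs_sub _ _).trans lin!
  have hx3 : 1 + ‖x‖ ≤ 3 * (1 + ‖x + c‖) := by
    linarith [norm_nonneg (x + c), norm_le_add_norm_add x c]
  rw [wwin_eq, wwin_eq, ← mul_sub, abs_mul, abs_of_nonneg (a := π ^ (-(3 / 4) : ℝ)) pos!]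
  set E1 := exp (wexp w (y + a) (v + b)); set E0 := exp (wexp w y v); have hE1 : 0 < E1 := exp_pos _
  have hE0 : 0 < E0 := exp_pos _; set D := (‖a‖ + ‖b‖) * (|w| + 1); have hD : 0 ≤ D := by positivity
  calc π ^ (-(3 / 4) : ℝ) * |E1 - E0| ≤ 1 * |E1 - E0| := by gcongr; exact pi_rpow_le_one
    _ ≤ D * (1 + ‖x‖) * E1 + D * (1 + ‖x‖) * E0 := by
        rw [one_mul]; refine (abs_exp_sub_exp_le _ _).trans ?_; gcongr
    _ ≤ D * (3 * (1 + ‖x + c‖)) * E1 + D * (3 * (1 + ‖x‖)) * E0 := by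
        gcongr; linarith [norm_nonneg x]
    _ = 3 * D * ((1 + ‖x + c‖) * E1 + (1 + ‖x‖) * E0) := by ring
    _ ≤ 3 * D * (domGauss w (x + c) + domGauss w x) := by gcongr
    _ = _ := by simp only [D]; ring

lemma integrable_gaussian (b : ℝ) (hb : 0 < b) : Integrable fun x : Vel => exp (-b * ‖x‖ ^ 2) := by
  have := (GaussianFourier.integrable_cexp_neg_mul_sq_norm_add (b := (b : ℂ))
    (by simpa using hb) 0 (0 : Vel)).norm
  refine this.congr (.of_forall fun x => ?_); simp only [norm_exp]; norm_cast; simp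

lemma lintegral_domGauss_lt_top (w : ℝ) : ∫⁻ x, ‖domGauss w x‖ₑ ^ 2 < ⊤ := by
  refine (lintegral_congr fun x => ?_).trans_lt ((integrable_gaussian (1 / 2) num!).const_mul
    (exp ((|w| + 1) ^ 2) ^ 2)).2
  rw [← enorm_pow]; congr 1; rw [domGauss, mul_pow, ← exp_nat_mul (-‖x‖ ^ 2 / 4)]; congr 2
  push_cast; ring

/-- The `L²` norm of the dominating Gaussian. -/
def domNorm (w : ℝ) : ℝ := sqrt (∫⁻ x, ‖domGauss w x‖ₑ ^ 2).toReal

lemma lintegral_domGauss (w : ℝ) : ∫⁻ x, ‖domGauss w x‖ₑ ^ 2 = ofR (domNorm w ^ 2) := by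
  rw [domNorm, sq_sqrt toReal_nonneg, ofReal_toReal (lintegral_domGauss_lt_top w).ne]

@[fun_prop]
lemma continuous_gauss : Continuous gauss := by unfold gauss; fun_prop

lemma continuous_jb_rpow (w : ℝ) : Continuous fun v => jb v ^ w :=
  continuous_jb.rpow_const fun v => Or.inl (jb_pos v).ne'

lemma continuous_wwin (w : ℝ) : Continuous fun p : Ph => wwin w p.1 p.2 := by
  exact (((continuous_jb_rpow w).comp continuous_fst).mul
    ((continuous_jb_rpow (-w)).comp continuous_snd)).mul (by fun_prop)

lemma domNorm_nonneg (w : ℝ) : 0 ≤ domNorm w := sqrt_nonneg _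

lemma isWin_wwin_shift (w : ℝ) (a b : Vel) :
    IsWin (fun y v => wwin w (y + a) (v + b)) (domNorm w) where
  meas := by
    have : Continuous fun p : Ph => (p.1 + a, p.2 + b) := by fun_prop
    exact ((continuous_wwin w).comp this).measurable
  nonneg := domNorm_nonneg w
  dom := by
    refine ⟨fun x => domGauss w (x + (b - a)), by fun_prop, fun y v => ?_, ?_⟩
    · exact (abs_wwin_le w _ _).trans_eq (by congr 1; abel)
    · rw [lintegral_add_right_eq_self (fun x => ‖domGauss w x‖ₑ ^ 2), lintegral_domGauss]

lemma isWin_wwin (w : ℝ) : IsWin (wwin w) (domNorm w) := by simpa using isWin_wwin_shift w 0 0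

/-- The Lipschitz constant of the weighted windows under shifts. -/
def lipNorm (w : ℝ) : ℝ := 3 * (|w| + 1) * (2 * domNorm w)

lemma lipNorm_nonneg (w : ℝ) : 0 ≤ lipNorm w := by
  have := domNorm_nonneg w; unfold lipNorm; positivity

lemma isWin_wwin_sub (w : ℝ) (a b : Vel) (ha : ‖a‖ ≤ 1) (hb : ‖b‖ ≤ 1) :
    IsWin (fun y v => wwin w (y + a) (v + b) - wwin w y v) ((‖a‖ + ‖b‖) * lipNorm w) where
  meas := (isWin_wwin_shift w a b).meas.sub (isWin_wwin w).meas
  nonneg := mul_nonneg pos! (lipNorm_nonneg w)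
  dom := by
    refine ⟨fun x => (‖a‖ + ‖b‖) * (3 * (|w| + 1)) *
      (domGauss w (x + (b - a)) + domGauss w x), by fun_prop,
      fun y v => abs_wwin_sub_le w y v a b ha hb, ?_⟩
    · set D := (‖a‖ + ‖b‖) * (3 * (|w| + 1))
      have hpt : ∀ x, ‖D * (domGauss w (x + (b - a)) + domGauss w x)‖ₑ ^ 2 ≤
          ofR (2 * D ^ 2) * (‖domGauss w (x + (b - a))‖ₑ ^ 2 + ‖domGauss w x‖ₑ ^ 2) := by
        intro x
        rw [← ofReal_norm_sq, ← ofReal_norm_sq, ← ofReal_norm_sq, ← ofReal_add pos! pos!,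
          ← ofReal_mul pos!]
        refine ofReal_le_ofReal ?_; simp only [norm_eq_abs, sq_abs]
        nlinarith [mul_nonneg (sq_nonneg D) (sq_nonneg (domGauss w (x + (b - a)) - domGauss w x))]
      calc _ ≤ ∫⁻ x, ofR (2 * D ^ 2) *
            (‖domGauss w (x + (b - a))‖ₑ ^ 2 + ‖domGauss w x‖ₑ ^ 2) := lintegral_mono hpt
        _ = ofR (2 * D ^ 2) * (ofR (domNorm w ^ 2) + ofR (domNorm w ^ 2)) := by
            have hm : Measurable fun x => ‖domGauss w (x + (b - a))‖ₑ ^ 2 :=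
              Continuous.measurable (by fun_prop)
            rw [lintegral_const_mul' _ _ ofReal_ne_top, lintegral_add_left hm,
              lintegral_add_right_eq_self (fun x => ‖domGauss w x‖ₑ ^ 2), lintegral_domGauss]
        _ = _ := by
            rw [← ofReal_add pos! pos!, ← ofReal_mul pos!]; congr 1; simp only [D, lipNorm]; ring

/-! ### Quadratic interpolation of weighted `L²` spaces -/

/-- The weight `t x / (t + x)` of the quadratic `K`-functional. -/
def kfun (t : ℝ) (x : ℝ≥0) : ℝ≥0∞ := ofR (t * x / (t + x))

lemma kfun_mul_le (ht : 0 < t) (x : ℝ≥0) (a b : E) :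
    kfun t x * ‖a + b‖ₑ ^ 2 ≤ ofR t * ‖a‖ₑ ^ 2 + x * ‖b‖ₑ ^ 2 := by
  have hx := x.2; simp_rw [kfun, ← ofReal_norm_sq]
  rw [← ofReal_coe_nnreal, ← ofReal_mul pos!, ← ofReal_mul pos!,
    ← ofReal_mul pos!, ← ofReal_add pos! pos!]
  refine ofReal_le_ofReal ?_
  have h : ‖a + b‖ ^ 2 ≤ (‖a‖ + ‖b‖) ^ 2 := by gcongr; exact norm_add_le a b
  have hp : 0 < t + (x : ℝ) := by positivity
  rw [div_mul_eq_mul_div, div_le_iff₀ hp]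
  calc t * x * ‖a + b‖ ^ 2 ≤ t * x * (‖a‖ + ‖b‖) ^ 2 := by gcongr
    _ ≤ _ := by nlinarith [sq_nonneg (t * ‖a‖ - x * ‖b‖)]

lemma kfun_le (t : ℝ) (ht : 0 < t) (x : ℝ≥0) : kfun t x ≤ ofR t := by
  have hx := x.2; refine ofReal_le_ofReal ?_; rw [div_le_iff₀ pos!]; nlinarith

lemma measurable_kfun : Measurable fun p : ℝ × ℝ≥0 => kfun p.1 p.2 := by unfold kfun; fun_prop

/-- A diagonalization of a normed space: an isometry into an `L²` space whose range is stable
under multiplication by functions with values in `[0, 1]`. -/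
structure Diag {H α E : Type*} [NormedAddCommGroup H] [NormedAddCommGroup E] [NormedSpace ℝ E]
    [MeasurableSpace α] (μ : Measure α) (U : H → α → E) : Prop where
  aesm : ∀ f, AEStronglyMeasurable (U f) μ
  norm_sq : ∀ f, ‖f‖ₑ ^ 2 = ∫⁻ a, ‖U f a‖ₑ ^ 2 ∂μ
  add : ∀ f g, U (f + g) =ᵐ[μ] fun a => U f a + U g a
  mult : ∀ c : α → ℝ, Measurable c → (∀ a, 0 ≤ c a ∧ c a ≤ 1) →
    ∀ f, ∃ b, U b =ᵐ[μ] fun a => c a • U f a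

section

variable {H α E β F : Type*} [NormedAddCommGroup H] [NormedAddCommGroup E] [NormedSpace ℝ E]
  [MeasurableSpace α] {μ : Measure α} {U : H → α → E} [NormedAddCommGroup F]
  [MeasurableSpace β] {ν : Measure β} {S : H → β → F} {w : β → ℝ≥0} {w' : α → ℝ≥0} {C : ℝ≥0∞}

/-- An operator that is bounded for the weight `1` and maps the weight `w'` to the weight `w`. -/
structure WeightBdd (μ : Measure α) (U : H → α → E) (w' : α → ℝ≥0) (C : ℝ≥0∞) (ν : Measure β)
    (w : β → ℝ≥0) (S : H → β → F) : Prop where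
  aesm f : AEStronglyMeasurable (S f) ν
  add f g : S (f + g) =ᵐ[ν] fun b => S f b + S g b
  bdd f : ∫⁻ y, ‖S f y‖ₑ ^ 2 ∂ν ≤ C * ‖f‖ₑ ^ 2
  bddw f : ∫⁻ y, w y * ‖S f y‖ₑ ^ 2 ∂ν ≤ C * ∫⁻ x, w' x * ‖U f x‖ₑ ^ 2 ∂μ

lemma lintegral_kfun_le (hU : Diag μ U) (hw' : Measurable w') (hS : WeightBdd μ U w' C ν w S)
    (ht : 0 < t) (f : H) :
    ∫⁻ y, kfun t (w y) * ‖S f y‖ₑ ^ 2 ∂ν ≤ C * ∫⁻ x, kfun t (w' x) * ‖U f x‖ₑ ^ 2 ∂μ := by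
  have hpos : ∀ x, 0 < t + (w' x : ℝ) := fun x => by have := (w' x).2; positivity
  obtain ⟨b, hb⟩ := hU.mult (fun x => t / (t + w' x)) (by fun_prop) (fun x => by
    have := (w' x).2; constructor
    · positivity
    · rw [div_le_one (hpos x)]; linarith) f
  have hsplit := hU.add (f - b) b; rw [sub_add_cancel] at hsplit; have hS' := hS.add (f - b) b
  rw [sub_add_cancel] at hS'
  calc ∫⁻ y, kfun t (w y) * ‖S f y‖ₑ ^ 2 ∂ν
      ≤ ∫⁻ y, (ofR t * ‖S (f - b) y‖ₑ ^ 2 + w y * ‖S b y‖ₑ ^ 2) ∂ν := by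
        refine lintegral_mono_ae ?_; filter_upwards [hS'] with y hy; rw [hy]
        exact kfun_mul_le ht _ _ _
    _ = ofR t * ∫⁻ y, ‖S (f - b) y‖ₑ ^ 2 ∂ν + ∫⁻ y, w y * ‖S b y‖ₑ ^ 2 ∂ν := by
        rw [lintegral_add_left' (((hS.aesm _).enorm.pow_const 2).const_mul _),
          lintegral_const_mul'' _ ((hS.aesm _).enorm.pow_const 2)]
    _ ≤ ofR t * (C * ‖f - b‖ₑ ^ 2) + C * ∫⁻ x, w' x * ‖U b x‖ₑ ^ 2 ∂μ := by
        gcongr; exacts [hS.bdd _, hS.bddw _]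
    _ = C * ∫⁻ x, (ofR t * ‖U (f - b) x‖ₑ ^ 2 + w' x * ‖U b x‖ₑ ^ 2) ∂μ := by
        rw [lintegral_add_left' (((hU.aesm _).enorm.pow_const 2).const_mul _),
          lintegral_const_mul'' _ ((hU.aesm _).enorm.pow_const 2), hU.norm_sq (f - b)]
        ring
    _ = _ := by
        congr 1; refine lintegral_congr_ae ?_; filter_upwards [hb, hsplit] with x hx hx2
        have e : U (f - b) x = (w' x / (t + w' x) : ℝ) • U f x := by
          rw [hx] at hx2; rw [eq_sub_of_add_eq hx2.symm]
          nth_rewrite 1 [← one_smul ℝ (U f x)]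
          rw [← sub_smul]; congr 1; field_simp [(hpos x).ne']; ring
        have hw0 := (w' x).2; have := hpos x
        rw [e, hx, kfun, ← ofReal_norm_sq, ← ofReal_norm_sq, ← ofReal_norm_sq,
          ← ofReal_coe_nnreal, norm_smul, norm_smul,
          ← ofReal_mul pos!, ← ofReal_mul pos!,
          ← ofReal_mul pos!, ← ofReal_add pos! pos!]
        congr 1; rw [norm_of_nonneg pos!, norm_of_nonneg pos!]; field_simp; ring

lemma lintegral_Ioi_comp_mul {G : ℝ → ℝ≥0∞} {x : ℝ} (hx : 0 < x) :
    ∫⁻ t in Ioi (0 : ℝ), G t = ofR x * ∫⁻ t in Ioi (0 : ℝ), G (x * t) := by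
  have h := lintegral_image_eq_lintegral_abs_deriv_mul (measurableSet_Ioi (a := (0 : ℝ)))
    (fun t _ => ((hasDerivAt_id t).const_mul x).hasDerivWithinAt)
    (mul_right_injective₀ hx.ne').injOn G
  simp only [id, image_mul_left_Ioi hx, mul_zero, mul_one, abs_of_pos hx] at h
  rw [h, lintegral_const_mul' _ _ ofReal_ne_top]

/-- The constant in the integral representation of `x ^ s`. -/
def kappa (s : ℝ) : ℝ≥0∞ := ∫⁻ t in Ioi (0 : ℝ), ofR (t ^ (s - 2)) * kfun t 1

lemma lintegral_kfun (s : ℝ) (hs : 0 < s) (x : ℝ≥0) :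
    ∫⁻ t in Ioi (0 : ℝ), ofR (t ^ (s - 2)) * kfun t x = kappa s * (x : ℝ≥0∞) ^ s := by
  rcases eq_or_ne x 0 with rfl | hx0
  · simp [kfun, hs]
  have hx : (0 : ℝ) < x := lt_of_le_of_ne x.2 (fun h => hx0 (by exact_mod_cast h.symm))
  rw [lintegral_Ioi_comp_mul hx, kappa, ← lintegral_const_mul' _ _ ofReal_ne_top,
    mul_comm, ← lintegral_const_mul']
  · refine setLIntegral_congr_fun measurableSet_Ioi fun t ht => ?_; have ht' : (0 : ℝ) < t := ht
    simp only [kfun]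
    rw [← ofReal_coe_nnreal, ofReal_rpow_of_pos hx, ← ofReal_mul pos!, ← ofReal_mul pos!,
      ← ofReal_mul pos!, ← ofReal_mul pos!]
    congr 1
    rw [mul_rpow hx.le ht'.le, show s = (s - 2) + 1 + 1 by ring, rpow_add hx,
      rpow_add hx, Real.rpow_one]
    simp only [NNReal.coe_one]; have : (x : ℝ) * t + x = x * (t + 1) := by ring
    rw [this]; field_simp; congr 1; ring
  · exact rpow_ne_top_of_nonneg hs.le coe_ne_top

lemma kappa_ne_zero (s : ℝ) : kappa s ≠ 0 := by
  rw [kappa, Ne, setLIntegral_eq_zero_iff measurableSet_Ioi (by unfold kfun; fun_prop)]; intro h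
  have hz : (volume : Measure ℝ) (Ioi 0) = 0 := by
    refine measure_mono_null (fun t (ht : 0 < t) => ?_) (ae_iff.1 h)
    simp only [mem_ofPred_eq, Classical.not_imp]
    exact ⟨ht, (ENNReal.mul_pos (ofReal_pos.2 pos!).ne'
      (ofReal_pos.2 (by simp only [NNReal.coe_one]; positivity)).ne').ne'⟩
  simp at hz

lemma kappa_ne_top (hs0 : 0 < s) (hs1 : s < 1) : kappa s ≠ ⊤ := by
  have h1 : IntegrableOn (fun t : ℝ => t ^ (s - 1)) (Ioc 0 1) :=
    (intervalIntegrable_iff_integrableOn_Ioc_of_le zero_le_one).1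
      (intervalIntegral.intervalIntegrable_rpow' lin!)
  have h2 : IntegrableOn (fun t : ℝ => t ^ (s - 2)) (Ioi 1) :=
    integrableOn_Ioi_rpow_of_lt lin! zero_lt_one
  have e : Ioi (0 : ℝ) = Ioc 0 1 ∪ Ioi 1 := (Ioc_union_Ioi_eq_Ioi zero_le_one).symm
  refine ne_of_lt ?_; rw [kappa, e]
  refine (lintegral_union_le _ _ _).trans_lt (add_lt_top.2 ⟨?_, ?_⟩)
  · refine lt_of_le_of_lt (setLIntegral_mono' measurableSet_Ioc fun t ht => ?_) h1.2
    have ht' : (0 : ℝ) < t := ht.1; rw [kfun, ← ofReal_mul pos!, enorm_eq_ofReal_abs]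
    refine ofReal_le_ofReal (le_trans ?_ (le_abs_self _))
    have e1 : t ^ (s - 1) = t ^ (s - 2) * t := by
      rw [show s - 1 = (s - 2) + 1 by ring, rpow_add ht', Real.rpow_one]
    simp only [e1]; gcongr; simp only [NNReal.coe_one, mul_one]; rw [div_le_iff₀ pos!]; nlinarith
  · refine lt_of_le_of_lt (setLIntegral_mono' measurableSet_Ioi fun t ht => ?_) h2.2
    have ht' : 0 < t := zero_lt_one.trans (mem_Ioi.1 ht)
    rw [kfun, ← ofReal_mul pos!, enorm_eq_ofReal_abs]
    refine ofReal_le_ofReal (le_trans ?_ (le_abs_self _)); refine mul_le_of_le_one_right pos! ?_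
    simp only [NNReal.coe_one, mul_one]; rw [div_le_iff₀ pos!]; linarith

lemma kappa_mul_lintegral [SFinite ν] {g : β → ℝ≥0∞} (hg : AEMeasurable g ν) (hw : Measurable w)
    (hs0 : 0 < s) (hs1 : s < 1) :
    AEMeasurable (fun t => ofR (t ^ (s - 2)) * ∫⁻ y, kfun t (w y) * g y ∂ν)
      (volume.restrict (Ioi 0)) ∧
    kappa s * ∫⁻ y, (w y : ℝ≥0∞) ^ s * g y ∂ν =
      ∫⁻ t in Ioi (0 : ℝ), ofR (t ^ (s - 2)) * ∫⁻ y, kfun t (w y) * g y ∂ν := by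
  have hm : AEMeasurable (fun p : ℝ × β => ofR (p.1 ^ (s - 2)) * (kfun p.1 (w p.2) * g p.2))
      ((volume.restrict (Ioi 0)).prod ν) :=
    .mul (Measurable.aemeasurable (by fun_prop)) (.mul (measurable_kfun.comp
      (f := fun p : ℝ × β => (p.1, w p.2)) (by fun_prop)).aemeasurable hg.comp_snd)
  simp_rw [← lintegral_const_mul' _ _ ofReal_ne_top]; refine ⟨hm.lintegral_prod_right', ?_⟩
  rw [lintegral_lintegral_swap hm, ← lintegral_const_mul' _ _ (kappa_ne_top hs0 hs1)]
  refine lintegral_congr fun y => ?_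
  rw [← mul_assoc, ← lintegral_kfun s hs0, ← lintegral_mul_const]
  · simp only [mul_assoc]
  · have : Measurable fun t => kfun t (w y) := measurable_kfun.comp (f := fun t => (t, w y)) (by fun_prop)
    fun_prop

/-- Quadratic interpolation: an operator bounded for the weights `1` and `w` is bounded for
the weight `w ^ s`. -/
lemma lintegral_rpow_le [SFinite μ] [SFinite ν] (hs0 : 0 < s) (hs1 : s < 1)
    (hU : Diag μ U) (hw : Measurable w) (hw' : Measurable w')
    (hS : WeightBdd μ U w' C ν w S) (f : H) :
    ∫⁻ y, (w y : ℝ≥0∞) ^ s * ‖S f y‖ₑ ^ 2 ∂ν ≤ C * ∫⁻ x, (w' x : ℝ≥0∞) ^ s * ‖U f x‖ₑ ^ 2 ∂μ := by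
  have hk := kappa_mul_lintegral ((hU.aesm f).enorm.pow_const 2) hw' hs0 hs1
  rw [← ENNReal.mul_le_mul_iff_right (kappa_ne_zero s) (kappa_ne_top hs0 hs1), mul_left_comm,
    (kappa_mul_lintegral ((hS.aesm f).enorm.pow_const 2) hw hs0 hs1).2, hk.2,
    ← lintegral_const_mul'' _ hk.1]
  refine setLIntegral_mono' measurableSet_Ioi fun t ht => ?_; rw [mul_left_comm]; gcongr
  exact lintegral_kfun_le hU hw' hS ht f

lemma tendsto_lintegral_rpow [SFinite μ] [SFinite ν] (hs0 : 0 < s) (hs1 : s < 1)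
    (hU : Diag μ U) (hw : Measurable w) (hw' : Measurable w') (hC : C ≠ ⊤)
    {S : ℕ → H → β → F}
    (hS : ∀ n, WeightBdd μ U w' C ν w (S n)) (f : H)
    (hlim : Tendsto (fun n => ∫⁻ y, ‖S n f y‖ₑ ^ 2 ∂ν) atTop (nhds 0))
    (hf : ∫⁻ x, (w' x : ℝ≥0∞) ^ s * ‖U f x‖ₑ ^ 2 ∂μ < ⊤) :
    Tendsto (fun n => ∫⁻ y, (w y : ℝ≥0∞) ^ s * ‖S n f y‖ₑ ^ 2 ∂ν) atTop (nhds 0) := by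
  have hκ0 := kappa_ne_zero s; have hκ1 := kappa_ne_top hs0 hs1
  have main : Tendsto (fun n => kappa s * ∫⁻ y, (w y : ℝ≥0∞) ^ s * ‖S n f y‖ₑ ^ 2 ∂ν)
      atTop (nhds 0) := by
    have hn n := kappa_mul_lintegral (((hS n).aesm f).enorm.pow_const 2) hw hs0 hs1
    have hk := kappa_mul_lintegral ((hU.aesm f).enorm.pow_const 2) hw' hs0 hs1; simp_rw [(hn _).2]
    rw [← lintegral_zero (μ := volume.restrict (Ioi (0 : ℝ)))]
    refine tendsto_lintegral_of_dominated_convergence'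
      (fun t => C * (ofR (t ^ (s - 2)) * ∫⁻ x, kfun t (w' x) * ‖U f x‖ₑ ^ 2 ∂μ))
      (fun n => (hn n).1) ?_ ?_ ?_
    · intro n; refine (ae_restrict_iff' measurableSet_Ioi).2 (.of_forall fun t ht => ?_); simp only
      rw [mul_left_comm C]; gcongr; exact lintegral_kfun_le hU hw' (hS n) ht f
    · rw [lintegral_const_mul'' _ hk.1, ← hk.2]; exact mul_ne_top hC (mul_ne_top hκ1 hf.ne)
    · refine (ae_restrict_iff' measurableSet_Ioi).2 (.of_forall fun t ht => ?_)
      have h0 : Tendsto (fun n => ofR (t ^ (s - 2)) *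
          (ofR t * ∫⁻ y, ‖S n f y‖ₑ ^ 2 ∂ν)) atTop (nhds 0) := by
        have := ENNReal.Tendsto.const_mul (a := ofR (t ^ (s - 2)) * ofR t)
          hlim (Or.inr (mul_ne_top ofReal_ne_top ofReal_ne_top))
        simpa only [mul_zero, mul_assoc] using this
      refine tendsto_of_tendsto_of_tendsto_of_le_of_le tendsto_const_nhds h0 (fun _ => zero_le)
        fun n => ?_
      simp only; gcongr; rw [← lintegral_const_mul' _ _ ofReal_ne_top]
      exact lintegral_mono fun y => by gcongr; exact kfun_le t ht _
  have := ENNReal.Tendsto.const_mul (a := (kappa s)⁻¹) main (Or.inr (inv_ne_top.2 hκ0))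
  simpa only [← mul_assoc, ENNReal.inv_mul_cancel hκ0 hκ1, one_mul, mul_zero] using this

end

/-! ### The Sobolev part of the triple norm -/

lemma lintegral_sq_mul_le_of_phase {β : Type*} [MeasurableSpace β] {ν : Measure β}
    {g : β → ℝ≥0∞} (hg : AEMeasurable g ν) {θ : β → ℝ} (hθ : Measurable θ) {K : ℝ≥0∞}
    (h : ∀ r : ℝ, 0 < r → r ≤ 1 → ∫⁻ y, ‖cexp (I * ((r * θ y : ℝ) : ℂ)) - 1‖ₑ ^ 2 * g y ∂ν ≤
        ofR (r ^ 2) * K) :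
    ∫⁻ y, ofR (θ y ^ 2) * g y ∂ν ≤ K := by
  set r : ℕ → ℝ := fun n => 1 / ((n : ℝ) + 1) with hr
  have hr0 : ∀ n, 0 < r n := fun n => by simp only [hr]; positivity
  have hr1 n : r n ≤ 1 := by rw [hr, div_le_one pos!]; linarith [(Nat.cast_nonneg n : (0 : ℝ) ≤ n)]
  have hrt : Tendsto r atTop (nhds 0) := tendsto_one_div_add_atTop_nhds_zero_nat
  set G : ℕ → β → ℝ≥0∞ := fun n y => ofR ((r n)⁻¹ ^ 2) *
    (‖cexp (I * ((r n * θ y : ℝ) : ℂ)) - 1‖ₑ ^ 2 * g y) with hG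
  have hGm n : AEMeasurable (G n) ν := ((Measurable.aemeasurable (by fun_prop)).mul hg).const_mul _
  have hGK n : ∫⁻ y, G n y ∂ν ≤ K := by
    simp only [hG]; rw [lintegral_const_mul' _ _ ofReal_ne_top]
    refine (mul_le_mul_right (h _ (hr0 n) (hr1 n)) _).trans_eq ?_
    rw [← mul_assoc, ← ofReal_mul pos!, ← mul_pow, inv_mul_cancel₀ (hr0 n).ne']; simp
  have hlim : ∀ y, Tendsto (fun n => ofR ((r n)⁻¹ ^ 2) *
      ‖cexp (I * ((r n * θ y : ℝ) : ℂ)) - 1‖ₑ ^ 2) atTop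
      (nhds (ofR (θ y ^ 2))) := fun y => by
    have hd : HasDerivAt (fun t : ℝ => cexp (I * ((t * θ y : ℝ) : ℂ))) (I * (θ y : ℂ)) 0 := by
      have h1 := ((hasDerivAt_id (0 : ℝ)).mul_const (θ y)).ofReal_comp.const_mul I
      simpa using h1.cexp
    have h2 := hd.tendsto_slope_zero.comp
      (tendsto_nhdsWithin_iff.2 ⟨hrt, .of_forall fun n => (hr0 n).ne'⟩)
    have h3 := (ENNReal.continuous_ofReal.tendsto _).comp ((h2.norm).pow 2)
    have e : ‖I * (θ y : ℂ)‖ ^ 2 = θ y ^ 2 := by simp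
    rw [e] at h3; refine h3.congr fun n => ?_; have := hr0 n
    simp only [Function.comp_apply, zero_add, zero_mul, ofReal_zero, mul_zero,
      Complex.exp_zero, norm_smul, mul_pow]
    rw [norm_of_nonneg (inv_nonneg.2 this.le), ofReal_mul pos!, ofReal_norm_sq (E := ℂ)]
  refine le_trans (lintegral_mono fun y => ?_) ((lintegral_liminf_le' hGm).trans
    ((liminf_le_liminf (f := atTop) (.of_forall hGK)).trans_eq (liminf_const K)))
  by_cases hgt : g y = ⊤
  · by_cases hz : θ y = 0
    · simp [hz]
    refine le_trans le_top (le_of_eq ?_)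
    have hev : ∀ᶠ n in atTop, G n y = ⊤ := by
      filter_upwards [(hlim y).eventually_ne (ofReal_pos.2 pos!).ne'] with n hn
      simp only [hG, hgt, ← mul_assoc]; exact mul_top hn
    exact ((liminf_congr hev).trans (liminf_const _)).symm
  · rw [← (ENNReal.Tendsto.mul_const (b := g y) (hlim y) (Or.inr hgt)).liminf_eq]
    simp only [hG, mul_assoc, le_refl]

lemma lintegral_jb_sq_mul {β : Type*} [MeasurableSpace β] {ν : Measure β} {g : β → ℝ≥0∞}
    (hg : AEMeasurable g ν) {η : β → Vel} (hη : Measurable η) :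
    ∫⁻ y, ofR (jb (η y) ^ 2) * g y ∂ν =
      ∫⁻ y, g y ∂ν + ∑ j : Fin 3, ∫⁻ y, ofR (η y j ^ 2) * g y ∂ν := by
  have hm : ∀ j : Fin 3, AEMeasurable (fun y => ofR (η y j ^ 2) * g y) ν := fun j => by
    refine AEMeasurable.mul (Measurable.aemeasurable ?_) hg
    have : Measurable fun x : Vel => x j := by fun_prop
    exact ((this.comp hη).pow_const 2).ennreal_ofReal
  rw [← lintegral_finsetSum' _ fun j _ => hm j, ← lintegral_add_left' hg]
  refine lintegral_congr fun y => ?_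
  rw [jb_sq, norm_sq_eq, ofReal_add zero_le_one pos!,
    ofReal_sum_of_nonneg (fun j _ => by positivity), add_mul, sum_mul,
    ofReal_one, one_mul]
  simp

/-- Translation on `L²(ℝ³)`. -/
abbrev transOp (z : Vel) : L2v →ₗᵢ[ℂ] L2v := motionOp (LinearIsometryEquiv.refl ℝ Vel) z

lemma coeFn_transOp (z : Vel) (u : L2v) : transOp z u =ᵐ[volume] fun v => u (v + z) :=
  coeFn_motionOp _ z u

lemma fourier_comp_add (z ξ : Vel) : 𝓕 (fun v => f (v + z)) ξ =
      cexp (I * ((2 * π * inner ℝ z ξ : ℝ) : ℂ)) * 𝓕 f ξ := by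
  rw [fourier_eq', fourier_eq', ← integral_add_right_eq_self (μ := volV)
      (fun v : Vel => cexp (((-2 * π * inner ℝ v ξ : ℝ) : ℂ) * I) • f v) z,
    ← integral_const_mul]
  refine integral_ext fun v => ?_; simp only [smul_eq_mul]
  rw [← mul_assoc, ← Complex.exp_add, inner_add_left]; congr 2; push_cast; ring

lemma coeFn_fourier_transOp (z : Vel) (f : L2v) : (𝓕 (transOp z f) : L2v) =ᵐ[volume] fun ξ =>
      cexp (I * ((2 * π * inner ℝ z ξ : ℝ) : ℂ)) * (𝓕 f : L2v) ξ := by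
  set E : Vel → ℂ := fun ξ => cexp (I * ((2 * π * inner ℝ z ξ : ℝ) : ℂ))
  have hE : Measurable E := Continuous.measurable (by fun_prop)
  have hE1 ξ : ‖E ξ‖ ≤ 1 := by simp only [E]; rw [norm_exp]; simp
  have key : ∀ f : L2v, 𝓕 (transOp z f) = mulOp volume E (𝓕 f) := by
    intro f
    refine DenseRange.induction_on (p := fun f : L2v => 𝓕 (transOp z f) = mulOp volume E (𝓕 f))
      (SchwartzMap.denseRange_toLpCLM (E := Vel) (F := ℂ) (p := 2) (μ := volume)
        ofNat_ne_top) f ?_ ?_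
    · exact isClosed_eq ((Lp.fourierTransformₗᵢ Vel ℂ).continuous.comp (transOp z).continuous)
        ((mulOp volume E).continuous.comp (Lp.fourierTransformₗᵢ Vel ℂ).continuous)
    · intro g; have hg1 : Integrable (g : Vel → ℂ) := g.integrable
      have hg2 : MemLp (g : Vel → ℂ) 2 volume := g.memLp 2 volume
      have e0 : SchwartzMap.toLpCLM ℝ ℂ 2 volV g = hg2.toLp _ := rfl; rw [e0]
      have ht2 : MemLp (fun v => g (v + z)) 2 volV :=
        hg2.comp_measurePreserving (measurePreserving_add_right volume z)
      have e1 : transOp z (hg2.toLp _) = ht2.toLp _ := by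
        ext1
        have h := (measurePreserving_add_right volV z).quasiMeasurePreserving.ae hg2.coeFn_toLp
        filter_upwards [coeFn_transOp z (hg2.toLp _), ht2.coeFn_toLp, h] with v h1 h2 h3
        rw [h1, h2, h3]
      rw [e1]
      ext1
      filter_upwards [coeFn_fourier_toLp (hg1.comp_add_right z) ht2, coeFn_fourier_toLp hg1 hg2,
        coeFn_mulOp hE hE1 (𝓕 (hg2.toLp _))] with ξ h1 h2 h3
      rw [h1, h3, h2, fourier_comp_add]
  rw [key f]; exact coeFn_mulOp hE hE1 _

/-- The weight `⟨2πξ⟩²`. -/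
def wS (ξ : Vel) : ℝ≥0 := ⟨jb ((2 * π) • ξ) ^ 2, by positivity⟩

lemma measurable_wS : Measurable wS := by
  refine Measurable.subtype_mk ?_; exact ((continuous_jb.comp (by fun_prop)).pow 2).measurable

lemma coe_wS (ξ : Vel) : (wS ξ : ℝ≥0∞) = ofR (jb ((2 * π) • ξ) ^ 2) := by
  rw [← ofReal_coe_nnreal]; rfl

lemma diag_fourier : Diag volV (fun (f : L2v) => ((𝓕 f : L2v) : Vel → ℂ)) where
  aesm f := Lp.aestronglyMeasurable _
  norm_sq f := by rw [← enorm_sq_eq_lintegral, ← ofReal_norm, ← ofReal_norm, Lp.norm_fourier_eq]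
  add f g := by simp only [FourierTransform.fourier_add]; exact Lp.coeFn_add _ _
  mult c hc hc1 f := by
    have h2 a : ‖(c a : ℂ)‖ ≤ 1 := by rw [norm_real, norm_of_nonneg (hc1 a).1]; exact (hc1 a).2
    refine ⟨(Lp.fourierTransformₗᵢ Vel ℂ).symm (mulOp volume (fun a => (c a : ℂ)) (𝓕 f)), ?_⟩
    have : 𝓕 ((Lp.fourierTransformₗᵢ Vel ℂ).symm (mulOp volume (fun a => (c a : ℂ)) (𝓕 f))) =
        mulOp volume (fun a => (c a : ℂ)) (𝓕 f) :=
      (Lp.fourierTransformₗᵢ Vel ℂ).apply_symm_apply _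
    rw [this]
    filter_upwards [coeFn_mulOp (q := fun a => (c a : ℂ)) (by fun_prop) h2 (𝓕 f)] with a ha
    rw [ha, real_smul]

lemma sobolevSq_eq (hf : MemLp f 2 volume) :
    sobolevSq s f = ∫⁻ ξ, (wS ξ : ℝ≥0∞) ^ s * ‖(𝓕 (hf.toLp f) : L2v) ξ‖ₑ ^ 2 := by
  rw [sobolevSq, dif_pos hf]; refine lintegral_congr fun ξ => ?_
  rw [coe_wS, ofReal_rpow_of_pos (by have := jb_pos ((2 * π) • ξ); positivity),
    ← rpow_natCast, ← rpow_mul (jb_pos _).le]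
  norm_num

lemma enorm_sq_transOp_sub (z : Vel) (f : L2v) : ‖transOp z f - f‖ₑ ^ 2 = ∫⁻ ξ, ‖cexp (I *
      ((2 * π * inner ℝ z ξ : ℝ) : ℂ)) - 1‖ₑ ^ 2 * ‖(𝓕 f : L2v) ξ‖ₑ ^ 2 := by
  have h : ‖transOp z f - f‖ₑ = ‖(𝓕 (transOp z f) - 𝓕 f : L2v)‖ₑ := by
    have : (𝓕 (transOp z f) - 𝓕 f : L2v) = 𝓕 (transOp z f - f) :=
      (map_sub (Lp.fourierTransformₗᵢ Vel ℂ) _ _).symm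
    rw [this, ← ofReal_norm, ← ofReal_norm, Lp.norm_fourier_eq]
  rw [h, enorm_sq_eq_lintegral]; refine lintegral_congr_ae ?_
  filter_upwards [coeFn_fourier_transOp z f, Lp.coeFn_sub (𝓕 (transOp z f)) (𝓕 f)] with ξ h1 h2
  rw [h2, Pi.sub_apply, h1, ← mul_pow, ← enorm_mul]; congr 2; ring

lemma enorm_sq_transOp_sub_le (z : Vel) (f : L2v) : ‖transOp z f - f‖ₑ ^ 2 ≤ ofR (‖z‖ ^ 2) *
      ∫⁻ ξ, wS ξ * ‖(𝓕 f : L2v) ξ‖ₑ ^ 2 := by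
  rw [enorm_sq_transOp_sub, ← lintegral_const_mul' _ _ ofReal_ne_top]
  refine lintegral_mono fun ξ => ?_; rw [← mul_assoc]; gcongr
  rw [coe_wS, ← ofReal_mul pos!, ← ofReal_norm_sq]; refine ofReal_le_ofReal ?_; rw [← mul_pow]
  gcongr; refine (norm_exp_I_mul_ofReal_sub_one_le).trans ?_; rw [norm_eq_abs]
  have h1 : 2 * π * inner ℝ z ξ = inner ℝ z ((2 * π) • ξ) := by rw [inner_smul_right]
  rw [h1]; exact (abs_real_inner_le_norm _ _).trans (by gcongr; exact norm_le_jb _)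

lemma lintegral_wS_le {f : L2v} (h : ∀ z : Vel, ‖z‖ ≤ 1 → ‖transOp z f - f‖ ≤ K * ‖z‖) :
    ∫⁻ ξ, wS ξ * ‖(𝓕 f : L2v) ξ‖ₑ ^ 2 ≤ ‖f‖ₑ ^ 2 + ofR (3 * K ^ 2) := by
  have hm : AEMeasurable (fun ξ => ‖(𝓕 f : L2v) ξ‖ₑ ^ 2) volV :=
    (Lp.aestronglyMeasurable _).enorm.pow_const 2
  simp_rw [coe_wS]
  rw [lintegral_jb_sq_mul hm (η := fun ξ : Vel => (2 * π) • ξ) (by fun_prop),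
    ← diag_fourier.norm_sq f]
  gcongr
  have hj : ∀ j : Fin 3, ∫⁻ ξ : Vel, ofR (((2 * π) • ξ) j ^ 2) *
      ‖(𝓕 f : L2v) ξ‖ₑ ^ 2 ≤ ofR (K ^ 2) := fun j => by
    refine lintegral_sq_mul_le_of_phase hm (θ := fun ξ : Vel => ((2 * π) • ξ) j)
      (by fun_prop) fun r hr0 hr1 => ?_
    have hz : ‖(single j r : Vel)‖ = r := by rw [PiLp.norm_single, norm_of_nonneg hr0.le]
    have h1 := h (single j r) (by rw [hz]; exact hr1); rw [hz] at h1
    rw [← ofReal_mul pos!, ← mul_pow, mul_comm r]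
    refine (le_of_eq ?_).trans (((ofReal_norm_sq _).symm.trans_le (ofReal_le_ofReal
      (pow_le_pow_left₀ pos! h1 2))))
    rw [enorm_sq_transOp_sub]; refine lintegral_congr fun ξ => ?_; congr 6; rw [inner_single_left]
    simp; ring
  refine (sum_le_sum fun j _ => hj j).trans_eq ?_
  rw [sum_const, card_univ, Fintype.card_fin, ofReal_mul num!]; simp

/-! ### The spherical Laplacian on polynomials -/

/-- Complex polynomials in the three velocity variables. -/
abbrev Poly3 : Type := MvPolynomial (Fin 3) ℂ

/-- The rotation field `X_j ∂_k - X_k ∂_j` on polynomials. -/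
def rotP (j k : Fin 3) : Derivation ℂ Poly3 Poly3 :=
  (X j : Poly3) • pderiv k - (X k : Poly3) • pderiv j

/-- The spherical Laplacian on polynomials. -/
def lapP : Poly3 →ₗ[ℂ] Poly3 :=
  ∑ j : Fin 3, ∑ k : Fin 3, (rotP j k : Poly3 →ₗ[ℂ] Poly3) ∘ₗ (rotP j k : Poly3 →ₗ[ℂ] Poly3)

lemma rotP_apply (j k : Fin 3) (p : Poly3) : rotP j k p = X j * pderiv k p - X k * pderiv j p := rfl

lemma lapP_apply (p : Poly3) : lapP p = ∑ j : Fin 3, ∑ k : Fin 3, rotP j k (rotP j k p) := by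
  simp [lapP]

/-- The eigenvalues of the negative spherical Laplacian. -/
def sphEig (l : ℕ) : ℝ≥0 := 2 * l * (l + 1)

lemma sphEig_strictMono : StrictMono sphEig := by
  refine strictMono_nat_of_lt_succ fun l => ?_
  have h : ((sphEig l : ℝ≥0) : ℝ) < sphEig (l + 1) := by
    simp only [sphEig]; push_cast; nlinarith [(Nat.cast_nonneg l : (0 : ℝ) ≤ l)]
  exact_mod_cast h

/-- The spherical eigenpolynomials. -/
def polyEig (l : ℕ) : Submodule ℂ Poly3 :=
  LinearMap.ker (lapP + ((sphEig l : ℝ) : ℂ) • LinearMap.id)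

lemma mem_polyEig {p : Poly3} : p ∈ polyEig l ↔ lapP p = -(((sphEig l : ℝ) : ℂ) • p) := by
  rw [polyEig, LinearMap.mem_ker, eq_neg_iff_add_eq_zero]; rfl

/-- The polynomial `|v|²`. -/
def radP : Poly3 := ∑ i : Fin 3, X i ^ 2

lemma rotP_radP (j k : Fin 3) : rotP j k radP = 0 := by
  rw [rotP_apply, radP]
  fin_cases j <;> fin_cases k <;>
    simp [Fin.sum_univ_three, Derivation.leibniz_pow, pderiv_X] <;> ring

lemma lapP_radP_mul (p : Poly3) : lapP (radP * p) = radP * lapP p := by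
  simp only [lapP_apply, Derivation.leibniz, rotP_radP, smul_eq_mul, mul_zero, add_zero, mul_sum]

lemma radP_mul_mem {p : Poly3} (hp : p ∈ polyEig l) : radP * p ∈ polyEig l := by
  rw [mem_polyEig] at hp ⊢; rw [lapP_radP_mul, hp, mul_neg, mul_smul_comm]

lemma pderiv_comm (i j : Fin 3) (p : Poly3) : pderiv i (pderiv j p) = pderiv j (pderiv i p) := by
  have h : ⁅(pderiv i : Derivation ℂ Poly3 Poly3), (pderiv j : Derivation ℂ Poly3 Poly3)⁆ = 0 := by
    refine derivation_ext fun l => ?_; rw [Derivation.commutator_apply]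
    simp [pderiv_X, Pi.single_apply, apply_ite]
  exact sub_eq_zero.1 ((Derivation.commutator_apply _).symm.trans (congrArg (fun D => D p) h))

lemma lapP_homogeneous {p : Poly3} (hp : p.IsHomogeneous n) :
    lapP p = 2 * (radP * ∑ i : Fin 3, pderiv i (pderiv i p)) - ((sphEig n : ℝ) : ℂ) • p := by
  have h0 := hp.sum_X_mul_pderiv
  have h1 : ∀ i : Fin 3, pderiv i p + ∑ j : Fin 3, X j * pderiv j (pderiv i p) =
      (n : Poly3) * pderiv i p := fun i => by
    have := congrArg (pderiv i) h0; rw [map_sum, map_nsmul, nsmul_eq_mul] at this; rw [← this]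
    simp only [Derivation.leibniz, pderiv_X, smul_eq_mul, Pi.single_apply,
      sum_add_distrib, mul_ite, mul_one, mul_zero]
    rw [sum_ite_eq' ]; simp only [Finset.mem_univ, if_true, pderiv_comm i]; rw [add_comm]
  have e : ((sphEig n : ℝ) : ℂ) • p = (2 * (n : Poly3) * ((n : Poly3) + 1)) * p := by
    rw [smul_eq_C_mul]; congr 1; have : (C 2 : Poly3) = 2 := map_ofNat C 2; simp [sphEig, this]
  rw [e, lapP_apply, radP]; have h10 := h1 0; have h11 := h1 1; have h12 := h1 2
  rw [nsmul_eq_mul] at h0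
  simp only [Fin.sum_univ_three, rotP_apply, Derivation.leibniz, map_sub, smul_eq_mul, pderiv_X,
    Pi.single_apply] at h0 h10 h11 h12 ⊢
  simp only [Fin.isValue, reduceIte, Fin.reduceEq, pderiv_comm 1 0, pderiv_comm 2 0,
    pderiv_comm 2 1] at h0 h10 h11 h12 ⊢
  linear_combination (-2 : Poly3) * X 0 * h10 - 2 * X 1 * h11 - 2 * X 2 * h12 -
    (2 * (n : Poly3) + 2) * h0

lemma exists_lapP_add {q : Poly3} (hq : q ∈ ⨆ l : Fin n, polyEig l) :
    ∃ r ∈ ⨆ l : Fin n, polyEig l, lapP r + ((sphEig n : ℝ) : ℂ) • r = q := by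
  induction hq using iSup_induction' with
  | mem l q hq =>
    have hne : (((sphEig n : ℝ) : ℂ) - ((sphEig l : ℝ) : ℂ)) ≠ 0 :=
      sub_ne_zero.2 (mod_cast (sphEig_strictMono l.2).ne')
    refine ⟨(((sphEig n : ℝ) : ℂ) - ((sphEig l : ℝ) : ℂ))⁻¹ • q,
      smul_mem _ _ (mem_iSup_of_mem l hq), ?_⟩
    rw [mem_polyEig] at hq
    rw [map_smul, hq, smul_comm _ _ q, ← smul_add, neg_add_eq_sub, ← sub_smul,
      smul_smul, inv_mul_cancel₀ hne, one_smul]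
  | zero => exact ⟨0, Submodule.zero_mem _, by simp⟩
  | add x y _ _ hx hy =>
    obtain ⟨a, ha, ha'⟩ := hx; obtain ⟨b, hb, hb'⟩ := hy
    refine ⟨a + b, Submodule.add_mem _ ha hb, ?_⟩; rw [map_add, smul_add, ← ha', ← hb']; abel

lemma pderiv_of_homogeneous_zero {p : Poly3} (hp : p.IsHomogeneous 0) (i : Fin 3) :
    pderiv i p = 0 := by
  have h : p.totalDegree = 0 := Nat.le_zero.1 hp.totalDegree_le
  rw [totalDegree_eq_zero_iff_eq_C.1 h, pderiv_C]

lemma iSup_polyEig_mono (h : l ≤ n) : ⨆ i : Fin l, polyEig i ≤ ⨆ i : Fin n, polyEig i :=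
  iSup_le fun i => le_iSup (fun i : Fin n => polyEig i) (i.castLE h)

lemma homogeneous_mem_iSup (n : ℕ) {p : Poly3} (hp : p.IsHomogeneous n) :
    p ∈ ⨆ l : Fin (n + 1), polyEig l := by
  induction n using Nat.strong_induction_on generalizing p with
  | _ n ih =>
    have hq : 2 * (radP * ∑ i : Fin 3, pderiv i (pderiv i p)) ∈ ⨆ l : Fin n, polyEig l := by
      have hΔ : ∑ i : Fin 3, pderiv i (pderiv i p) ∈ ⨆ l : Fin n, polyEig l := by
        rcases n with _ | _ | n
        · simp [pderiv_of_homogeneous_zero hp]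
        · simp [fun i => pderiv_of_homogeneous_zero (hp.pderiv (i := i)) i]
        · have h1 : (∑ i : Fin 3, pderiv i (pderiv i p)).IsHomogeneous n :=
            IsHomogeneous.sum _ _ _ fun i _ => (hp.pderiv (i := i)).pderiv
          exact iSup_polyEig_mono (by omega) (ih n (by omega) h1)
      have h3 : radP * ∑ i : Fin 3, pderiv i (pderiv i p) ∈ ⨆ l : Fin n, polyEig l := by
        generalize ∑ i : Fin 3, pderiv i (pderiv i p) = q at hΔ ⊢
        induction hΔ using iSup_induction' with
        | mem l q hq => exact mem_iSup_of_mem l (radP_mul_mem hq)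
        | zero => simp
        | add x y _ _ hx hy => rw [mul_add]; exact Submodule.add_mem _ hx hy
      rw [two_mul]; exact Submodule.add_mem _ h3 h3
    obtain ⟨r, hr, hr'⟩ := exists_lapP_add hq
    have h4 : p - r ∈ polyEig n := by
      rw [mem_polyEig, map_sub, lapP_homogeneous hp, ← hr', smul_sub]; abel
    rw [← sub_add_cancel p r]
    exact Submodule.add_mem _ (mem_iSup_of_mem (p := fun l : Fin (n + 1) => polyEig l)
      ⟨n, by omega⟩ h4) (iSup_polyEig_mono n.le_succ hr)

lemma iSup_polyEig : ⨆ l, polyEig l = ⊤ := by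
  refine eq_top_iff.2 fun p _ => ?_; rw [← p.sum_homogeneousComponent]
  refine Submodule.sum_mem _ fun n _ => ?_
  exact (iSup_le fun l => le_iSup polyEig l : (⨆ l : Fin (n + 1), polyEig l) ≤ _)
    (homogeneous_mem_iSup n (homogeneousComponent_isHomogeneous n p))

/-- The action of the rotation of angle `θ` in the plane `(j, k)` on polynomials. -/
def rotA (j k : Fin 3) (θ : ℝ) : Poly3 →ₐ[ℂ] Poly3 :=
  aeval fun i => if i = j then MvPolynomial.C (cos θ : ℂ) * X j - MvPolynomial.C (sin θ : ℂ) * X k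
    else if i = k then MvPolynomial.C (cos θ : ℂ) * X k + MvPolynomial.C (sin θ : ℂ) * X j else X i

lemma hasDerivAt_rotA {E : Type*} [NormedAddCommGroup E] [NormedSpace ℂ E] (hjk : j ≠ k) (p : Poly3) (ℓ : Poly3 →ₗ[ℂ] E) (θ : ℝ) :
    HasDerivAt (fun t => ℓ (rotA j k t p)) (ℓ (rotA j k θ (rotP j k p))) θ := by
  have hc : HasDerivAt (fun t : ℝ => ((cos t : ℝ) : ℂ)) ((-sin θ : ℝ) : ℂ) θ :=
    (hasDerivAt_cos θ).ofReal_comp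
  have hs : HasDerivAt (fun t : ℝ => ((sin t : ℝ) : ℂ)) ((cos θ : ℝ) : ℂ) θ :=
    (hasDerivAt_sin θ).ofReal_comp
  have hX : ∀ i, rotP j k (X i) = if i = j then -X k else if i = k then X j else 0 := fun i => by
    rw [rotP_apply, pderiv_X, pderiv_X]; simp only [Pi.single_apply]
    split_ifs with h1 h2 <;> simp_all
  induction p using induction_on generalizing ℓ with
  | C a =>
    have h : ∀ t, rotA j k t (C a) = C a := fun t => aeval_C _ _
    have h' : rotP j k (C a) = 0 := by simp
    simp only [h, h', map_zero]; exact hasDerivAt_const _ _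
  | add p q hp hq => simp only [map_add]; exact (hp ℓ).add (hq ℓ)
  | mul_X p i hp =>
    have hm : ∀ q : Poly3, HasDerivAt (fun t => ℓ (rotA j k t p * q))
        (ℓ (rotA j k θ (rotP j k p) * q)) θ := fun q =>
      hp (ℓ ∘ₗ LinearMap.mulRight ℂ q)
    have hsm : ∀ (t : Poly3) (c : ℂ) (q : Poly3), ℓ (t * (C c * q)) = c • ℓ (t * q) :=
      fun t c q => by rw [← map_smul, smul_eq_C_mul]; ring_nf
    rw [Derivation.leibniz, hX]
    have hA : ∀ t i, rotA j k t (X i) = if i = j then C (cos t : ℂ) * X j -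
        C (sin t : ℂ) * X k else if i = k then C (cos t : ℂ) * X k +
        C (sin t : ℂ) * X j else X i := fun t i => aeval_X _ _
    simp only [map_mul, smul_eq_mul, map_add, hA]; by_cases h1 : i = j
    · simp only [h1, if_true, mul_sub, map_sub, hsm, mul_neg, map_neg, hA, hjk.symm, if_false,
        mul_add, map_add]
      refine ((hc.smul (hm (X j))).sub (hs.smul (hm (X k)))).congr_deriv ?_
      rw [mul_comm (_ - _ : Poly3), mul_sub, map_sub, hsm, hsm]; push_cast; module
    · by_cases h2 : i = k
      · simp only [h2, hjk.symm, if_true, mul_add, map_add, hsm, hA, if_false]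
        refine ((hc.smul (hm (X k))).add (hs.smul (hm (X j)))).congr_deriv ?_
        rw [mul_comm (_ + _ : Poly3), mul_add, map_add, hsm, hsm, mul_sub, map_sub, hsm, hsm]
        push_cast; module
      · simp only [h1, h2, if_false, map_zero, mul_zero, zero_add]; rw [mul_comm]; exact hm (X i)

/-! ### Polynomials with a radial factor -/

/-- The function `p(v) r(|v|²)`. -/
def polyR (r : ℝ → ℝ) (p : Poly3) (v : Vel) : ℂ := eval (fun i => (v i : ℂ)) p * (r (‖v‖ ^ 2) : ℂ)

lemma hasFDerivAt_coord (i : Fin 3) (v : Vel) : HasFDerivAt (fun v : Vel => (v i : ℂ))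
      (ofRealCLM.comp (proj i : Vel →L[ℝ] ℝ)) v :=
  (ofRealCLM.comp (proj i : Vel →L[ℝ] ℝ)).hasFDerivAt

lemma contDiff_coord (i : Fin 3) : ContDiff ℝ ∞ fun v : Vel => (v i : ℂ) :=
  (ofRealCLM.comp (proj i : Vel →L[ℝ] ℝ)).contDiff

lemma contDiff_evalPoly (p : Poly3) : ContDiff ℝ ∞ fun v : Vel => eval (fun i => (v i : ℂ)) p := by
  induction p using induction_on with
  | C a => simpa using contDiff_const
  | add p q hp hq => simpa using hp.add hq
  | mul_X p i hp => simpa using hp.mul (contDiff_coord i)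

lemma contDiff_ofReal_normSq {r : ℝ → ℝ} (hr : ContDiff ℝ ∞ r) :
    ContDiff ℝ ∞ fun v : Vel => (r (‖v‖ ^ 2) : ℂ) :=
  ofRealCLM.contDiff.comp (hr.comp (contDiff_norm_sq ℝ))

lemma contDiff_polyR {r : ℝ → ℝ} (hr : ContDiff ℝ ∞ r) (p : Poly3) : ContDiff ℝ ∞ (polyR r p) :=
  (contDiff_evalPoly p).mul (contDiff_ofReal_normSq hr)

lemma fderiv_evalPoly (p : Poly3) (v : Vel) (k : Fin 3) :
    fderiv ℝ (fun v : Vel => eval (fun i => (v i : ℂ)) p) v (single k 1) =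
      eval (fun i => (v i : ℂ)) (MvPolynomial.pderiv k p) := by
  have hd : ∀ p : Poly3, DifferentiableAt ℝ
      (fun v : Vel => eval (fun i => (v i : ℂ)) p) v := fun p =>
    (contDiff_evalPoly p).differentiable (by simp) v
  induction p using induction_on with
  | C a => simp
  | add p q hp hq => simp only [map_add]; rw [fderiv_fun_add (hd p) (hd q), add_apply, hp, hq]
  | mul_X p i hp =>
    have h := ((hd p).hasFDerivAt.fun_mul (hasFDerivAt_coord i v)).fderiv
    simp only [map_mul, eval_X]; rw [h]
    simp only [add_apply, smul_apply, hp,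
      Derivation.leibniz, MvPolynomial.pderiv_X, smul_eq_mul, map_add, map_mul,
      eval_X, comp_apply, PiLp.proj_apply,
      ofRealCLM_apply, Pi.single_apply, PiLp.single_apply]
    split_ifs with h <;> simp [h]

lemma fderiv_radial {r : ℝ → ℝ} (hr : ContDiff ℝ ∞ r) (v : Vel) (k : Fin 3) :
    fderiv ℝ (fun v : Vel => (r (‖v‖ ^ 2) : ℂ)) v (single k 1) =
      (2 * deriv r (‖v‖ ^ 2) * v k : ℝ) := by
  have h1 : HasFDerivAt (fun v : Vel => ‖v‖ ^ 2) (2 • innerSL ℝ v) v :=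
    (hasStrictFDerivAt_norm_sq v).hasFDerivAt
  have h2 : HasDerivAt r (deriv r (‖v‖ ^ 2)) (‖v‖ ^ 2) := (hr.differentiable (by simp) _).hasDerivAt
  have h3 := (ofRealCLM.hasFDerivAt.comp v (h2.comp_hasFDerivAt v h1)).fderiv
  have h4 : (fun v : Vel => (r (‖v‖ ^ 2) : ℂ)) = (ofRealCLM ∘ (r ∘ fun v : Vel => ‖v‖ ^ 2)) := rfl
  rw [h4, h3]; simp [inner_single_right]; ring

lemma rotField_polyR {r : ℝ → ℝ} (hr : ContDiff ℝ ∞ r) (j k : Fin 3) (p : Poly3) :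
    rotField j k (polyR r p) = polyR r (rotP j k p) := by
  funext v
  have h := (((contDiff_evalPoly p).differentiable (by simp) v).hasFDerivAt.fun_mul
    ((contDiff_ofReal_normSq hr).differentiable (by simp) v).hasFDerivAt).fderiv
  have h' : polyR r p = fun v : Vel => eval (fun i => (v i : ℂ)) p * (r (‖v‖ ^ 2) : ℂ) := rfl
  rw [rotField, h', h]
  simp only [add_apply, smul_apply, fderiv_evalPoly,
    fderiv_radial hr, polyR, rotP_apply, map_sub, map_mul, eval_X, smul_eq_mul]
  push_cast; ring

lemma rotField_self (j : Fin 3) (φ : Vel → ℂ) : rotField j j φ = 0 := by funext v; simp [rotField]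

lemma sphLaplacian_eq (φ : Vel → ℂ) (v : Vel) :
    sphLaplacian φ v = ∑ j : Fin 3, ∑ k : Fin 3, rotField j k (rotField j k φ) v := by
  rw [sphLaplacian]; refine sum_congr rfl fun j _ => sum_congr rfl fun k _ => ?_
  split_ifs with h
  · rfl
  · rw [not_not.1 h, rotField_self]; rfl

lemma polyR_sum (r : ℝ → ℝ) (s : Finset ι) (p : ι → Poly3) (v : Vel) :
    polyR r (∑ i ∈ s, p i) v = ∑ i ∈ s, polyR r (p i) v := by
  simp [polyR, sum_mul]

lemma sphLaplacian_polyR {r : ℝ → ℝ} (hr : ContDiff ℝ ∞ r) (p : Poly3) (v : Vel) :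
    sphLaplacian (polyR r p) v = polyR r (lapP p) v := by
  simp only [sphLaplacian_eq, lapP_apply, polyR_sum, rotField_polyR hr]

lemma polyR_smul (r : ℝ → ℝ) (c : ℂ) (p : Poly3) (v : Vel) :
    polyR r (c • p) v = c * polyR r p v := by
  simp [polyR, smul_eval, mul_assoc]

lemma sphLaplacian_polyR_of_mem {r : ℝ → ℝ} (hr : ContDiff ℝ ∞ r) {p : Poly3}
    (hp : p ∈ polyEig l) (v : Vel) :
    sphLaplacian (polyR r p) v = -(((sphEig l : ℝ) : ℂ) * polyR r p v) := by
  rw [sphLaplacian_polyR hr, mem_polyEig.1 hp, ← neg_smul, polyR_smul, neg_mul]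

/-! ### Integration by parts for rotation fields -/

lemma contDiff_rotField (j k : Fin 3) (hφ : ContDiff ℝ ∞ φ) : ContDiff ℝ ∞ (rotField j k φ) := by
  have h : ∀ z : Vel, ContDiff ℝ ∞ fun v => fderiv ℝ φ v z := fun z =>
    (hφ.fderiv_right (m := ∞) (by simp)).clm_apply contDiff_const
  exact ((contDiff_coord j).mul (h _)).sub ((contDiff_coord k).mul (h _))

lemma hasCompactSupport_rotField (hφ : HasCompactSupport φ) (j k : Fin 3) :
    HasCompactSupport (rotField j k φ) := by
  have h : ∀ z : Vel, HasCompactSupport fun v => fderiv ℝ φ v z := fun z => hφ.fderiv_apply ℝ z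
  exact (h _).mul_left.sub (h _).mul_left

lemma integrable_conj_mul (hf : Continuous f) (hg : Continuous g) (hc : HasCompactSupport g) :
    Integrable fun v => conj (f v) * g v :=
  ((continuous_conj.comp hf).mul hg).integrable_of_hasCompactSupport hc.mul_left

lemma integral_conj_mul_rotField (j k : Fin 3) (hf : ContDiff ℝ ∞ f)
    (hφ : ContDiff ℝ ∞ φ) (hc : HasCompactSupport φ) :
    ∫ v, conj (f v) * rotField j k φ v = -∫ v, conj (rotField j k f v) * φ v := by
  have hco j : Continuous fun v : Vel => (v j : ℂ) := (contDiff_coord j).continuous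
  set B : ℂ →L[ℝ] ℂ →L[ℝ] ℂ := (mul ℝ ℂ).comp (conjCLE : ℂ →L[ℝ] ℂ) with hB
  have hBa : ∀ x y, B x y = conj x * y := fun x y => rfl
  have key j k : Integrable (fun v : Vel => conj ((v j : ℂ) * f v) * fderiv ℝ φ v (single k 1)) ∧
      Integrable (fun v : Vel => conj ((if k = j then 1 else 0) * f v +
        (v j : ℂ) * fderiv ℝ f v (single k 1)) * φ v) ∧
      ∫ v : Vel, conj ((v j : ℂ) * f v) * fderiv ℝ φ v (single k 1) =
      -∫ v : Vel, conj ((if k = j then 1 else 0) * f v +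
        (v j : ℂ) * fderiv ℝ f v (single k 1)) * φ v := by
    have hm : Continuous fun v : Vel => (v j : ℂ) * f v := (hco j).mul hf.continuous
    have ia := integrable_conj_mul hm
      ((hφ.continuous_fderiv (by simp)).clm_apply continuous_const) (hc.fderiv_apply ℝ (single k 1))
    have ib := integrable_conj_mul ((continuous_const.mul hf.continuous).add ((hco j).mul
      ((hf.continuous_fderiv (by simp)).clm_apply continuous_const))) hφ.continuous hc
      (f := fun v : Vel => (if k = j then 1 else 0) * f v + (v j : ℂ) * fderiv ℝ f v (single k 1))
    refine ⟨ia, ib, ?_⟩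
    have hd : ∀ v : Vel, fderiv ℝ (fun v : Vel => (v j : ℂ) * f v) v (single k 1) =
        (if k = j then 1 else 0) * f v + (v j : ℂ) * fderiv ℝ f v (single k 1) := by
      intro v
      have h := ((hasFDerivAt_coord j v).fun_mul (hf.differentiable (by simp) v).hasFDerivAt).fderiv
      rw [h]
      simp only [add_apply, smul_apply, smul_eq_mul, comp_apply, PiLp.proj_apply, ofRealCLM_apply,
        PiLp.single_apply]
      by_cases h1 : j = k
      · simp [h1, add_comm]
      · simp [h1, Ne.symm h1]
    have h := integral_bilinear_fderiv_right_eq_neg_left_of_integrable (μ := volV)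
      (f := fun v : Vel => (v j : ℂ) * f v) (g := φ) (v := single k 1) (B := B)
      (by simpa only [hBa, hd] using ib) (by simpa only [hBa] using ia)
      (by simpa only [hBa] using integrable_conj_mul hm hφ.continuous hc)
      (fun v _ => ((contDiff_coord j).mul hf).differentiable (by simp) v)
      (fun v _ => hφ.differentiable (by simp) v)
    simpa only [hBa, hd] using h
  have e1 : ∀ v, conj (f v) * rotField j k φ v =
      conj ((v j : ℂ) * f v) * fderiv ℝ φ v (single k 1) -
      conj ((v k : ℂ) * f v) * fderiv ℝ φ v (single j 1) := fun v => by
    simp only [rotField, map_mul, conj_ofReal]; ring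
  obtain ⟨⟨a1, b1, h1⟩, a2, b2, h2⟩ := And.intro (key j k) (key k j); simp_rw [e1]
  rw [integral_sub a1 a2, h1, h2, neg_sub_neg, ← integral_sub b2 b1, ← integral_neg]
  refine integral_ext fun v => ?_
  simp only [rotField, map_add, map_mul, map_sub, conj_ofReal, eq_comm (a := j)]; ring

lemma integral_conj_mul_sphLaplacian (hf : ContDiff ℝ ∞ f)
    (hφ : ContDiff ℝ ∞ φ) (hc : HasCompactSupport φ) :
    Integrable (fun v => conj (f v) * sphLaplacian φ v) ∧
    ∫ v, conj (f v) * sphLaplacian φ v = ∫ v, conj (sphLaplacian f v) * φ v := by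
  have h1 j k := integrable_conj_mul hf.continuous (contDiff_rotField j k
    (contDiff_rotField j k hφ)).continuous (hasCompactSupport_rotField
      (hasCompactSupport_rotField hc j k) j k)
  have h2 j k := integrable_conj_mul (contDiff_rotField j k (contDiff_rotField j k hf)).continuous
    hφ.continuous hc
  have h3 j := integrable_finsetSum Finset.univ fun k _ => h1 j k
  simp only [sphLaplacian_eq, map_sum, mul_sum, sum_mul]
  refine ⟨integrable_finsetSum _ fun j _ => h3 j, ?_⟩
  rw [integral_finsetSum _ fun j _ => h3 j,
    integral_finsetSum _ fun j _ => integrable_finsetSum _ fun k _ => h2 j k]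
  refine sum_congr rfl fun j _ => ?_
  rw [integral_finsetSum _ fun k _ => h1 j k, integral_finsetSum _ fun k _ => h2 j k]
  refine sum_congr rfl fun k _ => ?_
  rw [integral_conj_mul_rotField j k hf (contDiff_rotField j k hφ) (hasCompactSupport_rotField hc j k),
    integral_conj_mul_rotField j k (contDiff_rotField j k hf) hφ hc, neg_neg]

/-! ### Polynomials times a Gaussian -/

lemma norm_evalPoly_le (p : Poly3) (hb : 0 < b) :
    ∃ C : ℝ, 0 ≤ C ∧ ∀ v : Vel, ‖eval (fun i => (v i : ℂ)) p‖ ≤ C * exp (b * ‖v‖ ^ 2) := by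
  induction p using induction_on generalizing b with
  | C a =>
    refine ⟨‖a‖, norm_nonneg _, fun v => ?_⟩; rw [eval_C]
    exact le_mul_of_one_le_right pos! (one_le_exp pos!)
  | add p q hp hq =>
    obtain ⟨C, hC, h⟩ := hp hb; obtain ⟨D, hD, h'⟩ := hq hb
    refine ⟨C + D, by positivity, fun v => ?_⟩; rw [map_add, add_mul]
    exact (norm_add_le _ _).trans (add_le_add (h v) (h' v))
  | mul_X p i hp =>
    obtain ⟨C, hC, h⟩ := hp (b := b / 2) pos!; refine ⟨C * (1 + 2 / b), by positivity, fun v => ?_⟩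
    rw [map_mul, eval_X, norm_mul, norm_real]
    have h1 : ‖v i‖ ≤ (1 + 2 / b) * exp (b / 2 * ‖v‖ ^ 2) := by
      have h2 : ‖v i‖ ≤ ‖v‖ := PiLp.norm_apply_le v i; have h3 := add_one_le_exp (b / 2 * ‖v‖ ^ 2)
      have h4 : ‖v‖ ≤ 1 + ‖v‖ ^ 2 := by nlinarith [sq_nonneg (‖v‖ - 1)]
      have h5 : ‖v‖ ^ 2 ≤ 2 / b * exp (b / 2 * ‖v‖ ^ 2) := by
        rw [div_mul_eq_mul_div, le_div_iff₀ hb]; nlinarith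
      have h6 : 1 ≤ exp (b / 2 * ‖v‖ ^ 2) := one_le_exp pos!; linarith
    calc _ ≤ C * exp (b / 2 * ‖v‖ ^ 2) * ((1 + 2 / b) * exp (b / 2 * ‖v‖ ^ 2)) := by
          gcongr; exact h v
      _ = C * (1 + 2 / b) * (exp (b / 2 * ‖v‖ ^ 2) * exp (b / 2 * ‖v‖ ^ 2)) := by ring
      _ = _ := by rw [← exp_add]; ring_nf

/-- The radial Gaussian as a function of `|v|²`. -/
def gexp (x : ℝ) : ℝ := exp (-(1 / 2) * x)

lemma contDiff_gexp : ContDiff ℝ ∞ gexp := by unfold gexp; fun_prop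

lemma norm_polyR_gexp_le (p : Poly3) : ∃ C : ℝ, 0 ≤ C ∧ ∀ v : Vel,
    ‖polyR gexp p v‖ ≤ C * exp (-(1 / 4) * ‖v‖ ^ 2) := by
  obtain ⟨C, hC, h⟩ := norm_evalPoly_le p (b := 1 / 4) num!; refine ⟨C, hC, fun v => ?_⟩
  rw [polyR, norm_mul, norm_real, gexp, norm_of_nonneg (exp_pos _).le]
  calc _ ≤ C * exp (1 / 4 * ‖v‖ ^ 2) * exp (-(1 / 2) * ‖v‖ ^ 2) := by gcongr; exact h v
    _ = _ := by rw [mul_assoc, ← exp_add]; ring_nf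

lemma memLp_gaussian (hb : 0 < b) : MemLp (fun v : Vel => exp (-b * ‖v‖ ^ 2)) 2 volume := by
  rw [memLp_two_iff_integrable_sq (Continuous.aestronglyMeasurable (by fun_prop))]
  refine (integrable_gaussian (2 * b) pos!).congr (.of_forall fun v => ?_); simp only
  rw [sq (exp _), ← exp_add]; congr 1; ring

lemma memLp_polyR_gexp (p : Poly3) : MemLp (polyR gexp p) 2 volume := by
  obtain ⟨C, hC, h⟩ := norm_polyR_gexp_le p
  refine MemLp.of_le ((memLp_gaussian (b := 1 / 4) num!).const_mul C)
    (contDiff_polyR contDiff_gexp p).continuous.aestronglyMeasurable (.of_forall fun v => ?_)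
  rw [norm_of_nonneg pos!]; exact h v

/-- Polynomials times the Gaussian `e^{-|v|²/2}`, as elements of `L²(ℝ³)`. -/
def polyL : Poly3 →ₗ[ℂ] L2v where
  toFun p := (memLp_polyR_gexp p).toLp _
  map_add' p q := by
    rw [← MemLp.toLp_add]; exact MemLp.toLp_congr _ _ (.of_forall fun v => by simp [polyR, add_mul])
  map_smul' c p := by
    rw [RingHom.id_apply, ← MemLp.toLp_const_smul]
    exact MemLp.toLp_congr _ _ (.of_forall fun v => by rw [polyR_smul]; rfl)

lemma coeFn_polyL (p : Poly3) : polyL p =ᵐ[volume] polyR gexp p := (memLp_polyR_gexp p).coeFn_toLp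

lemma polyL_mem_sphEigenspace {p : Poly3} (hp : p ∈ polyEig l) :
    polyL p ∈ sphEigenspace (sphEig l) := by
  rw [sphEigenspace, mem_orthogonal']; intro g hg
  induction hg using span_induction with
  | zero => simp
  | add x y _ _ hx hy => rw [inner_add_right, hx, hy, add_zero]
  | smul c x _ hx => rw [inner_smul_right, hx, mul_zero]
  | mem g hg =>
    obtain ⟨φ, hφ, hc, hg⟩ := hg; have hf := contDiff_polyR contDiff_gexp p; rw [inner_eq_integral]
    have h1 : ∫ v, conj (polyL p v) * g v = ∫ v, conj (polyR gexp p v) *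
        (sphLaplacian φ v + ((sphEig l : ℝ) : ℂ) * φ v) := by
      refine integral_congr_ae ?_; filter_upwards [coeFn_polyL p, hg] with v h1 h2; rw [h1, h2]
    obtain ⟨hi1, hi⟩ := integral_conj_mul_sphLaplacian hf hφ hc; rw [h1]; simp_rw [mul_add]
    rw [integral_add hi1 (integrable_conj_mul (g := fun v => ((sphEig l : ℝ) : ℂ) * φ v)
      hf.continuous (continuous_const.mul hφ.continuous) hc.mul_left), hi, add_eq_zero_iff_eq_neg, ← integral_neg]
    refine integral_ext fun v => ?_
    simp only [sphLaplacian_polyR_of_mem contDiff_gexp hp, map_neg, map_mul, conj_ofReal]; ring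

/-! ### Completeness of the spherical eigenfunctions -/

lemma inner_polyL (p : Poly3) (u : L2v) : inn (polyL p) u = ∫ v, conj (polyR gexp p v) * u v := by
  rw [inner_eq_integral]; refine integral_congr_ae ?_; filter_upwards [coeFn_polyL p] with v hv
  rw [hv]

lemma integrable_conj_polyR_mul (p : Poly3) (u : L2v) :
    Integrable fun v => conj (polyR gexp p v) * u v :=
  MemLp.integrable_mul (p := 2) (q := 2) (memLp_polyR_gexp p).star (Lp.memLp u)

lemma exp_mul_gexp_le (ξ v : Vel) : exp |inner ℝ v ξ| * gexp (‖v‖ ^ 2) ≤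
      exp (‖ξ‖ ^ 2) * exp (-(1 / 4) * ‖v‖ ^ 2) := by
  rw [gexp, ← exp_add, ← exp_add]; refine exp_le_exp.2 ?_
  nlinarith [abs_real_inner_le_norm v ξ, sq_nonneg (‖v‖ - 2 * ‖ξ‖), norm_nonneg v, norm_nonneg ξ]

lemma eq_zero_of_inner_polyL {u : L2v} (hu : ∀ p, inn (polyL p) u = 0) : u = 0 := by
  set f : Vel → ℂ := fun v => (gexp (‖v‖ ^ 2) : ℂ) * u v with hf
  have hgc : Continuous fun v : Vel => (gexp (‖v‖ ^ 2) : ℂ) :=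
    (contDiff_ofReal_normSq contDiff_gexp).continuous
  have hg0 : ∀ x, 0 < gexp x := fun x => exp_pos _; have hum := Lp.aestronglyMeasurable u
  have hfm : AEStronglyMeasurable f volume := hgc.aestronglyMeasurable.mul hum
  have hg1 : ∀ v : Vel, ‖(gexp (‖v‖ ^ 2) : ℂ)‖ ≤ 1 := fun v => by
    rw [norm_real, norm_of_nonneg (hg0 _).le, gexp, exp_le_one_iff]; have := sq_nonneg ‖v‖; linarith
  have hf2 : MemLp f 2 volume := by
    refine MemLp.of_le (Lp.memLp u) hfm (.of_forall fun v => ?_); rw [hf, norm_mul]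
    exact mul_le_of_le_one_left pos! (hg1 v)
  have hbd : ∀ ξ : Vel, Integrable fun v => exp |inner ℝ v ξ| * ‖f v‖ := fun ξ => by
    have h1 : Integrable fun v => exp (‖ξ‖ ^ 2) * (exp (-(1 / 4) * ‖v‖ ^ 2) * ‖u v‖) :=
      (MemLp.integrable_mul (p := 2) (q := 2) (memLp_gaussian (b := 1 / 4) num!)
        (Lp.memLp u).norm).const_mul _
    refine h1.mono ((Continuous.aestronglyMeasurable (by fun_prop)).mul hfm.norm)
      (.of_forall fun v => ?_)
    rw [norm_of_nonneg pos!, norm_of_nonneg pos!, hf, norm_mul,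
      norm_real, norm_of_nonneg (hg0 _).le, ← mul_assoc, ← mul_assoc]
    exact mul_le_mul_of_nonneg_right (exp_mul_gexp_le ξ v) pos!
  have hf1 : Integrable f := (integrable_norm_iff hfm).1 (by simpa using hbd 0)
  have hmom : ∀ (ξ : Vel) (n : ℕ), ∫ v, (inner ℝ v ξ : ℂ) ^ n * f v = 0 := fun ξ n => by
    have h := hu ((∑ i : Fin 3, MvPolynomial.C (ξ i : ℂ) * MvPolynomial.X i) ^ n)
    rw [inner_polyL] at h; rw [← h]; refine integral_ext fun v => ?_
    have e : (inner ℝ v ξ : ℂ) = ∑ i : Fin 3, (ξ i : ℂ) * (v i : ℂ) := by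
      rw [PiLp.inner_apply]; push_cast; simp [Fin.sum_univ_three]
    simp only [polyR, map_pow, map_sum, map_mul, eval_C, eval_X, hf, conj_ofReal, e]; ring
  have hexp : ∀ ξ, expInt f ξ = 0 := fun ξ => by
    have h := hasSum_integral_of_dominated_convergence (μ := volV)
      (F := fun (n : ℕ) (v : Vel) => (-I * (inner ℝ v ξ : ℂ)) ^ n / (n.factorial : ℂ) * f v)
      (f := fun v => eN v ξ * f v)
      (fun n v => |inner ℝ v ξ| ^ n / n.factorial * ‖f v‖)
      (fun n => (Continuous.aestronglyMeasurable (by fun_prop)).mul hfm)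
      (fun n => .of_forall fun v => by simp)
      (.of_forall fun v => (summable_pow_div_factorial _).mul_right _)
      (by
        refine (hbd ξ).congr (.of_forall fun v => ?_); simp only
        rw [tsum_mul_right, exp_eq_exp_ℝ, NormedSpace.exp_eq_tsum_div])
      (.of_forall fun v => by
        refine HasSum.mul_right _ ?_; rw [exp_eq_exp_ℂ]
        exact NormedSpace.expSeries_div_hasSum_exp _)
    have hz (n : ℕ) : ∫ v : Vel, (-I * (inner ℝ v ξ : ℂ)) ^ n / (n.factorial : ℂ) * f v = 0 := by
      rw [← mul_zero ((-I) ^ n / (n.factorial : ℂ)), ← hmom ξ n, ← integral_const_mul]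
      exact integral_ext fun v => by rw [mul_pow]; ring
    simp only [hz] at h; exact h.unique hasSum_zero
  have h0 := lintegral_expInt hf1 hf2
  simp only [hexp, enorm_zero, ne_eq, OfNat.ofNat_ne_zero, not_false_eq_true, zero_pow,
    lintegral_zero] at h0
  have h1 := (mul_eq_zero.1 h0.symm).resolve_left (ofReal_pos.2 pos!).ne'
  rw [lintegral_eq_zero_iff' (hfm.enorm.pow_const 2)] at h1; refine (Lp.eq_zero_iff_ae_eq_zero).2 ?_
  filter_upwards [h1] with v hv
  exact (mul_eq_zero.1 (by simpa using hv : f v = 0)).resolve_left (mod_cast (hg0 _).ne')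

/-- The Gaussian cut off smoothly, as a function of `|v|²`. -/
def gcut (n : ℕ) (x : ℝ) : ℝ := gexp x * smoothTransition (2 - x / (n + 1))

lemma contDiff_gcut (n : ℕ) : ContDiff ℝ ∞ (gcut n) :=
  contDiff_gexp.mul (Real.smoothTransition.contDiff.comp (by fun_prop))

lemma hasCompactSupport_polyR_gcut (n : ℕ) (p : Poly3) : HasCompactSupport (polyR (gcut n) p) := by
  refine HasCompactSupport.of_support_subset_isCompact
    (isCompact_closedBall (0 : Vel) (sqrt (2 * (n + 1)))) fun v hv => ?_
  rw [mem_closedBall_zero_iff]; by_contra! h; refine hv ?_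
  rw [polyR, gcut, smoothTransition.zero_of_nonpos]
  · simp
  · rw [sub_nonpos, le_div_iff₀ pos!]; exact (lt_sq_of_sqrt_lt h).le

lemma norm_polyR_gcut_le (n : ℕ) (p : Poly3) (v : Vel) :
    ‖polyR (gcut n) p v‖ ≤ ‖polyR gexp p v‖ := by
  rw [polyR, polyR, norm_mul, norm_mul, norm_real, norm_real, gcut, norm_mul,
    norm_of_nonneg (smoothTransition.nonneg _)]
  exact mul_le_mul_of_nonneg_left (mul_le_of_le_one_right pos! (smoothTransition.le_one _)) pos!

lemma tendsto_polyR_gcut (p : Poly3) (v : Vel) :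
    Tendsto (fun n => polyR (gcut n) p v) atTop (nhds (polyR gexp p v)) := by
  refine tendsto_const_nhds.congr' ?_; obtain ⟨N, hN⟩ := exists_nat_ge (‖v‖ ^ 2)
  filter_upwards [eventually_ge_atTop N] with n hn
  rw [polyR, polyR, gcut, smoothTransition.one_of_one_le, mul_one]
  have : (N : ℝ) ≤ n := mod_cast hn
  linarith [(div_le_one (show (0 : ℝ) < n + 1 by positivity)).2 (by linarith : ‖v‖ ^ 2 ≤ n + 1)]

lemma inner_polyL_eq_zero {μ : ℝ≥0} {u : L2v} (hu : u ∈ sphEigenspace μ) {p : Poly3}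
    (hp : p ∈ polyEig l) (hl : sphEig l ≠ μ) : inn (polyL p) u = 0 := by
  have hz : ∀ n, ∫ v, conj (polyR (gcut n) p v) * u v = 0 := fun n => by
    have hφ := contDiff_polyR (contDiff_gcut n) p; have hc := hasCompactSupport_polyR_gcut n p
    have hm : MemLp (fun v => sphLaplacian (polyR (gcut n) p) v +
        ((μ : ℝ) : ℂ) * polyR (gcut n) p v) 2 volume := by
      have h1 : MemLp (polyR (gcut n) p) 2 volume := hφ.continuous.memLp_of_hasCompactSupport hc
      simp only [sphLaplacian_polyR_of_mem (contDiff_gcut n) hp]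
      exact (h1.const_mul ((sphEig l : ℝ) : ℂ)).neg.add (h1.const_mul ((μ : ℝ) : ℂ))
    have h := (mem_orthogonal _ _).1 hu (hm.toLp _) (subset_span ⟨_, hφ, hc, hm.coeFn_toLp⟩)
    rw [inner_eq_integral] at h
    have hne : ((μ : ℝ) : ℂ) - ((sphEig l : ℝ) : ℂ) ≠ 0 := sub_ne_zero.2 (mod_cast hl.symm)
    rw [← mul_right_inj' hne, mul_zero, ← integral_const_mul, ← h]; refine integral_congr_ae ?_
    filter_upwards [hm.coeFn_toLp] with v hv
    rw [hv, sphLaplacian_polyR_of_mem (contDiff_gcut n) hp]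
    simp only [map_add, map_neg, map_mul, conj_ofReal]; ring
  rw [inner_polyL]
  refine tendsto_nhds_unique (tendsto_integral_of_dominated_convergence
    (fun v => ‖conj (polyR gexp p v) * u v‖) (fun n => ?_)
    (integrable_conj_polyR_mul p u).norm (fun n => .of_forall fun v => ?_)
    (.of_forall fun v => ?_)) ((tendsto_const_nhds (x := (0 : ℂ))).congr fun n => (hz n).symm)
  · exact (continuous_conj.comp
      (contDiff_polyR (contDiff_gcut n) p).continuous).aestronglyMeasurable.mul
      (Lp.aestronglyMeasurable u)
  · rw [norm_mul, norm_mul, RCLike.norm_conj, RCLike.norm_conj]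
    exact mul_le_mul_of_nonneg_right (norm_polyR_gcut_le n p v) pos!
  · exact ((continuous_conj.tendsto _).comp (tendsto_polyR_gcut p v)).mul_const _

lemma eq_zero_of_forall_polyEig {u : L2v}
    (hu : ∀ l, ∀ p ∈ polyEig l, inn (polyL p) u = 0) : u = 0 := by
  refine eq_zero_of_inner_polyL fun p => ?_
  have hp : p ∈ ⨆ l, polyEig l := by rw [iSup_polyEig]; trivial
  induction hp using iSup_induction' with
  | mem l p hp => exact hu l p hp
  | zero => simp
  | add x y _ _ hx hy => rw [map_add, inner_add_left, hx, hy, add_zero]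

/-- The eigenspace of the negative spherical Laplacian of degree `l`. -/
abbrev sphSpace (l : ℕ) : Submodule ℂ L2v := sphEigenspace (sphEig l)

lemma sphEigenspace_eq_bot {μ : ℝ≥0} (hμ : μ ∉ Set.range sphEig) : sphEigenspace μ = ⊥ := by
  refine (Submodule.eq_bot_iff _).2 fun u hu => eq_zero_of_forall_polyEig fun l p hp => ?_
  exact inner_polyL_eq_zero hu hp fun h => hμ ⟨l, h⟩

lemma sphSpace_le_closure (l : ℕ) : sphSpace l ≤ ((polyEig l).map polyL).topologicalClosure := by
  intro u hu; set K := ((polyEig l).map polyL).topologicalClosure with hK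
  have : CompleteSpace K := (isClosed_topologicalClosure _).completeSpace_coe
  have hle : K ≤ sphSpace l := topologicalClosure_minimal _
    (map_le_iff_le_comap.2 fun p hp => polyL_mem_sphEigenspace hp) (isClosed_orthogonal _)
  have hw : u - K.starProjection u = 0 := by
    refine eq_zero_of_forall_polyEig fun m p hp => ?_; rcases eq_or_ne m l with rfl | hm
    · exact (mem_orthogonal _ _).1 (K.sub_starProjection_mem_orthogonal u) _
        (le_topologicalClosure _ ⟨p, hp, rfl⟩)
    · exact inner_polyL_eq_zero (Submodule.sub_mem _ hu (hle (starProjection_apply_mem _ _))) hp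
        (sphEig_strictMono.injective.ne hm)
  rw [sub_eq_zero.1 hw]; exact starProjection_apply_mem _ _

lemma sphSpace_orthogonal {m : ℕ} (h : l ≠ m) : sphSpace l ⟂ sphSpace m := by
  rw [isOrtho_iff_le]; intro u hu; refine orthogonal_le (sphSpace_le_closure m) ?_
  rw [orthogonal_closure, mem_orthogonal]; rintro _ ⟨p, hp, rfl⟩
  exact inner_polyL_eq_zero hu hp (sphEig_strictMono.injective.ne h.symm)

lemma iSup_sphSpace_orthogonal : (⨆ l, sphSpace l)ᗮ = ⊥ := by
  refine (Submodule.eq_bot_iff _).2 fun u hu => eq_zero_of_forall_polyEig fun l p hp => ?_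
  exact (mem_orthogonal _ _).1 hu _ (mem_iSup_of_mem l (polyL_mem_sphEigenspace hp))

/-! ### Hilbert sums of subspaces -/

section

variable {H : Type*} [NormedAddCommGroup H] [InnerProductSpace ℂ H] [CompleteSpace H]
  {ι : Type*} {V : ι → Submodule ℂ H} [∀ i, CompleteSpace (V i)]

lemma isHilbertSum_of_isOrtho (hV : ∀ i j, i ≠ j → V i ⟂ V j) (ht : (⨆ i, V i)ᗮ = ⊥) :
    IsHilbertSum ℂ (fun i => V i) fun i => (V i).subtypeₗᵢ := by
  refine IsHilbertSum.mkInternal _ (fun i j hij u v => ?_) ?_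
  · exact isOrtho_iff_inner_eq.1 (hV i j hij) u u.2 v v.2
  · rw [topologicalClosure_eq_top_iff.2 ht]

lemma starProjection_eq_of_isHilbertSum
    (h : IsHilbertSum ℂ (fun i => V i) fun i => (V i).subtypeₗᵢ) (f : H) (i : ι) :
    (V i).starProjection f = h.linearIsometryEquiv f i := by
  classical
  have h1 := h.hasSum_linearIsometryEquiv_symm (h.linearIsometryEquiv f)
  rw [LinearIsometryEquiv.symm_apply_apply] at h1
  refine (h1.mapL (V i).starProjection).unique ?_
  convert hasSum_single i fun j hj => ?_
  · simp
  · exact (starProjection_apply_eq_zero_iff _).2 ((mem_orthogonal _ _).2 fun u hu =>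
      h.OrthogonalFamily hj.symm ⟨u, hu⟩ (h.linearIsometryEquiv f j))

lemma hasSum_starProjection (h : IsHilbertSum ℂ (fun i => V i) fun i => (V i).subtypeₗᵢ) (f : H) :
    HasSum (fun i => (V i).starProjection f) f := by
  have h1 := h.hasSum_linearIsometryEquiv_symm (h.linearIsometryEquiv f)
  rw [LinearIsometryEquiv.symm_apply_apply] at h1; simp_rw [starProjection_eq_of_isHilbertSum h]
  exact h1

lemma hasSum_norm_sq_starProjection
    (h : IsHilbertSum ℂ (fun i => V i) fun i => (V i).subtypeₗᵢ) (f : H) :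
    HasSum (fun i => ‖(V i).starProjection f‖ ^ 2) (‖f‖ ^ 2) := by
  have h1 := lp.hasSum_norm (p := 2) num! (h.linearIsometryEquiv f)
  rw [LinearIsometryEquiv.norm_map] at h1; simpa [starProjection_eq_of_isHilbertSum h] using h1

lemma exists_starProjection_eq_smul
    (h : IsHilbertSum ℂ (fun i => V i) fun i => (V i).subtypeₗᵢ) (c : ι → ℝ)
    (hc : ∀ i, 0 ≤ c i ∧ c i ≤ 1) (f : H) :
    ∃ g, ∀ i, (V i).starProjection g = c i • (V i).starProjection f := by
  have hm : Memℓp (fun i => (c i : ℂ) • h.linearIsometryEquiv f i) 2 := by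
    refine memℓp_gen ?_
    have h1 := (lp.hasSum_norm (p := 2) num! (h.linearIsometryEquiv f)).summable
    refine h1.of_nonneg_of_le (fun i => by positivity) fun i => ?_; refine rpow_le_rpow pos! ?_ num!
    rw [norm_smul, norm_real, norm_of_nonneg (hc i).1]; exact mul_le_of_le_one_left pos! (hc i).2
  refine ⟨h.linearIsometryEquiv.symm ⟨_, hm⟩, fun i => ?_⟩
  rw [starProjection_eq_of_isHilbertSum h, starProjection_eq_of_isHilbertSum h,
    LinearIsometryEquiv.apply_symm_apply]
  simp

end

/-! ### The spherical part of the triple norm -/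

instance (l : ℕ) : CompleteSpace (sphSpace l) := by unfold sphSpace sphEigenspace; infer_instance

lemma isHilbertSum_sphSpace :
    IsHilbertSum ℂ (fun l => sphSpace l) fun l => (sphSpace l).subtypeₗᵢ :=
  isHilbertSum_of_isOrtho (fun _ _ h => sphSpace_orthogonal h) iSup_sphSpace_orthogonal

lemma enorm_sq_eq_tsum_sphSpace (f : L2v) :
    ‖f‖ₑ ^ 2 = ∑' l, ‖(sphSpace l).starProjection f‖ₑ ^ 2 := by
  have h := hasSum_norm_sq_starProjection isHilbertSum_sphSpace f
  rw [← ofReal_norm_sq, ← h.tsum_eq, ofReal_tsum_of_nonneg (fun _ => by positivity) h.summable]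
  simp only [ofReal_norm_sq]

lemma diag_sph : Diag (Measure.count : Measure ℕ)
    (fun (f : L2v) (l : ℕ) => (sphSpace l).starProjection f) where
  aesm f := (StronglyMeasurable.of_discrete).aestronglyMeasurable
  norm_sq f := by rw [lintegral_count, enorm_sq_eq_tsum_sphSpace]
  add f g := .of_forall fun l => map_add _ _ _
  mult c _ hc f := by
    obtain ⟨g, hg⟩ := exists_starProjection_eq_smul isHilbertSum_sphSpace c hc f
    exact ⟨g, .of_forall hg⟩

lemma sphSq_eq (hf : MemLp f 2 volume) : sphSq s f = ∑' l, (sphEig l : ℝ≥0∞) ^ s *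
      ‖(sphSpace l).starProjection (hf.toLp f)‖ₑ ^ 2 := by
  rw [sphSq, dif_pos hf]; refine (sphEig_strictMono.injective.tsum_eq fun μ hμ => ?_).symm
  by_contra h
  have h2 : (sphEigenspace μ).starProjection (hf.toLp f) = 0 :=
    (mem_bot ℂ).1 ((sphEigenspace_eq_bot h).le (starProjection_apply_mem _ _))
  exact hμ (by simp [h2])

/-! ### Rotations -/

/-- The rotation of angle `θ` in the plane `(j, k)`. -/
def rotFun (j k : Fin 3) (θ : ℝ) : Vel →ₗ[ℝ] Vel where
  toFun v := WithLp.toLp 2 fun i => if i = j then cos θ * v j - sin θ * v k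
    else if i = k then cos θ * v k + sin θ * v j else v i
  map_add' u v := by
    ext i; simp only [PiLp.add_apply]
    split_ifs <;> ring
  map_smul' c v := by
    ext i; simp only [PiLp.smul_apply, smul_eq_mul, RingHom.id_apply]
    split_ifs <;> ring

lemma rotFun_apply (j k : Fin 3) (θ : ℝ) (v : Vel) (i : Fin 3) :
    rotFun j k θ v i = if i = j then cos θ * v j - sin θ * v k
      else if i = k then cos θ * v k + sin θ * v j else v i := rfl

lemma norm_rotFun (hjk : j ≠ k) (θ : ℝ) (v : Vel) : ‖rotFun j k θ v‖ = ‖v‖ := by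
  have h := sin_sq_add_cos_sq θ
  rw [← sq_eq_sq₀ (norm_nonneg _) (norm_nonneg _), norm_sq_eq, norm_sq_eq]
  simp only [Fin.sum_univ_three, rotFun_apply, norm_eq_abs, sq_abs]
  fin_cases j <;> fin_cases k <;> first | exact absurd rfl hjk | skip
  all_goals simp
  all_goals grind

/-- The rotation of angle `θ` in the plane `(j, k)`, as a linear isometry. -/
def rotL {j k : Fin 3} (hjk : j ≠ k) (θ : ℝ) : Vel ≃ₗᵢ[ℝ] Vel :=
  LinearIsometry.toLinearIsometryEquiv ⟨rotFun j k θ, norm_rotFun hjk θ⟩ rfl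

lemma rotL_apply (hjk : j ≠ k) (θ : ℝ) (v : Vel) : rotL hjk θ v = rotFun j k θ v := rfl

lemma norm_rotFun_sub_le (hjk : j ≠ k) (θ : ℝ) (v : Vel) : ‖rotFun j k θ v - v‖ ≤ |θ| * ‖v‖ := by
  have h := sin_sq_add_cos_sq θ; have hc := one_sub_sq_div_two_le_cos (x := θ)
  refine (sq_le_sq₀ pos! pos!).1 ?_; rw [mul_pow, sq_abs, norm_sq_eq, norm_sq_eq]
  simp only [Fin.sum_univ_three, rotFun_apply, norm_eq_abs, sq_abs, PiLp.sub_apply]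
  have key : ∀ a b : ℝ, (cos θ * a - sin θ * b - a) ^ 2 +
      (cos θ * b + sin θ * a - b) ^ 2 ≤ θ ^ 2 * (a ^ 2 + b ^ 2) := fun a b => by
    have e : (cos θ * a - sin θ * b - a) ^ 2 +
      (cos θ * b + sin θ * a - b) ^ 2 = (2 - 2 * cos θ) * (a ^ 2 + b ^ 2) := by
      linear_combination (a ^ 2 + b ^ 2) * h
    rw [e]; gcongr; linarith
  have h0 i : 0 ≤ θ ^ 2 * v i ^ 2 := by positivity
  fin_cases j <;> fin_cases k <;> first | exact absurd rfl hjk | skip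
  all_goals simp
  all_goals linarith [key (v 0) (v 1), key (v 0) (v 2), key (v 1) (v 0), key (v 1) (v 2),
             key (v 2) (v 0), key (v 2) (v 1), h0 0, h0 1, h0 2]

lemma eval_rotFun (j k : Fin 3) (θ : ℝ) (p : Poly3) (v : Vel) :
    eval (fun i => (rotFun j k θ v i : ℂ)) p = eval (fun i => (v i : ℂ)) (rotA j k θ p) := by
  induction p using induction_on with
  | C a =>
    have : rotA j k θ (MvPolynomial.C a) = MvPolynomial.C a := MvPolynomial.aeval_C _ _
    rw [this, eval_C, eval_C]
  | add p q hp hq => simp only [map_add, hp, hq]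
  | mul_X p i hp =>
    have : rotA j k θ (MvPolynomial.X i) = _ := MvPolynomial.aeval_X _ _
    rw [map_mul, map_mul, map_mul, hp, this, eval_X, rotFun_apply]; congr 1
    split_ifs <;> simp

/-- Rotation on `L²(ℝ³)`. -/
abbrev rotOp {j k : Fin 3} (hjk : j ≠ k) (θ : ℝ) : L2v →ₗᵢ[ℂ] L2v := motionOp (rotL hjk θ) 0

lemma rotOp_polyL (hjk : j ≠ k) (θ : ℝ) (p : Poly3) :
    rotOp hjk θ (polyL p) = polyL (rotA j k θ p) := by
  ext1
  have h := (measurePreserving_motion (rotL hjk θ) 0).quasiMeasurePreserving.ae (coeFn_polyL p)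
  filter_upwards [coeFn_motionOp (rotL hjk θ) 0 (polyL p), coeFn_polyL (rotA j k θ p), h]
    with v h1 h2 h3
  rw [h1, h2, h3, motion, add_zero, rotL_apply, polyR, polyR, eval_rotFun, norm_rotFun hjk]

lemma rotA_zero (j k : Fin 3) (p : Poly3) : rotA j k 0 p = p := by
  have h : rotA j k 0 = AlgHom.id ℂ Poly3 := algHom_ext fun i => by
    refine (MvPolynomial.aeval_X _ _).trans ?_; simp only [cos_zero, sin_zero]
    split_ifs with h1 h2 <;> simp [*]
  rw [h]; rfl

lemma inner_polyL_rotP (j k : Fin 3) (p q : Poly3) :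
    inn (polyL p) (polyL (rotP j k q)) = -inn (polyL (rotP j k p)) (polyL q) := by
  by_cases hjk : j = k
  · subst hjk; simp [rotP_apply]
  have h := (hasDerivAt_rotA hjk p polyL 0).inner ℂ (hasDerivAt_rotA hjk q polyL 0)
  simp only [← rotOp_polyL hjk, LinearIsometry.inner_map_map] at h
  exact eq_neg_of_add_eq_zero_left (h.unique (hasDerivAt_const _ _))

lemma norm_rotOp_polyL_sub_le (hjk : j ≠ k) (θ : ℝ) (p : Poly3) :
    ‖rotOp hjk θ (polyL p) - polyL p‖ ≤ |θ| * ‖polyL (rotP j k p)‖ := by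
  have h := convex_univ.norm_image_sub_le_of_norm_hasDerivWithin_le
    (f := fun t => polyL (rotA j k t p)) (C := ‖polyL (rotP j k p)‖)
    (fun t _ => (hasDerivAt_rotA hjk p polyL t).hasDerivWithinAt)
    (fun t _ => by rw [← rotOp_polyL hjk, LinearIsometry.norm_map]) (mem_univ 0) (mem_univ θ)
  rw [rotA_zero, sub_zero, norm_eq_abs, mul_comm] at h; rw [rotOp_polyL]; exact h

lemma norm_inner_polyL_rotP_le (hjk : j ≠ k) {f : L2v} (hK : ∀ θ : ℝ, 0 < θ → θ ≤ 1 → ‖rotOp hjk θ f - f‖ ≤ K * θ) (p : Poly3) :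
    ‖inn f (polyL (rotP j k p))‖ ≤ K * ‖polyL p‖ := by
  have h := ((hasDerivAt_const (0 : ℝ) f).inner ℂ
    (hasDerivAt_rotA hjk p polyL 0)).tendsto_slope_zero_right.norm
  simp only [rotA_zero, inner_zero_left, add_zero, zero_add] at h; refine le_of_tendsto h ?_
  have h1 : Ioc (0 : ℝ) 1 ∈ nhdsWithin 0 (Ioi 0) := Ioc_mem_nhdsGT zero_lt_one
  filter_upwards [h1] with θ hθ
  have e : inn f (polyL (rotA j k θ p)) - inn f (polyL p) =
      -inn (rotOp hjk θ f - f) (rotOp hjk θ (polyL p)) := by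
    rw [inner_sub_left, LinearIsometry.inner_map_map, rotOp_polyL]; ring
  rw [e, norm_smul, norm_neg, norm_inv, norm_of_nonneg hθ.1.le, inv_mul_le_iff₀ hθ.1]
  refine (norm_inner_le_norm _ _).trans ?_; rw [LinearIsometry.norm_map, ← mul_assoc, mul_comm θ]
  gcongr; exact hK θ hθ.1 hθ.2

lemma inner_polyL_of_ne {m : ℕ} (h : l ≠ m) {p q : Poly3} (hp : p ∈ polyEig l)
    (hq : q ∈ polyEig m) : inn (polyL p) (polyL q) = 0 :=
  inner_polyL_eq_zero (polyL_mem_sphEigenspace hq) hp (sphEig_strictMono.injective.ne h)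

lemma sum_norm_sq_rotP (N : ℕ) (q : ℕ → Poly3) (hq : ∀ l, q l ∈ polyEig l) :
    ∑ j : Fin 3, ∑ k : Fin 3, ‖polyL (rotP j k (∑ l ∈ Finset.range N, q l))‖ ^ 2 =
      ∑ l ∈ Finset.range N, (sphEig l : ℝ) * ‖polyL (q l)‖ ^ 2 := by
  set Q := ∑ l ∈ Finset.range N, q l with hQ
  have h1 : ∀ j k, ((‖polyL (rotP j k Q)‖ ^ 2 : ℝ) : ℂ) =
      -inn (polyL Q) (polyL (rotP j k (rotP j k Q))) := fun j k => by
    rw [inner_polyL_rotP, neg_neg, inner_self_eq_norm_sq_to_K]; push_cast; rfl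
  have h2 : ((∑ j : Fin 3, ∑ k : Fin 3, ‖polyL (rotP j k Q)‖ ^ 2 : ℝ) : ℂ) =
      -inn (polyL Q) (polyL (lapP Q)) := by
    rw [lapP_apply]; simp only [ofReal_sum, h1, map_sum, inner_sum, sum_neg_distrib]
  have h3 : polyL (lapP Q) = -∑ l ∈ Finset.range N, ((sphEig l : ℝ) : ℂ) • polyL (q l) := by
    rw [hQ, map_sum, map_sum, ← sum_neg_distrib]; refine sum_congr rfl fun l _ => ?_
    rw [mem_polyEig.1 (hq l), map_neg, map_smul]
  have h4 : ∀ l ∈ Finset.range N, inn (polyL Q) (polyL (q l)) =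
      ((‖polyL (q l)‖ ^ 2 : ℝ) : ℂ) := fun l hl => by
    rw [hQ, map_sum, sum_inner, sum_eq_single l
      (fun m _ hm => inner_polyL_of_ne hm (hq m) (hq l)) (fun h => absurd hl h),
      inner_self_eq_norm_sq_to_K]
    push_cast; rfl
  rw [h3, inner_neg_right, neg_neg, inner_sum] at h2; refine ofReal_injective ?_
  rw [h2, ofReal_sum]; refine sum_congr rfl fun l hl => ?_; rw [inner_smul_right, h4 l hl]
  push_cast; rfl

lemma exists_polyEig_tendsto (f : L2v) : ∃ q : ℕ → ℕ → Poly3, (∀ n l, q n l ∈ polyEig l) ∧ ∀ l,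
      Tendsto (fun n => polyL (q n l)) atTop (nhds ((sphSpace l).starProjection f)) := by
  have h : ∀ l, ∃ q : ℕ → Poly3, (∀ n, q n ∈ polyEig l) ∧ Tendsto (fun n => polyL (q n)) atTop
        (nhds ((sphSpace l).starProjection f)) := fun l => by
    have h1 := sphSpace_le_closure l (starProjection_apply_mem (sphSpace l) f)
    obtain ⟨x, hx, hx'⟩ := mem_closure_iff_seq_limit.1 h1; choose q hq hq' using hx
    exact ⟨q, hq, by simpa only [hq'] using hx'⟩
  choose q hq hq' using h; exact ⟨fun n l => q l n, fun n l => hq l n, hq'⟩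

lemma tendsto_polyL_sum {f : L2v} {q : ℕ → ℕ → Poly3}
    (hq : ∀ l, Tendsto (fun n => polyL (q n l)) atTop
        (nhds ((sphSpace l).starProjection f))) (N : ℕ) :
    Tendsto (fun n => polyL (∑ l ∈ Finset.range N, q n l)) atTop
      (nhds (∑ l ∈ Finset.range N, (sphSpace l).starProjection f)) := by
  simp only [map_sum]; exact tendsto_finsetSum _ fun l _ => hq l

lemma tendsto_sum_norm_sq {f : L2v} {q : ℕ → ℕ → Poly3}
    (hq : ∀ l, Tendsto (fun n => polyL (q n l)) atTop
        (nhds ((sphSpace l).starProjection f))) (N : ℕ) :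
    Tendsto (fun n => ∑ l ∈ Finset.range N, (sphEig l : ℝ) * ‖polyL (q n l)‖ ^ 2)
      atTop (nhds (∑ l ∈ Finset.range N, (sphEig l : ℝ) * ‖(sphSpace l).starProjection f‖ ^ 2)) :=
  tendsto_finsetSum _ fun l _ => ((hq l).norm.pow 2).const_mul _

lemma enorm_sq_rotOp_sub_le (hjk : j ≠ k) (θ : ℝ) (f : L2v) :
    ‖rotOp hjk θ f - f‖ₑ ^ 2 ≤ ofR (θ ^ 2) *
      ∑' l, (sphEig l : ℝ≥0∞) * ‖(sphSpace l).starProjection f‖ₑ ^ 2 := by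
  obtain ⟨q, hq, hq'⟩ := exists_polyEig_tendsto f
  have hN : ∀ N, ‖rotOp hjk θ (∑ l ∈ Finset.range N, (sphSpace l).starProjection f) -
      ∑ l ∈ Finset.range N, (sphSpace l).starProjection f‖ ^ 2 ≤
      θ ^ 2 * ∑ l ∈ Finset.range N, (sphEig l : ℝ) * ‖(sphSpace l).starProjection f‖ ^ 2 := by
    intro N; have hl := tendsto_polyL_sum hq' N
    refine le_of_tendsto_of_tendsto' (((((rotOp hjk θ).continuous.tendsto _).comp hl).sub
      hl).norm.pow 2) ((tendsto_sum_norm_sq hq' N).const_mul _) fun n => ?_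
    rw [← sum_norm_sq_rotP N (q n) (hq n)]
    have h1 := norm_rotOp_polyL_sub_le hjk θ (∑ l ∈ Finset.range N, q n l)
    simp only [Function.comp_apply]; refine (pow_le_pow_left₀ pos! h1 2).trans ?_
    rw [mul_pow, sq_abs]
    exact mul_le_mul_of_nonneg_left ((single_le_sum
      (f := fun k => ‖polyL (rotP j k (∑ l ∈ Finset.range N, q n l))‖ ^ 2)
      (fun _ _ => by positivity) (Finset.mem_univ k)).trans (single_le_sum
      (f := fun j => ∑ k : Fin 3, ‖polyL (rotP j k (∑ l ∈ Finset.range N, q n l))‖ ^ 2)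
      (fun _ _ => by positivity) (Finset.mem_univ j))) pos!
  have hf := (hasSum_starProjection isHilbertSum_sphSpace f).tendsto_sum_nat
  have hlim := ((ENNReal.continuous_pow 2).tendsto _).comp
    ((((rotOp hjk θ).continuous.tendsto _).comp hf).sub hf).enorm
  refine le_of_tendsto hlim (.of_forall fun N => ?_); simp only [Function.comp_apply]
  rw [← ofReal_norm_sq]; refine (ofReal_le_ofReal (hN N)).trans ?_
  rw [ofReal_mul (sq_nonneg _), ofReal_sum_of_nonneg (fun _ _ => by positivity)]; gcongr
  refine le_trans (le_of_eq ?_) (ENNReal.sum_le_tsum (Finset.range N))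
  refine sum_congr rfl fun l _ => ?_; rw [ofReal_mul pos!, ofReal_norm_sq, ofReal_coe_nnreal]

lemma tsum_sphEig_le {f : L2v} (hK0 : 0 ≤ K)
    (hK : ∀ (j k : Fin 3) (hjk : j ≠ k) (θ : ℝ), 0 < θ → θ ≤ 1 → ‖rotOp hjk θ f - f‖ ≤ K * θ) :
    ∑' l, (sphEig l : ℝ≥0∞) * ‖(sphSpace l).starProjection f‖ₑ ^ 2 ≤ ofR (9 * K ^ 2) := by
  obtain ⟨q, hq, hq'⟩ := exists_polyEig_tendsto f
  have hN : ∀ N, ∑ l ∈ Finset.range N, (sphEig l : ℝ) * ‖(sphSpace l).starProjection f‖ ^ 2 ≤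
      9 * K ^ 2 := by
    intro N
    set D := ∑ l ∈ Finset.range N, (sphEig l : ℝ) * ‖(sphSpace l).starProjection f‖ ^ 2 with hD
    have hD0 : 0 ≤ D := sum_nonneg fun _ _ => by positivity
    have h1 : Tendsto (fun n => inn f (polyL (lapP (∑ l ∈ Finset.range N, q n l))))
        atTop (nhds (-(D : ℂ))) := by
      have e : ∀ n, inn f (polyL (lapP (∑ l ∈ Finset.range N, q n l))) =
          ∑ l ∈ Finset.range N, -(((sphEig l : ℝ) : ℂ) * inn f (polyL (q n l))) := fun n => by
        rw [map_sum, map_sum, inner_sum]; refine sum_congr rfl fun l _ => ?_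
        rw [mem_polyEig.1 (hq n l), map_neg, map_smul, inner_neg_right, inner_smul_right]
      simp_rw [e]
      have e2 : -(D : ℂ) = ∑ l ∈ Finset.range N, -(((sphEig l : ℝ) : ℂ) *
          inn f ((sphSpace l).starProjection f)) := by
        rw [hD, ofReal_sum, ← sum_neg_distrib]; refine sum_congr rfl fun l _ => ?_
        rw [← starProjection_eq_self_iff.2 (starProjection_apply_mem (sphSpace l) f),
          ← inner_starProjection_left_eq_right, inner_self_eq_norm_sq_to_K,
          starProjection_eq_self_iff.2 (starProjection_apply_mem _ _)]
        push_cast; rfl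
      rw [e2]
      exact tendsto_finsetSum _ fun l _ => ((tendsto_const_nhds.inner (hq' l)).const_mul _).neg
    have h2 : ∀ n, ‖inn f (polyL (lapP (∑ l ∈ Finset.range N, q n l)))‖ ≤
        3 * K * sqrt (∑ l ∈ Finset.range N, (sphEig l : ℝ) * ‖polyL (q n l)‖ ^ 2) := by
      intro n; set Q := ∑ l ∈ Finset.range N, q n l with hQ
      rw [← sum_norm_sq_rotP N (q n) (hq n), ← hQ, lapP_apply, map_sum, inner_sum]
      have h3 : ∀ j k, ‖inn f (polyL (rotP j k (rotP j k Q)))‖ ≤ K * ‖polyL (rotP j k Q)‖ := by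
        intro j k; by_cases hjk : j = k
        · subst hjk; simp [rotP_apply]
        · exact norm_inner_polyL_rotP_le hjk (hK j k hjk) _
      calc _ ≤ ∑ j : Fin 3, ∑ k : Fin 3, K * ‖polyL (rotP j k Q)‖ := by
            refine (norm_sum_le _ _).trans (sum_le_sum fun j _ => ?_); rw [map_sum, inner_sum]
            exact (norm_sum_le _ _).trans (sum_le_sum fun k _ => h3 j k)
        _ = K * ∑ p : Fin 3 × Fin 3, ‖polyL (rotP p.1 p.2 Q)‖ := by
            rw [Fintype.sum_prod_type, mul_sum]; simp only [mul_sum]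
        _ ≤ K * (3 * sqrt (∑ j : Fin 3, ∑ k : Fin 3, ‖polyL (rotP j k Q)‖ ^ 2)) := by
            gcongr
            rw [← Fintype.sum_prod_type (f := fun p : Fin 3 × Fin 3 => ‖polyL (rotP p.1 p.2 Q)‖ ^ 2)]
            have h4 := sq_sum_le_card_mul_sum_sq (s := Finset.univ)
              (f := fun p : Fin 3 × Fin 3 => ‖polyL (rotP p.1 p.2 Q)‖)
            have h5 : (Finset.univ : Finset (Fin 3 × Fin 3)).card = 9 := rfl; rw [h5] at h4
            refine (le_sqrt_of_sq_le h4).trans (le_of_eq ?_); push_cast; rw [sqrt_mul num!]; congr 1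
            rw [show (9 : ℝ) = 3 ^ 2 by norm_num, sqrt_sq num!]
        _ = _ := by ring
    have h3 := le_of_tendsto_of_tendsto' h1.norm
      ((tendsto_sum_norm_sq hq' N).sqrt.const_mul (3 * K)) h2
    rw [norm_neg, norm_real, norm_of_nonneg hD0, ← hD] at h3; have h4 := sq_sqrt hD0
    have h5 := sqrt_nonneg D; nlinarith [sq_nonneg (sqrt D - 3 * K)]
  refine tsum_le_of_sum_range_le fun N => ?_
  refine le_trans (le_of_eq ?_) (ofReal_le_ofReal (hN N))
  rw [ofReal_sum_of_nonneg (fun _ _ => by positivity)]; refine sum_congr rfl fun l _ => ?_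
  rw [ofReal_mul pos!, ofReal_norm_sq, ofReal_coe_nnreal]

/-! ### Fractional quadratic forms on `L²(ℝ³)` -/

/-- The weight `1 + l` on the spherical modes. -/
def wA (l : ℕ) : ℝ≥0 := 1 + sphEig l

/-- `‖⟨D_v⟩^s f‖²`. -/
def sobQ (s : ℝ) (f : L2v) : ℝ≥0∞ := ∫⁻ ξ, (wS ξ : ℝ≥0∞) ^ s * ‖(𝓕 f : L2v) ξ‖ₑ ^ 2

/-- `‖(1 - Δ_{𝕊²})^{s/2} f‖²`. -/
def angQ (s : ℝ) (f : L2v) : ℝ≥0∞ :=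
  ∫⁻ l : ℕ, (wA l : ℝ≥0∞) ^ s * ‖(sphSpace l).starProjection f‖ₑ ^ 2 ∂Measure.count

/-- The sum of the two quadratic forms. -/
def tripQ (s : ℝ) (f : L2v) : ℝ≥0∞ := sobQ s f + angQ s f

lemma one_le_wS (ξ : Vel) : (1 : ℝ≥0∞) ≤ wS ξ := by
  rw [coe_wS, ← ofReal_one]; exact ofReal_le_ofReal (one_le_pow₀ (one_le_jb _))

lemma enorm_sq_le_sobQ (hs : 0 ≤ s) (f : L2v) : ‖f‖ₑ ^ 2 ≤ sobQ s f := by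
  rw [diag_fourier.norm_sq f]; refine lintegral_mono fun ξ => ?_
  refine le_mul_of_one_le_left zero_le ?_
  exact (one_rpow s).symm.le.trans (ENNReal.rpow_le_rpow (one_le_wS ξ) hs)

lemma sphSq_le_angQ (hs : 0 ≤ s) (hf : MemLp f 2 volume) : sphSq s f ≤ angQ s (hf.toLp f) := by
  rw [sphSq_eq hf, angQ, lintegral_count]; refine ENNReal.tsum_le_tsum fun l => ?_; gcongr; rw [wA]
  exact le_add_self

lemma angQ_le (hs0 : 0 ≤ s) (hs1 : s ≤ 1) (hf : MemLp f 2 volume) :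
    angQ s (hf.toLp f) ≤ ‖hf.toLp f‖ₑ ^ 2 + sphSq s f := by
  rw [sphSq_eq hf, angQ, lintegral_count, enorm_sq_eq_tsum_sphSpace, ← ENNReal.tsum_add]
  refine ENNReal.tsum_le_tsum fun l => ?_; rw [← one_add_mul]; gcongr; rw [wA, coe_add, coe_one]
  refine (rpow_add_le_add_rpow _ _ hs0 hs1).trans ?_; rw [one_rpow]

lemma tripleSq_le_tripQ (hs : 0 ≤ s) (hf : MemLp (fun v => jbC v (γ / 2) * f v) 2 volume) :
    tripleSq s γ f ≤ tripQ s (hf.toLp _) := by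
  rw [tripleSq, tripQ, sobolevSq_eq hf]; gcongr
  · exact le_rfl
  · exact sphSq_le_angQ hs hf

lemma tripQ_le_tripleSq (hs0 : 0 ≤ s) (hs1 : s ≤ 1) (hf : MemLp (fun v => jbC v (γ / 2) * f v) 2 volume) :
    tripQ s (hf.toLp _) ≤ 2 * tripleSq s γ f := by
  have h1 := angQ_le hs0 hs1 hf; have h2 := enorm_sq_le_sobQ hs0 (hf.toLp _)
  have h3 : sobolevSq s (fun v => jbC v (γ / 2) * f v) = sobQ s (hf.toLp _) := sobolevSq_eq hf
  rw [tripleSq, tripQ, h3]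
  calc _ ≤ sobQ s (hf.toLp _) + (sobQ s (hf.toLp _) + sphSq s (fun v => jbC v (γ / 2) * f v)) := by
        gcongr; exact h1.trans (by gcongr)
    _ ≤ _ := by rw [mul_add, two_mul, two_mul, ← add_assoc]; gcongr; exact le_self_add

/-! ### Localization operators with Lipschitz symbols -/

lemma IsWin.mono (h : IsWin m A) (hAB : A ≤ B) : IsWin m B where
  meas := h.meas
  nonneg := h.nonneg.trans hAB
  dom := by
    have := h.nonneg; obtain ⟨Γ, h1, h2, h3⟩ := h.dom
    exact ⟨Γ, h1, h2, h3.trans (ofReal_le_ofReal (by gcongr))⟩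

lemma IsWin.neg_sub (h : IsWin (fun y v => m y v - m' y v) A) :
    IsWin (fun y v => m' y v - m y v) A where
  meas := by
    convert h.meas.neg using 1
    ext; simp
  nonneg := h.nonneg
  dom := by
    obtain ⟨Γ, h1, h2, h3⟩ := h.dom
    exact ⟨Γ, h1, fun y v => by rw [abs_sub_comm]; exact h2 y v, h3⟩

lemma isWin_self_sub (m : Vel → Vel → ℝ) (hA : 0 ≤ A) : IsWin (fun y v => m y v - m y v) A where
  meas := by simp only [sub_self]; exact measurable_const
  nonneg := hA
  dom := ⟨fun _ => 0, measurable_const, fun y v => by simp, by simp⟩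

/-- Bounded symbols, Lipschitz in `y` and under simultaneous rotations of `(y, ξ)`. -/
structure IsSym (q : Ph → ℂ) (Q : ℝ) : Prop where
  meas : Measurable q
  bdd : ∀ Y, ‖q Y‖ ≤ Q
  lip : ∀ (y z ξ : Vel), ‖z‖ ≤ 1 → ‖q (y + z, ξ) - q (y, ξ)‖ ≤ Q * ‖z‖
  rot : ∀ (j k : Fin 3), j ≠ k → ∀ θ : ℝ, 0 < θ → θ ≤ 1 → ∀ y ξ : Vel,
    ‖q (rotFun j k θ y, rotFun j k θ ξ) - q (y, ξ)‖ ≤ Q * θ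

lemma IsSym.nonneg (h : IsSym q Q) : 0 ≤ Q := (norm_nonneg _).trans (h.bdd 0)

/-- A common bound for two weighted windows. -/
def pairNorm (a b : ℝ) : ℝ := domNorm a + domNorm b

/-- A common Lipschitz bound for two weighted windows. -/
def pairLip (a b : ℝ) : ℝ := 2 * lipNorm a + 2 * lipNorm b

/-- The constant in the Lipschitz bounds for localization operators. -/
def symK (a b Q : ℝ) : ℝ := pairNorm a b * Q * pairNorm a b +
  (2 * pairNorm a b * Q * pairLip a b + pairNorm a b ^ 2 * Q)

lemma pairNorm_nonneg (a b : ℝ) : 0 ≤ pairNorm a b := add_nonneg (domNorm_nonneg _) (domNorm_nonneg _)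

lemma pairLip_nonneg (a b : ℝ) : 0 ≤ pairLip a b := by
  have := lipNorm_nonneg a; have := lipNorm_nonneg b; unfold pairLip; positivity

lemma symK_nonneg (a b : ℝ) (hQ : 0 ≤ Q) : 0 ≤ symK a b Q := by
  have := pairNorm_nonneg a b; have := pairLip_nonneg a b; unfold symK; positivity

lemma le_symK {x y z : ℝ} (hQ : 0 ≤ Q) (hx : 0 ≤ x) (hy : y ≤ R * x) (hz : z ≤ R) :
    pairNorm a b * Q * pairNorm a b * y + (2 * pairNorm a b * Q * (pairLip a b * x) +
      pairNorm a b ^ 2 * (Q * x)) * z ≤ symK a b Q * R * x := by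
  have := pairNorm_nonneg a b; have := pairLip_nonneg a b
  calc _ ≤ pairNorm a b * Q * pairNorm a b * (R * x) + (2 * pairNorm a b * Q * (pairLip a b * x)
        + pairNorm a b ^ 2 * (Q * x)) * R := by gcongr
    _ = _ := by unfold symK; ring

lemma isWin_wwin_left (a b : ℝ) : IsWin (wwin a) (pairNorm a b) :=
  (isWin_wwin a).mono (le_add_of_nonneg_right (domNorm_nonneg _))

lemma isWin_wwin_right (a b : ℝ) : IsWin (wwin b) (pairNorm a b) :=
  (isWin_wwin b).mono (le_add_of_nonneg_left (domNorm_nonneg _))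

lemma IsSym.norm_locOp_le_symK (hq : IsSym q Q) (f : L2v) :
    ‖locOp (wwin a) q (wwin b) f‖ ≤ symK a b Q * ‖f‖ := by
  have h := norm_locOp_le (isWin_wwin_left a b) (isWin_wwin_right a b) hq.meas hq.bdd f
  have := pairNorm_nonneg a b; have := pairLip_nonneg a b; have := hq.nonneg
  refine h.trans (mul_le_mul_of_nonneg_right ?_ pos!); unfold symK
  exact le_add_of_nonneg_right pos!

lemma IsSym.norm_transOp_sub_le (hq : IsSym q Q) {f : L2v} (hf : ‖f‖ ≤ R) {z : Vel}
    (hz : ‖z‖ ≤ 1) (hfz : ‖transOp z f - f‖ ≤ R * ‖z‖) :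
    ‖transOp z (locOp (wwin a) q (wwin b) f) - locOp (wwin a) q (wwin b) f‖ ≤
      symK a b Q * R * ‖z‖ := by
  have hnz : ‖-z‖ ≤ 1 := by rwa [norm_neg]
  have hs c := isWin_wwin_shift c (-z) (-z)
  have hl c d (h : pairLip a b = 2 * lipNorm c + 2 * lipNorm d) :=
    ((isWin_wwin_sub c (-z) (-z) hnz hnz).mono (B := pairLip a b * ‖z‖) (by
      rw [norm_neg, h]; nlinarith [mul_nonneg (lipNorm_nonneg d) (norm_nonneg z)])).neg_sub
  exact (norm_motionOp_locOp_sub_le (isWin_wwin_left a b)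
    ((hs a).mono (le_add_of_nonneg_right (domNorm_nonneg _))) (isWin_wwin_right a b)
    ((hs b).mono (le_add_of_nonneg_left (domNorm_nonneg _))) hq.meas
    (q' := fun Y => q (Y.1 + -z, Y.2)) (hq.meas.comp (by fun_prop)) hq.bdd (fun Y => hq.bdd _)
    (LinearIsometryEquiv.refl ℝ Vel) z (hl a b rfl) (hl b a (add_comm _ _))
    (ε := Q * ‖z‖) (fun Y => by rw [norm_sub_rev, ← norm_neg z]; exact hq.lip Y.1 (-z) Y.2 hnz)
    (fun y v => by simp [motion]) (fun y v => by simp [motion]) (fun Y => by simp [motion]) f).trans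
    (le_symK hq.nonneg (norm_nonneg z) hfz hf)

lemma wwin_rotFun (hjk : j ≠ k) (θ w : ℝ) (y v : Vel) :
    wwin w (rotFun j k θ y) (rotFun j k θ v) = wwin w y v := by
  rw [wwin, wwin, ← map_sub, jb, jb, gauss, gauss, norm_rotFun hjk, norm_rotFun hjk,
    norm_rotFun hjk]
  rfl

lemma IsSym.norm_rotOp_sub_le (hq : IsSym q Q) {f : L2v} (hf : ‖f‖ ≤ R)
    (hjk : j ≠ k) {θ : ℝ} (hθ0 : 0 < θ) (hθ1 : θ ≤ 1)
    (hfz : ‖rotOp hjk θ f - f‖ ≤ R * θ) :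
    ‖rotOp hjk θ (locOp (wwin a) q (wwin b) f) - locOp (wwin a) q (wwin b) f‖ ≤
      symK a b Q * R * θ := by
  have hL := mul_nonneg (pairLip_nonneg a b) hθ0.le
  have hr : ∀ v, rotFun j k θ ((rotL hjk θ).symm v) = v := fun v => (rotL hjk θ).apply_symm_apply v
  have hr' : ∀ v, (rotL hjk θ).symm (rotFun j k θ v) = v := fun v => (rotL hjk θ).symm_apply_apply v
  exact (norm_motionOp_locOp_sub_le (isWin_wwin_left a b) (isWin_wwin_left a b)
    (isWin_wwin_right a b) (isWin_wwin_right a b) hq.meas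
    (q' := fun Y => q ((rotL hjk θ).symm Y.1, (rotL hjk θ).symm Y.2)) (hq.meas.comp (by
      have := (rotL hjk θ).symm.continuous
      exact Continuous.measurable (by fun_prop))) hq.bdd (fun Y => hq.bdd _)
    (rotL hjk θ) 0 (isWin_self_sub _ hL) (isWin_self_sub _ hL) (ε := Q * θ) (fun Y => by
      have := hq.rot j k hjk θ hθ0 hθ1 ((rotL hjk θ).symm Y.1) ((rotL hjk θ).symm Y.2)
      rwa [hr, hr] at this)
    (fun y v => by simp only [motion, add_zero, rotL_apply, wwin_rotFun hjk])
    (fun y v => by simp only [motion, add_zero, rotL_apply, wwin_rotFun hjk])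
    (fun Y => by simp only [motion, add_zero, rotL_apply, hr']) f).trans
    (le_symK hq.nonneg hθ0.le hfz hf)

/-- The constant in the bounds for the quadratic forms. -/
def symC (a b Q : ℝ) : ℝ≥0∞ := ofR (10 * symK a b Q ^ 2 + 1)

lemma norm_le_sqrt_toReal {x : E} {S : ℝ≥0∞} (hS : S ≠ ⊤)
    {c : ℝ} (hc : 0 ≤ c) (h : ‖x‖ₑ ^ 2 ≤ ofR (c ^ 2) * S) :
    ‖x‖ ≤ sqrt S.toReal * c := by
  rw [← ofReal_norm_sq, ← ofReal_toReal hS, ← ofReal_mul pos!, ofReal_le_ofReal_iff pos!] at h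
  refine (sq_le_sq₀ pos! pos!).1 ?_; rw [mul_pow, sq_sqrt toReal_nonneg, mul_comm]; exact h

lemma IsSym.le_symC_mul (hq : IsSym q Q) {f : L2v} {S D : ℝ≥0∞} (hfS : ‖f‖ₑ ^ 2 ≤ S)
    (h : S ≠ ⊤ → ‖f‖ ≤ sqrt S.toReal →
      D ≤ ‖locOp (wwin a) q (wwin b) f‖ₑ ^ 2 + ofR (9 * (symK a b Q * sqrt S.toReal) ^ 2)) :
    D ≤ symC a b Q * S := by
  have hK := symK_nonneg a b hq.nonneg; rcases eq_or_ne S ⊤ with rfl | hSt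
  · exact le_top.trans_eq (mul_top (ofReal_pos.2 pos!).ne').symm
  have hR : ‖f‖ ≤ sqrt S.toReal := by
    simpa using norm_le_sqrt_toReal (x := f) hSt zero_le_one (by simpa using hfS)
  have h4 := pow_le_pow_left₀ pos! ((hq.norm_locOp_le_symK (a := a) (b := b) f).trans
    (mul_le_mul_of_nonneg_left hR hK)) 2
  refine (h hSt hR).trans ?_; rw [← ofReal_norm_sq, ← ofReal_add pos! pos!, symC]
  conv_rhs => rw [← ofReal_toReal hSt, ← ofReal_mul pos!]
  refine ofReal_le_ofReal ?_; rw [mul_pow, sq_sqrt toReal_nonneg] at h4 ⊢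
  linarith [toReal_nonneg (a := S)]

lemma IsSym.sobQ_one_le (hq : IsSym q Q) (f : L2v) :
    ∫⁻ ξ, wS ξ * ‖(𝓕 (locOp (wwin a) q (wwin b) f) : L2v) ξ‖ₑ ^ 2 ≤
      symC a b Q * ∫⁻ ξ, wS ξ * ‖(𝓕 f : L2v) ξ‖ₑ ^ 2 :=
  hq.le_symC_mul (by simpa only [sobQ, rpow_one] using enorm_sq_le_sobQ zero_le_one f)
    fun hSt hR => (lintegral_wS_le fun z hz => hq.norm_transOp_sub_le hR hz
      (norm_le_sqrt_toReal hSt pos! (enorm_sq_transOp_sub_le z f))).trans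
      (by gcongr; norm_num)

lemma IsSym.angQ_one_le (hq : IsSym q Q) (f : L2v) :
    ∫⁻ l : ℕ, wA l * ‖(sphSpace l).starProjection (locOp (wwin a) q (wwin b) f)‖ₑ ^ 2
        ∂Measure.count ≤
      symC a b Q * ∫⁻ l : ℕ, wA l * ‖(sphSpace l).starProjection f‖ₑ ^ 2 ∂Measure.count := by
  have hsplit (g : L2v) : ∫⁻ l : ℕ, wA l * ‖(sphSpace l).starProjection g‖ₑ ^ 2 ∂Measure.count =
      ‖g‖ₑ ^ 2 + ∑' l, (sphEig l : ℝ≥0∞) * ‖(sphSpace l).starProjection g‖ₑ ^ 2 := by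
    rw [lintegral_count, enorm_sq_eq_tsum_sphSpace, ← ENNReal.tsum_add]
    refine tsum_congr fun l => ?_; rw [wA, coe_add, coe_one, one_add_mul]
  rw [hsplit, hsplit]
  exact hq.le_symC_mul le_self_add fun hSt hR => add_le_add_right (tsum_sphEig_le
    (mul_nonneg (symK_nonneg a b hq.nonneg) (sqrt_nonneg _)) fun j k hjk θ hθ0 hθ1 =>
      hq.norm_rotOp_sub_le hR hjk hθ0 hθ1 (norm_le_sqrt_toReal hSt hθ0.le
        ((enorm_sq_rotOp_sub_le hjk θ f).trans (by gcongr; exact le_add_self)))) _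

lemma IsSym.enorm_sq_locOp_le (hq : IsSym q Q) (f : L2v) :
    ‖locOp (wwin a) q (wwin b) f‖ₑ ^ 2 ≤ symC a b Q * ‖f‖ₑ ^ 2 := by
  rw [← ofReal_norm_sq, ← ofReal_norm_sq, symC, ← ofReal_mul pos!]; refine ofReal_le_ofReal ?_
  have h : ‖locOp (wwin a) q (wwin b) f‖ ^ 2 ≤ (symK a b Q * ‖f‖) ^ 2 := by
    gcongr; exact hq.norm_locOp_le_symK f
  have h5 : 0 ≤ symK a b Q ^ 2 * ‖f‖ ^ 2 := by positivity
  rw [mul_pow] at h; nlinarith [sq_nonneg ‖f‖]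

lemma IsSym.weightBdd_sob (hq : IsSym q Q) :
    WeightBdd volV (fun f : L2v => ((𝓕 f : L2v) : Vel → ℂ)) wS (symC a b Q) volV wS
      fun f => ((𝓕 (locOp (wwin a) q (wwin b) f) : L2v) : Vel → ℂ) where
  aesm f := diag_fourier.aesm _
  add f g := by simp only [map_add]; exact diag_fourier.add _ _
  bdd f := by rw [← diag_fourier.norm_sq]; exact hq.enorm_sq_locOp_le f
  bddw := hq.sobQ_one_le

lemma IsSym.weightBdd_ang (hq : IsSym q Q) :
    WeightBdd Measure.count (fun (f : L2v) l => (sphSpace l).starProjection f) wA (symC a b Q)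
      Measure.count wA fun f l => (sphSpace l).starProjection (locOp (wwin a) q (wwin b) f) where
  aesm f := diag_sph.aesm _
  add f g := by simp only [map_add]; exact .of_forall fun l => rfl
  bdd f := by rw [← diag_sph.norm_sq]; exact hq.enorm_sq_locOp_le f
  bddw := hq.angQ_one_le

lemma IsSym.tripQ_le (hq : IsSym q Q) (hs0 : 0 < s) (hs1 : s < 1) (f : L2v) :
    tripQ s (locOp (wwin a) q (wwin b) f) ≤ symC a b Q * tripQ s f := by
  rw [tripQ, tripQ, mul_add]
  exact add_le_add
    (lintegral_rpow_le hs0 hs1 diag_fourier measurable_wS measurable_wS hq.weightBdd_sob f)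
    (lintegral_rpow_le hs0 hs1 diag_sph .of_discrete .of_discrete hq.weightBdd_ang f)

lemma tendsto_tripQ {q : ℕ → Ph → ℂ} (hq : ∀ n, IsSym (q n) Q) (hs0 : 0 < s)
    (hs1 : s < 1) {f : L2v} (hf : tripQ s f < ⊤)
    (hlim : Tendsto (fun n => ‖locOp (wwin a) (q n) (wwin b) f‖ₑ ^ 2) atTop (nhds 0)) :
    Tendsto (fun n => tripQ s (locOp (wwin a) (q n) (wwin b) f)) atTop (nhds 0) := by
  rw [tripQ, add_lt_top] at hf
  have h1 := tendsto_lintegral_rpow hs0 hs1 diag_fourier measurable_wS measurable_wS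
    ofReal_ne_top (fun n => (hq n).weightBdd_sob) f
    (by simpa only [← diag_fourier.norm_sq] using hlim) hf.1
  have h2 := tendsto_lintegral_rpow hs0 hs1 diag_sph .of_discrete .of_discrete
    ofReal_ne_top (fun n => (hq n).weightBdd_ang) f
    (by simpa only [← diag_sph.norm_sq] using hlim) hf.2
  have h3 := h1.add h2; rw [add_zero] at h3; exact h3

/-! ### Commutation with powers of the weight -/

lemma winFun_wwin_mul (c w : ℝ) (u : Vel → ℂ) (Y : Ph) :
    winFun (wwin c) (fun v => jbC v w * u v) Y = jbC Y.1 w * winFun (wwin (c - w)) u Y := by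
  simp only [winFun, expInt]; rw [mul_left_comm]; congr 1; rw [← integral_const_mul]
  refine integral_ext fun v => ?_
  have h1 : wwin c Y.1 v * jb v ^ w = jb Y.1 ^ w * wwin (c - w) Y.1 v := by
    rw [wwin, wwin, rpow_sub (jb_pos _), neg_sub, rpow_sub (jb_pos _), rpow_neg (jb_pos _).le]
    have := (rpow_pos_of_pos (jb_pos Y.1) w).ne'; field_simp
  have h2 : ((wwin c Y.1 v : ℝ) : ℂ) * jbC v w =
      jbC Y.1 w * ((wwin (c - w) Y.1 v : ℝ) : ℂ) := by exact_mod_cast h1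
  linear_combination (eN v Y.2 * u v) * h2

/-- Multiplication by `⟨v⟩^{-w}`, `w ≥ 0`. -/
abbrev decOp (w : ℝ) : L2v →L[ℂ] L2v := mulOp volume fun v => jbC v (-w)

lemma norm_jb_rpow_neg_le (hw : 0 ≤ w) (v : Vel) : ‖jbC v (-w)‖ ≤ 1 := by
  rw [norm_real, norm_of_nonneg (rpow_nonneg (jb_pos v).le _)]
  exact rpow_le_one_of_one_le_of_nonpos (one_le_jb v) lin!

lemma measurable_jb_rpow (w : ℝ) : Measurable fun v : Vel => jbC v w :=
  (continuous_ofReal.comp (continuous_jb_rpow w)).measurable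

lemma coeFn_decOp (hw : 0 ≤ w) (f : L2v) : decOp w f =ᵐ[volume] fun v => jbC v (-w) * f v :=
  coeFn_mulOp (measurable_jb_rpow _) (norm_jb_rpow_neg_le hw) f

lemma decOp_locOp {c : ℝ} (hw : 0 ≤ w) (hq : Measurable q) (hQ : ∀ Y, ‖q Y‖ ≤ Q) (f : L2v) :
    decOp w (locOp (wwin (-c)) q (wwin c) f) =
      locOp (wwin (-(c - w))) q (wwin (c - w)) (decOp w f) := by
  refine ext_inner_left ℂ fun u => ?_
  have hadj : inn u (decOp w (locOp (wwin (-c)) q (wwin c) f)) =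
      inn (decOp w u) (locOp (wwin (-c)) q (wwin c) f) := by
    rw [inner_eq_integral, inner_eq_integral]; refine integral_congr_ae ?_
    filter_upwards [coeFn_decOp hw u, coeFn_decOp hw (locOp (wwin (-c)) q (wwin c) f)] with v h1 h2
    rw [h1, h2, map_mul, conj_ofReal]; ring
  rw [hadj, inner_locOp_eq_integral (isWin_wwin _) (isWin_wwin _) hq hQ,
    inner_locOp_eq_integral (isWin_wwin _) (isWin_wwin _) hq hQ]
  refine integral_ext fun Y => ?_
  rw [winFun_congr _ (coeFn_decOp hw u), winFun_congr _ (coeFn_decOp hw f), winFun_wwin_mul,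
    winFun_wwin_mul, map_mul, conj_ofReal]
  have e1 : -c - -w = -(c - w) := by ring
  have e2 : c - w - -w = c := by ring
  rw [e1, e2]; ring

/-- The quantization `V^* q V`. -/
abbrev wickOp (q : Ph → ℂ) : L2v →L[ℂ] L2v := locOp (wwin 0) q (wwin 0)

lemma jb_rpow_mul_neg (w : ℝ) (v : Vel) (z : ℂ) : jbC v w * (jbC v (-w) * z) = z := by
  rw [← mul_assoc, ← Complex.ofReal_mul, ← rpow_add (jb_pos v), add_neg_cancel,
    rpow_zero, Complex.ofReal_one, one_mul]

lemma weight_wickOp (w : ℝ) (hq : Measurable q) (hQ : ∀ Y, ‖q Y‖ ≤ Q) (f : L2v)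
    (hf : MemLp (fun v => jbC v w * f v) 2 volume) :
    (fun v => jbC v w * wickOp q f v) =ᵐ[volume] locOp (wwin (-w)) q (wwin w) (hf.toLp _) := by
  rcases le_total 0 w with hw | hw
  · have h1 : decOp w (hf.toLp _) = f := by
      ext1
      filter_upwards [coeFn_decOp hw (hf.toLp _), hf.coeFn_toLp] with v h1 h2
      rw [h1, h2, mul_left_comm, jb_rpow_mul_neg]
    have h2 := decOp_locOp (c := w) hw hq hQ (hf.toLp _); rw [h1, sub_self, neg_zero] at h2
    rw [← h2]; filter_upwards [coeFn_decOp hw (locOp (wwin (-w)) q (wwin w) (hf.toLp _))] with v hv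
    rw [hv, jb_rpow_mul_neg]
  · have hw' : 0 ≤ -w := by linarith
    have h1 : decOp (-w) f = hf.toLp _ := by
      ext1
      filter_upwards [coeFn_decOp hw' f, hf.coeFn_toLp] with v h1 h2; rw [h1, h2, neg_neg]
    have h2 := decOp_locOp (c := 0) hw' hq hQ f; have e : (0 : ℝ) - -w = w := by ring
    rw [h1, e, neg_zero] at h2; rw [← h2]; filter_upwards [coeFn_decOp hw' (wickOp q f)] with v hv
    rw [hv, neg_neg]

/-! ### The symbol `ψ_k` -/

lemma one_le_jb_rpow {r : ℝ} (hr : 0 ≤ r) (v : Vel) : 1 ≤ jb v ^ r := one_le_rpow (one_le_jb v) hr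

lemma jb_rpow_pos (r : ℝ) (v : Vel) : 0 < jb v ^ r := rpow_pos_of_pos (jb_pos v) r

/-- Smooth functions with values in `[0, 1]`, equal to `1` on `[-1, 1]`, supported in `[-2, 2]`. -/
structure IsCutoff (χ : ℝ → ℝ) : Prop where
  smooth : ContDiff ℝ ∞ χ
  mem r : χ r ∈ Icc (0 : ℝ) 1
  one : ∀ r ∈ Icc (-1 : ℝ) 1, χ r = 1
  supp : tsupport χ ⊆ Icc (-2 : ℝ) 2

lemma IsCutoff.hasCompactSupport (hχ : IsCutoff χ) : HasCompactSupport χ :=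
  .of_support_subset_isCompact isCompact_Icc ((subset_tsupport χ).trans hχ.supp)

lemma exists_bound_mul_deriv {G : ℝ → ℝ} (hG : ContDiff ℝ ∞ G) (hc : HasCompactSupport G) :
    ∃ M : ℝ, 0 ≤ M ∧ ∀ r, |r * deriv G r| ≤ M := by
  have h1 : Continuous fun r => r * deriv G r := continuous_id.mul (hG.continuous_deriv (by simp))
  obtain ⟨C, hC⟩ := h1.bounded_above_of_compact_support (hc.deriv.mul_left (f := fun r => r))
  exact ⟨C, (norm_nonneg _).trans (hC 0), hC⟩

lemma abs_sub_le_mul_log {G : ℝ → ℝ} (hG : ContDiff ℝ ∞ G) (hM : ∀ r, |r * deriv G r| ≤ M) {x y : ℝ} (hx : 0 < x) (hy : 0 < y) :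
    |G y - G x| ≤ M * |log y - log x| := by
  have h := convex_univ.norm_image_sub_le_of_norm_hasDerivWithin_le
    (f := fun t => G (exp t)) (f' := fun t => deriv G (exp t) * exp t) (C := M)
    (x := log x) (y := log y) (fun t _ => HasDerivAt.hasDerivWithinAt
      (((hG.differentiable (by simp) _).hasDerivAt).comp t (Real.hasDerivAt_exp t)))
    (fun t _ => by rw [mul_comm]; exact hM _) (mem_univ _) (mem_univ _)
  simpa only [exp_log hx, exp_log hy, norm_eq_abs] using h

lemma rpow_two_add_div (hs : 0 < s) (v : Vel) :
    jb v ^ ((2 + 2 * s) / (1 + 2 * s)) = jb v * jb v ^ (1 / (1 + 2 * s)) := by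
  have h : (2 + 2 * s) / (1 + 2 * s) = 1 + 1 / (1 + 2 * s) := by field_simp; ring
  rw [h, rpow_add (jb_pos v), Real.rpow_one]

/-- The argument of the cutoff in `ψ_k`. -/
def psiArg (s γ : ℝ) (k : ℤ³) (y ξ : Vel) : ℝ :=
  jb y ^ (γ / (1 + 2 * s)) * jb ξ / jb (freq k) ^ (1 / (1 + 2 * s))

section

variable {k : ℤ³}

lemma psiArg_pos (s γ : ℝ) (k : ℤ³) (y ξ : Vel) : 0 < psiArg s γ k y ξ := by
  have := jb_pos ξ; have := jb_rpow_pos (γ / (1 + 2 * s)) y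
  have := jb_rpow_pos (1 / (1 + 2 * s)) (freq k); unfold psiArg; positivity

lemma psi_eq (hs : 0 < s) (y ξ : Vel) :
    psi s γ χ k y ξ = 2 * (inner ℝ (freq k) ξ / (jb (freq k) * jb ξ)) *
      (psiArg s γ k y ξ * χ (psiArg s γ k y ξ)) := by
  have := (jb_pos ξ).ne'; have := (jb_pos (freq k)).ne'
  have := (jb_rpow_pos (1 / (1 + 2 * s)) (freq k)).ne'; rw [psi, rpow_two_add_div hs, ← psiArg]
  generalize χ (psiArg s γ k y ξ) = A; rw [psiArg]; field_simp

lemma abs_inner_div_le (k ξ : Vel) : |inner ℝ k ξ / (jb k * jb ξ)| ≤ 1 := by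
  have h1 := jb_pos ξ; have h2 := jb_pos k
  rw [abs_div, abs_of_pos (mul_pos h2 h1), div_le_one pos!]
  exact (abs_real_inner_le_norm _ _).trans (mul_le_mul (norm_le_jb _) (norm_le_jb _) pos! h2.le)

lemma abs_mul_cutoff_le (hχ : IsCutoff χ) (r : ℝ) : |r * χ r| ≤ 2 := by
  by_cases hr : χ r = 0
  · rw [hr]; simp
  · have h1 := hχ.supp (subset_tsupport χ hr); rw [abs_mul, abs_of_nonneg (hχ.mem r).1]
    exact (mul_le_mul (abs_le.2 h1) (hχ.mem r).2 (hχ.mem r).1 num!).trans_eq num!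

lemma abs_psi_le (hs : 0 < s) (hχ : IsCutoff χ) (y ξ : Vel) : |psi s γ χ k y ξ| ≤ 4 := by
  rw [psi_eq hs, abs_mul, abs_mul, abs_of_pos (zero_lt_two (α := ℝ))]
  have h1 := abs_inner_div_le (freq k) ξ; have h2 := abs_mul_cutoff_le hχ (psiArg s γ k y ξ)
  calc _ ≤ (2 : ℝ) * 1 * 2 := by gcongr
    _ = 4 := by norm_num

lemma continuous_psi (hχ : IsCutoff χ) : Continuous fun Y : Ph => psi s γ χ k Y.1 Y.2 := by
  have h1 : Continuous fun Y : Ph => jb Y.1 ^ (γ / (1 + 2 * s)) :=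
    (continuous_jb_rpow _).comp continuous_fst
  have h2 : Continuous fun Y : Ph => jb Y.2 := continuous_jb.comp continuous_snd; unfold psi
  exact (((continuous_const.mul h1).mul (by fun_prop)).div_const _).mul
    (hχ.smooth.continuous.comp ((h1.mul h2).div_const _))

lemma abs_psi_add_sub_le (hs : 0 < s) (hγ : 0 ≤ γ) (hχ : IsCutoff χ) (hM0 : 0 ≤ M)
    (hM : ∀ r, |r * deriv (fun r => r * χ r) r| ≤ M) (y z ξ : Vel) :
    |psi s γ χ k (y + z) ξ - psi s γ χ k y ξ| ≤ 2 * M * (γ / (1 + 2 * s)) * ‖z‖ := by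
  have h1 := abs_inner_div_le (freq k) ξ; have hx := psiArg_pos s γ k y ξ
  have hx' := psiArg_pos s γ k (y + z) ξ
  have h2 := abs_sub_le_mul_log (G := fun r => r * χ r) (contDiff_id.mul hχ.smooth) hM hx hx'
  have hlog : ∀ y, log (psiArg s γ k y ξ) = γ / (1 + 2 * s) * log (jb y) +
      log (jb ξ) - log (jb (freq k) ^ (1 / (1 + 2 * s))) := fun y => by
    rw [psiArg, log_div (mul_pos (jb_rpow_pos _ _) (jb_pos _)).ne' (jb_rpow_pos _ _).ne',
      log_mul (jb_rpow_pos _ _).ne' (jb_pos _).ne', log_rpow (jb_pos y)]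
  have h3 : |log (psiArg s γ k (y + z) ξ) - log (psiArg s γ k y ξ)| ≤ γ / (1 + 2 * s) * ‖z‖ := by
    have e : log (psiArg s γ k (y + z) ξ) - log (psiArg s γ k y ξ) =
        γ / (1 + 2 * s) * (log (jb (y + z)) - log (jb y)) := by
      rw [hlog, hlog]; ring
    rw [e, abs_mul, abs_of_nonneg pos!]; gcongr; exact abs_log_jb_sub_le y z
  rw [psi_eq hs, psi_eq hs, ← mul_sub, abs_mul, abs_mul, abs_of_pos (zero_lt_two (α := ℝ))]
  calc _ ≤ 2 * 1 * (M * (γ / (1 + 2 * s) * ‖z‖)) := by gcongr; exact h2.trans (by gcongr)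
    _ = _ := by ring

lemma abs_psi_rotFun_sub_le (hs : 0 < s) (hχ : IsCutoff χ) {i : Fin 3} (hij : i ≠ j) (θ : ℝ) (y ξ : Vel) :
    |psi s γ χ k (rotFun i j θ y) (rotFun i j θ ξ) - psi s γ χ k y ξ| ≤ 4 * |θ| := by
  have hjb : ∀ v, jb (rotFun i j θ v) = jb v := fun v => by rw [jb, jb, norm_rotFun hij]
  have harg : psiArg s γ k (rotFun i j θ y) (rotFun i j θ ξ) = psiArg s γ k y ξ := by
    rw [psiArg, psiArg, hjb, hjb]
  rw [psi_eq hs, psi_eq hs, harg, hjb, ← sub_mul, ← mul_sub, ← sub_div, ← inner_sub_right, abs_mul,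
    abs_mul, abs_of_pos (zero_lt_two (α := ℝ))]
  have h1 : |inner ℝ (freq k) (rotFun i j θ ξ - ξ) / (jb (freq k) * jb ξ)| ≤ |θ| := by
    have h1 := jb_pos ξ; have h2 := jb_pos (freq k)
    rw [abs_div, abs_of_pos (mul_pos h2 h1), div_le_iff₀ pos!]
    calc _ ≤ ‖freq k‖ * ‖rotFun i j θ ξ - ξ‖ := abs_real_inner_le_norm _ _
      _ ≤ jb (freq k) * (|θ| * jb ξ) := by
        gcongr
        · exact norm_le_jb _
        · exact (norm_rotFun_sub_le hij θ ξ).trans (by gcongr; exact norm_le_jb _)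
      _ = _ := by ring
  calc _ ≤ 2 * |θ| * 2 := by gcongr; exact abs_mul_cutoff_le hχ _
    _ = 4 * |θ| := by ring

/-- A cutoff in the velocity variable, Lipschitz uniformly in `n`. -/
def velCut (n : ℕ) (y : Vel) : ℝ := max 0 (min 1 (2 - log (jb y) / (n + 1)))

lemma velCut_nonneg (n : ℕ) (y : Vel) : 0 ≤ velCut n y := le_max_left _ _

lemma velCut_le_one (n : ℕ) (y : Vel) : velCut n y ≤ 1 := max_le zero_le_one (min_le_left _ _)

lemma continuous_velCut (n : ℕ) : Continuous (velCut n) := by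
  have : Continuous fun y => log (jb y) := continuous_jb.log fun y => (jb_pos y).ne'; unfold velCut
  fun_prop

lemma abs_velCut_add_sub_le (n : ℕ) (y z : Vel) : |velCut n (y + z) - velCut n y| ≤ ‖z‖ := by
  unfold velCut
  have h1 : ∀ a b : ℝ, |max 0 (min 1 a) - max 0 (min 1 b)| ≤ |a - b| := fun a b => by
    rw [max_comm 0, max_comm 0, min_comm 1, min_comm 1]
    exact (abs_max_sub_max_le_abs _ _ _).trans (abs_min_sub_min_le_max _ _ _ _ |>.trans (by simp))
  refine (h1 _ _).trans ?_; have h2 := abs_log_jb_sub_le y z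
  have e : 2 - log (jb (y + z)) / (n + 1) - (2 - log (jb y) / (n + 1)) =
      -((log (jb (y + z)) - log (jb y)) / (n + 1)) := by ring
  have hn : (1 : ℝ) ≤ n + 1 := by linarith [(Nat.cast_nonneg n : (0 : ℝ) ≤ n)]
  rw [e, abs_neg, abs_div, abs_of_pos (by positivity : (0 : ℝ) < n + 1), div_le_iff₀ pos!]
  nlinarith [norm_nonneg z]

lemma velCut_rotFun {i : Fin 3} (hij : i ≠ j) (θ : ℝ) (n : ℕ) (y : Vel) :
    velCut n (rotFun i j θ y) = velCut n y := by
  rw [velCut, velCut, jb, jb, norm_rotFun hij]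

lemma tendsto_velCut (y : Vel) : Tendsto (fun n => velCut n y) atTop (nhds 1) := by
  refine tendsto_const_nhds.congr' ?_; obtain ⟨N, hN⟩ := exists_nat_ge (log (jb y))
  filter_upwards [eventually_ge_atTop N] with n hn; have : (N : ℝ) ≤ n := mod_cast hn
  have h1 := (div_le_one (show (0 : ℝ) < n + 1 by positivity)).2 (by linarith : log (jb y) ≤ n + 1)
  rw [velCut, min_eq_left lin!, max_eq_right zero_le_one]

lemma velCut_eq_zero {y : Vel} (hy : exp (2 * (n + 1)) ≤ jb y) : velCut n y = 0 := by
  have h1 : 2 * (n + 1 : ℝ) ≤ log (jb y) := (le_log_iff_exp_le (jb_pos y)).2 hy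
  have h2 : 2 ≤ log (jb y) / (n + 1) := by rwa [le_div_iff₀ pos!]
  rw [velCut, max_eq_left]; exact (min_le_right _ _).trans lin!

/-- The symbol `ψ_k` on phase space. -/
def psiY (s γ : ℝ) (χ : ℝ → ℝ) (k : ℤ³) (Y : Ph) : ℂ := (psi s γ χ k Y.1 Y.2 : ℂ)

/-- The symbol `ψ_k` cut off in the velocity variable. -/
def psiCut (s γ : ℝ) (χ : ℝ → ℝ) (n : ℕ) (k : ℤ³) (Y : Ph) : ℂ :=
  ((velCut n Y.1 * psi s γ χ k Y.1 Y.2 : ℝ) : ℂ)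

lemma exists_isSym (hs : 0 < s) (hγ : 0 ≤ γ) (hχ : IsCutoff χ) :
    ∃ Q : ℝ, 4 ≤ Q ∧ (∀ k, IsSym (psiY s γ χ k) Q) ∧ ∀ n k, IsSym (psiCut s γ χ n k) Q := by
  obtain ⟨M, hM0, hM⟩ := exists_bound_mul_deriv (G := fun r => r * χ r) (contDiff_id.mul hχ.smooth)
    (hχ.hasCompactSupport.mul_left (f := fun r => r))
  set D := 2 * M * (γ / (1 + 2 * s)); have hD : 0 ≤ D := by positivity
  have key {c : Vel → ℝ} (hc : Continuous c) (h0 : ∀ y, 0 ≤ c y) (h1 : ∀ y, c y ≤ 1)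
      (hl : ∀ y z, |c (y + z) - c y| ≤ ‖z‖)
      (hr : ∀ {i j : Fin 3}, i ≠ j → ∀ θ y, c (rotFun i j θ y) = c y) (k : ℤ³) :
      IsSym (fun Y => ((c Y.1 * psi s γ χ k Y.1 Y.2 : ℝ) : ℂ)) (4 + (4 + D)) := by
    refine ⟨(continuous_ofReal.comp ((hc.comp continuous_fst).mul (continuous_psi hχ))).measurable,
      fun Y => ?_, fun y z ξ _ => ?_, fun i j hij θ hθ0 _ y ξ => ?_⟩
    · rw [norm_real, norm_eq_abs, abs_mul, abs_of_nonneg (h0 _)]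
      exact (mul_le_mul (h1 _) (abs_psi_le hs hχ _ _) pos! zero_le_one).trans lin!
    · have h2 := abs_psi_add_sub_le (k := k) hs hγ hχ hM0 hM y z ξ
      have h3 := abs_psi_le (γ := γ) (k := k) hs hχ y ξ
      rw [← ofReal_sub, norm_real, norm_eq_abs, show c (y + z) * psi s γ χ k (y + z) ξ -
        c y * psi s γ χ k y ξ = c (y + z) * (psi s γ χ k (y + z) ξ - psi s γ χ k y ξ) +
        (c (y + z) - c y) * psi s γ χ k y ξ by ring]
      refine (abs_add_le _ _).trans ?_; rw [abs_mul, abs_mul, abs_of_nonneg (h0 _)]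
      nlinarith [norm_nonneg z, mul_le_mul (h1 (y + z)) h2 (abs_nonneg _) zero_le_one,
        mul_le_mul (hl y z) h3 pos! (norm_nonneg z)]
    · have h2 := abs_psi_rotFun_sub_le (γ := γ) (k := k) hs hχ hij θ y ξ; rw [abs_of_pos hθ0] at h2
      rw [← ofReal_sub, norm_real, norm_eq_abs, hr hij, ← mul_sub, abs_mul, abs_of_nonneg (h0 _)]
      exact (mul_le_mul (h1 _) h2 (abs_nonneg _) zero_le_one).trans (by nlinarith)
  refine ⟨_, by linarith, fun k => ?_, fun n => key (continuous_velCut n) (velCut_nonneg n)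
    (velCut_le_one n) (abs_velCut_add_sub_le n) fun hij θ y => velCut_rotFun hij θ n y⟩
  have h := key (c := fun _ => 1) continuous_const (by simp) (by simp) (by simp) (by simp) k
  simp only [one_mul] at h; exact h

/-! ### The derivative of `ψ_k` along the frequency -/

/-- Half of the derivative of `ψ_k` in the dual velocity variable, in the direction `k`. -/
def psiD (s γ : ℝ) (χ : ℝ → ℝ) (k : ℤ³) (y ξ : Vel) : ℝ :=
  jb y ^ (γ / (1 + 2 * s)) / jb (freq k) ^ ((2 + 2 * s) / (1 + 2 * s)) *
    (‖freq k‖ ^ 2 * χ (psiArg s γ k y ξ) + inner ℝ (freq k) ξ ^ 2 / jb ξ ^ 2 *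
      (psiArg s γ k y ξ * deriv χ (psiArg s γ k y ξ)))

lemma hasDerivAt_jb_add_smul (ξ κ : Vel) :
    HasDerivAt (fun t : ℝ => jb (ξ + t • κ)) (inner ℝ κ ξ / jb ξ) 0 := by
  have h1 : HasDerivAt (fun t : ℝ => ξ + t • κ) κ 0 := by
    simpa using ((hasDerivAt_id (0 : ℝ)).smul_const κ).const_add ξ
  have h2 := (h1.norm_sq.const_add 1).sqrt pos!; unfold jb; refine h2.congr_deriv ?_
  rw [zero_smul, add_zero, real_inner_comm]; field_simp

lemma hasDerivAt_psi (hχ : IsCutoff χ) (y ξ : Vel) :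
    HasDerivAt (fun t : ℝ => psi s γ χ k y (ξ + t • freq k)) (2 * psiD s γ χ k y ξ) 0 := by
  have h1 : HasDerivAt (fun t : ℝ => inner ℝ (freq k) (ξ + t • freq k)) (‖freq k‖ ^ 2) 0 := by
    simp_rw [inner_add_right, inner_smul_right, real_inner_self_eq_norm_sq]
    simpa using ((hasDerivAt_id (0 : ℝ)).mul_const (‖freq k‖ ^ 2)).const_add (inner ℝ (freq k) ξ)
  have h2 := ((hasDerivAt_jb_add_smul ξ (freq k)).const_mul
    (jb y ^ (γ / (1 + 2 * s)))).div_const (jb (freq k) ^ (1 / (1 + 2 * s)))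
  have h3 : HasDerivAt χ (deriv χ (psiArg s γ k y ξ))
      (jb y ^ (γ / (1 + 2 * s)) * jb (ξ + (0 : ℝ) • freq k) / jb (freq k) ^ (1 / (1 + 2 * s))) := by
    rw [zero_smul, add_zero]; exact (hχ.smooth.differentiable (by simp) _).hasDerivAt
  have h4 := h3.comp 0 h2
  have h5 := ((h1.const_mul (2 * jb y ^ (γ / (1 + 2 * s)))).div_const
    (jb (freq k) ^ ((2 + 2 * s) / (1 + 2 * s)))).mul h4
  refine h5.congr_deriv ?_; have e1 := (jb_pos ξ).ne'
  have e2 := (jb_rpow_pos (1 / (1 + 2 * s)) (freq k)).ne'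
  have e3 := (jb_rpow_pos ((2 + 2 * s) / (1 + 2 * s)) (freq k)).ne'
  simp only [Function.comp_apply, zero_smul, add_zero, psiD]; rw [← psiArg]
  generalize χ (psiArg s γ k y ξ) = A; generalize deriv χ (psiArg s γ k y ξ) = B; rw [psiArg]
  field_simp

lemma le_psiD (hs : 0 < s) (hχ : IsCutoff χ) (hM0 : 0 ≤ M)
    (hM : ∀ r, |r * deriv χ r| ≤ M) (y ξ : Vel) :
    jb y ^ (γ / (1 + 2 * s)) * jb (freq k) ^ (2 * s / (1 + 2 * s)) ≤
      psiD s γ χ k y ξ + (M + 1) * (jb y ^ γ * jb ξ ^ (2 * s)) + 1 := by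
  set x := psiArg s γ k y ξ with hx; set a := γ / (1 + 2 * s) with ha; set κ := jb (freq k) with hκ
  have hx0 : 0 < x := psiArg_pos s γ k y ξ; have hy := jb_rpow_pos a y; have hκ0 : 0 < κ := jb_pos _
  have hκ1 : 1 ≤ κ := one_le_jb _; have hξ0 := jb_pos ξ
  have hK := jb_rpow_pos (1 / (1 + 2 * s)) (freq k)
  have hn : ‖freq k‖ ^ 2 = κ ^ 2 - 1 := by rw [hκ, jb_sq]; ring
  have hb : jb y ^ a / κ ^ ((2 + 2 * s) / (1 + 2 * s)) * κ ^ 2 =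
      jb y ^ a * κ ^ (2 * s / (1 + 2 * s)) := by
    have e : κ ^ (2 : ℕ) = κ ^ ((2 + 2 * s) / (1 + 2 * s)) * κ ^ (2 * s / (1 + 2 * s)) := by
      rw [← rpow_add hκ0, ← rpow_natCast]; congr 1; push_cast; field_simp; ring
    have := (jb_rpow_pos ((2 + 2 * s) / (1 + 2 * s)) (freq k)).ne'; rw [e]; field_simp
  have hpos : 0 ≤ jb y ^ γ * jb ξ ^ (2 * s) := by
    have := jb_rpow_pos γ y; have := jb_rpow_pos (2 * s) ξ; positivity
  rw [psiD, ← hx, hn]; by_cases hx1 : x ≤ 1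
  · have hχx : χ x = 1 := hχ.one x ⟨by linarith, hx1⟩
    have hd : deriv χ x = 0 := by
      have h1 : HasDerivWithinAt χ (deriv χ x) (Iic x) x :=
        (hχ.smooth.differentiable (by simp) x).hasDerivAt.hasDerivWithinAt
      have h2 : HasDerivWithinAt χ 0 (Iic x) x := by
        refine (hasDerivWithinAt_const x (Iic x) (1 : ℝ)).congr_of_eventuallyEq ?_ hχx
        filter_upwards [Ioc_mem_nhdsLE (show -1 < x by linarith)] with r hr
        exact hχ.one r ⟨hr.1.le, hr.2.trans hx1⟩
      exact (uniqueDiffOn_Iic x x self_mem_Iic).eq_deriv _ h1 h2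
    rw [hχx, hd, mul_zero, mul_zero, add_zero, mul_one, mul_sub, hb, mul_one]
    have herr : jb y ^ a / κ ^ ((2 + 2 * s) / (1 + 2 * s)) ≤ 1 := by
      rw [hκ, rpow_two_add_div hs, div_le_one pos!]
      have h1 : jb y ^ a * jb ξ ≤ jb (freq k) ^ (1 / (1 + 2 * s)) := by
        rw [hx, psiArg, div_le_one hK] at hx1; exact hx1
      calc jb y ^ a ≤ jb y ^ a * jb ξ := le_mul_of_one_le_right hy.le (one_le_jb ξ)
        _ ≤ _ := h1
        _ ≤ _ := le_mul_of_one_le_left hK.le hκ1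
    nlinarith
  · have hx1' : 1 < x := not_le.1 hx1
    have hbig : jb y ^ a * κ ^ (2 * s / (1 + 2 * s)) ≤ jb y ^ γ * jb ξ ^ (2 * s) := by
      have h1 : jb (freq k) ^ (1 / (1 + 2 * s)) ≤ jb y ^ a * jb ξ := by
        rw [hx, psiArg, one_lt_div hK] at hx1'; exact hx1'.le
      have h2 := rpow_le_rpow hK.le h1 (by positivity : 0 ≤ 2 * s)
      rw [← rpow_mul hκ0.le, mul_rpow hy.le hξ0.le, ← rpow_mul (jb_pos y).le] at h2
      have e1 : 1 / (1 + 2 * s) * (2 * s) = 2 * s / (1 + 2 * s) := by ring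
      rw [e1] at h2
      calc _ ≤ jb y ^ a * (jb y ^ (a * (2 * s)) * jb ξ ^ (2 * s)) := by gcongr
        _ = jb y ^ (a + a * (2 * s)) * jb ξ ^ (2 * s) := by rw [rpow_add (jb_pos y), mul_assoc]
        _ = _ := by congr 2; rw [ha]; field_simp
    have hc := (hχ.mem x).1
    have hq : inner ℝ (freq k) ξ ^ 2 / jb ξ ^ 2 ≤ κ ^ 2 := by
      rw [div_le_iff₀ pos!, ← mul_pow, ← sq_abs]; gcongr
      exact (abs_real_inner_le_norm _ _).trans
        (mul_le_mul (norm_le_jb _) (norm_le_jb _) pos! hκ0.le)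
    have hq0 : 0 ≤ inner ℝ (freq k) ξ ^ 2 / jb ξ ^ 2 := by positivity
    have hm : -(κ ^ 2 * M) ≤ inner ℝ (freq k) ξ ^ 2 / jb ξ ^ 2 * (x * deriv χ x) := by
      have h1 := hM x
      have h2 : |inner ℝ (freq k) ξ ^ 2 / jb ξ ^ 2 * (x * deriv χ x)| ≤ κ ^ 2 * M := by
        rw [abs_mul, abs_of_nonneg hq0]; gcongr
      exact (abs_le.1 h2).1
    have hκ2 : 0 ≤ (κ ^ 2 - 1) * χ x := mul_nonneg (by nlinarith) hc
    have hL : 0 ≤ jb y ^ a / κ ^ ((2 + 2 * s) / (1 + 2 * s)) :=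
      div_nonneg hy.le (jb_rpow_pos _ (freq k)).le
    have h3 : -(M * (jb y ^ a * κ ^ (2 * s / (1 + 2 * s)))) ≤
        jb y ^ a / κ ^ ((2 + 2 * s) / (1 + 2 * s)) * ((κ ^ 2 - 1) * χ x +
          inner ℝ (freq k) ξ ^ 2 / jb ξ ^ 2 * (x * deriv χ x)) := by
      rw [← hb]
      calc _ = jb y ^ a / κ ^ ((2 + 2 * s) / (1 + 2 * s)) * (-(κ ^ 2 * M)) := by ring
        _ ≤ _ := by gcongr; linarith
    nlinarith

end

/-! ### The Wick quantization as a localization operator -/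

lemma integrable_prod_of_bound {α β : Type*} [MeasurableSpace α] [MeasurableSpace β]
    {μ : Measure α} {ν : Measure β} [SFinite μ] [SFinite ν] {f : α × β → ℂ}
    (hf : AEStronglyMeasurable f (μ.prod ν)) {Φ : α → ℝ} {Ψ : α → β → ℝ} (hΦ0 : ∀ a, 0 ≤ Φ a) (hΦ : Integrable Φ μ) (hΨ : ∀ a, Integrable (Ψ a) ν)
    (hC : ∀ a, ∫ b, Ψ a b ∂ν ≤ C) (h : ∀ a b, ‖f (a, b)‖ ≤ Φ a * Ψ a b) :
    Integrable f (μ.prod ν) := by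
  rw [integrable_prod_iff hf]; refine ⟨?_, ?_⟩
  · filter_upwards [hf.prodMk_left] with a ha
    exact ((hΨ a).const_mul (Φ a)).mono' ha (.of_forall fun b => h a b)
  · refine (hΦ.mul_const C).mono' hf.norm.integral_prod_right' ?_
    filter_upwards [hf.prodMk_left] with a ha
    rw [norm_of_nonneg (integral_nonneg fun b => norm_nonneg _)]
    calc ∫ b, ‖f (a, b)‖ ∂ν ≤ ∫ b, Φ a * Ψ a b ∂ν := by
          refine integral_mono_of_nonneg (.of_forall fun b => norm_nonneg _)
            ((hΨ a).const_mul _) (.of_forall fun b => h a b)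
      _ ≤ Φ a * C := by rw [integral_const_mul]; exact mul_le_mul_of_nonneg_left (hC a) (hΦ0 a)

lemma wwin_zero (y v : Vel) : wwin 0 y v = gauss (v - y) := by simp [wwin]

lemma integral_cexp_gaussian (x ξ : Vel) : ∫ η : Vel, eI x η * ((exp (-‖η - ξ‖ ^ 2) : ℝ) : ℂ) =
      ((π ^ (3 / 2 : ℝ) * exp (-‖x‖ ^ 2 / 4) : ℝ) : ℂ) * eI x ξ := by
  have h := GaussianFourier.integral_cexp_neg_mul_sq_norm_add (V := Vel) (b := 1) (by simp) I x
  have e1 := integral_add_right_eq_self (μ := volV) (fun η : Vel =>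
    eI x η * ((exp (-‖η - ξ‖ ^ 2) : ℝ) : ℂ)) ξ
  rw [← e1]
  have e2 : ∀ η : Vel, eI x (η + ξ) * ((exp (-‖η + ξ - ξ‖ ^ 2) : ℝ) : ℂ) = eI x ξ *
      cexp (-1 * ‖η‖ ^ 2 + I * (inner ℝ x η : ℝ)) := fun η => by
    rw [add_sub_cancel_right, ofReal_exp, ← Complex.exp_add, ← Complex.exp_add, inner_add_right]
    congr 1; push_cast; ring
  simp_rw [e2]; rw [integral_const_mul, h, mul_comm]; congr 1
  rw [finrank_euclideanSpace, Fintype.card_fin, div_one, I_sq, Complex.ofReal_mul,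
    ofReal_cpow pi_pos.le]
  push_cast; congr 2; ring

lemma gauss_mul_gauss (v v' y : Vel) : gauss (v - y) * gauss (v' - y) = π ^ (-(3 / 2) : ℝ) *
      (exp (-‖(1 / 2 : ℝ) • (v + v') - y‖ ^ 2) * exp (-‖v - v'‖ ^ 2 / 4)) := by
  rw [gauss, gauss, ← exp_add]
  have h1 : π ^ (-(3 / 4) : ℝ) * π ^ (-(3 / 4) : ℝ) = π ^ (-(3 / 2) : ℝ) := by
    rw [← rpow_add pi_pos]; norm_num
  have h2 := parallelogram_law_with_norm ℝ (v - y) (v' - y)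
  have h3 : v - y + (v' - y) = (2 : ℝ) • ((1 / 2 : ℝ) • (v + v') - y) := by module
  have h4 : v - y - (v' - y) = v - v' := by abel
  rw [h3, h4, norm_smul, norm_of_nonneg zero_le_two] at h2
  calc _ = (π ^ (-(3 / 4) : ℝ) * π ^ (-(3 / 4) : ℝ)) *
        (exp (-‖v - y‖ ^ 2 / 2) * exp (-‖v' - y‖ ^ 2 / 2)) := by ring
    _ = _ := by rw [h1, ← exp_add]; congr 2; linear_combination (1 / 4 : ℝ) * h2

lemma gauss_nonneg (x : Vel) : 0 ≤ gauss x := by unfold gauss; positivity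

lemma gauss_eq (x : Vel) : gauss x = π ^ (-(3 / 4) : ℝ) * exp (-(1 / 2) * ‖x‖ ^ 2) := by
  rw [gauss]; ring_nf

lemma integrable_gauss : Integrable gauss := by
  have := (integrable_gaussian (1 / 2) num!).const_mul (π ^ (-(3 / 4) : ℝ))
  exact this.congr (.of_forall fun x => (gauss_eq x).symm)

lemma memLp_gauss : MemLp gauss 2 volume := by
  have := (memLp_gaussian (b := 1 / 2) num!).const_mul (π ^ (-(3 / 4) : ℝ))
  exact this.ae_eq (.of_forall fun x => (gauss_eq x).symm)

lemma memLp_gauss_sub (y : Vel) : MemLp (fun v => gauss (v - y)) 2 volume := by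
  have := memLp_gauss.comp_measurePreserving (measurePreserving_add_right volume (-y))
  simpa only [Function.comp_def, ← sub_eq_add_neg] using this

lemma integrable_gauss_sub (v : Vel) : Integrable fun y => gauss (v - y) :=
  integrable_gauss.comp_sub_left v

lemma integrable_gauss_mul_norm (y : Vel) (f : L2v) :
    Integrable fun v' => gauss (v' - y) * ‖f v'‖ :=
  MemLp.integrable_mul (p := 2) (q := 2) (memLp_gauss_sub y) (Lp.memLp f).norm

/-- A bound for the windowed Fourier transform. -/
def winSup (f : L2v) : ℝ := ∫ v : Vel, (gauss v ^ 2 + ‖f v‖ ^ 2)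

lemma integral_gauss_mul_norm_le (y : Vel) (f : L2v) :
    ∫ v', gauss (v' - y) * ‖f v'‖ ≤ winSup f := by
  have h1 : Integrable fun v : Vel => gauss (v - y) ^ 2 := (memLp_gauss_sub y).integrable_sq
  have h2 : Integrable fun v : Vel => ‖f v‖ ^ 2 := (Lp.memLp f).norm.integrable_sq
  have h3 : winSup f = ∫ v, (gauss (v - y) ^ 2 + ‖f v‖ ^ 2) := by
    rw [winSup, integral_add memLp_gauss.integrable_sq h2, integral_add h1 h2,
      integral_sub_right_eq_self (μ := volV) (fun v => gauss v ^ 2) y]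
  rw [h3]; refine integral_mono (integrable_gauss_mul_norm y f) (h1.add h2) fun v => ?_; simp only
  nlinarith [sq_nonneg (gauss (v - y) - ‖f v‖), sq_nonneg (gauss (v - y)), sq_nonneg ‖f v‖]

lemma norm_winFun_zero_le (f : L2v) (Y : Ph) : ‖winFun (wwin 0) f Y‖ ≤ winSup f := by
  rw [winFun, norm_mul, norm_real, norm_of_nonneg pos!]; have h1 := two_pi_rpow_le_one
  have h2 : ‖expInt (fun v => (wwin 0 Y.1 v : ℂ) * f v) Y.2‖ ≤ winSup f := by
    refine (norm_integral_le_integral_norm _).trans ((integral_mono_of_nonneg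
      (.of_forall fun _ => norm_nonneg _) (integrable_gauss_mul_norm Y.1 f)
      (.of_forall fun v => ?_)).trans (integral_gauss_mul_norm_le Y.1 f))
    simp only
    rw [norm_mul, norm_mul, norm_exp, norm_real, wwin_zero, norm_of_nonneg (gauss_nonneg _)]; simp
  calc _ ≤ 1 * winSup f := mul_le_mul h1 h2 pos! zero_le_one
    _ = _ := one_mul _

/-- The indicator function of a ball. -/
def ballInd (R : ℝ) (ξ : Vel) : ℝ := (Metric.closedBall (0 : Vel) R).indicator (fun _ => 1) ξ

lemma ballInd_nonneg (R : ℝ) (ξ : Vel) : 0 ≤ ballInd R ξ :=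
  indicator_nonneg (fun _ _ => zero_le_one) _

lemma integrable_ballInd (R : ℝ) : Integrable (ballInd R) :=
  (integrable_indicator_iff Metric.isClosed_closedBall.measurableSet).2
    (integrableOn_const (isCompact_closedBall _ _).measure_lt_top.ne)

lemma measurable_ballInd (R : ℝ) : Measurable (ballInd R) :=
  measurable_const.indicator Metric.isClosed_closedBall.measurableSet

/-- Measurable symbols that are bounded and have bounded support in the dual variable. -/
structure IsLocSym (q : Vel → Vel → ℝ) (Q R : ℝ) : Prop where
  meas : Measurable fun Y : Ph => q Y.1 Y.2
  nonneg : 0 ≤ Q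
  bdd : ∀ y ξ, |q y ξ| ≤ Q * ballInd R ξ

/-- The integral kernel of a localization operator. -/
def locKer (q : Vel → Vel → ℝ) (v v' : Vel) : ℂ :=
  ∫ Z : Ph, (((2 * π) ^ (-3 : ℝ) * (q Z.1 Z.2 * (gauss (v - Z.1) *
    gauss (v' - Z.1))) : ℝ) : ℂ) * eI (v - v') Z.2

section

variable {q : Vel → Vel → ℝ} {Q R : ℝ}

lemma IsLocSym.abs_le (hq : IsLocSym q Q R) (y ξ : Vel) : |q y ξ| ≤ Q := by
  refine (hq.bdd y ξ).trans (mul_le_of_le_one_right hq.nonneg ?_)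
  exact indicator_le' (f := fun _ => (1 : ℝ)) (g := fun _ => 1) (fun _ _ => le_rfl)
    (fun _ _ => zero_le_one) ξ

lemma isNegInvariant_phase : ((volV).prod volV).IsNegInvariant := by
  have h : MeasurePreserving (Neg.neg : Vel → Vel) volume volume := Measure.measurePreserving_neg _
  exact ⟨(h.prod h).map_eq⟩

lemma integral_wickSymbol (hq : IsLocSym q Q R) (v v' : Vel) : ∫ η : Vel, eI (v - v') η *
      (wickSymbol q ((1 / 2 : ℝ) • (v + v')) η : ℂ) = locKer q v v' := by
  set X : Vel := (1 / 2 : ℝ) • (v + v') with hX; set x : Vel := v - v' with hx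
  have h1 : ∀ η, wickSymbol q X η = 1 / (8 * π ^ 6) * ∫ Z : Ph, q Z.1 Z.2 *
      (exp (-‖X - Z.1‖ ^ 2) * exp (-‖η - Z.2‖ ^ 2)) := fun η => by
    have := isNegInvariant_phase
    have h := integral_sub_left_eq_self (μ := (volV).prod volV) (fun Z : Ph => q Z.1 Z.2 *
        (exp (-‖X - Z.1‖ ^ 2) * exp (-‖η - Z.2‖ ^ 2))) (X, η)
    rw [wickSymbol, Measure.volume_eq_prod, ← h]; congr 1; refine integral_ext fun p => ?_
    simp only [Prod.fst_sub, Prod.snd_sub, sub_sub_cancel, ← exp_add]; ring_nf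
  have h2 : ∀ η, eI x η * (wickSymbol q X η : ℂ) =
      ∫ Z : Ph, ((1 / (8 * π ^ 6) * (q Z.1 Z.2 * exp (-‖X - Z.1‖ ^ 2)) : ℝ) : ℂ) * (eI x η *
        ((exp (-‖η - Z.2‖ ^ 2) : ℝ) : ℂ)) := fun η => by
    rw [h1, Complex.ofReal_mul, ← integral_complex_ofReal, ← integral_const_mul,
      ← integral_const_mul]
    refine integral_ext fun Z => ?_; push_cast; ring
  simp_rw [h2]
  have hint : Integrable (fun p : Ph × Vel =>
      ((1 / (8 * π ^ 6) * (q p.1.1 p.1.2 * exp (-‖X - p.1.1‖ ^ 2)) : ℝ) : ℂ) * (eI x p.2 *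
        ((exp (-‖p.2 - p.1.2‖ ^ 2) : ℝ) : ℂ)))
      ((volume : Measure Ph).prod volume) := by
    refine integrable_prod_of_bound (Φ := fun Z => 1 / (8 * π ^ 6) *
      (Q * (exp (-1 * ‖Z.1 - X‖ ^ 2) * ballInd R Z.2)))
      (Ψ := fun Z η => exp (-1 * ‖η - Z.2‖ ^ 2))
      (C := ∫ η : Vel, exp (-1 * ‖η‖ ^ 2)) ?_ (fun Z => ?_) ?_ (fun Z => ?_)
      (fun Z => ?_) fun Z η => ?_
    · have := hq.meas.comp (measurable_fst : Measurable (Prod.fst : Ph × Vel → Ph))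
      refine (Measurable.mul (measurable_ofReal.comp
        (Measurable.const_mul (Measurable.mul this ?_) _)) ?_).aestronglyMeasurable
      · exact Continuous.measurable (by fun_prop)
      · exact Continuous.measurable (by fun_prop)
    · have := ballInd_nonneg R Z.2; have := hq.nonneg; positivity
    · exact ((((integrable_gaussian 1 one_pos).comp_sub_right X).mul_prod
        (integrable_ballInd R)).const_mul _).const_mul _
    · exact (integrable_gaussian 1 one_pos).comp_sub_right Z.2
    · rw [integral_sub_right_eq_self (μ := volV) (fun η => exp (-1 * ‖η‖ ^ 2)) Z.2]
    · simp only
      rw [norm_mul, norm_mul, norm_exp, norm_real, norm_real,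
        norm_of_nonneg (exp_pos _).le, norm_mul, norm_mul,
        norm_of_nonneg (exp_pos _).le, norm_of_nonneg pos!]
      have h3 := hq.bdd Z.1 Z.2; have e : (I * (inner ℝ x η : ℂ)).re = 0 := by simp
      rw [e, exp_zero, one_mul, norm_sub_rev X, neg_one_mul, neg_one_mul, norm_eq_abs]; gcongr 1
      gcongr 1
      calc _ ≤ Q * ballInd R Z.2 * exp (-‖Z.1 - X‖ ^ 2) := by gcongr
        _ = _ := by ring
  rw [integral_integral_swap (f := fun (η : Vel) (Z : Ph) =>
    ((1 / (8 * π ^ 6) * (q Z.1 Z.2 * exp (-‖X - Z.1‖ ^ 2)) : ℝ) : ℂ) * (eI x η *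
        ((exp (-‖η - Z.2‖ ^ 2) : ℝ) : ℂ))) hint.swap, locKer]
  refine integral_ext fun Z => ?_
  rw [integral_const_mul, integral_cexp_gaussian, ← mul_assoc, ← Complex.ofReal_mul,
    gauss_mul_gauss v v' Z.1, ← hX, ← hx]
  congr 2; have e1 : π ^ (3 / 2 : ℝ) * π ^ (-(3 / 2) : ℝ) = 1 := by rw [← rpow_add pi_pos]; norm_num
  have e2 : π ^ (3 / 2 : ℝ) * π ^ (3 / 2 : ℝ) = π ^ 3 := by
    rw [← rpow_add pi_pos, ← rpow_natCast]; norm_num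
  have e3 : (2 * π) ^ (-3 : ℝ) = 1 / (8 * π ^ 3) := by
    rw [rpow_neg pos!, ← rpow_natCast π 3]
    have : (2 * π) ^ (3 : ℝ) = 8 * π ^ (3 : ℝ) := by rw [mul_rpow num! pi_pos.le]; norm_num
    rw [this, one_div]; norm_num
  have e4 : 1 / (8 * π ^ 6) * π ^ (3 / 2 : ℝ) = (2 * π) ^ (-3 : ℝ) * π ^ (-(3 / 2) : ℝ) := by
    have hp := pi_pos; have hp' := rpow_pos_of_pos hp (3 / 2)
    have hm : π ^ (-(3 / 2) : ℝ) = (π ^ (3 / 2 : ℝ))⁻¹ := rpow_neg hp.le _; rw [e3, hm]; field_simp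
    rw [sq, e2]
  linear_combination (q Z.1 Z.2 * exp (-‖X - Z.1‖ ^ 2) * exp (-‖x‖ ^ 2 / 4)) * e4

lemma wick_eq_integral (hq : IsLocSym q Q R) (f : L2v) (v : Vel) :
    wick q f v = ∫ Z : Ph, ((((2 * π) ^ (-(3 / 2) : ℝ) : ℝ) : ℂ) *
      (q Z.1 Z.2 * gauss (v - Z.1) : ℝ) * eI v Z.2) * winFun (wwin 0) f Z := by
  rw [wick]; simp_rw [integral_wickSymbol hq, locKer, ← integral_mul_const]
  have hint : Integrable (fun p : Ph × Vel =>
      (((2 * π) ^ (-3 : ℝ) * (q p.1.1 p.1.2 * (gauss (v - p.1.1) * gauss (p.2 - p.1.1))) : ℝ) : ℂ) *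
        eI (v - p.2) p.1.2 * f p.2)
      ((volume : Measure Ph).prod volume) := by
    have hg := continuous_gauss
    refine integrable_prod_of_bound (Φ := fun Z => (2 * π) ^ (-3 : ℝ) *
      (Q * (gauss (v - Z.1) * ballInd R Z.2))) (Ψ := fun Z v' => gauss (v' - Z.1) * ‖f v'‖)
      (C := winSup f) ?_ (fun Z => ?_) ?_ (fun Z => integrable_gauss_mul_norm _ _)
      (fun Z => integral_gauss_mul_norm_le _ _) fun Z v' => ?_
    · have := hq.meas.comp (measurable_fst : Measurable (Prod.fst : Ph × Vel → Ph))
      refine AEStronglyMeasurable.mul ((Measurable.mul (measurable_ofReal.comp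
        (Measurable.const_mul (Measurable.mul this ?_) _)) ?_).aestronglyMeasurable)
        (Lp.aestronglyMeasurable f).comp_snd
      · exact Continuous.measurable (by fun_prop)
      · exact Continuous.measurable (by fun_prop)
    · have := ballInd_nonneg R Z.2; have := hq.nonneg; have := gauss_nonneg (v - Z.1); positivity
    · exact (((integrable_gauss_sub v).mul_prod (integrable_ballInd R)).const_mul _).const_mul _
    · simp only
      rw [norm_mul, norm_mul, norm_exp, norm_real, norm_mul, norm_mul, norm_mul,
        norm_of_nonneg (gauss_nonneg _), norm_of_nonneg (gauss_nonneg _),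
        norm_of_nonneg (by positivity : (0 : ℝ) ≤ (2 * π) ^ (-3 : ℝ))]
      have h3 := hq.bdd Z.1 Z.2; have e : (I * (inner ℝ (v - v') Z.2 : ℂ)).re = 0 := by simp
      rw [e, exp_zero, mul_one, norm_eq_abs]; have h4 := gauss_nonneg (v - Z.1)
      have h5 := gauss_nonneg (v' - Z.1)
      calc _ ≤ (2 * π) ^ (-3 : ℝ) * (Q * ballInd R Z.2 * (gauss (v - Z.1) *
            gauss (v' - Z.1))) * ‖f v'‖ := by gcongr
        _ = _ := by ring
  rw [integral_integral_swap (f := fun (v' : Vel) (Z : Ph) =>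
    (((2 * π) ^ (-3 : ℝ) * (q Z.1 Z.2 * (gauss (v - Z.1) * gauss (v' - Z.1))) : ℝ) : ℂ) *
        eI (v - v') Z.2 * f v') hint.swap]
  refine integral_ext fun Z => ?_; simp only [winFun, expInt]
  rw [← mul_assoc, ← integral_const_mul]; refine integral_ext fun v' => ?_
  have e1 : (2 * π) ^ (-3 : ℝ) = (2 * π) ^ (-(3 / 2) : ℝ) * (2 * π) ^ (-(3 / 2) : ℝ) := by
    rw [← rpow_add pos!]; norm_num
  have e2 : eI (v - v') Z.2 = eI v Z.2 * cexp (-I * ((inner ℝ v' Z.2 : ℝ) : ℂ)) := by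
    rw [← Complex.exp_add, inner_sub_left]; congr 1; push_cast; ring
  rw [e1, e2, wwin_zero]; push_cast; ring

lemma wick_ae_eq (hq : IsLocSym q Q R) (f : L2v) :
    wick q f =ᵐ[volume] wickOp (fun Y => (q Y.1 Y.2 : ℂ)) f := by
  have hqm : Measurable fun Y : Ph => (q Y.1 Y.2 : ℂ) := measurable_ofReal.comp hq.meas
  have hqb : ∀ Y : Ph, ‖(q Y.1 Y.2 : ℂ)‖ ≤ Q := fun Y => by rw [norm_real]; exact hq.abs_le _ _
  set K : Vel × Ph → ℂ := fun p => ((((2 * π) ^ (-(3 / 2) : ℝ) : ℝ) : ℂ) *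
      (q p.2.1 p.2.2 * gauss (p.1 - p.2.1) : ℝ) *
      eI p.1 p.2.2) * winFun (wwin 0) f p.2 with hK
  have hw : wick q f = fun v => ∫ Z, K (v, Z) := funext fun v => wick_eq_integral hq f v
  have hint : ∀ s : Set Vel, MeasurableSet s → volume s < ⊤ →
      Integrable K ((volume.restrict s).prod volume) := fun s hs hμ => by
    have hg := continuous_gauss; have : IsFiniteMeasure (volume.restrict s) := ⟨by simpa using hμ⟩
    refine integrable_prod_of_bound (Φ := fun _ => 1) (Ψ := fun v Z => winSup f *
      (Q * (gauss (v - Z.1) * ballInd R Z.2))) (C := winSup f * (Q *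
        ((∫ y, gauss y) * ∫ ξ, ballInd R ξ))) ?_ (fun _ => zero_le_one) (integrable_const _)
      (fun v => ?_) (fun v => ?_) fun v Z => ?_
    · have := hq.meas.comp (measurable_snd : Measurable (Prod.snd : Vel × Ph → Ph))
      have hV := (stronglyMeasurable_winFun (isWin_wwin 0) f).measurable
      refine (Measurable.mul (Measurable.mul (Measurable.const_mul (measurable_ofReal.comp
        (Measurable.mul this ?_)) _) ?_) (hV.comp measurable_snd)).aestronglyMeasurable
      · exact Continuous.measurable (by fun_prop)
      · exact Continuous.measurable (by fun_prop)
    · exact (((integrable_gauss_sub v).mul_prod (integrable_ballInd R)).const_mul _).const_mul _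
    · rw [integral_const_mul, integral_const_mul]
      have := integral_prod_mul (μ := volV) (ν := volV) (fun y => gauss (v - y)) (ballInd R)
      rw [Measure.volume_eq_prod, this, integral_sub_left_eq_self (μ := volV) gauss v]
    · rw [one_mul, hK]; simp only
      rw [norm_mul, norm_mul, norm_mul, norm_exp, norm_real, norm_real,
        norm_mul, norm_of_nonneg (gauss_nonneg _), norm_of_nonneg pos!]
      have h3 := hq.bdd Z.1 Z.2; have e : (I * (inner ℝ v Z.2 : ℂ)).re = 0 := by simp
      rw [e, exp_zero, mul_one, norm_eq_abs]; have h4 := gauss_nonneg (v - Z.1)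
      have h1 := two_pi_rpow_le_one; have h5 := norm_winFun_zero_le f Z
      have h6 := mul_nonneg hq.nonneg (ballInd_nonneg R Z.2)
      calc _ ≤ 1 * (Q * ballInd R Z.2 * gauss (v - Z.1)) * winSup f := by gcongr
        _ = _ := by ring
  refine ae_eq_of_forall_setIntegral_eq_of_sigmaFinite (fun s hs hμ => ?_) (fun s hs hμ => ?_)
    fun s hs hμ => ?_
  · rw [hw]; exact (hint s hs hμ).integral_prod_left
  · exact integrableOn_Lp_of_measure_ne_top _ num! hμ.ne
  · rw [← L2.inner_indicatorConstLp_one (𝕜 := ℂ) hs hμ.ne, inner_locOp_eq_integral (isWin_wwin 0)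
      (isWin_wwin 0) hqm hqb, hw]
    simp only; rw [integral_integral_swap (f := fun v Z => K (v, Z)) (hint s hs hμ)]
    refine integral_ext fun Z => ?_; simp only [hK]; rw [integral_mul_const, ← mul_assoc]; congr 1
    rw [winFun_congr _ (indicatorConstLp_coeFn (p := 2) (hs := hs) (hμs := hμ.ne) (c := (1 : ℂ))),
      winFun, map_mul, conj_ofReal, expInt, ← integral_conj, ← integral_indicator hs,
      mul_left_comm, ← integral_const_mul, ← integral_const_mul]
    refine integral_ext fun v => ?_; by_cases hv : v ∈ s
    · rw [indicator_of_mem hv, indicator_of_mem hv, mul_one, map_mul, ← exp_conj,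
        conj_ofReal, map_mul, map_neg, conj_I, conj_ofReal, neg_neg,
        wwin_zero]
      push_cast; ring
    · rw [indicator_of_notMem hv, indicator_of_notMem hv]; simp

end

/-! ### Fourier series on the torus -/

section

variable {s γ : ℝ} {χ : ℝ → ℝ} {k : ℤ³}

lemma isLocSym_psi (hs : 0 < s) (hγ : 0 ≤ γ) (hχ : IsCutoff χ) :
    IsLocSym (psi s γ χ k) 4 (2 * jb (freq k) ^ (1 / (1 + 2 * s))) where
  meas := (continuous_psi hχ).measurable
  nonneg := by norm_num
  bdd y ξ := by
    by_cases h : ξ ∈ Metric.closedBall (0 : Vel) (2 * jb (freq k) ^ (1 / (1 + 2 * s)))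
    · rw [ballInd, indicator_of_mem h, mul_one]; exact abs_psi_le hs hχ y ξ
    · have h1 : 2 * jb (freq k) ^ (1 / (1 + 2 * s)) < jb ξ := by
        refine lt_of_lt_of_le ?_ (norm_le_jb ξ); simpa using h
      have h0 : 0 < jb (freq k) ^ (1 / (1 + 2 * s)) := jb_rpow_pos _ _
      have h2 : 1 ≤ jb y ^ (γ / (1 + 2 * s)) := one_le_jb_rpow pos! y
      have h3 : 2 < jb y ^ (γ / (1 + 2 * s)) * jb ξ / jb (freq k) ^ (1 / (1 + 2 * s)) := by
        rw [lt_div_iff₀ h0]; nlinarith [jb_pos ξ]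
      rw [ballInd, indicator_of_notMem h, psi, image_eq_zero_of_notMem_tsupport
        (fun h4 => h3.not_ge (hχ.supp h4).2)]
      simp

end

/-- The characters of the torus. -/
def torusChar (k : ℤ³) : C(Torus, ℂ) where
  toFun x := ∏ j : Fin 3, fourier (k j) (x j)
  continuous_toFun := by fun_prop

lemma torusChar_apply (k : ℤ³) (x : Torus) : torusChar k x = ∏ j : Fin 3, fourier (k j) (x j) := rfl

lemma torusChar_neg (k : ℤ³) (x : Torus) : torusChar (-k) x = conj (torusChar k x) := by
  simp only [torusChar_apply, Pi.neg_apply, fourier_neg, map_prod]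

lemma torusChar_add (k l : ℤ³) (x : Torus) :
    torusChar (k + l) x = torusChar k x * torusChar l x := by
  simp only [torusChar_apply, Pi.add_apply, fourier_add, prod_mul_distrib]

lemma norm_torusChar (k : ℤ³) (x : Torus) : ‖torusChar k x‖ = 1 := by
  simp only [torusChar_apply, fourier_apply, norm_prod, Circle.norm_coe, prod_const_one]

lemma torusChar_single (z : Torus) (i : Fin 3) : torusChar (Pi.single i 1) z = fourier 1 (z i) := by
  rw [torusChar_apply, prod_eq_single i (fun j _ hj => by simp [Pi.single_eq_of_ne hj])
    (by simp), Pi.single_eq_same]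

/-- The star algebra generated by the characters. -/
def torusAlg : StarSubalgebra ℂ C(Torus, ℂ) where
  toSubalgebra := Algebra.adjoin ℂ (range torusChar)
  star_mem' := by
    change Algebra.adjoin ℂ (range torusChar) ≤ star (Algebra.adjoin ℂ (range torusChar))
    refine Algebra.adjoin_le ?_; rintro _ ⟨n, rfl⟩; refine Algebra.subset_adjoin ⟨-n, ?_⟩
    ext1 x
    rw [torusChar_neg]; rfl

lemma torusAlg_coe : torusAlg.toSubalgebra.toSubmodule = span ℂ (range torusChar) := by
  apply Algebra.adjoin_eq_span_of_subset
  refine .trans (fun x => Submonoid.closure_induction (fun _ => id) ⟨0, ?_⟩ ?_) subset_span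
  · ext z; simp [torusChar_apply]
  · rintro _ _ _ _ ⟨m, rfl⟩ ⟨n, rfl⟩; exact ⟨m + n, ContinuousMap.ext fun z => torusChar_add m n z⟩

lemma torusAlg_separatesPoints : torusAlg.SeparatesPoints := by
  intro x y hxy; rw [Ne, funext_iff, not_forall] at hxy; obtain ⟨i, hi⟩ := hxy
  refine ⟨torusChar (Pi.single i 1), ⟨torusChar (Pi.single i 1),
    Algebra.subset_adjoin ⟨Pi.single i 1, rfl⟩, rfl⟩, ?_⟩
  rw [torusChar_single, torusChar_single, fourier_one, fourier_one]
  exact fun h => hi (AddCircle.injective_toCircle two_pi_pos.ne' (Circle.ext h))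

lemma span_torusChar_closure : (span ℂ (range torusChar)).topologicalClosure = ⊤ := by
  rw [← torusAlg_coe]
  exact congr_arg (Subalgebra.toSubmodule <| StarSubalgebra.toSubalgebra ·)
    (ContinuousMap.starSubalgebra_topologicalClosure_eq_top_of_separatesPoints _
      torusAlg_separatesPoints)

lemma volume_torus : (volume : Measure Torus) univ = ofR ((2 * π) ^ 3) := by
  rw [volume_pi, Measure.pi_univ]
  simp only [AddCircle.measure_univ, prod_const, card_univ, Fintype.card_fin]
  rw [ofReal_pow two_pi_pos.le]

instance isFiniteMeasure_torus : IsFiniteMeasure (volume : Measure Torus) :=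
  ⟨by rw [volume_torus]; exact ofReal_lt_top⟩

lemma integral_torusChar {k : ℤ³} (hk : k ≠ 0) : ∫ x, torusChar k x = 0 := by
  obtain ⟨i, hi⟩ := Function.ne_iff.mp hk; simp only [torusChar_apply]
  rw [integral_fintype_prod_volume_eq_prod (fun i => (fourier (k i) : AddCircle (2 * π) → ℂ))]
  refine prod_eq_zero (Finset.mem_univ i) ?_
  refine integral_eq_zero_of_add_right_eq_neg (g := ((2 * π / 2 / (k i) : ℝ) :
    AddCircle (2 * π))) fun x => ?_
  exact fourier_add_half_inv_index (by simpa using hi) two_pi_pos x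

/-- The normalization constant of the Fourier series. -/
def torusNorm : ℝ := (2 * π) ^ (-(3 / 2) : ℝ)

lemma torusNorm_pos : 0 < torusNorm := rpow_pos_of_pos two_pi_pos _

lemma torusNorm_sq : torusNorm * torusNorm * (2 * π) ^ 3 = 1 := by
  have h := two_pi_pos; rw [torusNorm, ← rpow_add h, ← rpow_natCast (2 * π) 3, ← rpow_add h]
  norm_num

/-- `L²(𝕋³)`. -/
abbrev L2x : Type := Lp ℂ 2 (volume : Measure Torus)

/-- The normalized characters. -/
def torusVec (k : ℤ³) : L2x :=
  ContinuousMap.toLp (E := ℂ) 2 volume ℂ ((torusNorm : ℂ) • torusChar k)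

lemma coeFn_torusVec (k : ℤ³) : torusVec k =ᵐ[volume] fun x => (torusNorm : ℂ) * torusChar k x :=
  ContinuousMap.coeFn_toLp volume _

lemma integral_torusVec (k l : ℤ³) : ∫ x : Torus, conj ((torusNorm : ℂ) * torusChar k x) *
      ((torusNorm : ℂ) * torusChar l x) = if k = l then 1 else 0 := by
  have h : ∀ x : Torus, conj ((torusNorm : ℂ) * torusChar k x) *
      ((torusNorm : ℂ) * torusChar l x) = ((torusNorm * torusNorm : ℝ) : ℂ) *
        torusChar (-k + l) x := fun x => by
    rw [torusChar_add, torusChar_neg, map_mul, conj_ofReal]; push_cast; ring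
  simp_rw [h]; rw [integral_const_mul]
  split_ifs with hkl
  · subst hkl
    have h1 : ∀ x, torusChar (-k + k) x = 1 := fun x => by
      rw [neg_add_cancel]; simp [torusChar_apply]
    simp_rw [h1]
    rw [integral_const, Measure.real, volume_torus, toReal_ofReal
      (by have := two_pi_pos; positivity), real_smul, mul_one,
      ← Complex.ofReal_mul, torusNorm_sq, Complex.ofReal_one]
  · rw [integral_torusChar, mul_zero]; intro h0; exact hkl (neg_add_eq_zero.1 h0)

lemma orthonormal_torusVec : Orthonormal ℂ torusVec := by
  rw [orthonormal_iff_ite]; intro k l; rw [inner_eq_integral, ← integral_torusVec k l]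
  refine integral_congr_ae ?_; filter_upwards [coeFn_torusVec k, coeFn_torusVec l] with x h1 h2
  rw [h1, h2]

lemma span_torusVec_closure : (span ℂ (range torusVec)).topologicalClosure = ⊤ := by
  have h : span ℂ (range torusVec) = (span ℂ (range torusChar)).map
      ((ContinuousMap.toLp (E := ℂ) 2 (volume : Measure Torus) ℂ : C(Torus, ℂ) →L[ℂ] L2x) :
        C(Torus, ℂ) →ₗ[ℂ] L2x) := by
    have hc : (torusNorm : ℂ) ≠ 0 := ofReal_ne_zero.2 torusNorm_pos.ne'
    refine le_antisymm (span_le.2 ?_) (map_le_iff_le_comap.2 (span_le.2 ?_))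
    · rintro _ ⟨k, rfl⟩; exact ⟨_, smul_mem _ _ (subset_span ⟨k, rfl⟩), rfl⟩
    · rintro _ ⟨k, rfl⟩
      have h1 := smul_mem (span ℂ (range torusVec)) (torusNorm : ℂ)⁻¹ (subset_span ⟨k, rfl⟩)
      rw [torusVec, map_smul, inv_smul_smul₀ hc] at h1; exact h1
  rw [h]
  exact (ContinuousMap.toLp_denseRange ℂ volume ℂ
    num!).topologicalClosure_map_submodule span_torusChar_closure

lemma enorm_sq_eq_tsum_torusVec (f : L2x) : ‖f‖ₑ ^ 2 = ∑' k, ‖inn (torusVec k) f‖ₑ ^ 2 := by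
  set b : HilbertBasis ℤ³ ℂ L2x :=
    HilbertBasis.mk orthonormal_torusVec span_torusVec_closure.ge with hb
  have h1 := lp.hasSum_norm (p := 2) num! (b.repr f); rw [LinearIsometryEquiv.norm_map] at h1
  have h2 : HasSum (fun k => ‖inn (torusVec k) f‖ ^ 2) (‖f‖ ^ 2) := by
    have e : ∀ k, b k = torusVec k := fun k => by rw [hb, HilbertBasis.coe_mk]
    simpa [b.repr_apply_apply, e] using h1
  rw [← ofReal_norm_sq, ← h2.tsum_eq, ofReal_tsum_of_nonneg (fun _ => by positivity) h2.summable]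
  simp only [ofReal_norm_sq]

/-! ### Partial Fourier series and Parseval's theorem -/

lemma exists_countable_hilbertBasis (H : Type*) [NormedAddCommGroup H] [InnerProductSpace ℂ H]
    [CompleteSpace H] [SecondCountableTopology H] :
    ∃ (w : Set H) (_ : HilbertBasis w ℂ H), w.Countable := by
  obtain ⟨w, b, hb⟩ := exists_hilbertBasis ℂ H; have ho := b.orthonormal
  refine ⟨w, b, PairwiseDisjoint.countable_of_isOpen (s := fun x : H => Metric.ball x (1 / 2))
    (fun x hx y hy hxy => ?_) (fun _ _ => Metric.isOpen_ball)
    (fun x _ => ⟨x, Metric.mem_ball_self num!⟩)⟩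
  refine Metric.ball_disjoint_ball ?_
  have h1 : inn x y = 0 := by
    have := ho.2 (i := ⟨x, hx⟩) (j := ⟨y, hy⟩) (fun h => hxy (congrArg Subtype.val h))
    simpa [hb] using this
  have h2 : ‖x‖ = 1 := by simpa [hb] using ho.1 ⟨x, hx⟩
  have h3 : ‖y‖ = 1 := by simpa [hb] using ho.1 ⟨y, hy⟩
  have h4 := norm_sub_sq (𝕜 := ℂ) x y; rw [h1, h2, h3] at h4; simp only [map_zero] at h4
  rw [dist_eq_norm]; nlinarith [norm_nonneg (x - y)]

lemma enorm_sq_hilbertBasis (b : HilbertBasis ι ℂ H) (f : H) :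
    ‖f‖ₑ ^ 2 = ∑' k, ‖inn (b k) f‖ₑ ^ 2 := by
  have h1 := lp.hasSum_norm (p := 2) num! (b.repr f); rw [LinearIsometryEquiv.norm_map] at h1
  have h2 : HasSum (fun k => ‖inn (b k) f‖ ^ 2) (‖f‖ ^ 2) := by simpa [b.repr_apply_apply] using h1
  rw [← ofReal_norm_sq, ← h2.tsum_eq, ofReal_tsum_of_nonneg (fun _ => by positivity) h2.summable]
  simp only [ofReal_norm_sq]

instance secondCountable_Lp {α : Type*} [MeasurableSpace α] [TopologicalSpace α] [BorelSpace α]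
    [SecondCountableTopology α] (μ : Measure α) [IsLocallyFiniteMeasure μ] : SecondCountableTopology (Lp ℂ 2 μ) :=
  have : Fact ((2 : ℝ≥0∞) ≠ ⊤) := ⟨by norm_num⟩
  Lp.SecondCountableTopology

/-- The function `b_k(x) g(v)`. -/
def modeFun (k : ℤ³) (g : Vel → ℂ) (z : Torus × Vel) : ℂ :=
  ((torusNorm : ℂ) * torusChar k z.1) * g z.2

lemma norm_mode_le (k : ℤ³) (z : Torus × Vel) :
    ‖(torusNorm : ℂ) * torusChar k z.1‖ ≤ torusNorm := by
  rw [norm_mul, norm_torusChar, norm_real, norm_of_nonneg torusNorm_pos.le, mul_one]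

lemma aesm_snd (hg : AEStronglyMeasurable g volume) :
    AEStronglyMeasurable (fun z : Torus × Vel => g z.2) volume := hg.comp_snd

lemma memLp_modeFun (k : ℤ³) (hg : MemLp g 2 volume) :
    MemLp (modeFun k g) 2 (volume : Measure (Torus × Vel)) :=
  memLp_mul_bdd (Continuous.aestronglyMeasurable (by fun_prop)) (norm_mode_le k)
    (hg.comp_snd (volume : Measure Torus))

lemma lintegral_enorm_modeFun (k : ℤ³) (hg : MemLp g 2 volume) :
    ∫⁻ z, ‖modeFun k g z‖ₑ ^ 2 = ∫⁻ v, ‖g v‖ₑ ^ 2 := by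
  rw [Measure.volume_eq_prod, lintegral_prod _ ((memLp_modeFun k hg).1.enorm.pow_const 2)]
  have h : ∀ x v, ‖modeFun k g (x, v)‖ₑ ^ 2 = ofR (torusNorm * torusNorm) *
      ‖g v‖ₑ ^ 2 := fun x v => by
    rw [modeFun, enorm_mul, enorm_mul, mul_pow, mul_pow, ← ofReal_norm (torusChar k x),
      norm_torusChar, ← ofReal_norm (torusNorm : ℂ), norm_real,
      norm_of_nonneg torusNorm_pos.le, ofReal_mul torusNorm_pos.le]
    simp [sq]
  simp_rw [h]
  rw [lintegral_const, lintegral_const_mul'' _ (hg.1.enorm.pow_const 2), volume_torus, mul_right_comm,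
    ← ofReal_mul (by have := torusNorm_pos; positivity), torusNorm_sq, ofReal_one,
    one_mul]

/-- The embedding `g ↦ b_k(x) g(v)`. -/
def modeOp (k : ℤ³) : L2v →ₗᵢ[ℂ] L2xv where
  toFun g := (memLp_modeFun k (Lp.memLp g)).toLp _
  map_add' f g := by
    rw [← MemLp.toLp_add]; refine MemLp.toLp_congr _ _ ?_
    have h : (fun z : Torus × Vel => (f + g : L2v) z.2) =ᵐ[volume] fun z => f z.2 + g z.2 :=
      (Measure.quasiMeasurePreserving_snd (μ := (volume : Measure Torus))).ae_eq_comp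
        (Lp.coeFn_add f g)
    filter_upwards [h] with z hz; simp only [modeFun, Pi.add_apply, hz, mul_add]
  map_smul' c f := by
    rw [RingHom.id_apply, ← MemLp.toLp_const_smul]; refine MemLp.toLp_congr _ _ ?_
    have h : (fun z : Torus × Vel => (c • f : L2v) z.2) =ᵐ[volume] fun z => c * f z.2 :=
      (Measure.quasiMeasurePreserving_snd (μ := (volume : Measure Torus))).ae_eq_comp
        (Lp.coeFn_smul c f)
    filter_upwards [h] with z hz; simp only [modeFun, Pi.smul_apply, hz, smul_eq_mul]; ring
  norm_map' g := by
    have h : ‖(memLp_modeFun k (Lp.memLp g)).toLp _‖ₑ ^ 2 = ‖g‖ₑ ^ 2 := by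
      rw [enorm_sq_toLp, lintegral_enorm_modeFun k (Lp.memLp g), enorm_sq_eq_lintegral]
    rw [← ofReal_norm_sq, ← ofReal_norm_sq, ofReal_eq_ofReal_iff pos! pos!] at h
    exact (sq_eq_sq₀ (norm_nonneg _) (norm_nonneg _)).1 h

lemma coeFn_modeOp (k : ℤ³) (g : L2v) : modeOp k g =ᵐ[volume] modeFun k g :=
  (memLp_modeFun k (Lp.memLp g)).coeFn_toLp

/-- The partial Fourier coefficient as an operator. -/
def coefX (k : ℤ³) : L2xv →L[ℂ] L2v := adjoint (modeOp k).toContinuousLinearMap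

lemma inner_coefX (k : ℤ³) (g : L2v) (u : L2xv) : inn g (coefX k u) = inn (modeOp k g) u := by
  rw [coefX, adjoint_inner_right]; rfl

lemma integrable_conj_modeFun (k : ℤ³) (g : L2v) (u : L2xv) :
    Integrable (fun z => conj (modeFun k g z) * u z) ((volume : Measure Torus).prod volV) := by
  refine (L2.integrable_inner (𝕜 := ℂ) (modeOp k g) u).congr ?_
  filter_upwards [coeFn_modeOp k g] with z hz; rw [hz, RCLike.inner_apply, mul_comm]

lemma inner_modeOp (k : ℤ³) (g : L2v) (u : L2xv) :
    inn (modeOp k g) u = ∫ z, conj (modeFun k g z) * u z := by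
  rw [inner_eq_integral]; refine integral_congr_ae ?_; filter_upwards [coeFn_modeOp k g] with z hz
  rw [hz]

lemma coefX_modeOp (k l : ℤ³) (g : L2v) : coefX k (modeOp l g) = if k = l then g else 0 := by
  refine ext_inner_left ℂ fun f => ?_; rw [inner_coefX, inner_modeOp]
  have h : ∫ z, conj (modeFun k f z) * modeOp l g z =
      ∫ z : Torus × Vel, (conj ((torusNorm : ℂ) * torusChar k z.1) *
        ((torusNorm : ℂ) * torusChar l z.1)) * (conj (f z.2) * g z.2) := by
    refine integral_congr_ae ?_; filter_upwards [coeFn_modeOp l g] with z hz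
    rw [hz, modeFun, modeFun, map_mul]; ring
  rw [h, Measure.volume_eq_prod, integral_prod_mul (fun x => conj ((torusNorm : ℂ) *
    torusChar k x) * ((torusNorm : ℂ) * torusChar l x)) fun v => conj (f v) * g v,
    integral_torusVec, ← inner_eq_integral]
  split_ifs <;> simp

lemma conj_mul_eq_fourierX (k : ℤ³) (g : Vel → ℂ) (u : Torus × Vel → ℂ) (v : Vel) :
    ∫ x, conj (modeFun k g (x, v)) * u (x, v) = conj (g v) * fourierX u k v := by
  rw [fourierX, ← integral_const_mul, ← integral_const_mul]; refine integral_ext fun x => ?_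
  have h := torusChar_neg k x; rw [torusChar_apply] at h; simp only [Pi.neg_apply] at h
  simp only [modeFun, map_mul, conj_ofReal, ← h, torusNorm]; ring

lemma coeFn_coefX (k : ℤ³) (u : L2xv) : coefX k u =ᵐ[volume] fourierX u k := by
  have key : ∀ s : Set Vel, ∀ hs : MeasurableSet s, ∀ hμ : volume s < ⊤, ∀ᵐ v : Vel,
      conj (indicatorConstLp 2 hs hμ.ne (1 : ℂ) v) * fourierX u k v =
        s.indicator (fourierX u k) v := fun s hs hμ => by
    filter_upwards [indicatorConstLp_coeFn (p := 2) (hs := hs) (hμs := hμ.ne) (c := (1 : ℂ))]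
      with v hv
    rw [hv]; by_cases h : v ∈ s <;> simp [h]
  refine ae_eq_of_forall_setIntegral_eq_of_sigmaFinite
    (fun s hs hμ => integrableOn_Lp_of_measure_ne_top _ num! hμ.ne)
    (fun s hs hμ => ?_) fun s hs hμ => ?_
  · have h := (integrable_conj_modeFun k (indicatorConstLp 2 hs hμ.ne (1 : ℂ)) u).integral_prod_right
    simp_rw [conj_mul_eq_fourierX] at h
    exact (integrable_indicator_iff hs).1 (h.congr (key s hs hμ))
  · rw [← L2.inner_indicatorConstLp_one (𝕜 := ℂ) hs hμ.ne, inner_coefX, inner_modeOp]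
    refine (integral_prod_symm _ (integrable_conj_modeFun k _ u)).trans ?_
    simp_rw [conj_mul_eq_fourierX]; rw [integral_congr_ae (key s hs hμ), integral_indicator hs]

open Classical in
/-- The slice `u(x, ·)` as an element of `L²(ℝ³)`. -/
def sliceX (u : L2xv) (x : Torus) : L2v :=
  if h : MemLp (fun v => u (x, v)) 2 volume then h.toLp _ else 0

lemma ae_memLp_slice {f : Torus × Vel → ℂ} (hf : MemLp f 2 volume) :
    ∀ᵐ x : Torus, MemLp (fun v => f (x, v)) 2 volume := by
  have h1 := lintegral_lt_top_of_memLp hf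
  have hm : AEStronglyMeasurable f ((volume : Measure Torus).prod volV) := hf.1
  rw [Measure.volume_eq_prod, lintegral_prod _ (hm.enorm.pow_const 2)] at h1
  filter_upwards [ae_lt_top' (hm.enorm.pow_const 2).lintegral_prod_right' h1.ne,
    hm.prodMk_left] with x h2 h3
  exact memLp_two_of_lintegral h3 h2

lemma ae_coeFn_sliceX (u : L2xv) : ∀ᵐ x : Torus, sliceX u x =ᵐ[volume] fun v => u (x, v) := by
  filter_upwards [ae_memLp_slice (Lp.memLp u)] with x hx; rw [sliceX, dif_pos hx]
  exact hx.coeFn_toLp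

lemma lintegral_sliceX (u : L2xv) (W : Vel → ℝ≥0∞) (hW : Measurable W) :
    ∫⁻ z, W z.2 * ‖u z‖ₑ ^ 2 = ∫⁻ x : Torus, ∫⁻ v, W v * ‖sliceX u x v‖ₑ ^ 2 := by
  have hm : AEStronglyMeasurable u ((volume : Measure Torus).prod volV) := Lp.aestronglyMeasurable u
  have hW2 : Measurable fun z : Torus × Vel => W z.2 := hW.comp measurable_snd
  refine (lintegral_prod (μ := (volume : Measure Torus)) (ν := volV)
    (fun z => W z.2 * ‖u z‖ₑ ^ 2) (hW2.aemeasurable.mul (hm.enorm.pow_const 2))).trans ?_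
  refine lintegral_congr_ae ?_; filter_upwards [ae_coeFn_sliceX u] with x hx
  refine lintegral_congr_ae ?_; filter_upwards [hx] with v hv; rw [hv]

/-- Parseval's theorem, tested against a function of the velocity. -/
lemma parseval_inner (u : L2xv) (g : L2v) :
    AEMeasurable (fun x : Torus => ‖inn g (sliceX u x)‖ₑ ^ 2) ∧
    ∫⁻ x : Torus, ‖inn g (sliceX u x)‖ₑ ^ 2 = ∑' k, ‖inn g (coefX k u)‖ₑ ^ 2 := by
  set c : Torus → ℂ := fun x => ∫ v, conj (g v) * u (x, v) with hc
  have hcs : ∀ᵐ x : Torus, inn g (sliceX u x) = c x := by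
    filter_upwards [ae_coeFn_sliceX u] with x hx; rw [inner_eq_integral, hc]
    refine integral_congr_ae ?_; filter_upwards [hx] with v hv; rw [hv]
  have hm : AEStronglyMeasurable u ((volume : Measure Torus).prod volV) := Lp.aestronglyMeasurable u
  have hg : AEStronglyMeasurable (fun z : Torus × Vel => conj (g z.2))
      ((volume : Measure Torus).prod volV) :=
    continuous_conj.comp_aestronglyMeasurable (aesm_snd (Lp.aestronglyMeasurable g))
  have hcm : AEStronglyMeasurable c volume := (hg.mul hm).integral_prod_right'
  have hc2 : MemLp c 2 volume := by
    refine memLp_two_of_lintegral hcm ?_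
    calc ∫⁻ x, ‖c x‖ₑ ^ 2 ≤ ∫⁻ x : Torus, ‖g‖ₑ ^ 2 * ∫⁻ v, 1 * ‖sliceX u x v‖ₑ ^ 2 := by
          refine lintegral_mono_ae ?_; filter_upwards [hcs] with x hx; simp only [one_mul]
          rw [← enorm_sq_eq_lintegral, ← mul_pow, ← hx]; gcongr
          rw [← ofReal_norm, ← ofReal_norm, ← ofReal_norm, ← ofReal_mul (norm_nonneg _)]
          exact ofReal_le_ofReal (norm_inner_le_norm _ _)
      _ = ‖g‖ₑ ^ 2 * ‖u‖ₑ ^ 2 := by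
          rw [lintegral_const_mul' _ _ (by simp),
            ← lintegral_sliceX u (fun _ => 1) measurable_const]
          simp only [one_mul]; rw [enorm_sq_eq_lintegral u]
      _ < ⊤ := mul_lt_top (by simp) (by simp)
  have hcs2 : (fun x : Torus => ‖inn g (sliceX u x)‖ₑ ^ 2) =ᵐ[volume] fun x => ‖c x‖ₑ ^ 2 :=
    hcs.mono fun x hx => by simp only [hx]
  refine ⟨(hcm.enorm.pow_const 2).congr hcs2.symm, ?_⟩
  rw [lintegral_congr_ae hcs2, ← enorm_sq_toLp hc2, enorm_sq_eq_tsum_torusVec]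
  refine tsum_congr fun k => ?_; congr 2; rw [inner_coefX, inner_modeOp]
  refine Eq.trans ?_ (integral_prod _ (integrable_conj_modeFun k g u)).symm; rw [inner_eq_integral]
  refine integral_congr_ae ?_; filter_upwards [coeFn_torusVec k, hc2.coeFn_toLp] with x h1 h2
  rw [h1, h2, hc, ← integral_const_mul]; refine integral_ext fun v => ?_
  simp only [modeFun, map_mul]; ring

/-- Quadratic forms that are countable sums of squared norms of bounded operators. -/
def IsForm (Q : L2v → ℝ≥0∞) : Prop := ∃ T : ℕ → L2v →L[ℂ] L2v, ∀ f, Q f = ∑' n, ‖T n f‖ₑ ^ 2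

lemma IsForm.parseval {Q : L2v → ℝ≥0∞} (hQ : IsForm Q) (u : L2xv) :
    AEMeasurable (fun x : Torus => Q (sliceX u x)) ∧
    ∫⁻ x : Torus, Q (sliceX u x) = ∑' k, Q (coefX k u) := by
  obtain ⟨T, hT⟩ := hQ; obtain ⟨w, b, hw⟩ := exists_countable_hilbertBasis L2v
  have := hw.to_subtype
  have h1 : ∀ f, Q f = ∑' p : ℕ × w, ‖inn (adjoint (T p.1) (b p.2)) f‖ₑ ^ 2 := fun f => by
    rw [hT, ENNReal.tsum_prod (f := fun n (j : w) => ‖inn (adjoint (T n) (b j)) f‖ₑ ^ 2)]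
    refine tsum_congr fun n => ?_; rw [enorm_sq_hilbertBasis b]; simp only [adjoint_inner_left]
  simp_rw [h1]; refine ⟨AEMeasurable.tsum fun p => (parseval_inner u _).1, ?_⟩
  rw [lintegral_tsum fun p => (parseval_inner u _).1, ENNReal.tsum_comm]
  exact tsum_congr fun p => (parseval_inner u _).2

lemma isForm_weight_comp {W : Vel → ℝ≥0∞} (hW : Measurable W) (hfin : ∀ v, W v ≠ ⊤)
    (S : L2v →L[ℂ] L2v) : IsForm fun f => ∫⁻ v, W v * ‖S f v‖ₑ ^ 2 := by
  set q : ℕ → Vel → ℂ := fun n v => if ⌊(W v).toReal⌋₊ = n then (sqrt (W v).toReal : ℂ) else 0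
    with hq
  have hqm : ∀ n, Measurable (q n) := fun n => by
    refine Measurable.ite ?_ (measurable_ofReal.comp hW.ennreal_toReal.sqrt) measurable_const
    exact (Nat.measurable_floor.comp hW.ennreal_toReal) (measurableSet_singleton n)
  have hqb : ∀ n v, ‖q n v‖ ≤ sqrt (n + 1) := fun n v => by
    simp only [hq]
    split_ifs with h
    · rw [norm_real, norm_of_nonneg (sqrt_nonneg _)]; refine sqrt_le_sqrt ?_; rw [← h]
      exact (Nat.lt_floor_add_one _).le
    · simp [sqrt_nonneg]
  refine ⟨fun n => mulOp volume (q n) ∘L S, fun f => ?_⟩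
  have h1 : ∀ n, ‖(mulOp volume (q n) ∘L S) f‖ₑ ^ 2 = ∫⁻ v, ‖q n v‖ₑ ^ 2 * ‖S f v‖ₑ ^ 2 :=
    fun n => by
    rw [comp_apply, enorm_sq_mulOp (hqm n) (hqb n)]
  simp_rw [h1]
  rw [← lintegral_tsum (f := fun n v => ‖q n v‖ₑ ^ 2 * ‖S f v‖ₑ ^ 2) fun n =>
    ((hqm n).enorm.pow_const 2).aemeasurable.mul ((Lp.aestronglyMeasurable _).enorm.pow_const 2)]
  refine lintegral_congr fun v => ?_; rw [ENNReal.tsum_mul_right]; congr 1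
  rw [tsum_eq_single ⌊(W v).toReal⌋₊ fun n hn => by simp [hq, hn.symm]]; simp only [hq, if_true]
  rw [← ofReal_norm_sq, norm_real, norm_of_nonneg (sqrt_nonneg _),
    sq_sqrt toReal_nonneg, ofReal_toReal (hfin v)]

lemma isForm_angular (c : ℕ → ℝ≥0∞) (hc : ∀ l, c l ≠ ⊤) :
    IsForm fun f => ∑' l, c l * ‖(sphSpace l).starProjection f‖ₑ ^ 2 := by
  refine ⟨fun l => (sqrt (c l).toReal : ℂ) • (sphSpace l).starProjection, fun f => ?_⟩
  refine tsum_congr fun l => ?_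
  rw [smul_apply, enorm_smul, mul_pow, ← ofReal_norm_sq (_ : ℂ),
    norm_real, norm_of_nonneg (sqrt_nonneg _),
    sq_sqrt toReal_nonneg, ofReal_toReal (hc l)]

lemma measurable_jb_ofReal (a : ℝ) : Measurable fun v => ofR (jb v ^ a) :=
  ENNReal.measurable_ofReal.comp (continuous_jb_rpow a).measurable

lemma parseval_weight (a : ℝ) (u : L2xv) : ∫⁻ z : Torus × Vel, ofR (jb z.2 ^ a) * ‖u z‖ₑ ^ 2 =
      ∑' k, ∫⁻ v, ofR (jb v ^ a) * ‖coefX k u v‖ₑ ^ 2 := by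
  rw [lintegral_sliceX u _ (measurable_jb_ofReal a)]
  exact ((isForm_weight_comp (measurable_jb_ofReal a) (fun _ => ofReal_ne_top)
    (ContinuousLinearMap.id ℂ L2v)).parseval u).2

lemma parseval_norm (u : L2xv) : ‖u‖ₑ ^ 2 = ∑' k, ‖coefX k u‖ₑ ^ 2 := by
  have h := parseval_weight 0 u
  simp only [rpow_zero, ofReal_one, one_mul, ← enorm_sq_eq_lintegral] at h; exact h

/-! ### The triple norm in terms of Fourier coefficients -/

lemma sobolevSq_congr (s : ℝ) (h : f =ᵐ[volume] g) : sobolevSq s f = sobolevSq s g := by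
  by_cases hf : MemLp f 2 volume
  · have hg := (memLp_congr_ae h).1 hf
    rw [sobolevSq_eq hf, sobolevSq_eq hg, MemLp.toLp_congr hf hg h]
  · have hg := fun hg => hf ((memLp_congr_ae h).2 hg)
    rw [sobolevSq, sobolevSq, dif_neg hf, dif_neg hg]

lemma sphSq_congr (s : ℝ) (h : f =ᵐ[volume] g) : sphSq s f = sphSq s g := by
  by_cases hf : MemLp f 2 volume
  · have hg := (memLp_congr_ae h).1 hf; rw [sphSq_eq hf, sphSq_eq hg, MemLp.toLp_congr hf hg h]
  · have hg := fun hg => hf ((memLp_congr_ae h).2 hg); rw [sphSq, sphSq, dif_neg hf, dif_neg hg]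

lemma ae_weight_congr (a : ℝ) (h : f =ᵐ[volume] g) :
    (fun v => jbC v a * f v) =ᵐ[volume] fun v => jbC v a * g v :=
  h.mono fun v hv => by simp only [hv]

lemma tripleSq_congr (s γ : ℝ) (h : f =ᵐ[volume] g) : tripleSq s γ f = tripleSq s γ g := by
  rw [tripleSq, tripleSq, sobolevSq_congr s (ae_weight_congr _ h),
    sphSq_congr s (ae_weight_congr _ h)]

/-- `‖⟨D_v⟩^s f‖² + ‖(-Δ_{𝕊²})^{s/2} f‖²`. -/
def tripForm (s : ℝ) (f : L2v) : ℝ≥0∞ := (∫⁻ ξ, (wS ξ : ℝ≥0∞) ^ s * ‖(𝓕 f : L2v) ξ‖ₑ ^ 2) +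
    ∑' l, (sphEig l : ℝ≥0∞) ^ s * ‖(sphSpace l).starProjection f‖ₑ ^ 2

lemma tripleSq_eq (hf : MemLp (fun v => jbC v (γ / 2) * f v) 2 volume) :
    tripleSq s γ f = tripForm s (hf.toLp _) := by
  rw [tripleSq, sobolevSq_eq hf, sphSq_eq hf, tripForm]

lemma isForm_sob (hs : 0 ≤ s) : IsForm fun f => ∫⁻ ξ, (wS ξ : ℝ≥0∞) ^ s * ‖(𝓕 f : L2v) ξ‖ₑ ^ 2 :=
  isForm_weight_comp (W := fun ξ => (wS ξ : ℝ≥0∞) ^ s)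
    (measurable_wS.coe_nnreal_ennreal.pow_const s)
    (fun ξ => (rpow_lt_top_of_nonneg hs coe_ne_top).ne)
    ((Lp.fourierTransformₗᵢ Vel ℂ).toContinuousLinearEquiv : L2v →L[ℂ] L2v)

lemma isForm_sph (hs : 0 ≤ s) :
    IsForm fun f => ∑' l, (sphEig l : ℝ≥0∞) ^ s * ‖(sphSpace l).starProjection f‖ₑ ^ 2 :=
  isForm_angular _ fun l => (rpow_lt_top_of_nonneg hs coe_ne_top).ne

lemma parseval_tripForm (hs : 0 ≤ s) (u : L2xv) :
    ∫⁻ x : Torus, tripForm s (sliceX u x) = ∑' k, tripForm s (coefX k u) := by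
  have p1 := (isForm_sob hs).parseval u; have p2 := (isForm_sph hs).parseval u; simp only [tripForm]
  rw [lintegral_add_left' p1.1, p1.2, p2.2, ENNReal.tsum_add]

lemma enorm_sq_weight (a : ℝ) (f : Vel → ℂ) (v : Vel) :
    ‖jbC v a * f v‖ₑ ^ 2 = ofR (jb v ^ (2 * a)) * ‖f v‖ₑ ^ 2 := by
  rw [enorm_mul, mul_pow, ← ofReal_norm_sq (_ : ℂ), norm_real,
    norm_of_nonneg (jb_rpow_pos a v).le, ← rpow_natCast, ← rpow_mul (jb_pos v).le]
  rw [mul_comm a]; norm_num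

lemma memLp_weight (hf : AEStronglyMeasurable f volume)
    (h : ∫⁻ v, ofR (jb v ^ (2 * a)) * ‖f v‖ₑ ^ 2 < ⊤) :
    MemLp (fun v => jbC v a * f v) 2 volume := by
  refine memLp_two_of_lintegral ((measurable_jb_rpow a).aestronglyMeasurable.mul hf) ?_
  simp_rw [enorm_sq_weight]; exact h

lemma lintegral_le_tripleSq (hs : 0 ≤ s) (γ : ℝ) (f : Vel → ℂ) :
    ∫⁻ v, ofR (jb v ^ γ) * ‖f v‖ₑ ^ 2 ≤ tripleSq s γ f := by
  rw [tripleSq]; refine le_trans ?_ le_self_add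
  by_cases hf : MemLp (fun v => jbC v (γ / 2) * f v) 2 volume
  · rw [sobolevSq_eq hf]; refine le_trans (le_of_eq ?_) (enorm_sq_le_sobQ hs _); rw [enorm_sq_toLp]
    simp_rw [enorm_sq_weight]; simp only [mul_div_cancel₀ γ (two_ne_zero (α := ℝ))]
  · rw [sobolevSq, dif_neg hf]; exact le_top

lemma memLp_of_tripleSq (hs : 0 ≤ s) (hf : AEStronglyMeasurable f volume) (h : tripleSq s γ f < ⊤) :
    MemLp (fun v => jbC v (γ / 2) * f v) 2 volume := by
  refine memLp_weight hf (lt_of_le_of_lt ?_ h); rw [mul_div_cancel₀ γ (two_ne_zero (α := ℝ))]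
  exact lintegral_le_tripleSq hs γ f

lemma fourierX_weight (a : ℝ) (u : Torus × Vel → ℂ) (k : ℤ³) (v : Vel) :
    fourierX (fun z => jbC z.2 a * u z) k v = jbC v a * fourierX u k v := by
  rw [fourierX, fourierX, mul_left_comm, ← integral_const_mul (jbC v a)]; congr 1
  refine integral_ext fun x => ?_; ring

lemma fourierX_congr {u u' : Torus × Vel → ℂ} (h : u =ᵐ[volume] u') (k : ℤ³) :
    fourierX u k =ᵐ[volume] fourierX u' k := by
  have h1 : (fun p : Vel × Torus => u p.swap) =ᵐ[(volV).prod
      (volume : Measure Torus)] fun p => u' p.swap :=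
    (Measure.measurePreserving_swap (μ := volV)
      (ν := (volume : Measure Torus))).quasiMeasurePreserving.ae_eq_comp h
  filter_upwards [Measure.ae_ae_of_ae_prod h1] with v hv; rw [fourierX, fourierX]; congr 1
  refine integral_congr_ae ?_; filter_upwards [hv] with x hx; simp only [Prod.swap_prod_mk] at hx
  rw [hx]

lemma rpow_half_sq (a : ℝ≥0∞) : (a ^ (1 / 2 : ℝ)) ^ 2 = a := by
  rw [← ENNReal.rpow_natCast, ← ENNReal.rpow_mul]; norm_num

lemma tripleNorm_sq (hs : 0 ≤ s) (γ : ℝ) (u : L2xv) :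
    tripleNorm s γ u ^ 2 = ∑' k, tripleSq s γ (coefX k u) := by
  rw [tripleNorm, rpow_half_sq]
  have hW : Measurable fun v => ofR (jb v ^ γ) := measurable_jb_ofReal γ
  have h0 := lintegral_sliceX u _ hW; have h1 := parseval_weight γ u
  have hsl : ∫⁻ x : Torus, tripleSq s γ (fun v => u (x, v)) =
      ∫⁻ x : Torus, tripleSq s γ (sliceX u x) := by
    refine lintegral_congr_ae ?_; filter_upwards [ae_coeFn_sliceX u] with x hx
    exact (tripleSq_congr s γ hx).symm
  by_cases hA : ∫⁻ z : Torus × Vel, ofR (jb z.2 ^ γ) * ‖u z‖ₑ ^ 2 = ⊤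
  · have e1 : ∫⁻ x : Torus, tripleSq s γ (sliceX u x) = ⊤ := by
      rw [← top_le_iff, ← hA, h0]; exact lintegral_mono fun x => lintegral_le_tripleSq hs γ _
    have e2 : ∑' k, tripleSq s γ (coefX k u) = ⊤ := by
      rw [← top_le_iff, ← hA, h1]; exact ENNReal.tsum_le_tsum fun k => lintegral_le_tripleSq hs γ _
    rw [hsl, e1, e2]
  · have hWz : Measurable fun z : Torus × Vel => jbC z.2 (γ / 2) :=
      (continuous_ofReal.comp ((continuous_jb_rpow _).comp continuous_snd)).measurable
    have hU : MemLp (fun z : Torus × Vel => jbC z.2 (γ / 2) * u z) 2 volume := by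
      refine memLp_two_of_lintegral (hWz.aestronglyMeasurable.mul (Lp.aestronglyMeasurable u)) ?_
      refine lt_of_eq_of_lt (lintegral_congr fun z => ?_) (lt_top_iff_ne_top.2 hA)
      rw [enorm_sq_weight (γ / 2) (fun _ => u z) z.2, mul_div_cancel₀ γ (two_ne_zero (α := ℝ))]
    set U : L2xv := hU.toLp _ with hUdef; rw [hsl]
    have e1 : ∀ᵐ x : Torus, tripleSq s γ (sliceX u x) = tripForm s (sliceX U x) := by
      have h2 : ∀ᵐ x : Torus, ∀ᵐ v : Vel, U (x, v) = jbC v (γ / 2) * u (x, v) :=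
        Measure.ae_ae_of_ae_prod hU.coeFn_toLp
      filter_upwards [h2, ae_coeFn_sliceX u, ae_coeFn_sliceX U] with x h3 h4 h5
      have h6 : (sliceX U x : Vel → ℂ) =ᵐ[volume] fun v => jbC v (γ / 2) * sliceX u x v := by
        filter_upwards [h3, h4, h5] with v a1 a2 a3; rw [a3, a1, a2]
      have h7 := (memLp_congr_ae h6).1 (Lp.memLp (sliceX U x)); rw [tripleSq_eq h7]; congr 1
      ext1
      exact h7.coeFn_toLp.trans h6.symm
    rw [lintegral_congr_ae e1, parseval_tripForm hs]; refine tsum_congr fun k => ?_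
    have h6 : (coefX k U : Vel → ℂ) =ᵐ[volume] fun v => jbC v (γ / 2) * coefX k u v := by
      filter_upwards [coeFn_coefX k U, coeFn_coefX k u, fourierX_congr hU.coeFn_toLp k]
        with v a1 a2 a3
      rw [a1, a3, a2, fourierX_weight]
    have h7 := (memLp_congr_ae h6).1 (Lp.memLp (coefX k U)); rw [tripleSq_eq h7]; congr 1
    ext1
    exact h6.trans h7.coeFn_toLp.symm

lemma weightNorm_sq (w : ℝ) (u : L2xv) : weightNorm w u ^ 2 =
      ∑' k, ∫⁻ v, ofR (jb v ^ (2 * w)) * ‖coefX k u v‖ₑ ^ 2 := by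
  rw [weightNorm, rpow_half_sq, parseval_weight]

lemma weightDxSq_eq (a r : ℝ) (u : L2xv) : weightDxSq a r u = ∑' k, ofR (jb (freq k) ^ (2 * r)) *
      ∫⁻ v, ofR (jb v ^ (2 * a)) * ‖coefX k u v‖ₑ ^ 2 := by
  rw [weightDxSq]; refine tsum_congr fun k => ?_; congr 1; refine lintegral_congr_ae ?_
  filter_upwards [coeFn_coefX k u] with v hv; rw [hv]

/-! ### Operators that are diagonal in `x` -/

lemma exists_diagonal {H G : Type*} [NormedAddCommGroup H] [InnerProductSpace ℂ H]
    [CompleteSpace H] [NormedAddCommGroup G] [InnerProductSpace ℂ G] [CompleteSpace G]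
    [DecidableEq ι] (E : ι → G →ₗᵢ[ℂ] H) (A : ι → H →L[ℂ] G)
    (hA : ∀ k g u, inn g (A k u) = inn (E k g) u)
    (hE : ∀ k l g, A k (E l g) = if k = l then g else 0)
    (hP : ∀ u, HasSum (fun k => ‖A k u‖ ^ 2) (‖u‖ ^ 2))
    (W : ι → G →L[ℂ] G) (hQ : 0 ≤ Q) (hW : ∀ k g, ‖W k g‖ ≤ Q * ‖g‖) :
    ∃ P : H →L[ℂ] H, (∀ u k, A k (P u) = W k (A k u)) ∧ ∀ u, ‖P u‖ ≤ Q * ‖u‖ := by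
  have hV : OrthogonalFamily ℂ (fun _ : ι => G) E := fun i j hij g g' => by
    rw [← hA, hE, if_neg hij, inner_zero_right]
  have hle : ∀ u k, ‖W k (A k u)‖ ^ 2 ≤ Q ^ 2 * ‖A k u‖ ^ 2 := fun u k => by
    rw [← mul_pow]; exact pow_le_pow_left₀ (norm_nonneg _) (hW k _) 2
  have hm : ∀ u, Memℓp (fun k => W k (A k u)) 2 := fun u => by
    refine memℓp_gen ?_
    have h := ((hP u).summable.mul_left (Q ^ 2)).of_nonneg_of_le (fun k => by positivity) (hle u)
    simpa using h
  let S : H →ₗ[ℂ] lp (fun _ : ι => G) 2 :=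
    { toFun := fun u => ⟨fun k => W k (A k u), hm u⟩
      map_add' := fun u u' => by ext k; simp; rfl
      map_smul' := fun c u => by ext k; simp }
  have hS : ∀ u, ‖S u‖ ≤ Q * ‖u‖ := fun u => by
    have h1 := lp.hasSum_norm (p := 2) num! (S u)
    have h2 : HasSum (fun k => ‖W k (A k u)‖ ^ 2) (‖S u‖ ^ 2) := by simpa [S] using h1
    refine (sq_le_sq₀ pos! pos!).1 ?_
    rw [mul_pow]
    exact hasSum_le (hle u) h2 ((hP u).mul_left _)
  refine ⟨hV.linearIsometry.toContinuousLinearMap ∘L S.mkContinuous Q hS, fun u k => ?_,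
    fun u => ?_⟩
  · have h1 := (hV.hasSum_linearIsometry (S u)).mapL (A k)
    simp only [hE] at h1
    refine HasSum.unique h1 ?_
    convert hasSum_single k fun j hj => ?_
    · simp [S]
    · simp [hj.symm]
  · simpa using hS u

lemma hasSum_coefX (u : L2xv) : HasSum (fun k => ‖coefX k u‖ ^ 2) (‖u‖ ^ 2) := by
  have h := parseval_norm u; simp only [← ofReal_norm_sq] at h
  have hs : Summable fun k => ‖coefX k u‖ ^ 2 :=
    (summable_toReal (f := fun k => ofR (‖coefX k u‖ ^ 2))
      (by rw [← h]; exact ofReal_ne_top)).congr fun k => (toReal_ofReal pos!)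
  rw [← ofReal_tsum_of_nonneg (fun _ => by positivity) hs,
    ofReal_eq_ofReal_iff pos! (tsum_nonneg fun _ => by positivity)] at h
  rw [h]; exact hs.hasSum

lemma exists_diagonal_wick {q : ℤ³ → Ph → ℂ} (hq : ∀ k, IsSym (q k) Q) :
    ∃ P : L2xv →L[ℂ] L2xv, ∀ u k, coefX k (P u) = wickOp (q k) (coefX k u) := by
  have hQ : 0 ≤ symK 0 0 Q := symK_nonneg 0 0 (hq 0).nonneg
  obtain ⟨P, h1, -⟩ := exists_diagonal modeOp coefX inner_coefX coefX_modeOp hasSum_coefX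
    (fun k => wickOp (q k)) hQ fun k g => (hq k).norm_locOp_le_symK g
  exact ⟨P, h1⟩

lemma ext_coefX {u u' : L2xv} (h : ∀ k, coefX k u = coefX k u') : u = u' := by
  have h1 := (hasSum_coefX (u - u')).unique (a₂ := 0) (by
    simp only [map_sub, h, sub_self, norm_zero]; simp)
  rw [sq_eq_zero_iff, norm_eq_zero, sub_eq_zero] at h1; exact h1

lemma one_le_symC (a b Q : ℝ) : 1 ≤ symC a b Q := by
  rw [symC, ← ofReal_one]; exact ofReal_le_ofReal (by nlinarith [sq_nonneg (symK a b Q)])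

section

variable {q : Ph → ℂ} {Q : ℝ}

lemma IsSym.tripleSq_wickOp_le (hq : IsSym q Q) (hs0 : 0 < s) (hs1 : s < 1) (γ : ℝ)
    (f : L2v) : tripleSq s γ (wickOp q f) ≤ 2 * symC (-(γ / 2)) (γ / 2) Q * tripleSq s γ f := by
  have hC := one_le_symC (-(γ / 2)) (γ / 2) Q; by_cases ht : tripleSq s γ f = ⊤
  · rw [ht, mul_top]
    · exact le_top
    · exact mul_ne_zero two_ne_zero (zero_lt_one.trans_le hC).ne'
  have hf := memLp_of_tripleSq hs0.le (Lp.aestronglyMeasurable f) (lt_top_iff_ne_top.2 ht)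
  have h1 := weight_wickOp (γ / 2) hq.meas hq.bdd f hf
  have h2 := (memLp_congr_ae h1.symm).1 (Lp.memLp _)
  have h3 : h2.toLp _ = locOp (wwin (-(γ / 2))) q (wwin (γ / 2)) (hf.toLp _) := by
    ext1; exact h2.coeFn_toLp.trans h1
  calc _ ≤ tripQ s (h2.toLp _) := tripleSq_le_tripQ hs0.le h2
    _ ≤ symC (-(γ / 2)) (γ / 2) Q * tripQ s (hf.toLp _) := by rw [h3]; exact hq.tripQ_le hs0 hs1 _
    _ ≤ symC (-(γ / 2)) (γ / 2) Q * (2 * tripleSq s γ f) := by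
        gcongr; exact tripQ_le_tripleSq hs0.le hs1.le hf
    _ = _ := by ring

lemma IsSym.lintegral_weight_wickOp_le (hq : IsSym q Q) (w : ℝ) (f : L2v) :
    ∫⁻ v, ofR (jb v ^ (2 * w)) * ‖wickOp q f v‖ₑ ^ 2 ≤
      symC (-w) w Q * ∫⁻ v, ofR (jb v ^ (2 * w)) * ‖f v‖ₑ ^ 2 := by
  have hC := one_le_symC (-w) w Q; by_cases ht : ∫⁻ v, ofR (jb v ^ (2 * w)) * ‖f v‖ₑ ^ 2 = ⊤
  · rw [ht, mul_top]
    · exact le_top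
    · exact (zero_lt_one.trans_le hC).ne'
  have hf := memLp_weight (Lp.aestronglyMeasurable f) (lt_top_iff_ne_top.2 ht)
  have h1 := weight_wickOp w hq.meas hq.bdd f hf
  have h3 := hq.enorm_sq_locOp_le (a := -w) (b := w) (hf.toLp _)
  rw [enorm_sq_toLp, enorm_sq_eq_lintegral] at h3; simp_rw [enorm_sq_weight] at h3
  refine le_of_eq_of_le (lintegral_congr_ae ?_) h3; filter_upwards [h1] with v hv
  rw [← hv, enorm_sq_weight]

end

section

variable {q : ℤ³ → Ph → ℂ} {Q : ℝ} {P : L2xv →L[ℂ] L2xv}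

lemma tripleNorm_sq_diagonal_le (hq : ∀ k, IsSym (q k) Q)
    (hP : ∀ u k, coefX k (P u) = wickOp (q k) (coefX k u)) (hs0 : 0 < s) (hs1 : s < 1)
    (γ : ℝ) (u : L2xv) :
    tripleNorm s γ (P u) ^ 2 ≤ 2 * symC (-(γ / 2)) (γ / 2) Q * tripleNorm s γ u ^ 2 := by
  rw [tripleNorm_sq hs0.le, tripleNorm_sq hs0.le, ← ENNReal.tsum_mul_left]
  refine ENNReal.tsum_le_tsum fun k => ?_; rw [hP]; exact (hq k).tripleSq_wickOp_le hs0 hs1 γ _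

lemma weightNorm_sq_diagonal_le (hq : ∀ k, IsSym (q k) Q)
    (hP : ∀ u k, coefX k (P u) = wickOp (q k) (coefX k u)) (w : ℝ) (u : L2xv) :
    weightNorm w (P u) ^ 2 ≤ symC (-w) w Q * weightNorm w u ^ 2 := by
  rw [weightNorm_sq, weightNorm_sq, ← ENNReal.tsum_mul_left]
  refine ENNReal.tsum_le_tsum fun k => ?_; rw [hP]; exact (hq k).lintegral_weight_wickOp_le w _

lemma enorm_sq_diagonal_le (hq : ∀ k, IsSym (q k) Q)
    (hP : ∀ u k, coefX k (P u) = wickOp (q k) (coefX k u)) (u : L2xv) :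
    ‖P u‖ₑ ^ 2 ≤ symC 0 0 Q * ‖u‖ₑ ^ 2 := by
  rw [parseval_norm, parseval_norm u, ← ENNReal.tsum_mul_left]
  refine ENNReal.tsum_le_tsum fun k => ?_; rw [hP]; exact (hq k).enorm_sq_locOp_le _

end

/-! ### Convergence of diagonal operators -/

section

open Filter Topology

lemma tendsto_enorm_sq_locOp (h₁ : IsWin m₁ A₁) {q : ℕ → Ph → ℂ} (hq : ∀ n, Measurable (q n))
    (hQ : ∀ n Y, ‖q n Y‖ ≤ Q) (hlim : ∀ Y, Tendsto (fun n => q n Y) atTop (𝓝 0)) (f : L2v) :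
    Tendsto (fun n => ‖locOp m₁ (q n) m₂ f‖ₑ ^ 2) atTop (𝓝 0) := by
  have hb : ∀ n, ‖locOp m₁ (q n) m₂ f‖ₑ ^ 2 ≤
      ofR (A₁ ^ 2) * ∫⁻ Y, ‖q n Y‖ₑ ^ 2 * ‖winOp m₂ f Y‖ₑ ^ 2 := fun n => by
    rw [← enorm_sq_mulOp (hq n) (hQ n)]; refine lintegral_le_of_norm_le h₁.nonneg ?_
    exact norm_locOp_apply_le h₁ f
  have hint : Tendsto (fun n => ∫⁻ Y, ‖q n Y‖ₑ ^ 2 * ‖winOp m₂ f Y‖ₑ ^ 2) atTop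
      (𝓝 (∫⁻ _ : Ph, (0 : ℝ≥0∞))) := by
    refine tendsto_lintegral_of_dominated_convergence'
      (fun Y => ofR (Q ^ 2) * ‖winOp m₂ f Y‖ₑ ^ 2) (fun n =>
        ((hq n).enorm.pow_const 2).aemeasurable.mul ((Lp.aestronglyMeasurable _).enorm.pow_const 2))
      (fun n => .of_forall fun Y => ?_) ?_ (.of_forall fun Y => ?_)
    · refine mul_le_mul_left ?_ _; rw [← ofReal_norm_sq]
      exact ofReal_le_ofReal (pow_le_pow_left₀ pos! (hQ n Y) 2)
    · rw [lintegral_const_mul' _ _ ofReal_ne_top]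
      exact (mul_lt_top ofReal_lt_top (lintegral_lt_top_of_memLp (Lp.memLp _))).ne
    · have h1 : Tendsto (fun n => ‖q n Y‖ₑ ^ 2) atTop (𝓝 0) := by
        have := ((ENNReal.continuous_pow 2).comp continuous_enorm).tendsto (0 : ℂ) |>.comp (hlim Y)
        simpa [Function.comp_def] using this
      have h2 := ENNReal.Tendsto.mul_const h1 (b := ‖winOp m₂ f Y‖ₑ ^ 2) (Or.inr (by simp))
      simpa using h2
  rw [lintegral_zero] at hint
  have h3 := ENNReal.Tendsto.const_mul hint (a := ofR (A₁ ^ 2)) (Or.inr ofReal_ne_top)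
  rw [mul_zero] at h3
  exact tendsto_of_tendsto_of_tendsto_of_le_of_le tendsto_const_nhds h3 (fun _ => zero_le) hb

variable {q : ℕ → Ph → ℂ} {Q : ℝ}

lemma tendsto_tripleSq_wickOp (hq : ∀ n, IsSym (q n) Q)
    (hlim : ∀ Y, Tendsto (fun n => q n Y) atTop (𝓝 0)) (hs0 : 0 < s) (hs1 : s < 1) (γ : ℝ)
    {f : L2v} (hf : tripleSq s γ f < ⊤) :
    Tendsto (fun n => tripleSq s γ (wickOp (q n) f)) atTop (𝓝 0) := by
  have hm := memLp_of_tripleSq hs0.le (Lp.aestronglyMeasurable f) hf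
  have ht : tripQ s (hm.toLp _) < ⊤ :=
    (tripQ_le_tripleSq hs0.le hs1.le hm).trans_lt (mul_lt_top (by simp) hf)
  have h1 := tendsto_tripQ (a := -(γ / 2)) (b := γ / 2) hq hs0 hs1 ht
    (tendsto_enorm_sq_locOp (isWin_wwin _) (fun n => (hq n).meas) (fun n => (hq n).bdd) hlim _)
  refine tendsto_of_tendsto_of_tendsto_of_le_of_le tendsto_const_nhds h1 (fun _ => zero_le)
    fun n => ?_
  have h2 := weight_wickOp (γ / 2) (hq n).meas (hq n).bdd f hm
  have h3 := (memLp_congr_ae h2.symm).1 (Lp.memLp _)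
  have h4 : h3.toLp _ = locOp (wwin (-(γ / 2))) (q n) (wwin (γ / 2)) (hm.toLp _) := by
    ext1; exact h3.coeFn_toLp.trans h2
  simp only; rw [← h4]; exact tripleSq_le_tripQ hs0.le h3

lemma tendsto_weight_wickOp (hq : ∀ n, IsSym (q n) Q)
    (hlim : ∀ Y, Tendsto (fun n => q n Y) atTop (𝓝 0)) (w : ℝ) {f : L2v}
    (hf : ∫⁻ v, ofR (jb v ^ (2 * w)) * ‖f v‖ₑ ^ 2 < ⊤) :
    Tendsto (fun n => ∫⁻ v, ofR (jb v ^ (2 * w)) * ‖wickOp (q n) f v‖ₑ ^ 2) atTop (𝓝 0) := by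
  have hm := memLp_weight (Lp.aestronglyMeasurable f) hf
  refine (tendsto_enorm_sq_locOp (m₂ := wwin w) (isWin_wwin (-w)) (fun n => (hq n).meas)
    (fun n => (hq n).bdd) hlim (hm.toLp _)).congr fun n => ?_
  rw [enorm_sq_eq_lintegral]; refine lintegral_congr_ae ?_
  filter_upwards [weight_wickOp w (hq n).meas (hq n).bdd f hm] with v hv; rw [← hv, enorm_sq_weight]

lemma tendsto_tsum_of_le [Countable ι] {a : ℕ → ι → ℝ≥0∞} {b : ι → ℝ≥0∞}
    (hab : ∀ n i, a n i ≤ b i) (hb : ∑' i, b i ≠ ⊤)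
    (hlim : ∀ i, Tendsto (fun n => a n i) atTop (𝓝 0)) :
    Tendsto (fun n => ∑' i, a n i) atTop (𝓝 0) := by
  let _ : MeasurableSpace ι := ⊤
  have h := tendsto_lintegral_of_dominated_convergence (μ := Measure.count) (F := a)
    (f := fun _ => 0) b (fun n => measurable_from_top) (fun n => .of_forall (hab n))
    (by rwa [lintegral_count]) (.of_forall hlim)
  simpa [lintegral_count] using h

variable {q : ℕ → ℤ³ → Ph → ℂ} {P : ℕ → L2xv →L[ℂ] L2xv}

lemma tendsto_tripleNorm_diagonal (hq : ∀ n k, IsSym (q n k) Q)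
    (hlim : ∀ k Y, Tendsto (fun n => q n k Y) atTop (𝓝 0))
    (hP : ∀ n u k, coefX k (P n u) = wickOp (q n k) (coefX k u)) (hs0 : 0 < s)
    (hs1 : s < 1) (γ : ℝ) {u : L2xv} (hu : tripleNorm s γ u < ⊤) :
    Tendsto (fun n => tripleNorm s γ (P n u) ^ 2) atTop (𝓝 0) := by
  have hu2 : tripleNorm s γ u ^ 2 < ⊤ := pow_lt_top hu; rw [tripleNorm_sq hs0.le] at hu2
  simp_rw [tripleNorm_sq hs0.le, hP]
  refine tendsto_tsum_of_le (fun n k => (hq n k).tripleSq_wickOp_le hs0 hs1 γ _) ?_ fun k => ?_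
  · rw [ENNReal.tsum_mul_left]; exact (mul_lt_top (mul_lt_top (by simp) ofReal_lt_top) hu2).ne
  · exact tendsto_tripleSq_wickOp (fun n => hq n k) (hlim k) hs0 hs1 γ
      ((ENNReal.le_tsum k).trans_lt hu2)

lemma tendsto_weightNorm_diagonal (hq : ∀ n k, IsSym (q n k) Q)
    (hlim : ∀ k Y, Tendsto (fun n => q n k Y) atTop (𝓝 0))
    (hP : ∀ n u k, coefX k (P n u) = wickOp (q n k) (coefX k u)) (w : ℝ) {u : L2xv}
    (hu : weightNorm w u < ⊤) : Tendsto (fun n => weightNorm w (P n u) ^ 2) atTop (𝓝 0) := by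
  have hu2 : weightNorm w u ^ 2 < ⊤ := pow_lt_top hu; rw [weightNorm_sq] at hu2
  simp_rw [weightNorm_sq, hP]
  refine tendsto_tsum_of_le (fun n k => (hq n k).lintegral_weight_wickOp_le w _) ?_ fun k => ?_
  · rw [ENNReal.tsum_mul_left]; exact (mul_lt_top ofReal_lt_top hu2).ne
  · exact tendsto_weight_wickOp (fun n => hq n k) (hlim k) w ((ENNReal.le_tsum k).trans_lt hu2)

lemma tendsto_norm_diagonal (hq : ∀ n k, IsSym (q n k) Q)
    (hlim : ∀ k Y, Tendsto (fun n => q n k Y) atTop (𝓝 0))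
    (hP : ∀ n u k, coefX k (P n u) = wickOp (q n k) (coefX k u)) (u : L2xv) :
    Tendsto (fun n => ‖P n u‖ₑ ^ 2) atTop (𝓝 0) := by
  have hu2 : ‖u‖ₑ ^ 2 < ⊤ := pow_lt_top (by simp); rw [parseval_norm] at hu2
  simp_rw [parseval_norm, hP]
  refine tendsto_tsum_of_le (fun n k => (hq n k).enorm_sq_locOp_le _) ?_ fun k => ?_
  · rw [ENNReal.tsum_mul_left]; exact (mul_lt_top ofReal_lt_top hu2).ne
  · exact tendsto_enorm_sq_locOp (isWin_wwin _) (fun n => (hq n k).meas)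
      (fun n => (hq n k).bdd) (hlim k) _

end

lemma IsSym.sub {r : Ph → ℂ} (hq : IsSym q Q) (hr : IsSym r Q) :
    IsSym (fun Y => q Y - r Y) (2 * Q) where
  meas := hq.meas.sub hr.meas
  bdd Y := (norm_sub_le _ _).trans (by linarith [hq.bdd Y, hr.bdd Y])
  lip y z ξ hz := by
    rw [sub_sub_sub_comm]
    exact (norm_sub_le _ _).trans (by linarith [hq.lip y z ξ hz, hr.lip y z ξ hz])
  rot j k hjk θ h0 h1 y ξ := by
    rw [sub_sub_sub_comm]
    exact (norm_sub_le _ _).trans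
      (by linarith [hq.rot j k hjk θ h0 h1 y ξ, hr.rot j k hjk θ h0 h1 y ξ])

lemma isSym_zero (hQ : 0 ≤ Q) : IsSym (fun _ => 0) Q where
  meas := measurable_const
  bdd _ := by simpa using hQ
  lip y z ξ _ := by simpa using mul_nonneg hQ (norm_nonneg z)
  rot j k _ θ h0 _ y ξ := by simpa using mul_nonneg hQ h0.le

lemma wickOp_sub {r : Ph → ℂ} (hq : IsSym q Q) (hr : IsSym r Q) (f : L2v) :
    wickOp q f - wickOp r f = wickOp (fun Y => q Y - r Y) f := by
  simp only [wickOp, locOp, ContinuousLinearMap.comp_apply, ← map_sub,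
    mulOp_sub hq.meas hr.meas hq.bdd hr.bdd]

/-! ### Regularity of the windowed Fourier transform -/

lemma winFun_transOp (m : Vel → Vel → ℝ) (z : Vel) (f : L2v) (Y : Ph) :
    winFun m (transOp z f) Y = eI z Y.2 * winFun (fun y v => m (y + 0) (v + -z)) f Y := by
  rw [winFun_congr m (coeFn_transOp z f), winFun, winFun, mul_left_comm]; congr 1
  simp only [expInt]; rw [← integral_add_right_eq_self (μ := volV) _ (-z), ← integral_const_mul]
  refine integral_ext fun v => ?_; simp only [neg_add_cancel_right, add_zero]
  have e : eN (v + -z) Y.2 = eI z Y.2 * eN v Y.2 := by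
    rw [← Complex.exp_add, inner_add_left, inner_neg_left]; congr 1; push_cast; ring
  rw [e]; ring

/-- The constant in the bound for the windowed Fourier transform with one derivative. -/
def winLip (c : ℝ) : ℝ := lipNorm c + domNorm c

lemma lintegral_phase_winOp_le (c : ℝ) {f : L2v} (hf : ‖f‖ ≤ R) {z : Vel} (hz : ‖z‖ ≤ 1)
    (hfz : ‖transOp z f - f‖ ≤ R * ‖z‖) :
    ∫⁻ Y : Ph, ‖eI z Y.2 - 1‖ₑ ^ 2 *
      ‖winOp (wwin c) f Y‖ₑ ^ 2 ≤ ofR ((winLip c * R * ‖z‖) ^ 2) := by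
  have hd := isWin_wwin_sub c 0 (-z) (by simp) (by rwa [norm_neg]); have hL := lipNorm_nonneg c
  have hD := domNorm_nonneg c; have hR : 0 ≤ R := (norm_nonneg _).trans hf
  have hem : Measurable fun Y : Ph => eI z Y.2 := Continuous.measurable (by fun_prop)
  have heb : ∀ Y : Ph, ‖eI z Y.2‖ ≤ 1 := fun Y => by rw [mul_comm, norm_exp_ofReal_mul_I]
  set g : L2p := winOp (wwin c) (transOp z f - f) - mulOp volume (fun Y : Ph => eI z Y.2)
    (winOp (fun y v => wwin c (y + 0) (v + -z) - wwin c y v) f) with hg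
  have hnorm : ‖g‖ ≤ winLip c * R * ‖z‖ := by
    have h1 := norm_winOp_apply_le (isWin_wwin c) (transOp z f - f)
    have h2 := norm_mulOp_apply_le hem heb
      (winOp (fun y v => wwin c (y + 0) (v + -z) - wwin c y v) f)
    have h3 := norm_winOp_apply_le hd f; rw [norm_zero, zero_add, norm_neg] at h3
    calc ‖g‖ ≤ domNorm c * (R * ‖z‖) + 1 * (‖z‖ * lipNorm c * R) := by
          refine (norm_sub_le _ _).trans (add_le_add (h1.trans ?_) (h2.trans ?_))
          · gcongr
          · gcongr; exact h3.trans (by gcongr)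
      _ = _ := by rw [winLip]; ring
  have hle : ‖g‖ₑ ^ 2 ≤ ofR ((winLip c * R * ‖z‖) ^ 2) := by
    rw [← ofReal_norm_sq]; exact ofReal_le_ofReal (by gcongr)
  refine le_trans (le_of_eq ?_) hle; rw [enorm_sq_eq_lintegral]; refine lintegral_congr_ae ?_
  filter_upwards [Lp.coeFn_sub (winOp (wwin c) (transOp z f - f)) (mulOp volume
      (fun Y : Ph => eI z Y.2)
      (winOp (fun y v => wwin c (y + 0) (v + -z) - wwin c y v) f)),
    coeFn_mulOp hem heb (winOp (fun y v => wwin c (y + 0) (v + -z) - wwin c y v) f),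
    coeFn_winOp hd f, coeFn_winOp (isWin_wwin c) (transOp z f), coeFn_winOp (isWin_wwin c) f,
    Lp.coeFn_sub (winOp (wwin c) (transOp z f)) (winOp (wwin c) f)] with Y h1 h2 h3 h4 h5 h6
  rw [hg, h1, Pi.sub_apply, h2, h3, map_sub, h6, Pi.sub_apply, h4, h5, winFun_transOp,
    winFun_sub_win (isWin_wwin_shift c 0 (-z)) (isWin_wwin c) (Lp.memLp f), ← mul_pow, ← enorm_mul]
  congr 2; ring

/-- The weight `⟨ξ⟩²` on phase space. -/
def wP (Y : Ph) : ℝ≥0 := ⟨jb Y.2 ^ 2, by positivity⟩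

lemma measurable_wP : Measurable wP :=
  Measurable.subtype_mk ((continuous_jb.comp continuous_snd).pow 2).measurable

lemma coe_wP (Y : Ph) : (wP Y : ℝ≥0∞) = ofR (jb Y.2 ^ 2) := by rw [← ofReal_coe_nnreal]; rfl

lemma lintegral_wP_winOp_le (c : ℝ) (f : L2v) : ∫⁻ Y, wP Y * ‖winOp (wwin c) f Y‖ₑ ^ 2 ≤
      ofR (domNorm c ^ 2 + 3 * winLip c ^ 2 + 1) * ∫⁻ ξ, wS ξ * ‖(𝓕 f : L2v) ξ‖ₑ ^ 2 := by
  set S := ∫⁻ ξ, wS ξ * ‖(𝓕 f : L2v) ξ‖ₑ ^ 2 with hS; by_cases hSt : S = ⊤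
  · rw [hSt, mul_top (ofReal_pos.2 pos!).ne']; exact le_top
  have hfS : ‖f‖ₑ ^ 2 ≤ S := by
    have := enorm_sq_le_sobQ zero_le_one f; simpa only [sobQ, rpow_one] using this
  set R := sqrt S.toReal with hRdef
  have hR : ‖f‖ ≤ R := by
    have := norm_le_sqrt_toReal (x := f) hSt zero_le_one (by simpa using hfS); rwa [mul_one] at this
  have hR2 : R ^ 2 = S.toReal := sq_sqrt toReal_nonneg
  have hm : AEMeasurable (fun Y : Ph => ‖winOp (wwin c) f Y‖ₑ ^ 2) volume :=
    (Lp.aestronglyMeasurable _).enorm.pow_const 2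
  simp_rw [coe_wP]
  rw [lintegral_jb_sq_mul hm (η := fun Y : Ph => Y.2) measurable_snd, ← enorm_sq_eq_lintegral]
  have hj : ∀ j : Fin 3, ∫⁻ Y : Ph, ofR (Y.2 j ^ 2) *
      ‖winOp (wwin c) f Y‖ₑ ^ 2 ≤ ofR ((winLip c * R) ^ 2) := fun j => by
    have hθ : Measurable fun Y : Ph => Y.2 j := by fun_prop
    refine lintegral_sq_mul_le_of_phase hm hθ fun r hr0 hr1 => ?_
    have hz : ‖(single j r : Vel)‖ = r := by rw [PiLp.norm_single, norm_of_nonneg hr0.le]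
    have h1 := lintegral_phase_winOp_le c hR (z := single j r) (by rwa [hz])
      (norm_le_sqrt_toReal hSt pos! (enorm_sq_transOp_sub_le _ f))
    rw [hz] at h1; rw [← ofReal_mul pos!, ← mul_pow, mul_comm r]
    refine le_of_eq_of_le (lintegral_congr fun Y => ?_) h1; congr 6; rw [inner_single_left]; simp
  calc _ ≤ ofR ((domNorm c * R) ^ 2) + ∑ _j : Fin 3, ofR ((winLip c * R) ^ 2) := by
        refine add_le_add ?_ (sum_le_sum fun j _ => hj j); rw [← ofReal_norm_sq]
        refine ofReal_le_ofReal (pow_le_pow_left₀ pos! ?_ 2)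
        exact (norm_winOp_apply_le (isWin_wwin c) f).trans
          (mul_le_mul_of_nonneg_left hR (domNorm_nonneg c))
    _ = ofR ((domNorm c * R) ^ 2 + 3 * (winLip c * R) ^ 2) := by
        rw [sum_const, card_univ, Fintype.card_fin, ofReal_add pos! pos!, ofReal_mul num!]; simp
    _ ≤ _ := by
        conv_rhs => rw [← ofReal_toReal hSt, ← ofReal_mul pos!]
        refine ofReal_le_ofReal ?_; rw [mul_pow, mul_pow, hR2]; have := toReal_nonneg (a := S)
        nlinarith

lemma lintegral_wP_rpow_winOp_le (c : ℝ) (hs0 : 0 < s) (hs1 : s < 1) (f : L2v) :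
    ∫⁻ Y, (wP Y : ℝ≥0∞) ^ s * ‖winOp (wwin c) f Y‖ₑ ^ 2 ≤
      ofR (domNorm c ^ 2 + 3 * winLip c ^ 2 + 1) * sobQ s f :=
  lintegral_rpow_le hs0 hs1 diag_fourier measurable_wP measurable_wS
    (S := fun f => (winOp (wwin c) f : Ph → ℂ))
    ⟨fun f => Lp.aestronglyMeasurable _,
    fun f g => by simp only [map_add]; exact Lp.coeFn_add _ _,
    fun f => by
      rw [← enorm_sq_eq_lintegral, ← ofReal_norm_sq, ← ofReal_norm_sq, ← ofReal_mul pos!]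
      refine ofReal_le_ofReal ?_
      have h := pow_le_pow_left₀ pos! (norm_winOp_apply_le (isWin_wwin c) f) 2; rw [mul_pow] at h
      nlinarith [sq_nonneg (winLip c), sq_nonneg ‖f‖, mul_nonneg (sq_nonneg (winLip c))
        (sq_nonneg ‖f‖)],
    lintegral_wP_winOp_le c⟩ f

lemma lintegral_weight_jb_winFun_le (hs0 : 0 < s) (hs1 : s < 1) (f : L2v) :
    ∫⁻ Y : Ph, ofR (jb Y.1 ^ γ * jb Y.2 ^ (2 * s)) * ‖winFun (wwin 0) f Y‖ₑ ^ 2 ≤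
      ofR (domNorm (γ / 2) ^ 2 + 3 * winLip (γ / 2) ^ 2 + 1) * tripleSq s γ f := by
  by_cases ht : tripleSq s γ f = ⊤
  · rw [ht, mul_top (ofReal_pos.2 pos!).ne']; exact le_top
  have hm := memLp_of_tripleSq hs0.le (Lp.aestronglyMeasurable f) (lt_top_iff_ne_top.2 ht)
  have h1 := lintegral_wP_rpow_winOp_le (γ / 2) hs0 hs1 (hm.toLp _)
  have h2 : sobQ s (hm.toLp _) ≤ tripleSq s γ f := by
    rw [tripleSq, sobolevSq_eq hm]; exact le_self_add
  refine le_trans (le_of_eq (lintegral_congr_ae ?_)) (h1.trans (mul_le_mul_right h2 _))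
  filter_upwards [coeFn_winOp (isWin_wwin (γ / 2)) (hm.toLp _)] with Y hY
  rw [hY, winFun_congr _ hm.coeFn_toLp, winFun_wwin_mul, sub_self,
    enorm_sq_weight (γ / 2) (fun _ => winFun (wwin 0) f Y) Y.1, ← mul_assoc, coe_wP,
    ofReal_rpow_of_pos (by have := jb_pos Y.2; positivity),
    ← ofReal_mul (by have := jb_pos Y.2; positivity), ← rpow_natCast,
    ← rpow_mul (jb_pos _).le, mul_div_cancel₀ γ (two_ne_zero (α := ℝ)), mul_comm (jb Y.1 ^ γ)]
  norm_num

/-! ### Gaussian averages of powers of the bracket -/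

lemma lintegral_exp_neg_mul_sq (b : ℝ) (hb : 0 < b) :
    ∫⁻ r : ℝ, ofR (exp (-b * r ^ 2)) = ofR (sqrt (π / b)) := by
  rw [← ofReal_integral_eq_lintegral_ofReal (integrable_exp_neg_mul_sq hb)
    (.of_forall fun _ => (exp_pos _).le), integral_gaussian]

lemma lintegral_exp_neg_mul_jb (v : Vel) : ∫⁻ r : ℝ, ofR (exp (-(jb v ^ 2) * r ^ 2)) =
      ofR (sqrt π) * ofR (jb v)⁻¹ := by
  have := jb_pos v
  rw [lintegral_exp_neg_mul_sq _ pos!, ← ofReal_mul (sqrt_nonneg _),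
    sqrt_div pi_pos.le, sqrt_sq this.le, div_eq_mul_inv]

lemma lintegral_gauss_sq_mul_exp (t : ℝ) (ht : 0 ≤ t) (v : Vel) :
    ∫⁻ y, ofR (exp (-t * ‖y‖ ^ 2)) * ofR (gauss (v - y) ^ 2) =
      ofR ((1 + t) ^ (-(3 / 2) : ℝ) * exp (-(t / (1 + t)) * ‖v‖ ^ 2)) := by
  have h1 : 0 < 1 + t := by linarith
  have hpt : ∀ y, ofR (exp (-t * ‖y‖ ^ 2)) * ofR (gauss (v - y) ^ 2) =
      ofR (π ^ (-(3 / 2) : ℝ) * exp (-(t / (1 + t)) * ‖v‖ ^ 2)) *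
        ofR (exp (-(1 + t) * ‖y - (1 + t)⁻¹ • v‖ ^ 2)) := fun y => by
    rw [← ofReal_mul (exp_pos _).le, ← ofReal_mul
      (by have := pi_pos; positivity), gauss, mul_pow, ← rpow_natCast (π ^ _),
      ← rpow_mul pi_pos.le, ← exp_nat_mul, mul_left_comm, mul_assoc,
      ← exp_add, ← exp_add, norm_sub_sq_real, norm_sub_sq_real, inner_smul_right,
      norm_smul, norm_of_nonneg (inv_nonneg.2 h1.le), real_inner_comm v y]
    congr 3
    · norm_num
    · push_cast; field_simp; ring
  simp_rw [hpt]; have hi := (integrable_gaussian (1 + t) h1).comp_sub_right ((1 + t)⁻¹ • v)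
  rw [lintegral_const_mul' _ _ ofReal_ne_top, ← ofReal_integral_eq_lintegral_ofReal hi
    (.of_forall fun _ => (exp_pos _).le), integral_sub_right_eq_self
    (μ := volV) (fun y => exp (-(1 + t) * ‖y‖ ^ 2)),
    GaussianFourier.integral_rexp_neg_mul_sq_norm h1, ← ofReal_mul
      (by have := pi_pos; positivity), finrank_euclideanSpace_fin]
  congr 1; rw [div_rpow pi_pos.le h1.le, rpow_neg pi_pos.le, rpow_neg h1.le]
  have := rpow_pos_of_pos pi_pos (3 / 2); push_cast; field_simp

lemma hasDerivAt_div_sqrt (r : ℝ) : HasDerivAt (fun r : ℝ => r / sqrt (1 + r ^ 2))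
    ((1 + r ^ 2) ^ (-(3 / 2) : ℝ)) r := by
  have h0 : 0 < 1 + r ^ 2 := by positivity
  have hs : HasDerivAt (fun r : ℝ => sqrt (1 + r ^ 2)) (2 * r / (2 * sqrt (1 + r ^ 2))) r := by
    have := ((hasDerivAt_pow 2 r).const_add 1).sqrt h0.ne'; simpa using this
  have h1 := (hasDerivAt_id r).fun_div hs (sqrt_pos.2 h0).ne'; refine h1.congr_deriv ?_
  have h2 := sq_sqrt h0.le; have h3 := sqrt_pos.2 h0
  have h4 : (1 + r ^ 2) ^ (-(3 / 2) : ℝ) = (sqrt (1 + r ^ 2) ^ 3)⁻¹ := by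
    rw [rpow_neg h0.le, sqrt_eq_rpow,
      ← rpow_natCast ((1 + r ^ 2) ^ (1 / 2 : ℝ)) 3, ← rpow_mul h0.le]
    norm_num
  rw [h4]; simp only [id_eq]; field_simp; nlinarith

lemma lintegral_gauss_sq_mul_inv_jb_le (v : Vel) : ∫⁻ y, ofR (jb y)⁻¹ * ofR (gauss (v - y) ^ 2) ≤
      ofR (jb v)⁻¹ := by
  have hpi : ofR (sqrt π) ≠ 0 := (ofReal_pos.2 (sqrt_pos.2 pi_pos)).ne'
  rw [← ENNReal.mul_le_mul_iff_right hpi ofReal_ne_top, ← lintegral_exp_neg_mul_jb,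
    ← lintegral_const_mul' _ _ ofReal_ne_top]
  simp_rw [← mul_assoc, ← lintegral_exp_neg_mul_jb]
  have hm : Measurable fun p : Vel × ℝ => ofR (exp (-(jb p.1 ^ 2) * p.2 ^ 2)) *
      ofR (gauss (v - p.1) ^ 2) := by
    have := continuous_jb; have := continuous_gauss
    refine Measurable.fun_mul ?_ ?_ <;>
      exact ENNReal.measurable_ofReal.comp (Continuous.measurable (by fun_prop))
  have h1 : ∀ y, (∫⁻ r : ℝ, ofR (exp (-(jb y ^ 2) * r ^ 2))) * ofR (gauss (v - y) ^ 2) = ∫⁻ r : ℝ,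
        ofR (exp (-(jb y ^ 2) * r ^ 2)) * ofR (gauss (v - y) ^ 2) :=
    fun y => (lintegral_mul_const' _ _ ofReal_ne_top).symm
  simp_rw [h1]; rw [lintegral_lintegral_swap hm.aemeasurable]
  set ρ : ℝ → ℝ := fun r => r / sqrt (1 + r ^ 2) with hρ
  have hinj : Function.Injective ρ := by
    refine (strictMono_of_deriv_pos fun r => ?_).injective; rw [(hasDerivAt_div_sqrt r).deriv]
    positivity
  have hcv := lintegral_image_eq_lintegral_abs_deriv_mul MeasurableSet.univ
    (fun r _ => (hasDerivAt_div_sqrt r).hasDerivWithinAt) hinj.injOn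
    (fun r => ofR (exp (-(jb v ^ 2) * r ^ 2)))
  refine le_trans ?_ ((le_of_eq hcv.symm).trans (setLIntegral_le_lintegral _ _))
  rw [setLIntegral_univ]; refine lintegral_mono fun r => ?_
  have h0 : 0 < 1 + r ^ 2 := by positivity
  have hρ2 : ρ r ^ 2 = r ^ 2 / (1 + r ^ 2) := by simp only [hρ]; rw [div_pow, sq_sqrt h0.le]
  have h2 : ∀ y, ofR (exp (-(jb y ^ 2) * r ^ 2)) * ofR (gauss (v - y) ^ 2) = ofR (exp (-r ^ 2)) *
        (ofR (exp (-(r ^ 2) * ‖y‖ ^ 2)) * ofR (gauss (v - y) ^ 2)) :=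
    fun y => by
    rw [← mul_assoc, ← ofReal_mul (exp_pos (-r ^ 2)).le, ← exp_add, jb_sq]; congr 3; ring
  simp_rw [h2]
  rw [lintegral_const_mul' _ _ ofReal_ne_top, lintegral_gauss_sq_mul_exp _ (sq_nonneg r),
    ← ofReal_mul (exp_pos _).le, abs_of_pos pos!,
    ← ofReal_mul pos!]
  refine ofReal_le_ofReal ?_; change _ ≤ _ * exp (-(jb v ^ 2) * ρ r ^ 2)
  rw [hρ2, mul_left_comm, ← exp_add]; refine mul_le_mul_of_nonneg_left (exp_le_exp.2 ?_) pos!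
  rw [jb_sq]
  have h3 : r ^ 2 / (1 + r ^ 2) ≤ r ^ 2 := div_le_self (sq_nonneg r) (by nlinarith [sq_nonneg r])
  nlinarith

lemma jb_rpow_tangent (ha : 0 ≤ a) (v y : Vel) :
    (1 + a) * jb v ^ a ≤ jb y ^ a + a * jb v ^ (a + 1) * (jb y)⁻¹ := by
  have hv := jb_pos v; have hy := jb_pos y
  have h1 := add_one_le_exp (a * (log (jb y) - log (jb v)))
  have h2 : log (jb v) - log (jb y) ≤ jb v / jb y - 1 := by
    rw [← log_div hv.ne' hy.ne']; exact log_le_sub_one_of_pos pos!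
  have h3 : jb y ^ a = jb v ^ a * exp (a * (log (jb y) - log (jb v))) := by
    rw [rpow_def_of_pos hv, rpow_def_of_pos hy, ← exp_add]; ring_nf
  have h4 : jb v ^ (a + 1) = jb v ^ a * jb v := by rw [rpow_add hv, Real.rpow_one]
  have h5 := jb_rpow_pos a v; rw [h3, h4]
  have h6 : a * (jb v ^ a * jb v) * (jb y)⁻¹ = jb v ^ a * (a * (jb v / jb y)) := by field_simp
  rw [h6, ← mul_add, mul_comm]; refine mul_le_mul_of_nonneg_left ?_ h5.le; nlinarith

lemma lintegral_gauss_sq (v : Vel) : ∫⁻ y, ofR (gauss (v - y) ^ 2) = 1 := by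
  have h := lintegral_gauss_sq_mul_exp 0 le_rfl v; simpa using h

lemma jb_rpow_le_lintegral (ha : 0 ≤ a) (v : Vel) : ofR (jb v ^ a) ≤
      ∫⁻ y, ofR (jb y ^ a) * ofR (gauss (v - y) ^ 2) := by
  have hgm : Measurable fun y => ofR (gauss (v - y) ^ 2) := by
    have := continuous_gauss
    exact ENNReal.measurable_ofReal.comp (Continuous.measurable (by fun_prop))
  have hpos := jb_pos v; have hposa := jb_rpow_pos a v
  set A := ∫⁻ y, ofR (jb y ^ a) * ofR (gauss (v - y) ^ 2) with hA
  have h1 : ofR ((1 + a) * jb v ^ a) ≤ A + ofR (a * jb v ^ (a + 1)) * ofR (jb v)⁻¹ := by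
    calc _ = ofR ((1 + a) * jb v ^ a) *
          ∫⁻ y, ofR (gauss (v - y) ^ 2) := by rw [lintegral_gauss_sq, mul_one]
      _ = ∫⁻ y, ofR ((1 + a) * jb v ^ a) * ofR (gauss (v - y) ^ 2) :=
          (lintegral_const_mul' _ _ ofReal_ne_top).symm
      _ ≤ ∫⁻ y, (ofR (jb y ^ a) * ofR (gauss (v - y) ^ 2) + ofR (a * jb v ^ (a + 1)) *
            (ofR (jb y)⁻¹ * ofR (gauss (v - y) ^ 2))) := by
          refine lintegral_mono fun y => ?_; have := jb_pos y; rw [← mul_assoc, ← add_mul]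
          refine mul_le_mul_left ?_ _
          rw [← ofReal_mul (p := a * jb v ^ (a + 1)) pos!, ← ofReal_add pos! pos!]
          exact ofReal_le_ofReal (jb_rpow_tangent ha v y)
      _ ≤ _ := by
          rw [lintegral_add_left (f := fun y => ofR (jb y ^ a) *
            ofR (gauss (v - y) ^ 2)) ((measurable_jb_ofReal a).mul hgm),
            lintegral_const_mul' _ _ ofReal_ne_top]
          gcongr; exact lintegral_gauss_sq_mul_inv_jb_le v
  have h2 : a * jb v ^ (a + 1) * (jb v)⁻¹ = a * jb v ^ a := by
    rw [rpow_add hpos, Real.rpow_one]; field_simp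
  rw [← ofReal_mul pos!, h2, add_mul, one_mul, ofReal_add hposa.le pos!] at h1
  exact (ENNReal.add_le_add_iff_right ofReal_ne_top).1 h1

lemma lintegral_weight_le_winFun (ha : 0 ≤ a) (f : L2v) : ∫⁻ v, ofR (jb v ^ a) * ‖f v‖ₑ ^ 2 ≤
      ∫⁻ Y : Ph, ofR (jb Y.1 ^ a) * ‖winFun (wwin 0) f Y‖ₑ ^ 2 := by
  rw [lintegral_weight_winFun (isWin_wwin 0) f (measurable_jb_ofReal a)]
  refine lintegral_mono fun v => mul_le_mul_left ?_ _
  refine (jb_rpow_le_lintegral ha v).trans (le_of_eq (lintegral_congr fun y => ?_))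
  rw [wwin_zero, ← ofReal_norm_sq, norm_eq_abs, sq_abs]

/-! ### Weak derivatives in time -/

/-- Test functions of time on `(0, T)`. -/
structure IsTimeTest (T : ℝ) (ρ : ℝ → ℝ) : Prop where
  smooth : ContDiff ℝ ∞ ρ
  compact : HasCompactSupport ρ
  support : tsupport ρ ⊆ Ioo 0 T

namespace IsTimeTest

variable {T : ℝ} {ρ : ℝ → ℝ}

lemma eq_zero (hρ : IsTimeTest T ρ) (ht : t ∉ Ioo 0 T) : ρ t = 0 :=
  image_eq_zero_of_notMem_tsupport fun h => ht (hρ.support h)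

lemma continuous_deriv (hρ : IsTimeTest T ρ) : Continuous (deriv ρ) :=
  hρ.smooth.continuous_deriv num!

lemma hasDerivAt (hρ : IsTimeTest T ρ) (t : ℝ) : HasDerivAt ρ (deriv ρ t) t :=
  (hρ.smooth.differentiable num! t).hasDerivAt

lemma exists_bound (hρ : IsTimeTest T ρ) : ∃ M, (∀ t, ‖ρ t‖ ≤ M) ∧ ∀ t, ‖deriv ρ t‖ ≤ M := by
  obtain ⟨A, hA⟩ := hρ.smooth.continuous.bounded_above_of_compact_support hρ.compact
  obtain ⟨B, hB⟩ := hρ.continuous_deriv.bounded_above_of_compact_support hρ.compact.deriv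
  exact ⟨max A B, fun t => (hA t).trans (le_max_left _ _), fun t => (hB t).trans (le_max_right _ _)⟩

end IsTimeTest

/-- `r` is the weak derivative of `c` on `(0, T)`. -/
structure HasWeakDeriv (T : ℝ) (c r : ℝ → ℂ) : Prop where
  left : IntegrableOn c (Ioo 0 T)
  right : IntegrableOn r (Ioo 0 T)
  eq : ∀ ρ, IsTimeTest T ρ → ∫ t in Ioo 0 T, deriv ρ t • c t = -∫ t in Ioo 0 T, ρ t • r t

lemma absolutelyContinuous_primitive (hr : Integrable r) (T : ℝ) :
    AbsolutelyContinuousOnInterval (fun t => ∫ x in (0 : ℝ)..t, r x) 0 T := by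
  have h1 := hr.re.intervalIntegrable (a := 0) (b := T)
    |>.absolutelyContinuousOnInterval_intervalIntegral (c := 0) left_mem_uIcc
  have h2 := hr.im.intervalIntegrable (a := 0) (b := T)
    |>.absolutelyContinuousOnInterval_intervalIntegral (c := 0) left_mem_uIcc
  have hc : ∀ z : ℂ, AbsolutelyContinuousOnInterval (fun _ : ℝ => z) 0 T := fun z =>
    (LipschitzWith.const z).lipschitzOnWith.absolutelyContinuousOnInterval (K := 0)
  have key := (h1.smul (hc 1)).add (h2.smul (hc I))
  refine (congr_arg (AbsolutelyContinuousOnInterval · 0 T) (funext fun t => ?_)).mpr key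
  have hi := hr.intervalIntegrable (a := 0) (b := t); have e1 := reCLM.intervalIntegral_comp_comm hi
  have e2 := imCLM.intervalIntegral_comp_comm hi; simp only [reCLM_apply, imCLM_apply] at e1 e2
  simp only [Pi.add_apply, Pi.smul_apply', RCLike.re_eq_complex_re, RCLike.im_eq_complex_im, e1, e2]
  apply Complex.ext <;> simp

lemma integral_deriv_mul_primitive (hT : 0 ≤ T) {e : ℝ → ℂ} (hr : Integrable r)
    (he : Integrable e) (C D : ℂ) (hρ : IsTimeTest T ρ) :
    ∫ t in Ioo 0 T, deriv ρ t • ((C + ∫ x in (0 : ℝ)..t, r x) * (D + ∫ x in (0 : ℝ)..t, e x)) =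
      -∫ t in Ioo 0 T, ρ t • (r t * (D + ∫ x in (0 : ℝ)..t, e x) +
        (C + ∫ x in (0 : ℝ)..t, r x) * e t) := by
  set f : ℝ → ℂ := fun t => C + ∫ x in (0 : ℝ)..t, r x with hf
  set g : ℝ → ℂ := fun t => D + ∫ x in (0 : ℝ)..t, e x with hg
  have hc : ∀ z : ℂ, AbsolutelyContinuousOnInterval (fun _ : ℝ => z) 0 T := fun z =>
    (LipschitzWith.const z).lipschitzOnWith.absolutelyContinuousOnInterval (K := 0)
  have af : AbsolutelyContinuousOnInterval f 0 T := (hc C).add (absolutelyContinuous_primitive hr T)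
  have ag : AbsolutelyContinuousOnInterval g 0 T := (hc D).add (absolutelyContinuous_primitive he T)
  have cf : Continuous f := continuous_const.add
    (intervalIntegral.continuous_primitive (fun a b => hr.intervalIntegrable) 0)
  have cg : Continuous g := continuous_const.add
    (intervalIntegral.continuous_primitive (fun a b => he.intervalIntegrable) 0)
  have aρ : AbsolutelyContinuousOnInterval ρ 0 T :=
    (hρ.smooth.of_le num!).contDiffOn.absolutelyContinuousOnInterval
  obtain ⟨M, hM1, hM2⟩ := hρ.exists_bound
  have b1 : IntegrableOn (fun t => deriv ρ t • (f t * g t)) (Ioo 0 T) :=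
    ((hρ.continuous_deriv.smul (cf.mul cg)).integrableOn_Icc).mono_set Ioo_subset_Icc_self
  have b2 : IntegrableOn (fun t => ρ t • (r t * g t + f t * e t)) (Ioo 0 T) := by
    have i1 : IntegrableOn (fun t => r t * (ρ t • g t)) (Icc 0 T) :=
      hr.integrableOn.mul_continuousOn (hρ.smooth.continuous.smul cg).continuousOn isCompact_Icc
    have i2 : IntegrableOn (fun t => e t * (ρ t • f t)) (Icc 0 T) :=
      he.integrableOn.mul_continuousOn (hρ.smooth.continuous.smul cf).continuousOn isCompact_Icc
    refine ((i1.add i2).mono_set Ioo_subset_Icc_self).congr (.of_forall fun t => ?_)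
    simp only [Pi.add_apply, real_smul]; ring
  set w : ℝ → ℂ := (Ioo 0 T).indicator fun t => deriv ρ t • (f t * g t) +
    ρ t • (r t * g t + f t * e t) with hw
  have hwi : Integrable w := (integrable_indicator_iff measurableSet_Ioo).2 (b1.add b2)
  have aG := (aρ.smul (af.smul ag)).sub (absolutelyContinuous_primitive hwi T)
  have hz : ∀ᵐ x : ℝ, x ∈ uIcc 0 T → HasDerivAt (ρ • f • g - fun t => ∫ x in (0 : ℝ)..t, w x) 0 x := by
    have n0 : ∀ᵐ x : ℝ, x ≠ 0 := by simp [ae_iff, measure_singleton]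
    have nT : ∀ᵐ x : ℝ, x ≠ T := by simp [ae_iff, measure_singleton]
    filter_upwards [n0, nT, LocallyIntegrable.ae_hasDerivAt_integral hr.locallyIntegrable,
      LocallyIntegrable.ae_hasDerivAt_integral he.locallyIntegrable,
      LocallyIntegrable.ae_hasDerivAt_integral hwi.locallyIntegrable] with x x0 xT h1 h2 h3 hx
    rw [uIcc_of_le hT] at hx
    have hx' : x ∈ Ioo 0 T := ⟨lt_of_le_of_ne hx.1 (Ne.symm x0), lt_of_le_of_ne hx.2 xT⟩
    have d1 := (h1 0).const_add C; have d2 := (h2 0).const_add D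
    have d3 := (hρ.hasDerivAt x).smul (d1.mul d2); refine (d3.sub (h3 0)).congr_deriv ?_
    rw [hw, indicator_of_mem hx']; simp only [Pi.mul_apply, hf, hg]; ring
  obtain ⟨K, hK⟩ := aG.const_of_ae_hasDerivAt_zero hz; have k0 := hK 0 left_mem_uIcc
  have kT := hK T right_mem_uIcc; rw [← k0] at kT
  simp only [Pi.sub_apply, Pi.smul_apply', hρ.eq_zero (t := 0) (by simp), hρ.eq_zero (t := T)
    (by simp), zero_smul, intervalIntegral.integral_same, sub_self, zero_sub, neg_eq_zero] at kT
  rw [intervalIntegral.integral_of_le hT, integral_Ioc_eq_integral_Ioo, hw,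
    setIntegral_indicator measurableSet_Ioo, inter_self, integral_add b1 b2] at kT
  exact eq_neg_of_add_eq_zero_left kT

/-- Functions with a weak derivative that is integrable are absolutely continuous. -/
lemma HasWeakDeriv.exists_primitive (hT : 0 < T) (h : HasWeakDeriv T c r) :
    ∃ C, ∀ᵐ t ∂volT T,
      c t = C + ∫ x in (0 : ℝ)..t, (Ioo 0 T).indicator r x := by
  set r' := (Ioo 0 T).indicator r with hr'
  have hri : Integrable r' := (integrable_indicator_iff measurableSet_Ioo).2 h.right
  set R : ℝ → ℂ := fun t => ∫ x in (0 : ℝ)..t, r' x with hR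
  have cR : Continuous R := intervalIntegral.continuous_primitive (fun a b => hri.intervalIntegrable) 0
  have iR : IntegrableOn R (Ioo 0 T) := cR.integrableOn_Icc.mono_set Ioo_subset_Icc_self
  set f : ℝ → ℂ := fun t => c t - R t with hf
  have fi : IntegrableOn f (Ioo 0 T) := h.left.sub iR
  have h0 : ∀ ρ, IsTimeTest T ρ → ∫ t in Ioo 0 T, deriv ρ t • f t = 0 := fun ρ hρ => by
    obtain ⟨M, hM1, hM2⟩ := hρ.exists_bound
    have e1 := integral_deriv_mul_primitive hT.le hri (e := fun _ => 0) (integrable_zero ℝ ℂ volume) 0 1 hρ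
    simp only [zero_add, intervalIntegral.integral_zero, add_zero, mul_one,
      mul_zero] at e1
    have e2 : ∫ t in Ioo 0 T, ρ t • r' t = ∫ t in Ioo 0 T, ρ t • r t :=
      setIntegral_congr_fun measurableSet_Ioo fun t ht => by simp only [hr', indicator_of_mem ht]
    simp only [hf, smul_sub]
    refine (integral_sub (h.left.bdd_smul M hρ.continuous_deriv.aestronglyMeasurable
      (.of_forall hM2)) (iR.bdd_smul M hρ.continuous_deriv.aestronglyMeasurable
      (.of_forall hM2))).trans ?_
    refine sub_eq_zero.2 ((h.eq ρ hρ).trans (Eq.trans ?_ e1.symm))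
    rw [e2]
  let η : ContDiffBump (T / 2) := ⟨T / 8, T / 4, by positivity, by linarith⟩
  have ηs : tsupport (η.normed volume) ⊆ Icc (T / 4) (3 * T / 4) := by
    rw [η.tsupport_normed_eq, closedBall_eq_Icc]
    exact Icc_subset_Icc (by simp only [η]; linarith) (by simp only [η]; linarith)
  set K : ℂ := ∫ t in Ioo 0 T, η.normed volume t • f t with hK
  refine ⟨K, ?_⟩
  have key : ∀ᵐ t : ℝ, t ∈ Ioo 0 T → f t - K = 0 := by
    refine isOpen_Ioo.ae_eq_zero_of_integral_contDiff_smul_eq_zero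
      (fi.sub (integrableOn_const (by simp))).locallyIntegrableOn fun φ φs φc φt => ?_
    set m : ℝ := ∫ t, φ t with hm
    have φi : Integrable φ := φs.continuous.integrable_of_hasCompactSupport φc
    have ηi : Integrable (η.normed volume) := η.integrable_normed
    set ψ : ℝ → ℝ := fun t => φ t - m * η.normed volume t with hψ
    have ψs : ContDiff ℝ ∞ ψ := φs.sub (contDiff_const.mul η.contDiff_normed)
    have ψi : Integrable ψ := φi.sub (ηi.const_mul m)
    have hc : IsCompact (tsupport φ ∪ Icc (T / 4) (3 * T / 4)) := φc.isCompact.union isCompact_Icc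
    have hs : tsupport φ ∪ Icc (T / 4) (3 * T / 4) ⊆ Ioo 0 T :=
      union_subset φt fun t ht => ⟨by linarith [ht.1], by linarith [ht.2]⟩
    have hne : (tsupport φ ∪ Icc (T / 4) (3 * T / 4)).Nonempty :=
      ⟨T / 2, Or.inr ⟨by linarith, by linarith⟩⟩
    obtain ⟨a, ha, hamin⟩ := hc.exists_isLeast hne
    obtain ⟨b, hb, hbmax⟩ := hc.exists_isGreatest hne
    have ψ0 : ∀ t, t ∉ Icc a b → ψ t = 0 := fun t ht => by
      have : t ∉ tsupport φ ∪ Icc (T / 4) (3 * T / 4) := fun hu => ht ⟨hamin hu, hbmax hu⟩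
      rw [mem_union, not_or] at this
      simp only [hψ, image_eq_zero_of_notMem_tsupport this.1,
        image_eq_zero_of_notMem_tsupport fun hh => this.2 (ηs hh), mul_zero, sub_zero]
    have ψint : ∫ t, ψ t = 0 := by
      simp only [hψ]
      rw [integral_sub φi (ηi.const_mul m), integral_const_mul, η.integral_normed, mul_one, sub_self]
    set ρ : ℝ → ℝ := fun t => ∫ x in (0 : ℝ)..t, ψ x with hρ
    have ρd : ∀ t, HasDerivAt ρ (ψ t) t := fun t =>
      intervalIntegral.integral_hasDerivAt_right ψi.intervalIntegrable
        ψs.continuous.stronglyMeasurable.stronglyMeasurableAtFilter ψs.continuous.continuousAt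
    have ρd' : deriv ρ = ψ := funext fun t => (ρd t).deriv
    have ρ0 : ∀ t, t ∉ Icc a b → ρ t = 0 := fun t ht => by
      have ha0 := (hs ha).1
      have hbT := (hs hb).2
      rcases lt_or_ge t a with h1 | h1
      · refine intervalIntegral.integral_zero_ae (.of_forall fun x hx => ψ0 x fun hh => ?_)
        rcases le_total 0 t with h2 | h2
        · rw [uIoc_of_le h2] at hx; linarith [hx.2, hh.1]
        · rw [uIoc_of_ge h2] at hx; linarith [hx.2, hh.1]
      · have h2 : b < t := by by_contra h3; exact ht ⟨h1, not_lt.1 h3⟩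
        have ht0 : 0 ≤ t := by linarith
        simp only [hρ]
        rw [intervalIntegral.integral_of_le ht0, setIntegral_eq_integral_of_forall_compl_eq_zero,
          ψint]
        intro x hx
        refine ψ0 x fun hh => hx ⟨by linarith [hh.1], by linarith [hh.2]⟩
    have ρt : IsTimeTest T ρ := by
      have hsub : tsupport ρ ⊆ Icc a b := closure_minimal
        (fun t ht => by by_contra hh; exact ht (ρ0 t hh)) isClosed_Icc
      refine ⟨?_, isCompact_Icc.of_isClosed_subset (isClosed_tsupport _) hsub,
        hsub.trans fun t ht => ⟨(hs ha).1.trans_le ht.1, ht.2.trans_lt (hs hb).2⟩⟩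
      rw [contDiff_infty_iff_deriv, ρd']
      exact ⟨fun t => (ρd t).differentiableAt, ψs⟩
    have hz := h0 ρ ρt
    obtain ⟨M, hM⟩ := φs.continuous.bounded_above_of_compact_support φc
    obtain ⟨N, hN⟩ := (η.contDiff_normed (n := 0)).continuous.bounded_above_of_compact_support
      (η.hasCompactSupport_normed (μ := volume))
    have j1 : IntegrableOn (fun t => φ t • f t) (Ioo 0 T) :=
      fi.bdd_smul M φs.continuous.aestronglyMeasurable (.of_forall hM)
    have j2 : IntegrableOn (fun t => η.normed volume t • f t) (Ioo 0 T) :=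
      fi.bdd_smul N (η.contDiff_normed (n := 0)).continuous.aestronglyMeasurable (.of_forall hN)
    rw [ρd'] at hz
    simp only [hψ, sub_smul, mul_smul] at hz
    have hz' := (integral_sub j1 (j2.smul m)).symm.trans hz
    simp only [Pi.smul_apply] at hz'
    rw [integral_smul, ← hK] at hz'
    have e3 : ∫ t, φ t • (f t - K) = ∫ t in Ioo 0 T, φ t • (f t - K) := by
      rw [setIntegral_eq_integral_of_forall_compl_eq_zero]
      intro t ht
      rw [image_eq_zero_of_notMem_tsupport fun hh => ht (φt hh), zero_smul]
    have e4 : ∫ t in Ioo 0 T, φ t • K = m • K := by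
      rw [integral_smul_const, setIntegral_eq_integral_of_forall_compl_eq_zero]
      intro t ht
      rw [image_eq_zero_of_notMem_tsupport fun hh => ht (φt hh)]
    refine e3.trans ?_
    simp only [smul_sub]
    rw [integral_sub j1 (φi.integrableOn.smul_const K), e4, hz']
  filter_upwards [ae_restrict_of_ae key, ae_restrict_mem measurableSet_Ioo] with t ht hm
  have := ht hm
  simp only [hf] at this
  rw [← sub_eq_zero, ← this]
  ring

lemma HasWeakDeriv.star (h : HasWeakDeriv T c r) :
    HasWeakDeriv T (fun t => conj (c t)) fun t => conj (r t) where
  left := conjCLE.toContinuousLinearMap.integrable_comp h.left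
  right := conjCLE.toContinuousLinearMap.integrable_comp h.right
  eq ρ hρ := by
    have := congr_arg conj (h.eq ρ hρ)
    rw [map_neg, ← integral_conj, ← integral_conj] at this
    simpa [real_smul] using this

/-- The product rule for weak derivatives. -/
lemma HasWeakDeriv.integral_mul (hT : 0 < T) {d e : ℝ → ℂ} (h : HasWeakDeriv T c r)
    (h' : HasWeakDeriv T d e) (hρ : IsTimeTest T ρ) :
    ∫ t in Ioo 0 T, deriv ρ t • (c t * d t) =
      -∫ t in Ioo 0 T, ρ t • (r t * d t + c t * e t) := by
  obtain ⟨C, hC⟩ := h.exists_primitive hT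
  obtain ⟨D, hD⟩ := h'.exists_primitive hT
  have key := integral_deriv_mul_primitive hT.le
    ((integrable_indicator_iff measurableSet_Ioo).2 h.right)
    ((integrable_indicator_iff measurableSet_Ioo).2 h'.right) C D hρ
  refine Eq.trans (integral_congr_ae ?_) (key.trans (congr_arg Neg.neg (integral_congr_ae ?_)))
  · filter_upwards [hC, hD] with t h1 h2
    rw [h1, h2]
  · filter_upwards [hC, hD, ae_restrict_mem measurableSet_Ioo] with t h1 h2 h3
    rw [h1, h2, indicator_of_mem h3, indicator_of_mem h3]

/-! ### Superpositions of coherent states -/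

/-- The exponent `v ↦ ⟨y, v⟩ + i⟨ξ, v⟩`. -/
def phL (Y : Ph) : Vel →L[ℝ] ℂ := ofRealCLM ∘L innerSL ℝ Y.1 + I • (ofRealCLM ∘L innerSL ℝ Y.2)

lemma phL_apply (Y : Ph) (v : Vel) : phL Y v = (inner ℝ Y.1 v : ℂ) + I * (inner ℝ Y.2 v : ℂ) := rfl

lemma continuous_phL : Continuous phL := continuous_clm_apply.2 fun v => by
    simp only [phL_apply]; fun_prop

lemma norm_phL_le (h : ‖Y‖ ≤ R) : ‖phL Y‖ ≤ 2 * R := by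
  have h1 := (norm_fst_le Y).trans h; have h2 := (norm_snd_le Y).trans h
  refine opNorm_le_bound _ (by linarith [norm_nonneg Y]) fun v => ?_; rw [phL_apply]
  refine (norm_add_le _ _).trans ?_; rw [norm_mul, norm_I, one_mul, norm_real, norm_real]
  calc _ ≤ ‖Y.1‖ * ‖v‖ + ‖Y.2‖ * ‖v‖ := add_le_add (norm_inner_le_norm _ _) (norm_inner_le_norm _ _)
    _ ≤ R * ‖v‖ + R * ‖v‖ := by gcongr
    _ = _ := by ring

section

variable {E : Type} [NormedAddCommGroup E] [NormedSpace ℂ E]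

lemma norm_cexp_phL_le {r : ℝ} (h : ‖Y‖ ≤ R) {v : Vel} (hv : ‖v‖ ≤ r) :
    ‖cexp (phL Y v)‖ ≤ exp (2 * R * r) := by
  have hR : 0 ≤ R := (norm_nonneg _).trans h
  refine (norm_exp_le_exp_norm _).trans (exp_le_exp.2 ?_)
  exact ((phL Y).le_opNorm v).trans (by have := norm_phL_le h; gcongr)

lemma norm_smulRight_phL_le (Y : Ph) (x : E) : ‖(phL Y).smulRight x‖ ≤ ‖phL Y‖ * ‖x‖ := by
  refine opNorm_le_bound _ pos! fun v => ?_; rw [smulRight_apply, norm_smul, mul_right_comm]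
  exact mul_le_mul_of_nonneg_right ((phL Y).le_opNorm v) pos!

lemma integrable_smulRight_phL {X : Ph → E} (hX : Integrable X)
    (hs : ∀ Y, R < ‖Y‖ → X Y = 0) : Integrable fun Y => (phL Y).smulRight (X Y) := by
  refine (hX.norm.const_mul (2 * R)).mono ?_ (.of_forall fun Y => ?_)
  · have hc : Continuous fun p : Ph × E => (phL p.1).smulRight p.2 :=
      continuous_clm_apply.2 fun v => by
        simp only [smulRight_apply]
        exact ((continuous_phL.comp continuous_fst).clm_apply continuous_const).smul continuous_snd
    have hcm := hc.comp_aestronglyMeasurable (continuous_id.aestronglyMeasurable.prodMk hX.1)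
    exact hcm
  · rcases le_or_gt ‖Y‖ R with h | h
    · refine (norm_smulRight_phL_le Y (X Y)).trans ?_
      exact (mul_le_mul_of_nonneg_right (norm_phL_le h) pos!).trans (le_abs_self _)
    · rw [hs Y h]; simp

lemma integrable_cexp_phL_smul {X : Ph → E} (hX : Integrable X)
    (hs : ∀ Y, R < ‖Y‖ → X Y = 0) (v : Vel) :
    Integrable fun Y => cexp (phL Y v) • X Y := by
  have hc : Continuous fun Y => cexp (phL Y v) :=
    continuous_exp.comp (continuous_phL.clm_apply continuous_const)
  refine (hX.norm.const_mul (exp (2 * R * ‖v‖))).mono (hc.aestronglyMeasurable.smul hX.1)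
    (.of_forall fun Y => ?_)
  rcases le_or_gt ‖Y‖ R with h | h
  · rw [norm_smul]
    exact (mul_le_mul_of_nonneg_right (norm_cexp_phL_le h le_rfl) pos!).trans (le_abs_self _)
  · rw [hs Y h]; simp

lemma hasFDerivAt_integral_cexp_phL {X : Ph → E} (hX : Integrable X)
    (hs : ∀ Y, R < ‖Y‖ → X Y = 0) (v : Vel) :
    HasFDerivAt (fun v => ∫ Y, cexp (phL Y v) • X Y)
      (∫ Y, cexp (phL Y v) • (phL Y).smulRight (X Y)) v := by
  have hi := integrable_smulRight_phL hX hs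
  have hs' : ∀ Y, R < ‖Y‖ → (phL Y).smulRight (X Y) = 0 := fun Y h => by rw [hs Y h]; simp
  refine hasFDerivAt_integral_of_dominated_of_fderiv_le (s := Metric.ball v 1)
    (F' := fun v Y => cexp (phL Y v) • (phL Y).smulRight (X Y))
    (bound := fun Y => exp (2 * R * (‖v‖ + 1)) * ‖(phL Y).smulRight (X Y)‖)
    (Metric.ball_mem_nhds v one_pos)
    (.of_forall fun w => (integrable_cexp_phL_smul hX hs w).1) (integrable_cexp_phL_smul hX hs v)
    (integrable_cexp_phL_smul hi hs' v).1 (.of_forall fun Y w hw => ?_)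
    (hi.norm.const_mul _) (.of_forall fun Y w _ => ?_)
  · rcases le_or_gt ‖Y‖ R with h | h
    · rw [norm_smul]
      have hw' : ‖w‖ ≤ ‖v‖ + 1 := by
        have := norm_sub_norm_le w v; rw [Metric.mem_ball, dist_eq_norm] at hw; linarith
      exact mul_le_mul_of_nonneg_right (norm_cexp_phL_le h hw') pos!
    · rw [hs' Y h]; simp
  · refine (((phL Y).hasFDerivAt (x := w)).cexp.smul_const (X Y)).congr_fderiv ?_; ext z
    simp [mul_smul]

lemma contDiff_integral_cexp_phL {X : Ph → E} (hX : Integrable X) (hs : ∀ Y, R < ‖Y‖ → X Y = 0) :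
    ContDiff ℝ ∞ (fun v => ∫ Y, cexp (phL Y v) • X Y) := by
  refine contDiff_infty.2 fun n => ?_
  induction n generalizing E with
  | zero =>
    exact contDiff_zero.2 (Differentiable.continuous (𝕜 := ℝ)
      fun v => (hasFDerivAt_integral_cexp_phL hX hs v).differentiableAt)
  | succ n ih =>
    rw [Nat.cast_add, Nat.cast_one, contDiff_succ_iff_fderiv]
    refine ⟨fun v => (hasFDerivAt_integral_cexp_phL hX hs v).differentiableAt, by simp, ?_⟩
    have e : fderiv ℝ (fun v => ∫ Y, cexp (phL Y v) • X Y) =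
        fun v => ∫ Y, cexp (phL Y v) • (phL Y).smulRight (X Y) :=
      funext fun v => (hasFDerivAt_integral_cexp_phL hX hs v).fderiv
    rw [e]; exact ih (integrable_smulRight_phL hX hs) fun Y h => by rw [hs Y h]; simp

end

/-- The superposition of coherent states with density `X`. -/
def synth (X : Ph → ℂ) (v : Vel) : ℂ :=
  ∫ Y, (((2 * π) ^ (-(3 / 2) : ℝ) * gauss (v - Y.1) : ℝ) : ℂ) * eI v Y.2 * X Y

lemma gauss_sub_eq (v y : Vel) : gauss (v - y) = π ^ (-(3 / 4) : ℝ) *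
    (exp (-‖v‖ ^ 2 / 2) * (exp (-‖y‖ ^ 2 / 2) * exp (inner ℝ y v))) := by
  rw [gauss, ← exp_add, ← exp_add, norm_sub_sq_real, real_inner_comm]; ring_nf

lemma synth_eq (X : Ph → ℂ) (v : Vel) :
    synth X v = (((2 * π) ^ (-(3 / 2) : ℝ) * π ^ (-(3 / 4) : ℝ) * exp (-‖v‖ ^ 2 / 2) : ℝ) : ℂ) *
      ∫ Y, cexp (phL Y v) • (((exp (-‖Y.1‖ ^ 2 / 2) : ℝ) : ℂ) * X Y) := by
  rw [synth, ← integral_const_mul]; refine integral_ext fun Y => ?_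
  rw [phL_apply, Complex.exp_add, gauss_sub_eq, real_inner_comm Y.2 v, smul_eq_mul]; push_cast; ring

lemma gauss_sub_le (hM : 0 ≤ M) {y : Vel} (hy : ‖y‖ ≤ R) (v : Vel) :
    gauss (v - y) ≤ (1 + R) ^ M * exp (M ^ 2 / 2) * jb v ^ (-M) := by
  have hR : 0 ≤ R := (norm_nonneg _).trans hy; have hj := jb_pos v; set r := ‖v - y‖ with hr
  have h1 : jb v ≤ (1 + R) * exp r := by
    have := jb_add_le y (v - y); rw [add_sub_cancel] at this
    refine this.trans (mul_le_mul ?_ (by linarith [add_one_le_exp r]) pos! lin!); have h2 := jb_sq y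
    have h3 := jb_pos y; nlinarith [norm_nonneg y]
  have h2 : jb v ^ M ≤ (1 + R) ^ M * exp (r * M) := by
    rw [exp_mul, ← mul_rpow lin! (exp_pos _).le]; exact rpow_le_rpow hj.le h1 hM
  have h3 : gauss (v - y) ≤ exp (-r ^ 2 / 2) := by
    rw [gauss]; exact mul_le_of_le_one_left (exp_pos _).le pi_rpow_le_one
  rw [rpow_neg hj.le, ← div_eq_mul_inv, le_div_iff₀ (rpow_pos_of_pos hj _)]
  calc gauss (v - y) * jb v ^ M ≤ exp (-r ^ 2 / 2) * ((1 + R) ^ M * exp (r * M)) := by gcongr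
    _ = (1 + R) ^ M * exp (-r ^ 2 / 2 + r * M) := by rw [exp_add]; ring
    _ ≤ _ := by gcongr; nlinarith [sq_nonneg (r - M)]

/-- The constant in the decay estimate for superpositions of coherent states. -/
def decC (M R : ℝ) : ℝ := (2 * R + 2) * ((1 + R) ^ (M + 1) * exp ((M + 1) ^ 2 / 2))

section

variable {X : Ph → ℂ} {R : ℝ}

lemma contDiff_gaussian_factor (c : ℝ) :
    ContDiff ℝ ∞ fun v : Vel => ((c * exp (-‖v‖ ^ 2 / 2) : ℝ) : ℂ) :=
  ofRealCLM.contDiff.comp (contDiff_const.mul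
    (contDiff_exp.comp ((contDiff_norm_sq ℝ).neg.div_const 2)))

lemma integrable_exp_mul (hX : Integrable X) :
    Integrable fun Y : Ph => ((exp (-‖Y.1‖ ^ 2 / 2) : ℝ) : ℂ) * X Y := by
  refine hX.bdd_mul (c := 1) (Continuous.aestronglyMeasurable (by fun_prop)) (.of_forall fun Y => ?_)
  rw [norm_real, norm_of_nonneg (exp_pos _).le]
  exact exp_le_one_iff.2 (by nlinarith [sq_nonneg ‖Y.1‖])

lemma contDiff_synth (hX : Integrable X) (hs : ∀ Y, R < ‖Y‖ → X Y = 0) :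
    ContDiff ℝ ∞ (synth X) := by
  have e : synth X = _ := funext fun v => synth_eq X v; rw [e]
  exact (contDiff_gaussian_factor _).mul (contDiff_integral_cexp_phL (R := R)
    (integrable_exp_mul hX) fun Y h => by rw [hs Y h, mul_zero])

lemma norm_coherent_le (hM : 0 ≤ M) (hY : ‖Y‖ ≤ R) (v : Vel) :
    (2 * π) ^ (-(3 / 2) : ℝ) * π ^ (-(3 / 4) : ℝ) * exp (-‖v‖ ^ 2 / 2) *
      (‖cexp (phL Y v)‖ * exp (-‖Y.1‖ ^ 2 / 2)) ≤
      (1 + R) ^ M * exp (M ^ 2 / 2) * jb v ^ (-M) := by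
  have h1 := two_pi_rpow_le_one; refine le_trans ?_ (gauss_sub_le hM ((norm_fst_le Y).trans hY) v)
  have h2 : ‖cexp (phL Y v)‖ = exp (inner ℝ Y.1 v) := by rw [norm_exp, phL_apply]; simp
  rw [h2]
  calc _ = (2 * π) ^ (-(3 / 2) : ℝ) * gauss (v - Y.1) := by rw [gauss_sub_eq]; ring
    _ ≤ _ := mul_le_of_le_one_left (gauss_nonneg _) h1

/-- Decay of superpositions of coherent states and their derivatives. -/
lemma norm_synth_le (hX : Integrable X) (hs : ∀ Y, R < ‖Y‖ → X Y = 0) (hR : 0 ≤ R) (hM : 0 ≤ M) (v : Vel) :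
    ‖synth X v‖ ≤ decC M R * (∫ Y, ‖X Y‖) * jb v ^ (-M) ∧
      ‖fderiv ℝ (synth X) v‖ ≤ decC M R * (∫ Y, ‖X Y‖) * jb v ^ (-M) := by
  set K := (1 + R) ^ (M + 1) * exp ((M + 1) ^ 2 / 2) with hK; have hK0 : 0 ≤ K := by positivity
  set c : ℝ := (2 * π) ^ (-(3 / 2) : ℝ) * π ^ (-(3 / 4) : ℝ) with hc
  have hc0 : 0 ≤ c := by positivity
  have hX' := integrable_exp_mul hX
  have hs' : ∀ Y, R < ‖Y‖ → ((exp (-‖Y.1‖ ^ 2 / 2) : ℝ) : ℂ) * X Y = 0 :=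
    fun Y h => by rw [hs Y h, mul_zero]
  have hj := jb_pos v
  have hj1 : jb v ^ (-(M + 1)) * jb v = jb v ^ (-M) := by rw [← rpow_add_one hj.ne']; ring_nf
  have hj2 : jb v ^ (-(M + 1)) ≤ jb v ^ (-M) := jb_rpow_mono lin! v
  set g := exp (-‖v‖ ^ 2 / 2) with hg
  set G := ∫ Y, cexp (phL Y v) • (((exp (-‖Y.1‖ ^ 2 / 2) : ℝ) : ℂ) * X Y) with hG
  set G' := ∫ Y, cexp (phL Y v) •
    (phL Y).smulRight (((exp (-‖Y.1‖ ^ 2 / 2) : ℝ) : ℂ) * X Y) with hG'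
  have hI : 0 ≤ ∫ Y, ‖X Y‖ := integral_nonneg fun _ => norm_nonneg _
  have key {E : Type} [NormedAddCommGroup E] [NormedSpace ℂ E] {Z : Ph → E} {a : ℝ} (ha : 0 ≤ a)
      (hZ : ∀ Y, ‖Y‖ ≤ R → ‖Z Y‖ ≤ a * (exp (-‖Y.1‖ ^ 2 / 2) * ‖X Y‖))
      (h0 : ∀ Y, R < ‖Y‖ → Z Y = 0) : c * g * ‖∫ Y, cexp (phL Y v) • Z Y‖ ≤
        a * (K * jb v ^ (-(M + 1)) * ∫ Y, ‖X Y‖) := by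
    rw [← integral_const_mul, ← integral_const_mul]
    refine (mul_le_mul_of_nonneg_left (norm_integral_le_integral_norm _) pos!).trans ?_
    rw [← integral_const_mul]
    refine integral_mono_of_nonneg (.of_forall fun Y => by positivity)
      ((hX.norm.const_mul _).const_mul _) (.of_forall fun Y => ?_)
    rcases le_or_gt ‖Y‖ R with h | h
    · simp only [norm_smul]
      calc _ ≤ c * g * (‖cexp (phL Y v)‖ * (a * (exp (-‖Y.1‖ ^ 2 / 2) * ‖X Y‖))) := by
            gcongr; exact hZ Y h
        _ = a * (c * g * (‖cexp (phL Y v)‖ * exp (-‖Y.1‖ ^ 2 / 2)) * ‖X Y‖) := by ring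
        _ ≤ a * (K * jb v ^ (-(M + 1)) * ‖X Y‖) := by
            have := norm_coherent_le (M := M + 1) lin! h v; gcongr
    · simp [h0 Y h, hs Y h]
  have e1 : ‖synth X v‖ = c * g * ‖G‖ := by rw [synth_eq, norm_mul, norm_real, norm_of_nonneg pos!]
  have hexp : ∀ Y : Ph, ‖((exp (-‖Y.1‖ ^ 2 / 2) : ℝ) : ℂ)‖ = exp (-‖Y.1‖ ^ 2 / 2) := fun Y => by
    rw [norm_real, norm_of_nonneg (exp_pos _).le]
  have b1 : c * g * ‖G‖ ≤ 1 * (K * jb v ^ (-(M + 1)) * ∫ Y, ‖X Y‖) :=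
    key zero_le_one (fun Y _ => by rw [norm_mul, hexp, one_mul]) hs'
  have b2 : c * g * ‖G'‖ ≤ 2 * R * (K * jb v ^ (-(M + 1)) * ∫ Y, ‖X Y‖) :=
    key pos! (fun Y h => (norm_smulRight_phL_le _ _).trans (by
      rw [norm_mul, hexp]; have := norm_phL_le h; gcongr)) fun Y h => by rw [hs' Y h]; simp
  rw [one_mul] at b1
  have hd : HasFDerivAt (synth X) (((c * g : ℝ) : ℂ) • G' -
      synth X v • (ofRealCLM ∘L innerSL ℝ v)) v := by
    have e : synth X = _ := funext fun v => synth_eq X v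
    have d1 : HasFDerivAt (fun v : Vel => exp (-‖v‖ ^ 2 / 2)) (g • (-(innerSL ℝ v))) v := by
      refine HasFDerivAt.exp ?_
      have := ((hasStrictFDerivAt_norm_sq (F := Vel) v).hasFDerivAt.neg).mul_const (2 : ℝ)⁻¹
      refine (this.congr_fderiv ?_).congr_of_eventuallyEq (.of_forall fun x => ?_)
      · ext z; simp
      · simp [div_eq_mul_inv]
    have d2 : HasFDerivAt (synth X) (((c * g : ℝ) : ℂ) • G' +
        G • (ofRealCLM ∘L (c • g • -(innerSL ℝ v)))) v := by
      rw [e]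
      exact (ofRealCLM.hasFDerivAt.comp v (d1.const_mul c)).mul
        (hasFDerivAt_integral_cexp_phL (R := R) hX' hs' v)
    have es : synth X v = ((c * g : ℝ) : ℂ) * G := synth_eq X v; refine d2.congr_fderiv ?_; rw [es]
    clear_value G G' c g
    ext z; simp; ring
  have hnv := norm_le_jb v; refine ⟨?_, ?_⟩
  · rw [e1]; refine b1.trans ?_
    calc _ = 1 * K * (∫ Y, ‖X Y‖) * jb v ^ (-(M + 1)) := by ring
      _ ≤ _ := by rw [decC, ← hK]; gcongr; linarith
  · rw [hd.fderiv]
    have hn : ‖(ofRealCLM ∘L innerSL ℝ v : Vel →L[ℝ] ℂ)‖ ≤ ‖v‖ :=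
      (opNorm_comp_le _ _).trans (by simp)
    calc _ ≤ c * g * ‖G'‖ + c * g * ‖G‖ * ‖v‖ := by
          refine (norm_sub_le _ _).trans ?_
          rw [norm_smul, norm_smul, norm_real, norm_of_nonneg pos!, e1]; gcongr
      _ ≤ 2 * R * (K * jb v ^ (-(M + 1)) * ∫ Y, ‖X Y‖) +
          (K * jb v ^ (-(M + 1)) * ∫ Y, ‖X Y‖) * jb v := by gcongr
      _ = 2 * R * (K * jb v ^ (-(M + 1)) * ∫ Y, ‖X Y‖) +
          (K * jb v ^ (-M) * ∫ Y, ‖X Y‖) := by rw [← hj1]; ring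
      _ ≤ 2 * R * (K * jb v ^ (-M) * ∫ Y, ‖X Y‖) + (K * jb v ^ (-M) * ∫ Y, ‖X Y‖) := by gcongr
      _ = (2 * R + 1) * K * (∫ Y, ‖X Y‖) * jb v ^ (-M) := by ring
      _ ≤ _ := by rw [decC, ← hK]; gcongr; linarith

end

/-! ### The triple norm of differentiable functions with decay -/

lemma integrable_jb_rpow : Integrable fun v : Vel => jb v ^ (-4 : ℝ) := by
  have := integrable_rpow_neg_one_add_norm_sq (E := Vel) (μ := volume) (r := 4)
    (by rw [finrank_euclideanSpace_fin]; norm_num)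
  refine this.congr (.of_forall fun v => ?_); simp only
  rw [← jb_sq, ← rpow_natCast, ← rpow_mul (jb_pos v).le]; norm_num

/-- The norm of `⟨v⟩^{-2}` in `L²(ℝ³)`. -/
def jbN : ℝ := sqrt (∫ v : Vel, jb v ^ (-4 : ℝ))

lemma jbN_sq : jbN ^ 2 = ∫ v : Vel, jb v ^ (-4 : ℝ) :=
  sq_sqrt (integral_nonneg fun v => (jb_rpow_pos _ v).le)

lemma jbN_nonneg : 0 ≤ jbN := sqrt_nonneg _

lemma lintegral_enorm_sq_le (hf : ∀ᵐ v, ‖f v‖ ≤ K * jb v ^ (-2 : ℝ)) :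
    ∫⁻ v, ‖f v‖ₑ ^ 2 ≤ ofR ((K * jbN) ^ 2) := by
  rw [mul_pow, jbN_sq, ← integral_const_mul, ofReal_integral_eq_lintegral_ofReal
    (integrable_jb_rpow.const_mul _) (.of_forall fun v => by have := jb_rpow_pos (-4) v; positivity)]
  refine lintegral_mono_ae ?_; filter_upwards [hf] with v hv; rw [← ofReal_norm_sq]
  refine ofReal_le_ofReal ((pow_le_pow_left₀ pos! hv 2).trans_eq ?_)
  rw [mul_pow, ← rpow_natCast, ← rpow_natCast (jb v ^ (-2 : ℝ)), ← rpow_mul (jb_pos v).le]; norm_num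

lemma norm_le_mul_jbN {f : L2v} (hK : 0 ≤ K) (hf : ∀ᵐ v, ‖f v‖ ≤ K * jb v ^ (-2 : ℝ)) :
    ‖f‖ ≤ K * jbN := by
  have h := lintegral_enorm_sq_le hf
  rw [← enorm_sq_eq_lintegral, ← ofReal_norm_sq, ofReal_le_ofReal_iff pos!] at h
  exact (pow_le_pow_iff_left₀ (norm_nonneg _) (mul_nonneg hK jbN_nonneg) two_ne_zero).1 h

/-- Differentiable functions that decay like `⟨v⟩^{-M}` with their derivatives. -/
structure HasDecay (f : Vel → ℂ) (ε M : ℝ) : Prop where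
  nonneg : 0 ≤ ε
  diff : Differentiable ℝ f
  bound : ∀ v, ‖f v‖ ≤ ε * jb v ^ (-M)
  bound_fderiv : ∀ v, ‖fderiv ℝ f v‖ ≤ ε * jb v ^ (-M)

lemma HasDecay.norm_sub_le (hf : HasDecay f ε 3) {v v' : Vel}
    (h : ∀ w ∈ segment ℝ v v', jb v ≤ 2 * jb w) :
    ‖f v' - f v‖ ≤ 8 * ε * jb v ^ (-3 : ℝ) * ‖v' - v‖ := by
  refine (convex_segment v v').norm_image_sub_le_of_norm_fderiv_le (𝕜 := ℝ)
    (fun w _ => hf.diff w) (fun w hw => ?_) (left_mem_segment ℝ v v') (right_mem_segment ℝ v v')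
  refine (hf.bound_fderiv w).trans ?_
  have h1 : (2 * jb w) ^ (-3 : ℝ) ≤ jb v ^ (-3 : ℝ) :=
    rpow_le_rpow_of_nonpos (jb_pos v) (h w hw) num!
  rw [mul_rpow num! (jb_pos w).le] at h1
  have h2 : (2 : ℝ) ^ (-3 : ℝ) = 8⁻¹ := by rw [rpow_neg num!]; norm_num
  rw [h2] at h1; have := hf.nonneg
  calc ε * jb w ^ (-3 : ℝ) = ε * (8 * (8⁻¹ * jb w ^ (-3 : ℝ))) := by ring
    _ ≤ ε * (8 * jb v ^ (-3 : ℝ)) := by gcongr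
    _ = _ := by ring

lemma jb_le_two_mul {v w : Vel} (h : ‖v‖ ≤ 2 * ‖w‖) : jb v ≤ 2 * jb w := by
  rw [jb]; refine sqrt_le_iff.2 ⟨by have := jb_pos w; positivity, ?_⟩; rw [mul_pow, jb_sq]
  nlinarith [norm_nonneg v, norm_nonneg w]

lemma HasDecay.memLp (hf : HasDecay f ε 3) : MemLp f 2 volume := by
  refine memLp_two_of_lintegral hf.diff.continuous.aestronglyMeasurable
    ((lintegral_enorm_sq_le (K := ε) (.of_forall fun v => (hf.bound v).trans ?_)).trans_lt
      ofReal_lt_top)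
  exact mul_le_mul_of_nonneg_left (jb_rpow_mono num! v) hf.nonneg

lemma tripQ_mono (h : s ≤ t) (f : L2v) : tripQ s f ≤ tripQ t f := by
  refine add_le_add (lintegral_mono fun ξ => ?_) (lintegral_mono fun l => ?_)
  · exact mul_le_mul_left (ENNReal.rpow_le_rpow_of_exponent_le (one_le_wS ξ) h) _
  · refine mul_le_mul_left (ENNReal.rpow_le_rpow_of_exponent_le ?_ h) _; rw [wA, coe_add, coe_one]
    exact le_self_add

lemma HasDecay.tripQ_le (hf : HasDecay f ε 3) (hs : s ≤ 1) :
    tripQ s (hf.memLp.toLp f) ≤ ofR (800 * (ε * jbN) ^ 2) := by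
  refine (tripQ_mono hs _).trans ?_; set F := hf.memLp.toLp f with hF
  have hFf : F =ᵐ[volume] f := hf.memLp.coeFn_toLp; have hε := hf.nonneg; have hN := jbN_nonneg
  have b0 : ‖F‖ ≤ ε * jbN := by
    refine norm_le_mul_jbN hε ?_; filter_upwards [hFf] with v hv; rw [hv]
    exact (hf.bound v).trans (mul_le_mul_of_nonneg_left (jb_rpow_mono num! v) hε)
  have b0' : ‖F‖ₑ ^ 2 ≤ ofR ((ε * jbN) ^ 2) := by
    rw [← ofReal_norm_sq]; exact ofReal_le_ofReal (by gcongr)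
  have key {L : Vel ≃ₗᵢ[ℝ] Vel} {z : Vel} {θ : ℝ} (hθ : 0 ≤ θ)
      (hg : ∀ v, ‖motion L z v - v‖ ≤ θ * jb v)
      (hs : ∀ v, ∀ w ∈ segment ℝ v (motion L z v), jb v ≤ 2 * jb w) :
      ‖motionOp L z F - F‖ ≤ 8 * (ε * jbN) * θ := by
    have := norm_le_mul_jbN (f := motionOp L z F - F) (K := 8 * ε * θ) pos! ?_
    · exact this.trans_eq (by ring)
    filter_upwards [Lp.coeFn_sub (motionOp L z F) F, coeFn_motionOp L z F, hFf,
      (measurePreserving_motion L z).quasiMeasurePreserving.ae hFf] with v h1 h2 h3 h4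
    rw [h1, Pi.sub_apply, h2, h4, h3]; refine (hf.norm_sub_le (hs v)).trans ?_
    have e : jb v ^ (-3 : ℝ) * jb v = jb v ^ (-2 : ℝ) := by
      rw [← rpow_add_one (jb_pos v).ne']; norm_num
    have h7 := jb_rpow_pos (-3) v
    calc _ ≤ 8 * ε * jb v ^ (-3 : ℝ) * (θ * jb v) := by gcongr; exact hg v
      _ = 8 * ε * θ * (jb v ^ (-3 : ℝ) * jb v) := by ring
      _ = _ := by rw [e]
  have b1 (z : Vel) (hz : ‖z‖ ≤ 1) : ‖transOp z F - F‖ ≤ 8 * (ε * jbN) * ‖z‖ := by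
    refine key pos! (fun v => ?_) fun v w hw => ?_
    · simpa [motion] using le_mul_of_one_le_right (norm_nonneg z) (one_le_jb v)
    · have h5 : ‖v - w‖ ≤ 1 := by
        rw [segment_eq_image'] at hw; obtain ⟨t, ht, rfl⟩ := hw
        simpa [motion, norm_smul, abs_of_nonneg ht.1] using mul_le_one₀ ht.2 pos! hz
      have h6 := jb_add_le w (v - w); rw [add_sub_cancel] at h6; nlinarith [jb_pos w]
  have b2 : ∀ (j k : Fin 3) (hjk : j ≠ k) (θ : ℝ), 0 < θ → θ ≤ 1 →
      ‖rotOp hjk θ F - F‖ ≤ 8 * (ε * jbN) * θ := fun j k hjk θ hθ hθ1 => by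
    have h5 v : motion (rotL hjk θ) 0 v = rotFun j k θ v := by rw [motion, add_zero, rotL_apply]
    have h6 v := norm_rotFun_sub_le hjk θ v; rw [abs_of_pos hθ] at h6
    refine key hθ.le (fun v => ?_) fun v w hw => jb_le_two_mul ?_
    · rw [h5]; exact (h6 v).trans (by gcongr; exact norm_le_jb v)
    · rw [h5, segment_eq_image'] at hw; obtain ⟨t, ht, rfl⟩ := hw
      set d := rotFun j k θ v - v with hd
      have hd1 : ‖d‖ ≤ ‖v‖ := (h6 v).trans (mul_le_of_le_one_left pos! hθ1)
      rcases le_total t (1 / 2) with h7 | h7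
      · have h8 := norm_sub_norm_le v (-(t • d))
        rw [sub_neg_eq_add, norm_neg, norm_smul, norm_of_nonneg ht.1] at h8
        nlinarith [norm_nonneg d]
      · have e : v + t • d = rotFun j k θ v - (1 - t) • d := by rw [hd]; module
        have h8 := norm_sub_norm_le (rotFun j k θ v) ((1 - t) • d)
        rw [norm_smul, norm_of_nonneg (by linarith [ht.2]), norm_rotFun hjk] at h8
        show ‖v‖ ≤ 2 * ‖v + t • d‖
        rw [e]; nlinarith [norm_nonneg d]
  have c1 := lintegral_wS_le b1; have c2 := tsum_sphEig_le pos! b2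
  have c3 : angQ 1 F = ‖F‖ₑ ^ 2 + ∑' l, (sphEig l : ℝ≥0∞) * ‖(sphSpace l).starProjection F‖ₑ ^ 2 := by
    rw [angQ, lintegral_count, enorm_sq_eq_tsum_sphSpace, ← ENNReal.tsum_add]
    refine tsum_congr fun l => ?_; rw [rpow_one, wA, coe_add, coe_one, one_add_mul]
  rw [tripQ, c3, sobQ]; simp only [rpow_one]
  calc _ ≤ (ofR ((ε * jbN) ^ 2) + ofR (3 * (8 * (ε * jbN)) ^ 2)) +
        (ofR ((ε * jbN) ^ 2) + ofR (9 * (8 * (ε * jbN)) ^ 2)) := by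
        gcongr; exact c1.trans (by gcongr)
    _ = ofR (770 * (ε * jbN) ^ 2) := by
        rw [← ofReal_add pos! pos!, ← ofReal_add pos! pos!, ← ofReal_add pos! pos!]; congr 1; ring
    _ ≤ _ := ofReal_le_ofReal (by nlinarith [sq_nonneg (ε * jbN)])

lemma hasFDerivAt_jb (v : Vel) : HasFDerivAt jb ((jb v)⁻¹ • innerSL ℝ v) v := by
  have h1 := (hasStrictFDerivAt_norm_sq (F := Vel) v).hasFDerivAt.const_add (1 : ℝ)
  have h2 := h1.sqrt (by positivity : (1 : ℝ) + ‖v‖ ^ 2 ≠ 0); refine h2.congr_fderiv ?_; ext z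
  rw [← jb_sq, sqrt_sq (jb_pos v).le]; simp; have := (jb_pos v).ne'; field_simp

lemma HasDecay.ofReal_mul {M' : ℝ} (hf : HasDecay f ε M) {φ : Vel → ℝ} {φ' : Vel → Vel →L[ℝ] ℝ}
    (hφ : ∀ v, HasFDerivAt φ (φ' v) v) (hC : 0 ≤ C)
    (hb : ∀ v, (|φ v| + ‖φ' v‖) * jb v ^ (-M) ≤ C * jb v ^ (-M')) :
    HasDecay (fun v => ((φ v : ℝ) : ℂ) * f v) (C * ε) M' := by
  have hε := hf.nonneg
  have hd v := (ofRealCLM.hasFDerivAt.comp v (hφ v)).mul (hf.diff v).hasFDerivAt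
  have hle v : |φ v| * (ε * jb v ^ (-M)) + ε * jb v ^ (-M) * ‖φ' v‖ ≤ C * ε * jb v ^ (-M') := by
    linarith [mul_le_mul_of_nonneg_left (hb v) hε]
  refine ⟨by positivity, fun v => (hd v).differentiableAt, fun v => ?_, fun v => ?_⟩
  · rw [norm_mul, norm_real, norm_eq_abs]; have := jb_rpow_pos (-M) v
    exact (mul_le_mul_of_nonneg_left (hf.bound v) pos!).trans
      ((le_add_of_nonneg_right pos!).trans (hle v))
  · refine (congr_arg norm (hd v).fderiv).trans_le ((norm_add_le _ _).trans (le_trans ?_ (hle v)))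
    rw [norm_smul, norm_smul]
    exact add_le_add (mul_le_mul (by simp) (hf.bound_fderiv v) pos! pos!) (mul_le_mul (hf.bound v)
      ((opNorm_comp_le _ _).trans (by simp)) pos! ((norm_nonneg _).trans (hf.bound v)))

lemma HasDecay.weight (hf : HasDecay f ε M) (ha : 0 ≤ a) :
    HasDecay (fun v => jbC v a * f v) ((a + 1) * ε) (M - a) := by
  refine hf.ofReal_mul (fun v => (hasFDerivAt_jb v).rpow_const (Or.inl (jb_pos v).ne')) pos!
    fun v => ?_
  have h1 := jb_rpow_pos a v; have h2 := jb_pos v; have h3 := jb_rpow_pos (a - 1) v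
  have hn : ‖(a * jb v ^ (a - 1)) • ((jb v)⁻¹ • innerSL ℝ v)‖ ≤ a * jb v ^ a := by
    rw [norm_smul, norm_smul, innerSL_apply_norm, norm_of_nonneg pos!, norm_of_nonneg pos!]
    calc _ ≤ a * jb v ^ a * ((jb v)⁻¹ * jb v) := by
          gcongr; exacts [one_le_jb v, by linarith, norm_le_jb v]
      _ = _ := by rw [inv_mul_cancel₀ h2.ne', mul_one]
  rw [show -(M - a) = a + -M by ring, rpow_add h2, ← mul_assoc, abs_of_pos h1]
  exact mul_le_mul_of_nonneg_right lin! (jb_rpow_pos _ v).le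

lemma HasDecay.mono {M' : ℝ} (hf : HasDecay f ε M) (h : M' ≤ M) : HasDecay f ε M' := by
  have : ∀ v, ε * jb v ^ (-M) ≤ ε * jb v ^ (-M') := fun v => mul_le_mul_of_nonneg_left
    (jb_rpow_mono lin! v) hf.nonneg
  exact ⟨hf.nonneg, hf.diff, fun v => (hf.bound v).trans (this v),
    fun v => (hf.bound_fderiv v).trans (this v)⟩

lemma HasDecay.tripleSq_le (hf : HasDecay f ε M) (hs0 : 0 ≤ s)
    (hs1 : s ≤ 1) (hγ : 0 ≤ γ) (hM : 3 + γ / 2 ≤ M) :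
    tripleSq s γ f ≤ ofR (800 * ((γ / 2 + 1) * ε * jbN) ^ 2) := by
  have h1 : HasDecay (fun v => jbC v (γ / 2) * f v) ((γ / 2 + 1) * ε) 3 :=
    (hf.weight pos!).mono lin!
  exact (tripleSq_le_tripQ hs0 h1.memLp).trans (h1.tripQ_le hs1)

lemma HasDecay.lintegral_weight_le (hf : HasDecay f ε M) (hM : 2 + w ≤ M) :
    ∫⁻ v, ofR (jb v ^ (2 * w)) * ‖f v‖ₑ ^ 2 ≤ ofR ((ε * jbN) ^ 2) := by
  simp_rw [← enorm_sq_weight]; refine lintegral_enorm_sq_le (.of_forall fun v => ?_)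
  rw [norm_mul, norm_real, norm_of_nonneg (jb_rpow_pos w v).le]; have h1 := jb_rpow_pos w v
  have hε := hf.nonneg
  calc _ ≤ jb v ^ w * (ε * jb v ^ (-M)) := by gcongr; exact hf.bound v
    _ = ε * jb v ^ (w - M) := by rw [sub_eq_add_neg, rpow_add (jb_pos v)]; ring
    _ ≤ _ := by
      gcongr
      · exact one_le_jb v
      · linarith

/-! ### Adjoints of the windowed Fourier transform -/

/-- The indicator function of a ball in phase space. -/
def ballSym (R : ℝ) (Y : Ph) : ℂ := (Metric.closedBall (0 : Ph) R).indicator 1 Y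

lemma measurable_ballSym (R : ℝ) : Measurable (ballSym R) :=
  measurable_one.indicator Metric.isClosed_closedBall.measurableSet

lemma norm_ballSym_le (R : ℝ) (Y : Ph) : ‖ballSym R Y‖ ≤ 1 := by
  rw [ballSym, norm_indicator_eq_indicator_norm]
  exact indicator_le' (fun _ _ => by simp) (fun _ _ => zero_le_one) Y

lemma ballSym_of_le (h : ‖Y‖ ≤ R) : ballSym R Y = 1 := by
  rw [ballSym, indicator_of_mem (by simpa using h), Pi.one_apply]

lemma ballSym_of_lt (h : R < ‖Y‖) : ballSym R Y = 0 := by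
  rw [ballSym, indicator_of_notMem (by simpa using h)]

/-- The square root of the volume of a ball in phase space. -/
def phC (R : ℝ) : ℝ := ((volume (Metric.closedBall (0 : Ph) R)) ^ (1 / 2 : ℝ)).toReal

lemma ballSym_mul_eq_indicator (R : ℝ) (x : Ph → ℂ) :
    (fun Y => ballSym R Y * x Y) = (Metric.closedBall (0 : Ph) R).indicator x := by
  ext Y; by_cases h : Y ∈ Metric.closedBall (0 : Ph) R
  · rw [ballSym, indicator_of_mem h, indicator_of_mem h, Pi.one_apply, one_mul]
  · rw [ballSym, indicator_of_notMem h, indicator_of_notMem h, zero_mul]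

lemma integrable_ballSym_mul (R : ℝ) (x : L2p) : Integrable fun Y => ballSym R Y * x Y := by
  rw [ballSym_mul_eq_indicator]
  exact (integrable_indicator_iff Metric.isClosed_closedBall.measurableSet).2
    (integrableOn_Lp_of_measure_ne_top x num! (isCompact_closedBall _ _).measure_lt_top.ne)

lemma integral_norm_ballSym_mul_le (R : ℝ) (x : L2p) : ∫ Y, ‖ballSym R Y * x Y‖ ≤ phC R * ‖x‖ := by
  have hB := (isCompact_closedBall (0 : Ph) R).measure_lt_top (μ := volume)
  have e1 : ∫ Y, ‖ballSym R Y * x Y‖ =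
      (eLpNorm x 1 (volume.restrict (Metric.closedBall (0 : Ph) R))).toReal := by
    have h : ∀ Y, ballSym R Y * x Y = _ := congr_fun (ballSym_mul_eq_indicator R x)
    simp only [h, norm_indicator_eq_indicator_norm]
    rw [integral_indicator Metric.isClosed_closedBall.measurableSet,
      integral_norm_eq_lintegral_enorm (Lp.aestronglyMeasurable x).restrict,
      eLpNorm_one_eq_lintegral_enorm]
  have h2 := eLpNorm_le_eLpNorm_mul_rpow_measure_univ (p := 1) (q := 2) num!
    ((Lp.aestronglyMeasurable x).restrict (s := Metric.closedBall (0 : Ph) R))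
  rw [e1, phC, Lp.norm_def, ← toReal_mul]
  refine toReal_mono (mul_lt_top (rpow_lt_top_of_nonneg num! hB.ne) (Lp.memLp x).2).ne (h2.trans ?_)
  rw [mul_comm, Measure.restrict_apply_univ]; norm_num; gcongr; exact Measure.restrict_le_self

lemma adjoint_winOp_ae (hm : IsWin m A) (R : ℝ) (x : L2p) :
    (adjoint (winOp m)) (mulOp volume (ballSym R) x) =ᵐ[volume]
      fun v => ∫ Y, ((((2 * π) ^ (-(3 / 2) : ℝ) * m Y.1 v : ℝ) : ℂ) *
        eI v Y.2) * (ballSym R Y * x Y) := by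
  set K : Vel × Ph → ℂ := fun p => ((((2 * π) ^ (-(3 / 2) : ℝ) * m p.2.1 p.1 : ℝ) :
    ℂ) * eI p.1 p.2.2) * (ballSym R p.2 * x p.2) with hK
  have hint : ∀ s : Set Vel, MeasurableSet s → volume s < ⊤ →
      Integrable K ((volume.restrict s).prod volume) := fun s hs hμ => by
    have : IsFiniteMeasure (volume.restrict s) := ⟨by simpa using hμ⟩
    have hsw : Integrable (fun p : Ph × Vel => K p.swap)
        ((volume : Measure Ph).prod (volume.restrict s)) := by
      have hm2 y : Integrable fun v => m y v ^ 2 := by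
        simpa only [norm_real, norm_eq_abs, sq_abs] using (hm.memLp_right y).norm.integrable_sq
      refine integrable_prod_of_bound (Φ := fun Y => ‖ballSym R Y * x Y‖)
        (Ψ := fun Y v => 1 + m Y.1 v ^ 2) (C := volume.real s + A ^ 2) ?_
        (fun _ => norm_nonneg _) (integrable_ballSym_mul R x).norm
        (fun Y => (integrable_const _).add (hm2 Y.1).restrict) (fun Y => ?_) fun Y v => ?_
      · have h1 : Measurable fun p : Ph × Vel => m p.1.1 p.2 := hm.meas.comp
          ((measurable_fst.comp (measurable_fst :
            Measurable (Prod.fst : Ph × Vel → Ph))).prodMk measurable_snd)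
        have h2 : AEStronglyMeasurable (fun p : Ph × Vel => ballSym R p.1 * x p.1)
            ((volume : Measure Ph).prod (volume.restrict s)) :=
          (integrable_ballSym_mul R x).1.comp_fst
        refine AEStronglyMeasurable.mul ((Measurable.mul (measurable_ofReal.comp
          (h1.const_mul _)) ?_).aestronglyMeasurable) h2
        exact Continuous.measurable (by simp only [Prod.fst_swap, Prod.snd_swap]; fun_prop)
      · have h1 := hm2 Y.1
        rw [integral_add (integrable_const _) h1.restrict, integral_const, smul_eq_mul, mul_one,
          measureReal_restrict_apply_univ]
        gcongr; refine (setIntegral_le_integral h1 (.of_forall fun v => sq_nonneg _)).trans ?_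
        rw [integral_eq_lintegral_of_nonneg_ae (.of_forall fun v => sq_nonneg _) h1.1]
        refine toReal_le_of_le_ofReal pos! (le_trans (le_of_eq ?_) (hm.lintegral_right Y.1))
        refine lintegral_congr fun v => ?_; rw [← ofReal_norm_sq, norm_eq_abs, sq_abs]
      · simp only [hK, Prod.swap_prod_mk]
        rw [norm_mul, norm_mul, norm_exp, norm_real, norm_mul, norm_of_nonneg pos!]
        have e : (I * (inner ℝ v Y.2 : ℂ)).re = 0 := by simp
        rw [e, exp_zero, mul_one, mul_comm, norm_eq_abs]; have h1 := two_pi_rpow_le_one; gcongr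
        calc _ ≤ 1 * |m Y.1 v| := by gcongr
          _ ≤ _ := by nlinarith [sq_abs (m Y.1 v), sq_nonneg (|m Y.1 v| - 1)]
    exact hsw.swap
  refine ae_eq_of_forall_setIntegral_eq_of_sigmaFinite (fun s hs hμ => ?_) (fun s hs hμ => ?_)
    fun s hs hμ => ?_
  · exact integrableOn_Lp_of_measure_ne_top _ num! hμ.ne
  · exact (hint s hs hμ).integral_prod_left
  · rw [← L2.inner_indicatorConstLp_one (𝕜 := ℂ) hs hμ.ne, adjoint_inner_right, inner_eq_integral]
    refine Eq.trans ?_ (integral_integral_swap (f := fun v Z => K (v, Z)) (hint s hs hμ)).symm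
    refine integral_congr_ae ?_
    filter_upwards [coeFn_winOp hm (indicatorConstLp 2 hs hμ.ne (1 : ℂ)),
      coeFn_mulOp (measurable_ballSym R) (norm_ballSym_le R) x] with Z h1 h2
    rw [h1, h2]; simp only [hK]; rw [integral_mul_const]; congr 1
    rw [winFun_congr _ (indicatorConstLp_coeFn (p := 2) (hs := hs) (hμs := hμ.ne) (c := (1 : ℂ))),
      winFun, map_mul, conj_ofReal, expInt, ← integral_conj, ← integral_indicator hs,
      ← integral_const_mul]
    refine integral_ext fun v => ?_; by_cases hv : v ∈ s
    · rw [indicator_of_mem hv, indicator_of_mem hv, mul_one, map_mul, ← exp_conj,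
        conj_ofReal, map_mul, map_neg, conj_I, conj_ofReal, neg_neg]
      push_cast; ring
    · rw [indicator_of_notMem hv, indicator_of_notMem hv]; simp

/-- The operator that superposes coherent states with a density supported in a ball. -/
def synthOp (R : ℝ) : L2p →L[ℂ] L2v := adjoint (winOp (wwin 0)) ∘L mulOp volume (ballSym R)

lemma coeFn_synthOp (R : ℝ) (x : L2p) :
    synthOp R x =ᵐ[volume] synth fun Y => ballSym R Y * x Y := by
  refine (adjoint_winOp_ae (isWin_wwin 0) R x).trans (.of_forall fun v => ?_); simp only [wwin_zero]
  rfl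

/-- The window `1_{|y| ≤ R} (k·v) g(v - y)`. -/
def kwin (k : ℤ³) (R : ℝ) (y v : Vel) : ℝ := ballInd R y * (inner ℝ (freq k) v * gauss (v - y))

lemma exists_isWin_kwin (k : ℤ³) (hR : 0 ≤ R) : ∃ A, IsWin (kwin k R) A := by
  set c := ‖freq k‖ * ((R + 1) * exp 1) with hc
  have hL := (memLp_gaussian (b := 1 / 4) num!).const_mul c
  refine ⟨sqrt (∫⁻ x : Vel, ‖c * exp (-(1 / 4) * ‖x‖ ^ 2)‖ₑ ^ 2).toReal, ?_,
    sqrt_nonneg _, fun x : Vel => c * exp (-(1 / 4) * ‖x‖ ^ 2),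
    Continuous.measurable (by fun_prop), fun y v => ?_, ?_⟩
  · have h1 : Measurable fun p : Ph => ballInd R p.1 := (measurable_ballInd R).comp measurable_fst
    have hg := continuous_gauss; exact h1.mul (Continuous.measurable (by fun_prop))
  · rw [kwin]; by_cases hy : ‖y‖ ≤ R
    · rw [ballInd, indicator_of_mem (by simpa using hy), one_mul, abs_mul,
        abs_of_nonneg (gauss_nonneg _)]
      set r := ‖v - y‖ with hr
      have h1 : |inner ℝ (freq k) v| ≤ ‖freq k‖ * ((R + 1) * exp r) := by
        refine (abs_real_inner_le_norm _ _).trans (mul_le_mul_of_nonneg_left ?_ pos!)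
        have h2 : ‖v‖ ≤ r + ‖y‖ := by simpa using norm_add_le (v - y) y
        nlinarith [add_one_le_exp r, exp_pos r, norm_nonneg (v - y)]
      have h3 : gauss (v - y) ≤ exp (-r ^ 2 / 2) :=
        mul_le_of_le_one_left (exp_pos _).le pi_rpow_le_one
      calc _ ≤ ‖freq k‖ * ((R + 1) * exp r) * exp (-r ^ 2 / 2) := by gcongr; exact gauss_nonneg _
        _ = ‖freq k‖ * (R + 1) * exp (r + -r ^ 2 / 2) := by rw [exp_add]; ring
        _ ≤ ‖freq k‖ * (R + 1) * exp (1 + -(1 / 4) * r ^ 2) := by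
            refine mul_le_mul_of_nonneg_left (exp_le_exp.2 ?_) pos!; nlinarith [sq_nonneg (r - 2)]
        _ = _ := by rw [exp_add, hc]; ring
    · rw [ballInd, indicator_of_notMem (by simpa using hy), zero_mul, abs_zero]; positivity
  · rw [sq_sqrt toReal_nonneg, ofReal_toReal]; exact (lintegral_lt_top_of_memLp hL).ne

/-- The composition of `synthOp` with the multiplication by `k·v`. -/
def synthOpK (k : ℤ³) (R : ℝ) : L2p →L[ℂ] L2v :=
  adjoint (winOp (kwin k R)) ∘L mulOp volume (ballSym R)

lemma coeFn_synthOpK (k : ℤ³) (hR : 0 ≤ R) (x : L2p) : synthOpK k R x =ᵐ[volume]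
      fun v => (inner ℝ (freq k) v : ℂ) * synth (fun Y => ballSym R Y * x Y) v := by
  obtain ⟨A, hA⟩ := exists_isWin_kwin k hR
  refine (adjoint_winOp_ae hA R x).trans (.of_forall fun v => ?_); simp only [synth]
  rw [← integral_const_mul]; refine integral_ext fun Y => ?_; rcases le_or_gt ‖Y‖ R with h | h
  · rw [kwin, ballInd, indicator_of_mem (by simpa using (norm_fst_le Y).trans h)]; push_cast; ring
  · rw [ballSym_of_lt h]; ring

lemma contDiff_synth_ballSym (R : ℝ) (x : L2p) : ContDiff ℝ ∞ (synth fun Y => ballSym R Y * x Y) :=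
  contDiff_synth (R := R) (integrable_ballSym_mul R x) fun Y h => by rw [ballSym_of_lt h, zero_mul]

lemma hasDecay_synth (hR : 0 ≤ R) (hM : 0 ≤ M) (x : L2p) :
    HasDecay (synth fun Y => ballSym R Y * x Y) (decC M R * phC R * ‖x‖) M := by
  have h0 : ∀ Y, R < ‖Y‖ → ballSym R Y * x Y = 0 := fun Y h => by rw [ballSym_of_lt h, zero_mul]
  have h := norm_synth_le (integrable_ballSym_mul R x) h0 hR hM
  have hC : 0 ≤ decC M R := by unfold decC; positivity
  have hle : ∀ v, decC M R * (∫ Y, ‖ballSym R Y * x Y‖) * jb v ^ (-M) ≤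
      decC M R * phC R * ‖x‖ * jb v ^ (-M) := fun v => by
    refine mul_le_mul_of_nonneg_right ?_ (jb_rpow_pos (-M) v).le; rw [mul_assoc]
    exact mul_le_mul_of_nonneg_left (integral_norm_ballSym_mul_le R x) hC
  refine ⟨mul_nonneg (mul_nonneg hC toReal_nonneg) pos!,
    (contDiff_synth_ballSym R x).differentiable (by simp), fun v => (h v).1.trans (hle v),
    fun v => (h v).2.trans (hle v)⟩

/-! ### Cutoff functions -/

/-- A smooth bump function. -/
def velBump : ContDiffBump (0 : Vel) := ⟨1, 2, one_pos, one_lt_two⟩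

/-- A smooth cutoff at the scale `n + 1`. -/
def cutFun (n : ℕ) (v : Vel) : ℝ := velBump (((n : ℝ) + 1)⁻¹ • v)

lemma contDiff_cutFun (n : ℕ) : ContDiff ℝ ∞ (cutFun n) :=
  velBump.contDiff.comp (contDiff_const_smul _)

lemma hasCompactSupport_cutFun (n : ℕ) : HasCompactSupport (cutFun n) :=
  velBump.hasCompactSupport.comp_homeomorph (Homeomorph.smulOfNeZero (((n : ℝ) + 1)⁻¹) pos!)

lemma exists_hasDecay_cutFun : ∃ K : ℝ, 0 ≤ K ∧ ∀ (n : ℕ) (f : Vel → ℂ) (ε M : ℝ),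
    HasDecay f ε (M + 1) → HasDecay (fun v => f v - (cutFun n v : ℂ) * f v)
      (K * ε / (n + 1)) M := by
  have hb1 : ContDiff ℝ ∞ (velBump : Vel → ℝ) := velBump.contDiff
  obtain ⟨K, hK⟩ := (hb1.continuous_fderiv (by simp)).bounded_above_of_compact_support
    (velBump.hasCompactSupport.fderiv (𝕜 := ℝ))
  have hK0 : 0 ≤ K := (norm_nonneg _).trans (hK 0)
  refine ⟨K + 1, by positivity, fun n f ε M hf => ?_⟩; have hε := hf.nonneg
  have hn : (0 : ℝ) < (n : ℝ) + 1 := by positivity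
  have hcd v : HasFDerivAt (fun v => 1 - cutFun n v) (-(((n : ℝ) + 1)⁻¹ •
      fderiv ℝ (velBump : Vel → ℝ) (((n : ℝ) + 1)⁻¹ • v))) v := by
    have h1 := (hb1.differentiable (by simp) (((n : ℝ) + 1)⁻¹ • v)).hasFDerivAt
    have h2 := h1.comp v ((hasFDerivAt_id v).const_smul (((n : ℝ) + 1)⁻¹))
    refine (h2.const_sub 1).congr_fderiv ?_; ext z; simp
  have key := hf.ofReal_mul hcd (C := (K + 1) / (n + 1)) (M' := M) pos! fun v => ?_
  · convert key using 1
    · ext v; push_cast; ring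
    · ring
  have h4 := jb_rpow_pos (-M) v; have h8 : 0 ≤ cutFun n v := velBump.nonneg
  have h9 : cutFun n v ≤ 1 := velBump.le_one
  have hw : (1 - cutFun n v) * jb v ^ (-(M + 1)) ≤ ((n : ℝ) + 1)⁻¹ * jb v ^ (-M) := by
    rcases le_or_gt ‖v‖ ((n : ℝ) + 1) with h | h
    · have : cutFun n v = 1 := by
        refine velBump.one_of_mem_closedBall ?_
        rw [mem_closedBall_zero_iff, norm_smul, norm_of_nonneg pos!]; change _ ≤ (1 : ℝ)
        rwa [inv_mul_le_iff₀ hn, mul_one]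
      rw [this, sub_self, zero_mul]; positivity
    · rw [neg_add_rev, rpow_add (jb_pos v), rpow_neg_one]
      refine (mul_le_of_le_one_left (by have := jb_pos v; positivity) lin!).trans ?_; gcongr
      exact h.le.trans (norm_le_jb v)
  have h5 := jb_rpow_mono (by linarith : -(M + 1) ≤ -M) v
  rw [norm_neg, norm_smul, norm_of_nonneg pos!, abs_of_nonneg lin!, add_mul]
  have h6 := hK (((n : ℝ) + 1)⁻¹ • v); have h7 := jb_rpow_pos (-(M + 1)) v
  calc _ ≤ ((n : ℝ) + 1)⁻¹ * jb v ^ (-M) + ((n : ℝ) + 1)⁻¹ * K * jb v ^ (-M) := by gcongr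
    _ = _ := by ring

/-! ### Norms of single modes -/

/-- The constant in the bounds for norms of modes with decay. -/
def decK (γ : ℝ) : ℝ := (29 * (γ / 2 + 1) + 1) * jbN

lemma decK_nonneg (hγ : 0 ≤ γ) : 0 ≤ decK γ := mul_nonneg pos! jbN_nonneg

lemma coeFn_modeOp_congr (k : ℤ³) {g : L2v} (h : g =ᵐ[volume] f) :
    modeOp k g =ᵐ[volume] modeFun k f := by
  have h2 : ∀ᵐ z : Torus × Vel, g z.2 = f z.2 :=
    (Measure.quasiMeasurePreserving_snd (μ := (volume : Measure Torus)) (ν := volV)).ae h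
  filter_upwards [coeFn_modeOp k g, h2] with z h1 h2; rw [h1, modeFun, modeFun, h2]

lemma enorm_le_ofReal_of_sq_le {a : ℝ≥0∞} (hb : 0 ≤ b) (h : a ^ 2 ≤ ofR (b ^ 2)) : a ≤ ofR b :=
  enorm_le_of_sq_le (by rwa [← ofReal_pow hb])

lemma norms_modeOp_le (hs0 : 0 ≤ s) (hs1 : s ≤ 1) (hγ : 0 ≤ γ) (k : ℤ³)
    {g : L2v} (hg : g =ᵐ[volume] f) (hf : HasDecay f ε M)
    (hM : 3 + γ / 2 + |w| ≤ M) :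
    ‖modeOp k g‖ ≤ decK γ * ε ∧
      tripleNorm s γ (modeOp k g) + weightNorm w (modeOp k g) ≤ ofR (decK γ * ε) := by
  have hε := hf.nonneg; have hN := jbN_nonneg; have hw := le_abs_self w; have hw0 := abs_nonneg w
  have hz : ∀ l, l ≠ k → coefX l (modeOp k g) = 0 := fun l hl => by rw [coefX_modeOp, if_neg hl]
  have hk : coefX k (modeOp k g) = g := by rw [coefX_modeOp, if_pos rfl]
  have h0 : HasDecay (fun _ => 0) 0 (3 + γ / 2) :=
    ⟨le_rfl, differentiable_const _, fun v => by simp, fun v => by simp⟩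
  have t1 : tripleNorm s γ (modeOp k g) ≤ ofR (29 * ((γ / 2 + 1) * ε * jbN)) := by
    refine enorm_le_ofReal_of_sq_le pos! ?_
    rw [tripleNorm_sq hs0, tsum_eq_single k, hk, tripleSq_congr s γ hg]
    · refine (hf.tripleSq_le hs0 hs1 hγ lin!).trans (ofReal_le_ofReal ?_)
      nlinarith [sq_nonneg ((γ / 2 + 1) * ε * jbN)]
    · intro l hl; rw [hz l hl, tripleSq_congr s γ (Lp.coeFn_zero ℂ 2 volume)]
      have := h0.tripleSq_le hs0 hs1 hγ le_rfl
      simp only [mul_zero, zero_mul, ne_eq, OfNat.ofNat_ne_zero, not_false_eq_true, zero_pow,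
        ENNReal.ofReal_zero, nonpos_iff_eq_zero] at this
      exact this
  have t2 : weightNorm w (modeOp k g) ≤ ofR (ε * jbN) := by
    refine enorm_le_ofReal_of_sq_le pos! ?_; rw [weightNorm_sq, tsum_eq_single k, hk]
    · refine le_trans (le_of_eq (lintegral_congr_ae ?_)) (hf.lintegral_weight_le (w := w) lin!)
      filter_upwards [hg] with v hv; rw [hv]
    · intro l hl; rw [hz l hl, lintegral_congr_ae (g := fun _ => 0)]
      · simp
      · filter_upwards [Lp.coeFn_zero ℂ 2 volV] with v hv; rw [hv]; simp
  refine ⟨?_, ?_⟩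
  · rw [LinearIsometry.norm_map]; have := norm_le_mul_jbN (f := g) (K := ε) hε ?_
    · refine this.trans ?_; rw [decK]
      nlinarith [mul_nonneg hε hN, mul_nonneg (mul_nonneg hε hN) hγ]
    · filter_upwards [hg] with v hv; rw [hv]
      exact (hf.bound v).trans (mul_le_mul_of_nonneg_left (jb_rpow_mono lin! v) hε)
  · refine (add_le_add t1 t2).trans ?_; rw [← ofReal_add pos! pos!, decK]
    exact ofReal_le_ofReal (by nlinarith)

lemma IsTransportSolution.exists_source_bound (hF : IsTransportSolution s γ w T h F) :
    ∃ m : ℝ → ℝ, IntegrableOn m (Ioo 0 T) ∧ (∀ t, 0 ≤ m t) ∧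
      ∀ᵐ t ∂volT T, ∀ (u : L2xv) (δ : ℝ), ‖u‖ ≤ δ →
        tripleNorm s γ u + weightNorm w u ≤ ofR δ → ‖F t u‖ ≤ m t * δ := by
  obtain ⟨m₀, m₁, h0, h1, i0, i1, hb⟩ := hF.source_bound
  refine ⟨fun t => (m₀ t : ℝ) + (m₁ t : ℝ), Integrable.add ?_ ?_, fun t => by positivity, ?_⟩
  · exact ⟨h0.coe_nnreal_real.aestronglyMeasurable, by simpa [HasFiniteIntegral] using i0⟩
  · have : MemLp (fun t => (m₁ t : ℝ)) 2 (volT T) :=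
      memLp_two_of_lintegral h1.coe_nnreal_real.aestronglyMeasurable (by simpa using i1)
    exact this.integrable num!
  · filter_upwards [hb] with t ht u δ hu hN; have hδ : 0 ≤ δ := (norm_nonneg _).trans hu
    have hlt := hN.trans_lt ofReal_lt_top
    have := ht u (le_self_add.trans_lt hlt) (le_add_self.trans_lt hlt)
    rw [← ofReal_le_ofReal_iff pos!, ofReal_norm]; refine this.trans ?_
    have e : ofR (((m₀ t : ℝ) + m₁ t) * δ) = m₀ t * ofR δ + m₁ t * ofR δ := by
      rw [ofReal_mul pos!, ofReal_add pos! pos!, ofReal_coe_nnreal, ofReal_coe_nnreal, add_mul]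
    rw [e]; gcongr; rw [← ofReal_norm]; exact ofReal_le_ofReal hu

/-! ### Test functions with a single mode -/

lemma torusChar_coe (k : ℤ³) (y : Fin 3 → ℝ) : torusChar k (fun j => (y j : AddCircle (2 * π))) =
      cexp (I * ((∑ j, (k j : ℝ) * y j : ℝ) : ℂ)) := by
  rw [torusChar_apply]; simp only [fourier_coe_apply]; rw [← exp_sum]; congr 1; push_cast
  rw [mul_sum]; refine sum_congr rfl fun j _ => ?_
  have : (π : ℂ) ≠ 0 := ofReal_ne_zero.2 pi_ne_zero; field_simp

lemma torusChar_add_arg (k : ℤ³) (x y : Torus) :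
    torusChar k (fun j => x j + y j) = torusChar k x * torusChar k y := by
  simp only [torusChar_apply, fourier_apply, smul_add, AddCircle.toCircle_add, Circle.coe_mul,
    prod_mul_distrib]

lemma inner_freq (k : ℤ³) (v : Vel) : inner ℝ (freq k) v = ∑ j, (k j : ℝ) * v j := by
  simp [freq, PiLp.inner_apply, mul_comm]

lemma isTest_mode (hρ : IsTimeTest T ρ) (k : ℤ³) (hg : ContDiff ℝ ∞ g) (hgc : HasCompactSupport g) :
    IsTest T fun p : ℝ × Torus × Vel => (ρ p.1 : ℂ) * modeFun k g p.2 := by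
  have hsub : Function.support (fun p : ℝ × Torus × Vel => (ρ p.1 : ℂ) * modeFun k g p.2) ⊆
      tsupport ρ ×ˢ (univ ×ˢ tsupport g) := fun p hp => by
    rw [Function.mem_support] at hp
    refine ⟨subset_tsupport _ fun h => hp (by rw [h]; simp), mem_univ _,
      subset_tsupport _ fun h => hp (by rw [modeFun, h]; simp)⟩
  have hK : IsCompact (tsupport ρ ×ˢ ((univ : Set Torus) ×ˢ tsupport g)) :=
    hρ.compact.isCompact.prod (isCompact_univ.prod hgc.isCompact)
  refine ⟨?_, HasCompactSupport.of_support_subset_isCompact hK hsub, fun p hp =>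
    hρ.support ((closure_minimal hsub hK.isClosed) hp).1⟩
  have e : (fun p : ℝ × (Fin 3 → ℝ) × Vel =>
      (ρ p.1 : ℂ) * modeFun k g ((fun j => (p.2.1 j : AddCircle (2 * π))), p.2.2)) =
      fun p => ((ρ p.1 : ℝ) : ℂ) * (((torusNorm : ℂ) * cexp (I *
        ((∑ j, (k j : ℝ) * p.2.1 j : ℝ) : ℂ))) * g p.2.2) := funext fun p => by
    rw [modeFun, torusChar_coe]
  rw [e]
  have h1 : ContDiff ℝ ∞ fun p : ℝ × (Fin 3 → ℝ) × Vel => ((ρ p.1 : ℝ) : ℂ) :=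
    ofRealCLM.contDiff.comp (hρ.smooth.comp contDiff_fst)
  have h2 : ContDiff ℝ ∞ fun p : ℝ × (Fin 3 → ℝ) × Vel => g p.2.2 :=
    hg.comp (contDiff_snd.comp contDiff_snd)
  have h0 : ContDiff ℝ ∞ fun p : ℝ × (Fin 3 → ℝ) × Vel => ∑ j, (k j : ℝ) * p.2.1 j :=
    ContDiff.sum fun j _ => contDiff_const.mul
      ((contDiff_apply ℝ ℝ j).comp (contDiff_fst.comp contDiff_snd))
  have h3 : ContDiff ℝ ∞ fun p : ℝ × (Fin 3 → ℝ) × Vel => ((∑ j, (k j : ℝ) * p.2.1 j : ℝ) : ℂ) :=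
    ofRealCLM.contDiff.comp h0
  exact h1.mul ((contDiff_const.mul (contDiff_const.mul h3).cexp).mul h2)

lemma transport_mode (hρ : IsTimeTest T ρ) (k : ℤ³) (g : Vel → ℂ) (t : ℝ) (z : Torus × Vel) :
    transport (fun p : ℝ × Torus × Vel => (ρ p.1 : ℂ) * modeFun k g p.2) (t, z) =
      (((deriv ρ t : ℝ) : ℂ) + I * (inner ℝ (freq k) z.2 : ℂ) * ρ t) * modeFun k g z := by
  rw [transport]
  have e : (fun τ : ℝ => ((ρ (t + τ) : ℝ) : ℂ) * modeFun k g
      ((fun j => z.1 j + ((τ * z.2 j : ℝ) : AddCircle (2 * π))), z.2)) =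
      fun τ : ℝ => ((ρ (t + τ) : ℝ) : ℂ) *
        (cexp (I * (inner ℝ (freq k) z.2 : ℂ) * τ) * modeFun k g z) :=
    funext fun τ => by
      rw [modeFun, modeFun]; simp only
      rw [torusChar_add_arg k z.1 (fun j => ((τ * z.2 j : ℝ) : AddCircle (2 * π))),
        torusChar_coe k fun j => τ * z.2 j, inner_freq]
      have : I * ((∑ j, (k j : ℝ) * z.2 j : ℝ) : ℂ) * (τ : ℂ) =
          I * ((∑ j, (k j : ℝ) * (τ * z.2 j) : ℝ) : ℂ) := by
        push_cast; rw [mul_assoc, sum_mul]; congr 1; refine sum_congr rfl fun j _ => by ring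
      rw [this]; ring
  refine (congr_arg (fun f => deriv f 0) e).trans ?_; set c := I * (inner ℝ (freq k) z.2 : ℂ)
  have d1 : HasDerivAt (fun τ : ℝ => ((ρ (t + τ) : ℝ) : ℂ)) ((deriv ρ t : ℝ) : ℂ) 0 := by
    have := (hρ.hasDerivAt (t + 0)).comp_const_add t 0; rw [add_zero] at this
    exact this.ofReal_comp
  have d2 : HasDerivAt (fun τ : ℝ => cexp (c * τ)) c 0 := by
    have := ((ofRealCLM.hasDerivAt (x := (0 : ℝ))).const_mul c).cexp; simpa using this
  have d3 := d1.mul (d2.mul_const (modeFun k g z)); refine (HasDerivAt.deriv d3).trans ?_; simp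
  ring

lemma IsTransportSolution.mode_eq (hF : IsTransportSolution s γ w T h F) (hρ : IsTimeTest T ρ) (k : ℤ³)
    (hg : ContDiff ℝ ∞ g) (hgc : HasCompactSupport g) {G G' : L2v}
    (hG : G =ᵐ[volume] g)
    (hG' : G' =ᵐ[volume] fun v => (inner ℝ (freq k) v : ℂ) * g v) :
    ∫ t in Ioo 0 T, ρ t • F t (modeOp k G) = -∫ t in Ioo 0 T, (deriv ρ t • inn G (coefX k (h t)) -
        I * ρ t • inn G' (coefX k (h t))) := by
  have key := hF.equation _ (fun t => (ρ t : ℂ) • modeOp k G) (isTest_mode hρ k hg hgc) fun t => by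
    filter_upwards [Lp.coeFn_smul (ρ t : ℂ) (modeOp k G), coeFn_modeOp_congr k hG] with z h1 h2
    rw [h1, Pi.smul_apply, h2, smul_eq_mul]
  simp only [map_smulₛₗ, conj_ofReal] at key
  refine Eq.trans (integral_ext fun t => ?_) (key.trans (congr_arg Neg.neg
    (integral_ext fun t => ?_)))
  · simp
  · have hi (f u : L2xv) : Integrable fun z => conj (f z) * u z := by
      simpa [mul_comm] using L2.integrable_inner (𝕜 := ℂ) f u
    rw [inner_coefX, inner_coefX, inner_eq_integral, inner_eq_integral, real_smul,
      real_smul, ← integral_const_mul, ← integral_const_mul, ← integral_const_mul,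
      ← integral_sub ((hi _ _).const_mul _) (((hi _ _).const_mul _).const_mul _)]
    refine integral_congr_ae ?_
    filter_upwards [coeFn_modeOp_congr k hG, coeFn_modeOp_congr k hG'] with z h1 h2
    rw [h1, h2, transport_mode hρ, map_mul, map_add, map_mul, map_mul, conj_I,
      conj_ofReal, conj_ofReal, conj_ofReal]
    simp only [modeFun, map_mul, conj_ofReal]; ring

/-! ### Weak derivatives of the coefficients of a solution -/

lemma aesm_inner_coefX (hF : IsTransportSolution s γ w T h F) (k : ℤ³) (G : L2v) :
    AEStronglyMeasurable (fun t => inn G (coefX k (h t))) (volT T) :=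
  ((innerSL ℂ G).comp (coefX k)).continuous.comp_aestronglyMeasurable hF.meas

lemma norm_coefX_le (k : ℤ³) (u : L2xv) : ‖coefX k u‖ ≤ ‖u‖ := by
  have h := (hasSum_coefX u).summable.le_tsum k fun _ _ => sq_nonneg _
  rw [(hasSum_coefX u).tsum_eq] at h
  exact (pow_le_pow_iff_left₀ (norm_nonneg _) (norm_nonneg _) two_ne_zero).1 h

lemma norm_inner_coefX_le (k : ℤ³) (G : L2v) {u : L2xv} (hS : ‖u‖ ≤ S) :
    ‖inn G (coefX k u)‖ ≤ ‖G‖ * S :=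
  (norm_inner_le_norm _ _).trans (mul_le_mul_of_nonneg_left ((norm_coefX_le k u).trans hS) pos!)

lemma integrableOn_of_norm_le {f : ℝ → ℂ}
    (hf : AEStronglyMeasurable f (volT T)) (h : ∀ t ∈ Ioo 0 T, ‖f t‖ ≤ C) :
    IntegrableOn f (Ioo 0 T) :=
  ((integrable_const C : Integrable _ (volT T)).mono' hf
    ((ae_restrict_mem measurableSet_Ioo).mono h))

lemma IsTimeTest.integrable_smul {f : ℝ → ℝ} {g : ℝ → ℂ} (hρ : IsTimeTest T ρ)
    (hf : f = ρ ∨ f = deriv ρ) (hg : IntegrableOn g (Ioo 0 T)) :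
    IntegrableOn (fun t => f t • g t) (Ioo 0 T) := by
  obtain ⟨M, h1, h2⟩ := hρ.exists_bound; obtain rfl | rfl := hf
  · exact Integrable.bdd_smul hg M hρ.smooth.continuous.aestronglyMeasurable (.of_forall h1)
  · exact Integrable.bdd_smul hg M hρ.continuous_deriv.aestronglyMeasurable (.of_forall h2)

lemma HasWeakDeriv.of_tendsto {a b : ℝ → ℂ} {a' b' : ℕ → ℝ → ℂ} {m : ℝ → ℝ} {c : ℕ → ℝ}
    (ha : IntegrableOn a (Ioo 0 T)) (hb : IntegrableOn b (Ioo 0 T))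
    (h : ∀ n, HasWeakDeriv T (a' n) (b' n)) (hm : IntegrableOn m (Ioo 0 T))
    (hc : Tendsto c atTop (nhds 0))
    (hd : ∀ n, ∀ᵐ t ∂volT T, ‖a t - a' n t‖ ≤ m t * c n ∧ ‖b t - b' n t‖ ≤ m t * c n) :
    HasWeakDeriv T a b := by
  have key {f : ℝ → ℂ} {f' : ℕ → ℝ → ℂ} {ρ σ} (hρ : IsTimeTest T ρ) (hσ : σ = ρ ∨ σ = deriv ρ)
      (hf : IntegrableOn f (Ioo 0 T)) (hf' : ∀ n, IntegrableOn (f' n) (Ioo 0 T))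
      (hd : ∀ n, ∀ᵐ t ∂volT T, ‖f t - f' n t‖ ≤ m t * c n) :
      Tendsto (fun n => ∫ t in Ioo 0 T, σ t • f' n t) atTop (nhds (∫ t in Ioo 0 T, σ t • f t)) := by
    obtain ⟨M, h1, h2⟩ := hρ.exists_bound; rw [tendsto_iff_norm_sub_tendsto_zero]
    refine squeeze_zero (fun _ => norm_nonneg _) (g := fun n => (∫ t in Ioo 0 T, M * m t) * c n)
      (fun n => ?_) (by simpa using hc.const_mul _)
    rw [← integral_sub (hρ.integrable_smul hσ (hf' n)) (hρ.integrable_smul hσ hf),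
      ← integral_mul_const]
    refine norm_integral_le_of_norm_le ((hm.const_mul M).mul_const _) ((hd n).mono fun t ht => ?_)
    rw [← smul_sub, norm_smul, norm_sub_rev, mul_assoc]
    exact mul_le_mul (hσ.elim (· ▸ h1 t) (· ▸ h2 t)) ht pos! ((norm_nonneg _).trans (h1 0))
  exact ⟨ha, hb, fun ρ hρ => tendsto_nhds_unique
    (key hρ (.inr rfl) ha (fun n => (h n).left) fun n => (hd n).mono fun _ h => h.1)
    ((key hρ (.inl rfl) hb (fun n => (h n).right) fun n => (hd n).mono fun _ h => h.2).neg.congr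
      fun n => ((h n).eq ρ hρ).symm)⟩

section
variable (hs0 : 0 ≤ s) (hs1 : s ≤ 1) (hγ : 0 ≤ γ) (hF : IsTransportSolution s γ w T h F)
include hs0 hs1 hγ hF

lemma IsTransportSolution.exists_mode_bound :
    ∃ m : ℝ → ℝ, IntegrableOn m (Ioo 0 T) ∧ (∀ t, 0 ≤ m t) ∧
      (∀ᵐ t ∂volT T, ∀ (k : ℤ³) (g : L2v) (f : Vel → ℂ) (ε : ℝ),
        g =ᵐ[volume] f → HasDecay f ε (3 + γ / 2 + |w|) → ‖F t (modeOp k g)‖ ≤ m t * ε) ∧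
      ∀ (k : ℤ³) (g : L2v) (f : Vel → ℂ) (ε : ℝ), g =ᵐ[volume] f → HasDecay f ε (3 + γ / 2 + |w|) →
        IntegrableOn (fun t => F t (modeOp k g)) (Ioo 0 T) := by
  obtain ⟨m, hm, hm0, hb⟩ := hF.exists_source_bound
  have hb' : ∀ᵐ t ∂volT T, ∀ (k : ℤ³) (g : L2v) (f : Vel → ℂ) (ε : ℝ),
      g =ᵐ[volume] f → HasDecay f ε (3 + γ / 2 + |w|) →
      ‖F t (modeOp k g)‖ ≤ m t * decK γ * ε := by
    filter_upwards [hb] with t ht k g f ε hg hf; have := norms_modeOp_le hs0 hs1 hγ k hg hf le_rfl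
    exact (ht _ _ this.1 this.2).trans_eq (by ring)
  refine ⟨fun t => m t * decK γ, hm.mul_const _, fun t => mul_nonneg (hm0 t) (decK_nonneg hγ), hb',
    fun k g f ε hg hf => ?_⟩
  have hN := (norms_modeOp_le hs0 hs1 hγ k hg hf le_rfl).2.trans_lt ofReal_lt_top
  exact ((hm.mul_const (decK γ)).mul_const ε).mono'
    (hF.source_meas _ (le_self_add.trans_lt hN) (le_add_self.trans_lt hN)).aestronglyMeasurable
    (hb'.mono fun t ht => ht k g f ε hg hf)

lemma IsTransportSolution.hasWeakDeriv_inner (hS : ∀ t ∈ Ioo 0 T, ‖h t‖ ≤ S)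
    (k : ℤ³) (hR : 0 ≤ R) (x : L2p) :
    HasWeakDeriv T (fun t => inn (synthOp R x) (coefX k (h t)))
      (fun t => F t (modeOp k (synthOp R x)) - I * inn (synthOpK k R x) (coefX k (h t))) := by
  obtain ⟨m, hm, hm0, hb, hint⟩ := hF.exists_mode_bound hs0 hs1 hγ
  set M := 3 + γ / 2 + |w| with hMdef; have hM3 : 3 ≤ M := by have := abs_nonneg w; linarith
  have hin (G : L2v) : IntegrableOn (fun t => inn G (coefX k (h t))) (Ioo 0 T) :=
    integrableOn_of_norm_le (aesm_inner_coefX hF k G) fun t ht => norm_inner_coefX_le k G (hS t ht)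
  have hd := hasDecay_synth hR (M := M + 1) lin! x; have hx := coeFn_synthOp R x
  have hxK := coeFn_synthOpK k hR x; set u := synth fun Y => ballSym R Y * x Y with hu
  set ε₀ := decC (M + 1) R * phC R * ‖x‖; have hFx := hint k _ _ _ hx (hd.mono lin!)
  obtain ⟨K, hK, hcut⟩ := exists_hasDecay_cutFun
  have hm' : IntegrableOn (fun t => m t + (1 + ‖freq k‖) * jbN * |S|) (Ioo 0 T) :=
    hm.add (integrable_const _)
  have main (n : ℕ) : ∃ G G' : L2v, HasWeakDeriv T (fun t => inn G (coefX k (h t)))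
      (fun t => F t (modeOp k G) - I * inn G' (coefX k (h t))) ∧ ∀ᵐ t ∂volT T,
      ‖F t (modeOp k (synthOp R x - G))‖ ≤ m t * (K * ε₀ / (n + 1)) ∧
      ‖synthOp R x - G‖ ≤ K * ε₀ / (n + 1) * jbN ∧
      ‖synthOpK k R x - G'‖ ≤ ‖freq k‖ * (K * ε₀ / (n + 1)) * jbN := by
    have hdn := hcut n u ε₀ M hd; set ε := K * ε₀ / (n + 1); have hε := hdn.nonneg
    have hg : ContDiff ℝ ∞ fun v => (cutFun n v : ℂ) * u v :=
      (ofRealCLM.contDiff.comp (contDiff_cutFun n)).mul (contDiff_synth_ballSym R x)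
    have hgc : HasCompactSupport fun v => (cutFun n v : ℂ) * u v :=
      ((hasCompactSupport_cutFun n).comp_left (g := ((↑) : ℝ → ℂ)) ofReal_zero).mul_right
    have hGm : MemLp (fun v => (cutFun n v : ℂ) * u v) 2 volV :=
      hg.continuous.memLp_of_hasCompactSupport hgc
    have hkc : Continuous fun v : Vel => (inner ℝ (freq k) v : ℂ) := by fun_prop
    have hGm' : MemLp (fun v => (inner ℝ (freq k) v : ℂ) * ((cutFun n v : ℂ) * u v)) 2 volV :=
      (hkc.mul hg.continuous).memLp_of_hasCompactSupport hgc.mul_left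
    set G := hGm.toLp _; set G' := hGm'.toLp _
    have hD : (synthOp R x - G : L2v) =ᵐ[volume] fun v => u v - (cutFun n v : ℂ) * u v := by
      filter_upwards [Lp.coeFn_sub (synthOp R x) G, hx, hGm.coeFn_toLp] with v h1 h2 h3
      rw [h1, Pi.sub_apply, h2, h3]
    have hFG : IntegrableOn (fun t => F t (modeOp k G)) (Ioo 0 T) := by
      refine (hFx.sub (hint k _ _ _ hD hdn)).congr (.of_forall fun t => ?_)
      simp only [Pi.sub_apply, map_sub]; ring
    refine ⟨G, G', ⟨hin G, hFG.sub ((hin G').const_mul _), fun ρ hρ => ?_⟩, hb.mono fun t ht =>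
      ⟨ht k _ _ _ hD hdn, norm_le_mul_jbN hε ?_, norm_le_mul_jbN pos! ?_⟩⟩
    · have h1 := hρ.integrable_smul (.inr rfl) (hin G)
      have h2 := (hρ.integrable_smul (.inl rfl) (hin G')).const_mul I
      have h3 := hF.mode_eq hρ k hg hgc hGm.coeFn_toLp hGm'.coeFn_toLp
      rw [integral_sub h1 h2] at h3; simp only [smul_sub, ← mul_smul_comm]
      rw [integral_sub (hρ.integrable_smul (.inl rfl) hFG) h2, h3]; ring
    · filter_upwards [hD] with v hv; rw [hv]; exact (hdn.mono lin!).bound v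
    · filter_upwards [Lp.coeFn_sub (synthOpK k R x) G', hxK, hGm'.coeFn_toLp] with v h1 h2 h3
      rw [h1, Pi.sub_apply, h2, h3, ← mul_sub, norm_mul, norm_real]
      calc _ ≤ (‖freq k‖ * jb v) * (ε * jb v ^ (-3 : ℝ)) := by
            refine mul_le_mul ((norm_inner_le_norm _ _).trans ?_) ((hdn.mono hM3).bound v)
              pos! (by have := jb_pos v; positivity)
            gcongr; exact norm_le_jb v
        _ = ‖freq k‖ * ε * (jb v ^ (1 : ℝ) * jb v ^ (-3 : ℝ)) := by rw [Real.rpow_one]; ring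
        _ = _ := by rw [← rpow_add (jb_pos v)]; norm_num
  choose G G' hW hB using main
  refine .of_tendsto (c := fun n : ℕ => K * ε₀ / (n + 1)) (hin _)
    (hFx.sub ((hin _).const_mul _)) hW hm'
    (by simpa [div_eq_mul_inv] using tendsto_one_div_add_atTop_nhds_zero_nat.const_mul (K * ε₀))
    fun n => ?_
  filter_upwards [hB n, ae_restrict_mem measurableSet_Ioo] with t ⟨h1, h2, h3⟩ htT
  have hSt : ‖h t‖ ≤ |S| := (hS t htT).trans (le_abs_self S)
  have i2 := (norm_inner_coefX_le k (synthOp R x - G n) hSt).trans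
    (mul_le_mul_of_nonneg_right h2 pos!)
  have i3 := (norm_inner_coefX_le k (synthOpK k R x - G' n) hSt).trans
    (mul_le_mul_of_nonneg_right h3 pos!)
  have h4 := norm_nonneg (F t (modeOp k (synthOp R x - G n)))
  have h5 := norm_nonneg (inn (synthOpK k R x - G' n) (coefX k (h t)))
  have h6 := norm_nonneg (inn (synthOp R x - G n) (coefX k (h t)))
  rw [sub_sub_sub_comm, ← mul_sub, ← map_sub, ← map_sub, ← inner_sub_left, ← inner_sub_left]
  refine ⟨by linarith, (norm_sub_le _ _).trans ?_⟩; rw [norm_mul, norm_I, one_mul]; linarith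

end

/-! ### Weak derivatives of inner products -/

lemma norm_sum_inner_mul_inner_le [CompleteSpace H] (e : HilbertBasis ι ℂ H) (J : Finset ι) (x y : H) :
    ‖∑ i ∈ J, inn x (e i) * inn (e i) y‖ ≤ ‖x‖ * ‖y‖ := by
  have hb : ∀ z : H, √(∑ i ∈ J, ‖inn (e i) z‖ ^ 2) ≤ ‖z‖ := fun z =>
    (sqrt_le_sqrt (e.orthonormal.sum_inner_products_le z)).trans_eq (sqrt_sq (norm_nonneg z))
  refine (norm_sum_le _ _).trans (le_trans (le_of_eq ?_) ((sum_mul_le_sqrt_mul_sqrt J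
    (fun i => ‖inn (e i) x‖) fun i => ‖inn (e i) y‖).trans
      (mul_le_mul (hb x) (hb y) (sqrt_nonneg _) pos!)))
  exact sum_congr rfl fun i _ => by rw [norm_mul, norm_inner_symm]

lemma tendsto_integral_sum_inner [CompleteSpace H] [Countable ι] (e : HilbertBasis ι ℂ H)
    {μ : Measure ℝ} {x y : ℝ → H} {X Y : ℝ → ℝ}
    (hx : ∀ z, AEStronglyMeasurable (fun t => inn z (x t)) μ)
    (hy : ∀ z, AEStronglyMeasurable (fun t => inn z (y t)) μ)
    (hm : Integrable (fun t => X t * Y t) μ) (hX : ∀ᵐ t ∂μ, ‖x t‖ ≤ X t)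
    (hY : ∀ᵐ t ∂μ, ‖y t‖ ≤ Y t) :
    Integrable (fun t => inn (x t) (y t)) μ ∧
    (∀ i, Integrable (fun t => inn (x t) (e i) * inn (e i) (y t)) μ) ∧
    ∀ {ρ : ℝ → ℝ} {M}, Continuous ρ → (∀ t, ‖ρ t‖ ≤ M) →
      Tendsto (fun J => ∑ i ∈ J, ∫ t, ρ t • (inn (x t) (e i) * inn (e i) (y t)) ∂μ)
        atTop (nhds (∫ t, ρ t • inn (x t) (y t) ∂μ)) := by
  have hxy : ∀ᵐ t ∂μ, ‖x t‖ * ‖y t‖ ≤ X t * Y t := (hX.and hY).mono fun t ht =>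
    mul_le_mul ht.1 ht.2 pos! ((norm_nonneg _).trans ht.1)
  have hm1 i : AEStronglyMeasurable (fun t => inn (x t) (e i) * inn (e i) (y t)) μ :=
    ((continuous_conj.comp_aestronglyMeasurable (hx (e i))).congr
      (.of_forall fun t => inner_conj_symm _ _)).mul (hy (e i))
  have hlim t : Tendsto _ _ _ := e.hasSum_inner_mul_inner (x t) (y t)
  have hb (J : Finset ι) : ∀ᵐ t ∂μ, ‖∑ i ∈ J, inn (x t) (e i) * inn (e i) (y t)‖ ≤ X t * Y t :=
    hxy.mono fun t ht => (norm_sum_inner_mul_inner_le e J _ _).trans ht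
  have hi i : Integrable (fun t => inn (x t) (e i) * inn (e i) (y t)) μ :=
    hm.mono' (hm1 i) ((hb {i}).mono fun t ht => by simpa using ht)
  have hms (J : Finset ι) := aestronglyMeasurable_fun_sum J fun i _ => hm1 i
  refine ⟨hm.mono' (aestronglyMeasurable_of_tendsto_ae atTop hms (.of_forall hlim))
    (hxy.mono fun t ht => (norm_inner_le_norm _ _).trans ht), hi, fun {ρ M} hρ hM => ?_⟩
  refine (tendsto_integral_filter_of_dominated_convergence (fun t => M * (X t * Y t))
    (F := fun (J : Finset ι) t => ρ t • ∑ i ∈ J, inn (x t) (e i) * inn (e i) (y t))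
    (.of_forall fun J => hρ.aestronglyMeasurable.smul (hms J))
    (.of_forall fun J => (hb J).mono fun t ht => ?_) (hm.const_mul M)
    (.of_forall fun t => (hlim t).const_smul (ρ t))).congr fun J => ?_
  · rw [norm_smul]; exact mul_le_mul (hM t) ht pos! ((norm_nonneg _).trans (hM t))
  · simp only [smul_sum]
    have hρi i : Integrable (fun t => ρ t • (inn (x t) (e i) * inn (e i) (y t))) μ :=
      Integrable.bdd_smul (hi i) M hρ.aestronglyMeasurable (.of_forall hM)
    exact integral_finsetSum J fun i _ => hρi i

lemma HasWeakDeriv.inner [CompleteSpace H] [SecondCountableTopology H] (hT : 0 < T)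
    {a b a' b' : ℝ → H} {S' : ℝ} {m m' : ℝ → ℝ}
    (ha : ∀ x, HasWeakDeriv T (fun t => inn x (a t)) fun t => inn x (b t))
    (ha' : ∀ x, HasWeakDeriv T (fun t => inn x (a' t)) fun t => inn x (b' t))
    (hm : IntegrableOn m (Ioo 0 T)) (hm' : IntegrableOn m' (Ioo 0 T))
    (hS : ∀ᵐ t ∂volT T, ‖a t‖ ≤ S) (hS' : ∀ᵐ t ∂volT T, ‖a' t‖ ≤ S')
    (hb : ∀ᵐ t ∂volT T, ‖b t‖ ≤ m t) (hb' : ∀ᵐ t ∂volT T, ‖b' t‖ ≤ m' t) :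
    HasWeakDeriv T (fun t => inn (a t) (a' t)) fun t => inn (b t) (a' t) + inn (a t) (b' t) := by
  obtain ⟨w, e, hw⟩ := exists_countable_hilbertBasis H; have := hw.to_subtype
  have ⟨k0, _, l0⟩ := tendsto_integral_sum_inner e (fun z => (ha z).left.1)
    (fun z => (ha' z).left.1) (integrable_const _) hS hS'
  have ⟨k1, i1, l1⟩ := tendsto_integral_sum_inner e (fun z => (ha z).right.1)
    (fun z => (ha' z).left.1) (hm.mul_const _) hb hS'
  have ⟨k2, i2, l2⟩ := tendsto_integral_sum_inner e (fun z => (ha z).left.1)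
    (fun z => (ha' z).right.1) (hm'.const_mul _) hS hb'
  refine ⟨k0, k1.add k2, fun ρ hρ => ?_⟩; obtain ⟨M, hM1, hM2⟩ := hρ.exists_bound
  have hc := hρ.smooth.continuous; simp only [smul_add]
  rw [integral_add (hρ.integrable_smul (.inl rfl) k1) (hρ.integrable_smul (.inl rfl) k2)]
  refine tendsto_nhds_unique (l0 hρ.continuous_deriv hM2)
    (((l1 hc hM1).add (l2 hc hM1)).neg.congr fun J => ?_)
  rw [← sum_add_distrib, ← sum_neg_distrib]; refine sum_congr rfl fun i _ => ?_
  have h := (ha (e i)).star.integral_mul hT (ha' (e i)) hρ; simp only [inner_conj_symm] at h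
  rw [h, ← integral_add (hρ.integrable_smul (.inl rfl) (i1 i))
    (hρ.integrable_smul (.inl rfl) (i2 i))]
  simp only [smul_add]

lemma exists_riesz [CompleteSpace H] (L : H →ₗ⋆[ℂ] ℂ) (C : ℝ) :
    ∃ f : H, ‖f‖ ≤ |C| ∧ ((∀ x, ‖L x‖ ≤ C * ‖x‖) → ∀ x, inn x f = L x) := by
  by_cases hL : ∀ x, ‖L x‖ ≤ C * ‖x‖
  · let L' : H →ₗ[ℂ] ℂ :=
      { toFun := fun x => conj (L x)
        map_add' := fun x y => by simp
        map_smul' := fun c x => by simp }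
    have hb x : ‖L' x‖ ≤ |C| * ‖x‖ := (RCLike.norm_conj _).trans_le
      ((hL x).trans (mul_le_mul_of_nonneg_right (le_abs_self C) pos!))
    refine ⟨(InnerProductSpace.toDual ℂ H).symm (L'.mkContinuous |C| hb), ?_, fun _ x => ?_⟩
    · rw [LinearIsometryEquiv.norm_map]
      exact LinearMap.mkContinuous_norm_le _ (abs_nonneg C) hb
    · rw [← inner_conj_symm, InnerProductSpace.toDual_symm_apply]
      exact conj_conj _
  · exact ⟨0, by simp, fun h => absurd h hL⟩

/-! ### The energy identity for Wick operators -/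

lemma inner_mulOp_left (hq : Measurable q) (hQ : ∀ Y, ‖q Y‖ ≤ Q)
    (hr : ∀ Y, conj (q Y) = q Y) (x y : L2p) :
    inn (mulOp volume q x) y = inn x (mulOp volume q y) := by
  rw [inner_eq_integral, inner_eq_integral]; refine integral_congr_ae ?_
  filter_upwards [coeFn_mulOp hq hQ x, coeFn_mulOp hq hQ y] with Y h1 h2; rw [h1, h2, map_mul, hr]
  ring

lemma mulOp_mulOp {p : Ph → ℂ} (hp : Measurable p) {P : ℝ} (hP : ∀ Y, ‖p Y‖ ≤ P)
    (hq : Measurable q) (hQ : ∀ Y, ‖q Y‖ ≤ Q) (x : L2p) :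
    mulOp volume p (mulOp volume q x) =ᵐ[volume] fun Y => p Y * q Y * x Y := by
  filter_upwards [coeFn_mulOp hp hP (mulOp volume q x), coeFn_mulOp hq hQ x] with Y h1 h2
  rw [h1, h2, mul_assoc]

lemma conj_ballSym (R : ℝ) (Y : Ph) : conj (ballSym R Y) = ballSym R Y := by
  rcases le_or_gt ‖Y‖ R with h | h
  · rw [ballSym_of_le h, map_one]
  · rw [ballSym_of_lt h, map_zero]

lemma HasWeakDeriv.congr_right {r' : ℝ → ℂ} (h : HasWeakDeriv T c r)
    (hr : ∀ᵐ t ∂volT T, r' t = r t) : HasWeakDeriv T c r' :=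
  ⟨h.left, h.right.congr (hr.mono fun _ h => h.symm), fun ρ hρ => (h.eq ρ hρ).trans
    (congr_arg Neg.neg (integral_congr_ae (hr.mono fun t h => by simp only [h])))⟩

lemma IsTransportSolution.hasWeakDeriv_wick (hs0 : 0 ≤ s) (hs1 : s ≤ 1) (hγ : 0 ≤ γ) (hT : 0 < T)
    (hF : IsTransportSolution s γ w T h F) (hS : ∀ t ∈ Ioo 0 T, ‖h t‖ ≤ S)
    (k : ℤ³) (hR : 0 ≤ R) {q : Ph → ℝ} (hq : Measurable q)
    (hQ : ∀ Y, |q Y| ≤ Q) (hqR : ∀ Y, R < ‖Y‖ → q Y = 0) :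
    HasWeakDeriv T (fun t => inn (coefX k (h t)) (wickOp (fun Y => (q Y : ℂ)) (coefX k (h t))))
      fun t => ((2 * (F t (modeOp k (wickOp (fun Y => (q Y : ℂ)) (coefX k (h t)))) -
        I * ∫ Y, (q Y : ℂ) * (conj (winFun (wwin 0) (coefX k (h t)) Y) *
          winFun (kwin k R) (coefX k (h t)) Y)).re : ℝ) : ℂ) := by
  obtain ⟨m, hm, hm0, hb, -⟩ := hF.exists_mode_bound hs0 hs1 hγ
  obtain ⟨A₂, hA₂⟩ := exists_isWin_kwin k hR
  have hq' : Measurable fun Y => (q Y : ℂ) := measurable_ofReal.comp hq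
  have hQ' : ∀ Y, ‖(q Y : ℂ)‖ ≤ Q := fun Y => by rw [norm_real]; exact hQ Y
  have hqr : ∀ Y, conj (q Y : ℂ) = q Y := fun Y => conj_ofReal _; have hκ := measurable_ballSym R
  have hκ1 := norm_ballSym_le R
  have hκq : ∀ Y, (q Y : ℂ) * ballSym R Y = q Y := fun Y => by
    rcases le_or_gt ‖Y‖ R with h | h
    · rw [ballSym_of_le h, mul_one]
    · rw [hqR Y h, ofReal_zero, zero_mul]
  set κ : L2p →L[ℂ] L2p := mulOp volume (ballSym R)
  set Qo : L2p →L[ℂ] L2p := mulOp volume fun Y => (q Y : ℂ)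
  have c1 : ∀ x, Qo (κ x) = Qo x := fun x => Lp.ext <| by
    filter_upwards [mulOp_mulOp hq' hQ' hκ hκ1 x, coeFn_mulOp hq' hQ' x] with Y h1 h2
    rw [h1, h2, hκq]
  have c2 : ∀ x, κ (Qo x) = Qo x := fun x => Lp.ext <| by
    filter_upwards [mulOp_mulOp hκ hκ1 hq' hQ' x, coeFn_mulOp hq' hQ' x] with Y h1 h2
    rw [h1, h2, mul_comm (ballSym R Y), hκq]
  set A : L2xv →L[ℂ] L2p := κ ∘L winOp (wwin 0) ∘L coefX k with hAdef
  set D : L2xv →L[ℂ] L2p := κ ∘L winOp (kwin k R) ∘L coefX k with hDdef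
  have hB : ∀ x u, inn (synthOp R x) (coefX k u) = inn x (A u) := fun x u => by
    rw [synthOp, comp_apply, adjoint_inner_left]; exact inner_mulOp_left hκ hκ1 (conj_ballSym R) _ _
  have hBK : ∀ x u, inn (synthOpK k R x) (coefX k u) = inn x (D u) := fun x u => by
    rw [synthOpK, comp_apply, adjoint_inner_left]
    exact inner_mulOp_left hκ hκ1 (conj_ballSym R) _ _
  have hBQ : ∀ u, synthOp R (Qo (A u)) = wickOp (fun Y => (q Y : ℂ)) (coefX k u) := fun u => by
    simp only [synthOp, wickOp, locOp, comp_apply, hAdef]; exact congr_arg _ ((c2 _).trans (c1 _))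
  set C := decC (3 + γ / 2 + |w|) R * phC R
  set L : ℝ → L2p →ₗ⋆[ℂ] ℂ := fun t =>
    (F t).comp ((modeOp k).toLinearMap.comp (synthOp R).toLinearMap)
  have hL : ∀ᵐ t ∂volT T, ∀ x, ‖L t x‖ ≤ m t * C * ‖x‖ := by
    filter_upwards [hb] with t ht x
    exact (ht k _ _ _ (coeFn_synthOp R x) (hasDecay_synth hR pos! x)).trans_eq
      (mul_assoc _ _ _).symm
  choose f hf1 hf2 using fun t => exists_riesz (L t) (m t * C)
  have hQa : ∀ x y, inn x (Qo y) = inn (Qo x) y := fun x y =>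
    (inner_mulOp_left hq' hQ' hqr x y).symm
  have hweak : ∀ x, HasWeakDeriv T (fun t => inn x (A (h t)))
      fun t => inn x (f t - I • D (h t)) := fun x => by
    have := hF.hasWeakDeriv_inner hs0 hs1 hγ hS k hR x; simp only [hB, hBK] at this
    refine this.congr_right ?_; filter_upwards [hL] with t ht
    rw [inner_sub_right, inner_smul_right, hf2 t ht]; rfl
  have hI {P : ℝ → Prop} (h : ∀ t ∈ Ioo 0 T, P t) : ∀ᵐ t ∂volT T, P t :=
    (ae_restrict_mem measurableSet_Ioo).mono h
  have hle (B : L2xv →L[ℂ] L2p) : ∀ t ∈ Ioo 0 T, ‖B (h t)‖ ≤ ‖B‖ * S := fun t ht =>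
    B.le_opNorm_of_le (hS t ht)
  have hD : ∀ t ∈ Ioo 0 T, ‖f t - I • D (h t)‖ ≤ |m t * C| + ‖D‖ * S := fun t ht => by
    refine (norm_sub_le _ _).trans (add_le_add (hf1 t) ?_); rw [norm_smul, norm_I, one_mul]
    exact hle D t ht
  have hmi := (hm.mul_const C).abs.add (integrable_const (‖D‖ * S))
  have main := HasWeakDeriv.inner hT (a' := fun t => Qo (A (h t)))
    (b' := fun t => Qo (f t - I • D (h t))) hweak
    (fun x => by simp only [hQa]; exact hweak (Qo x)) hmi (hmi.const_mul ‖Qo‖) (hI (hle A))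
    (hI (hle (Qo ∘L A))) (hI hD) (hI fun t ht => Qo.le_opNorm_of_le (hD t ht))
  have e1 : ∀ t, inn (A (h t)) (Qo (A (h t))) =
      inn (coefX k (h t)) (wickOp (fun Y => (q Y : ℂ)) (coefX k (h t))) := fun t => by
    rw [← hBQ, ← inner_conj_symm (coefX k (h t)), hB, inner_conj_symm]
  simp only [e1] at main; refine main.congr_right ?_; filter_upwards [hL] with t ht
  have e2 : inn (Qo (A (h t))) (D (h t)) =
      ∫ Y, (q Y : ℂ) * (conj (winFun (wwin 0) (coefX k (h t)) Y) *
        winFun (kwin k R) (coefX k (h t)) Y) := by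
    rw [← inner_locOp_eq_integral (isWin_wwin 0) hA₂ hq' hQ', inner_locOp, ← hQa]
    change inn (κ (winOp (wwin 0) (coefX k (h t)))) (Qo (κ (winOp (kwin k R) _))) = _
    rw [c1, hQa, c1, ← hQa]; rfl
  rw [hQa (A (h t)), ← inner_conj_symm _ (Qo (A (h t))), add_comm, add_conj, inner_sub_right,
    inner_smul_right, hf2 t ht, e2, ← hBQ]
  rfl

/-! ### Integration by parts in the dual velocity variable -/

lemma norm_cexp_inner (v ξ : Vel) : ‖eN v ξ‖ = 1 := by rw [norm_exp]; simp

lemma hasDerivAt_expInt {κ : Vel} (h0 : Integrable u)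
    (h1 : Integrable fun v => (inner ℝ κ v : ℂ) * u v) (ξ : Vel) :
    HasDerivAt (fun t : ℝ => expInt u (ξ + t • κ))
      (-I * expInt (fun v => (inner ℝ κ v : ℂ) * u v) ξ) 0 := by
  have hc : ∀ t : ℝ, Continuous fun v : Vel => eN v (ξ + t • κ) := fun t => by fun_prop
  have hd : ∀ (v : Vel) (t : ℝ), HasDerivAt (fun t : ℝ =>
      eN v (ξ + t • κ) * u v)
      (eN v (ξ + t • κ) * (-I * ((inner ℝ κ v : ℂ) * u v))) t := fun v t => by
    have h : HasDerivAt (fun t : ℝ => inner ℝ v (ξ + t • κ)) (inner ℝ κ v) t := by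
      simp_rw [inner_add_right, inner_smul_right, real_inner_comm κ v]
      simpa using ((hasDerivAt_id t).mul_const (inner ℝ κ v)).const_add (inner ℝ v ξ)
    exact ((h.ofReal_comp.const_mul (-I)).cexp.mul_const (u v)).congr_deriv (by ring)
  have key := (hasDerivAt_integral_of_dominated_loc_of_deriv_le (μ := volume) (x₀ := (0 : ℝ))
    (bound := fun v => ‖(inner ℝ κ v : ℂ) * u v‖) univ_mem
    (.of_forall fun t => (hc t).aestronglyMeasurable.mul h0.1)
    (h0.mono ((hc 0).aestronglyMeasurable.mul h0.1) (.of_forall fun v => by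
      rw [Pi.mul_apply, norm_mul, norm_cexp_inner, one_mul]))
    ((hc 0).aestronglyMeasurable.mul (h1.1.const_mul _))
    (.of_forall fun v t _ => by
      rw [norm_mul, norm_cexp_inner, one_mul, norm_mul, norm_neg, norm_I, one_mul])
    h1.norm (.of_forall fun v t _ => hd v t)).2
  refine key.congr_deriv ?_; rw [expInt, ← integral_const_mul]; refine integral_ext fun v => ?_
  simp only [zero_smul, add_zero]; ring

lemma hasDerivAt_winFun (k : ℤ³) (hR : 0 ≤ R) (f : L2v) (hY : ‖Y.1‖ ≤ R) :
    HasDerivAt (fun t : ℝ => winFun (wwin 0) f (Y + t • (0, freq k)))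
      (-I * winFun (kwin k R) f Y) 0 := by
  obtain ⟨A, hA⟩ := exists_isWin_kwin k hR
  have e : (fun v => (kwin k R Y.1 v : ℂ) * f v) =
      fun v => (inner ℝ (freq k) v : ℂ) * ((wwin 0 Y.1 v : ℂ) * f v) := funext fun v => by
    rw [kwin, ballInd, indicator_of_mem (by simpa using hY), wwin_zero]; push_cast; ring
  have h1 := hA.integrable Y.1 (Lp.memLp f); rw [e] at h1
  have := (hasDerivAt_expInt ((isWin_wwin 0).integrable Y.1 (Lp.memLp f)) h1 Y.2).const_mul
    ((((2 * π) ^ (-(3 / 2) : ℝ) : ℝ) : ℂ))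
  refine (this.congr_deriv ?_).congr_of_eventuallyEq (.of_forall fun t => ?_)
  · rw [winFun, e]; ring
  · simp [winFun]

lemma re_integral_kwin (k : ℤ³) (hR : 0 ≤ R) {q q' : Ph → ℝ}
    (hq : Continuous q) (hq' : Continuous q') (hqR : ∀ Y, R < ‖Y‖ → q Y = 0)
    (hd : ∀ Y, HasDerivAt (fun t : ℝ => q (Y + t • (0, freq k))) (2 * q' Y) 0) (f : L2v) :
    Integrable (fun Y => q' Y * ‖winFun (wwin 0) f Y‖ ^ 2) ∧
    (I * ∫ Y, (q Y : ℂ) * (conj (winFun (wwin 0) f Y) *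
      winFun (kwin k R) f Y)).re = ∫ Y, q' Y * ‖winFun (wwin 0) f Y‖ ^ 2 := by
  obtain ⟨A, hA⟩ := exists_isWin_kwin k hR
  have hq0 : ∀ Y, R < ‖Y‖ → q' Y = 0 := fun Y hY => by
    have hc : Continuous fun t : ℝ => ‖Y + t • ((0 : Vel), freq k)‖ := by fun_prop
    have h1 : ∀ᶠ t : ℝ in nhds 0, R < ‖Y + t • ((0 : Vel), freq k)‖ :=
      hc.continuousAt.eventually_const_lt (by simpa using hY)
    have h2 := (hd Y).unique ((hasDerivAt_const (0 : ℝ) (0 : ℝ)).congr_of_eventuallyEq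
      (h1.mono fun t ht => hqR _ ht))
    linarith
  have hsupp : ∀ p : Ph → ℝ, (∀ Y, R < ‖Y‖ → p Y = 0) →
      tsupport p ⊆ Metric.closedBall 0 R := fun p hp =>
    closure_minimal (fun Y hY => by
      by_contra h; exact hY (hp Y (by simpa using h))) Metric.isClosed_closedBall
  have hbd : ∀ p : Ph → ℝ, Continuous p → (∀ Y, R < ‖Y‖ → p Y = 0) →
      ∃ C, ∀ Y, ‖p Y‖ ≤ C := fun p hp h0 => hp.bounded_above_of_compact_support
    (HasCompactSupport.of_support_subset_isCompact (isCompact_closedBall 0 R)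
      ((subset_tsupport p).trans (hsupp p h0)))
  obtain ⟨C, hC⟩ := hbd q hq hqR; obtain ⟨C', hC'⟩ := hbd q' hq' hq0; set c := winFun (wwin 0) f
  set e := winFun (kwin k R) f; have mc : MemLp c 2 volume := memLp_winFun (isWin_wwin 0) f
  have me : MemLp e 2 volume := memLp_winFun hA f
  have i0 : Integrable fun Y => ‖c Y‖ ^ 2 := mc.norm.integrable_sq
  have i1 : Integrable fun Y => (q Y : ℂ) * (conj (c Y) * e Y) :=
    Integrable.bdd_mul (c := C) (mc.star.integrable_mul me)
      (continuous_ofReal.comp hq).aestronglyMeasurable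
      (.of_forall fun Y => by rw [norm_real]; exact hC Y)
  have i2 : Integrable fun Y => q' Y * ‖c Y‖ ^ 2 :=
    Integrable.bdd_mul (c := C') i0 hq'.aestronglyMeasurable (.of_forall hC')
  refine ⟨i2, ?_⟩
  have hg : ∀ Y ∈ tsupport q, HasLineDerivAt ℝ (fun Y => ‖c Y‖ ^ 2)
      (2 * inner ℝ (c Y) (-I * e Y)) Y ((0 : Vel), freq k) := fun Y hY => by
    have h1 := (norm_fst_le Y).trans (by simpa using hsupp q hqR hY)
    simpa [HasLineDerivAt] using (hasDerivAt_winFun k hR f h1).norm_sq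
  have er : ∀ Y, q Y * (2 * inner ℝ (c Y) (-I * e Y)) =
      -2 * (I * ((q Y : ℂ) * (conj (c Y) * e Y))).re := fun Y => by
    rw [Complex.inner]; simp; ring
  have hI := integral_bilinear_hasLineDerivAt_right_eq_neg_left_of_integrable
    (μ := (volV).prod volume) (B := mul ℝ ℝ)
    (f := q) (f' := fun Y => 2 * q' Y) (g := fun Y => ‖c Y‖ ^ 2) (v := ((0 : Vel), freq k))
    ((i2.const_mul 2).congr (.of_forall fun Y => by simp [mul_assoc]))
    (((i1.const_mul I).re.const_mul (-2)).congr (.of_forall fun Y => (er Y).symm))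
    (Integrable.bdd_mul (c := C) i0 hq.aestronglyMeasurable (.of_forall hC)) (fun Y _ => hd Y) hg
  simp only [mul_apply'] at hI; rw [integral_ext er, integral_const_mul] at hI
  have e1 : ∫ Y, (I * ((q Y : ℂ) * (conj (c Y) * e Y))).re =
      (I * ∫ Y, (q Y : ℂ) * (conj (c Y) * e Y)).re := by
    rw [← integral_const_mul]; exact integral_re (i1.const_mul I)
  have e2 : ∫ Y, 2 * q' Y * ‖c Y‖ ^ 2 = 2 * ∫ Y, q' Y * ‖c Y‖ ^ 2 := by
    rw [← integral_const_mul]; exact integral_ext fun Y => mul_assoc _ _ _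
  rw [← e1]
  have hI' : -2 * ∫ Y, (I * ((q Y : ℂ) * (conj (c Y) * e Y))).re = -∫ Y, 2 * q' Y * ‖c Y‖ ^ 2 := hI
  linarith

/-! ### Measurability of the norms -/

lemma IsForm.measurable [MeasurableSpace L2v] [BorelSpace L2v] {Q : L2v → ℝ≥0∞} (hQ : IsForm Q) :
    Measurable Q := by
  obtain ⟨T, hT⟩ := hQ; rw [funext hT]
  exact Measurable.tsum fun n => (T n).continuous.enorm.measurable.pow_const 2

lemma measurable_tripleSq [MeasurableSpace L2v] [BorelSpace L2v] (hs : 0 ≤ s)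
    (hγ : 0 ≤ γ) : Measurable fun f : L2v => tripleSq s γ f := by
  have hb : ∀ v : Vel, ‖jbC v (-(γ / 2))‖ ≤ 1 := fun v => by
    rw [norm_real, norm_of_nonneg (jb_rpow_pos _ v).le]
    exact rpow_le_one_of_one_le_of_nonpos (one_le_jb v) lin!
  set A : L2v →L[ℂ] L2v := mulOp volume fun v : Vel => jbC v (-(γ / 2))
  have hA : ∀ g, A g =ᵐ[volume] fun v => jbC v (-(γ / 2)) * g v :=
    coeFn_mulOp (measurable_jb_rpow _) hb
  have hc : ∀ v : Vel, jbC v (γ / 2) * jbC v (-(γ / 2)) = 1 := fun v => by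
    rw [← Complex.ofReal_mul, ← rpow_add (jb_pos v)]; simp
  have hw : ∀ g, (fun v => jbC v (γ / 2) * A g v) =ᵐ[volume] g := fun g => by
    filter_upwards [hA g] with v hv; rw [hv, ← mul_assoc, hc, one_mul]
  have hinj : Function.Injective A := fun g g' h => Lp.ext <| by
    filter_upwards [hw g, hw g'] with v h1 h2; rw [← h1, ← h2, h]
  have e : (fun f : L2v => tripleSq s γ f) = Function.extend A (tripForm s) fun _ => ⊤ := by
    funext f; by_cases hf : ∃ g, A g = f
    · obtain ⟨g, rfl⟩ := hf; have hm := (memLp_congr_ae (hw g)).2 (Lp.memLp g)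
      rw [hinj.extend_apply, tripleSq_eq hm]
      exact congr_arg _ (Lp.ext (hm.coeFn_toLp.trans (hw g)))
    · rw [Function.extend_apply' _ _ _ hf]; by_contra hlt
      have hm := memLp_of_tripleSq hs (Lp.aestronglyMeasurable f) (lt_top_iff_ne_top.2 hlt)
      refine hf ⟨hm.toLp _, Lp.ext ?_⟩; filter_upwards [hA (hm.toLp _), hm.coeFn_toLp] with v h1 h2
      rw [h1, h2, ← mul_assoc, mul_comm jbC v (-(γ / 2)), hc, one_mul]
  rw [e]
  exact (A.continuous.measurableEmbedding hinj).measurable_extend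
    ((isForm_sob hs).measurable.add (isForm_sph hs).measurable) measurable_const

lemma aemeasurable_norms (hs : 0 ≤ s) (hγ : 0 ≤ γ) (w : ℝ) {μ : Measure ℝ}
    (hm : AEStronglyMeasurable h μ) :
    AEMeasurable (fun t => tripleNorm s γ (h t)) μ ∧ AEMeasurable (fun t => weightNorm w (h t)) μ := by
  borelize L2v
  have hk : ∀ k, AEMeasurable (fun t => coefX k (h t)) μ := fun k =>
    ((coefX k).continuous.comp_aestronglyMeasurable hm).aemeasurable
  have e : ∀ x : ℝ≥0∞, x = (x ^ 2) ^ (1 / 2 : ℝ) := fun x => by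
    rw [← ENNReal.rpow_natCast, ← ENNReal.rpow_mul]; norm_num
  constructor
  · simp_rw [fun t => (e (tripleNorm s γ (h t))).trans (by rw [tripleNorm_sq hs])]
    exact (AEMeasurable.tsum fun k =>
      (measurable_tripleSq hs hγ).comp_aemeasurable (hk k)).pow_const _
  · simp_rw [fun t => (e (weightNorm w (h t))).trans (by rw [weightNorm_sq])]
    exact (AEMeasurable.tsum fun k => (isForm_weight_comp (measurable_jb_ofReal (2 * w))
      (fun _ => ofReal_ne_top)
      (ContinuousLinearMap.id ℂ L2v)).measurable.comp_aemeasurable (hk k)).pow_const _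

/-! ### The energy inequality for finitely many modes -/

lemma lintegral_add_ofReal_le {α : Type*} [MeasurableSpace α] {μ : Measure α} {r : α → ℝ}
    (hr : Integrable r μ) {L A : α → ℝ≥0∞}
    (h : ∀ᵐ t ∂μ, L t + ofR (r t) ≤ A t + ofR (-r t)) :
    (∫⁻ t, L t ∂μ) + ofR (∫ t, r t ∂μ) ≤ (∫⁻ t, A t ∂μ) + ofR (-∫ t, r t ∂μ) := by
  have h1 := lintegral_mono_ae h
  rw [lintegral_add_right' _ hr.1.aemeasurable.ennreal_ofReal,
    lintegral_add_right' (g := fun t => ofR (-r t)) _ hr.1.aemeasurable.neg.ennreal_ofReal] at h1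
  have hX := hr.lintegral_lt_top.ne; have hY := hr.neg.lintegral_lt_top.ne
  simp only [Pi.neg_apply] at hY; rw [integral_eq_lintegral_pos_part_sub_lintegral_neg_part hr]
  set X := ∫⁻ t, ofR (r t) ∂μ; set Y := ∫⁻ t, ofR (-r t) ∂μ
  have e : ofR (X.toReal - Y.toReal) + Y = X + ofR (-(X.toReal - Y.toReal)) := by
    nth_rw 2 [← ofReal_toReal hX, ← ofReal_toReal hY]
    rcases le_total X.toReal Y.toReal with hle | hle
    · rw [ofReal_of_nonpos (sub_nonpos.2 hle), zero_add, ← ofReal_add toReal_nonneg lin!]; ring_nf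
    · rw [ofReal_of_nonpos (p := -(X.toReal - Y.toReal)) lin!, add_zero,
        ← ofReal_add lin! toReal_nonneg, sub_add_cancel]
  refine (ENNReal.add_le_add_iff_right hY).1 ?_
  rw [add_assoc, e, ← add_assoc, add_right_comm _ _ Y]; exact add_le_add_left h1 _

lemma add_ofReal_le_of_add_ofReal_le {L E : ℝ≥0∞} {G : ℝ} (y : ℝ) (h : L + ofR (-G) ≤ E + ofR G) :
    L + ofR (y - G) ≤ E + ofR |y| + ofR (-(y - G)) := by
  have h1 : ofR (y - G) + ofR G ≤ ofR |y| + ofR (-(y - G)) + ofR (-G) := by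
    have : ∀ x : ℝ, ofR x = ofR (max x 0) := fun x => by
      rcases le_total 0 x with h | h
      · rw [max_eq_left h]
      · rw [max_eq_right h, ofReal_of_nonpos h, ENNReal.ofReal_zero]
    rw [this (y - G), this G, this (-(y - G)), this (-G), ← ofReal_add (by simp) (by simp),
      ← ofReal_add (by simp) (by simp), ← ofReal_add pos! (by simp)]
    refine ofReal_le_ofReal ?_; grind
  refine (ENNReal.add_le_add_iff_right (ofReal_ne_top (r := G))).1
    ((ENNReal.add_le_add_iff_right (ofReal_ne_top (r := -G))).1 ?_)
  calc _ = (L + ofR (-G)) + (ofR (y - G) + ofR G) := by ring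
    _ ≤ _ := add_le_add h h1
    _ = _ := by ring

lemma HasWeakDeriv.sum (J : Finset ι) {c r : ι → ℝ → ℂ} (h : ∀ i ∈ J, HasWeakDeriv T (c i) (r i)) :
    HasWeakDeriv T (fun t => ∑ i ∈ J, c i t) fun t => ∑ i ∈ J, r i t where
  left := integrable_finsetSum J fun i hi => (h i hi).left
  right := integrable_finsetSum J fun i hi => (h i hi).right
  eq ρ hρ := by
    simp only [smul_sum]
    rw [integral_finsetSum J fun i hi => hρ.integrable_smul (.inr rfl) (h i hi).left,
      integral_finsetSum J fun i hi => hρ.integrable_smul (.inl rfl) (h i hi).right,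
      ← sum_neg_distrib]
    exact sum_congr rfl fun i hi => (h i hi).eq ρ hρ

lemma HasWeakDeriv.norm_integral_le (hT : 0 < T) (h : HasWeakDeriv T c r)
    (hK : ∀ t ∈ Ioo 0 T, ‖c t‖ ≤ K) : ‖∫ t in Ioo 0 T, r t‖ ≤ 2 * K := by
  obtain ⟨C, hC⟩ := h.exists_primitive hT
  set R : ℝ → ℂ := fun t => ∫ x in (0 : ℝ)..t, (Ioo 0 T).indicator r x with hR
  have hri : Integrable ((Ioo 0 T).indicator r) := (integrable_indicator_iff measurableSet_Ioo).2 h.right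
  have cR : Continuous R := intervalIntegral.continuous_primitive (fun a b => hri.intervalIntegrable) 0
  have hle : ∀ t ∈ Icc 0 T, ‖C + R t‖ ≤ K := by
    have := Measure.eqOn_Icc_of_ae_eq volume hT.ne (f := fun t => max ‖C + R t‖ K) (g := fun _ => K)
      (by
        rw [← restrict_Ioo_eq_restrict_Icc]
        filter_upwards [hC, ae_restrict_mem measurableSet_Ioo] with t h1 h2
        exact max_eq_right (by rw [← h1]; exact hK t h2))
      (by fun_prop) continuousOn_const
    exact fun t ht => max_eq_right_iff.1 (this ht)
  have e : ∫ t in Ioo 0 T, r t = (C + R T) - (C + R 0) := by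
    rw [hR]; simp only [intervalIntegral.integral_same, add_zero, add_sub_cancel_left]
    rw [intervalIntegral.integral_of_le hT.le, ← integral_indicator measurableSet_Ioo,
      setIntegral_eq_integral_of_forall_compl_eq_zero]
    exact fun t ht => indicator_of_notMem (fun h => ht (Ioo_subset_Ioc_self h)) _
  rw [e]
  exact (norm_sub_le _ _).trans (by linarith [hle T (right_mem_Icc.2 hT.le), hle 0 (left_mem_Icc.2 hT.le)])

section
variable (hs0 : 0 < s) (hγ : 0 ≤ γ) (hχ : IsCutoff χ) (n : ℕ) (k : ℤ³)
include hχ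

lemma continuous_psiD : Continuous fun Y : Ph => psiD s γ χ k Y.1 Y.2 := by
  have h1 : Continuous fun Y : Ph => jb Y.1 ^ (γ / (1 + 2 * s)) :=
    (continuous_jb_rpow _).comp continuous_fst
  have h2 : Continuous fun Y : Ph => jb Y.2 := continuous_jb.comp continuous_snd
  have h3 : Continuous fun Y : Ph => psiArg s γ k Y.1 Y.2 := (h1.mul h2).div_const _
  have h4 := hχ.smooth.continuous_deriv (by simp); have h5 := hχ.smooth.continuous; unfold psiD
  exact (h1.div_const _).mul ((continuous_const.mul (h5.comp h3)).add
    (((by fun_prop : Continuous fun Y : Ph => inner ℝ (freq k) Y.2 ^ 2).div (h2.pow 2)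
      fun Y => (pow_pos (jb_pos _) 2).ne').mul (h3.mul (h4.comp h3))))

include hs0 hγ hχ

lemma re_integral_psiCut : ∃ R : ℝ, 0 ≤ R ∧
    (∀ Y : Ph, R < ‖Y‖ → velCut n Y.1 * psi s γ χ k Y.1 Y.2 = 0) ∧ ∀ f : L2v,
    Integrable (fun Y => velCut n Y.1 * psiD s γ χ k Y.1 Y.2 * ‖winFun (wwin 0) f Y‖ ^ 2) ∧
    (I * ∫ Y, psiCut s γ χ n k Y * (conj (winFun (wwin 0) f Y) * winFun (kwin k R) f Y)).re =
      ∫ Y, velCut n Y.1 * psiD s γ χ k Y.1 Y.2 * ‖winFun (wwin 0) f Y‖ ^ 2 := by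
  set R₁ := 2 * jb (freq k) ^ (1 / (1 + 2 * s)); set R := max R₁ (exp (2 * (n + 1)))
  have hR : 0 ≤ R := (exp_pos _).le.trans (le_max_right _ _)
  have h0 : ∀ Y : Ph, R < ‖Y‖ → velCut n Y.1 * psi s γ χ k Y.1 Y.2 = 0 := fun Y hY => by
    rcases lt_max_iff.1 (Prod.norm_def Y ▸ hY) with h | h
    · rw [velCut_eq_zero ((le_max_right _ _).trans (h.le.trans (norm_le_jb _))), zero_mul]
    · have := (isLocSym_psi (k := k) hs0 hγ hχ).bdd Y.1 Y.2
      rw [ballInd, indicator_of_notMem fun h' => ((le_max_left _ _).trans_lt h).not_ge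
        (mem_closedBall_zero_iff.1 h'), mul_zero] at this
      rw [abs_nonpos_iff.1 this, mul_zero]
  have hv : Continuous fun Y : Ph => velCut n Y.1 := (continuous_velCut n).comp continuous_fst
  refine ⟨R, hR, h0, fun f => re_integral_kwin k hR (hv.mul (continuous_psi hχ))
    (hv.mul (continuous_psiD hχ k)) h0 (fun Y => ?_) f⟩
  have := (hasDerivAt_psi (s := s) (γ := γ) (k := k) hχ Y.1 Y.2).const_mul (velCut n Y.1)
  refine (this.congr_deriv (mul_left_comm _ _ _)).congr_of_eventuallyEq (.of_forall fun t => by simp)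

lemma IsTransportSolution.hasWeakDeriv_psiCut (hs1 : s ≤ 1) (hT : 0 < T)
    (hF : IsTransportSolution s γ w T h F) (hS : ∀ t ∈ Ioo 0 T, ‖h t‖ ≤ S) :
    HasWeakDeriv T (fun t => inn (coefX k (h t)) (wickOp (psiCut s γ χ n k) (coefX k (h t))))
      fun t => ((2 * ((F t (modeOp k (wickOp (psiCut s γ χ n k) (coefX k (h t))))).re -
        ∫ Y, velCut n Y.1 * psiD s γ χ k Y.1 Y.2 * ‖winFun (wwin 0) (coefX k (h t)) Y‖ ^ 2) : ℝ) : ℂ) := by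
  obtain ⟨R, hR, h0, hI⟩ := re_integral_psiCut hs0 hγ hχ n k
  have hc : Continuous fun Y : Ph => velCut n Y.1 * psi s γ χ k Y.1 Y.2 :=
    ((continuous_velCut n).comp continuous_fst).mul (continuous_psi hχ)
  refine (hF.hasWeakDeriv_wick hs0.le hs1 hγ hT hS k hR hc.measurable (Q := 4) (fun Y => ?_)
    h0).congr_right (.of_forall fun t => ?_)
  · rw [abs_mul, abs_of_nonneg (velCut_nonneg n _)]
    exact (mul_le_of_le_one_left pos! (velCut_le_one n _)).trans (abs_psi_le hs0 hχ _ _)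
  · rw [sub_re, ← (hI (coefX k (h t))).2]; rfl

end

/-- The density of the weighted norm of finitely many modes in phase space. -/
def lowDensity (s γ : ℝ) (n : ℕ) (J : Finset ℤ³) (u : L2xv) (Y : Ph) : ℝ≥0∞ :=
  ofR (velCut n Y.1) * ∑ k ∈ J, ofR (jb Y.1 ^ (γ / (1 + 2 * s)) *
    jb (freq k) ^ (2 * s / (1 + 2 * s))) * ‖winFun (wwin 0) (coefX k u) Y‖ₑ ^ 2

lemma ofReal_add_ofReal_neg_le {x y p : ℝ} (hx : 0 ≤ x) (hy : 0 ≤ y) (h : x ≤ p + y) :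
    ofR x + ofR (-p) ≤ ofR y + ofR p := by
  rcases le_total 0 p with hp | hp
  · rw [ofReal_of_nonpos (neg_nonpos.2 hp), add_zero, ← ofReal_add hy hp]
    exact ofReal_le_ofReal lin!
  · rw [ofReal_of_nonpos hp, add_zero, ← ofReal_add hx lin!]; exact ofReal_le_ofReal lin!

lemma sum_ofReal_mul_enorm_sq (J : Finset ι) {a : ι → ℝ} (ha : ∀ i ∈ J, 0 ≤ a i)
    (z : ι → ℂ) : ∑ i ∈ J, ofR (a i) * ‖z i‖ₑ ^ 2 = ofR (∑ i ∈ J, a i * ‖z i‖ ^ 2) := by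
  rw [ofReal_sum_of_nonneg fun i hi => mul_nonneg (ha i hi) (sq_nonneg _)]
  exact sum_congr rfl fun i hi => by rw [ofReal_mul (ha i hi), ofReal_norm_sq]

section
variable (hs0 : 0 < s) (hs1 : s < 1) (hγ : 0 ≤ γ) (hχ : IsCutoff χ) (hM0 : 0 ≤ M) (hM : ∀ r, |r * deriv χ r| ≤ M)
  (n : ℕ) (J : Finset ℤ³)
include hs0 hs1 hγ hχ hM0 hM

lemma lintegral_lowDensity_add_le (u : L2xv) :
    (∫⁻ Y, lowDensity s γ n J u Y) + ofR (-∑ k ∈ J, ∫ Y, velCut n Y.1 *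
      psiD s γ χ k Y.1 Y.2 * ‖winFun (wwin 0) (coefX k u) Y‖ ^ 2) ≤
    ofR ((M + 2) * (domNorm (γ / 2) ^ 2 + 3 * winLip (γ / 2) ^ 2 + 1)) *
      tripleNorm s γ u ^ 2 + ofR (∑ k ∈ J, ∫ Y, velCut n Y.1 *
      psiD s γ χ k Y.1 Y.2 * ‖winFun (wwin 0) (coefX k u) Y‖ ^ 2) := by
  have hi := fun k => (re_integral_psiCut hs0 hγ hχ n k).choose_spec.2.2 (coefX k u)
  have hp := integrable_finsetSum J fun k _ => (hi k).1
  set c := fun k => winFun (wwin 0) (coefX k u) with hc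
  rw [← integral_finsetSum J fun k _ => (hi k).1]
  have key := lintegral_add_ofReal_le (L := lowDensity s γ n J u) (A := fun Y => ∑ k ∈ J,
    ofR ((M + 2) * (jb Y.1 ^ γ * jb Y.2 ^ (2 * s))) * ‖c k Y‖ₑ ^ 2) hp.neg
    (.of_forall fun Y => ?_)
  · simp only [Pi.neg_apply, integral_neg, neg_neg] at key; refine key.trans (add_le_add_left ?_ _)
    have hm : ∀ k, AEMeasurable (fun Y : Ph =>
        ofR ((M + 2) * (jb Y.1 ^ γ * jb Y.2 ^ (2 * s))) * ‖c k Y‖ₑ ^ 2) := fun k =>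
      (((((continuous_jb_rpow γ).comp continuous_fst).mul ((continuous_jb_rpow (2 * s)).comp
        continuous_snd)).const_mul (M + 2)).measurable.ennreal_ofReal.mul
        ((stronglyMeasurable_winFun (isWin_wwin 0) _).measurable.enorm.pow_const 2)).aemeasurable
    rw [lintegral_finsetSum' J fun k _ => hm k, tripleNorm_sq hs0.le]
    refine le_trans (sum_le_sum fun k _ => ?_) ((ENNReal.sum_le_tsum J).trans_eq
      ENNReal.tsum_mul_left)
    rw [ofReal_mul pos!, mul_assoc]
    simp only [ofReal_mul (show 0 ≤ M + 2 by positivity), mul_assoc]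
    rw [lintegral_const_mul' _ _ ofReal_ne_top]
    exact mul_le_mul_right (lintegral_weight_jb_winFun_le hs0 hs1 _) _
  · have h0 : ∀ k, 0 ≤ velCut n Y.1 * (jb Y.1 ^ (γ / (1 + 2 * s)) *
        jb (freq k) ^ (2 * s / (1 + 2 * s))) := fun k => mul_nonneg (velCut_nonneg n _)
      (mul_nonneg (jb_rpow_pos _ _).le (jb_rpow_pos _ _).le)
    have e := sum_ofReal_mul_enorm_sq J (a := fun k => velCut n Y.1 * (jb Y.1 ^ (γ / (1 + 2 * s)) *
      jb (freq k) ^ (2 * s / (1 + 2 * s)))) (fun k _ => h0 k) fun k => c k Y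
    have hJ := mul_nonneg (jb_rpow_pos γ Y.1).le (jb_rpow_pos (2 * s) Y.2).le
    simp only [ofReal_mul (velCut_nonneg n Y.1), mul_assoc] at e
    rw [lowDensity, mul_sum, e, sum_ofReal_mul_enorm_sq J (a := fun _ => _)
      (fun k _ => by positivity)]
    simp only [Pi.neg_apply, neg_neg]
    refine ofReal_add_ofReal_neg_le (sum_nonneg fun k _ => ?_)
      (sum_nonneg fun k _ => by positivity) ?_
    · simpa only [mul_assoc] using mul_nonneg (h0 k) (sq_nonneg ‖c k Y‖)
    rw [← sum_add_distrib]; refine sum_le_sum fun k _ => ?_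
    have h1 := le_psiD (γ := γ) (k := k) hs0 hχ hM0 hM Y.1 Y.2
    have h2 := one_le_mul_of_one_le_of_one_le (one_le_jb_rpow hγ Y.1)
      (one_le_jb_rpow (mul_pos two_pos hs0).le Y.2)
    have h3 := velCut_nonneg n Y.1; have h4 := velCut_le_one n Y.1
    rw [← mul_assoc (jb Y.1 ^ _), ← mul_assoc (velCut n Y.1), ← add_mul]
    refine mul_le_mul_of_nonneg_right ?_ pos!
    have h5 : 0 ≤ (M + 2) * (jb Y.1 ^ γ * jb Y.2 ^ (2 * s)) := by positivity
    have h6 := mul_le_of_le_one_left h5 h4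
    have h7 := mul_le_mul_of_nonneg_left (h1.trans (show _ ≤ psiD s γ χ k Y.1 Y.2 +
      (M + 2) * (jb Y.1 ^ γ * jb Y.2 ^ (2 * s)) by linarith)) h3
    linarith

lemma IsTransportSolution.lintegral_lowDensity_le (hT : 0 < T) (hF : IsTransportSolution s γ w T h F)
    (hS : ∀ t ∈ Ioo 0 T, ‖h t‖ ≤ S) {P : L2xv →L[ℂ] L2xv}
    (hP : ∀ u, P u = ∑ k ∈ J, modeOp k (wickOp (psiCut s γ χ n k) (coefX k u)))
    (hK0 : 0 ≤ K) (hK : ∀ u, ‖P u‖ ≤ K * ‖u‖) :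
    ∫⁻ t in Ioo 0 T, ∫⁻ Y, lowDensity s γ n J (h t) Y ≤ ofR (K * S ^ 2) +
      ofR ((M + 2) * (domNorm (γ / 2) ^ 2 + 3 * winLip (γ / 2) ^ 2 + 1)) *
        (∫⁻ t in Ioo 0 T, tripleNorm s γ (h t) ^ 2) + ∫⁻ t in Ioo 0 T, ‖F t (P (h t))‖ₑ := by
  have hd := HasWeakDeriv.sum J fun k _ => hF.hasWeakDeriv_psiCut hs0 hγ hχ n k hs1.le hT hS
  set G : ℝ → ℝ := fun t => ∑ k ∈ J, ∫ Y, velCut n Y.1 *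
      psiD s γ χ k Y.1 Y.2 * ‖winFun (wwin 0) (coefX k (h t)) Y‖ ^ 2 with hG
  set r : ℝ → ℝ := fun t => (F t (P (h t))).re - G t with hr
  have e1 : (fun t => ∑ k ∈ J, ((2 * ((F t (modeOp k (wickOp (psiCut s γ χ n k)
      (coefX k (h t))))).re - ∫ Y, velCut n Y.1 * psiD s γ χ k Y.1 Y.2 *
        ‖winFun (wwin 0) (coefX k (h t)) Y‖ ^ 2) : ℝ) : ℂ)) = fun t => ((2 * r t : ℝ) : ℂ) := by
    funext t; rw [← ofReal_sum, ← mul_sum, sum_sub_distrib]; simp only [hr, hP, map_sum, re_sum, hG]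
  rw [e1] at hd
  have hri : IntegrableOn r (Ioo 0 T) := by
    have := (Integrable.re hd.right).const_mul (1 / 2)
    exact this.congr (.of_forall fun t => by simp)
  have hb := hd.norm_integral_le hT (K := K * S ^ 2) fun t ht => by
    have e2 : ∑ k ∈ J, inn (coefX k (h t)) (wickOp (psiCut s γ χ n k) (coefX k (h t))) =
        inn (h t) (P (h t)) := by
      rw [hP, inner_sum]; refine sum_congr rfl fun k _ => ?_
      rw [← inner_conj_symm, inner_coefX, inner_conj_symm]
    rw [e2]; have h1 := hS t ht; have h2 := hK (h t)
    calc _ ≤ ‖h t‖ * (K * ‖h t‖) := (norm_inner_le_norm _ _).trans (by gcongr)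
      _ ≤ S * (K * S) := by gcongr; exact (norm_nonneg _).trans h1
      _ = _ := by ring
  rw [integral_complex_ofReal, integral_const_mul, norm_real, norm_mul, norm_ofNat,
    mul_le_mul_iff_right₀ two_pos] at hb
  have key := lintegral_add_ofReal_le (L := fun t => ∫⁻ Y, lowDensity s γ n J (h t) Y)
    (A := fun t => ofR ((M + 2) * (domNorm (γ / 2) ^ 2 + 3 * winLip (γ / 2) ^ 2 + 1)) *
      tripleNorm s γ (h t) ^ 2 + ofR |(F t (P (h t))).re|) hri
    (.of_forall fun t => add_ofReal_le_of_add_ofReal_le _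
      (lintegral_lowDensity_add_le hs0 hs1 hγ hχ hM0 hM n J (h t)))
  have hm := ((aemeasurable_norms hs0.le hγ w hF.meas).1.pow_const 2).const_mul
    (ofR ((M + 2) * (domNorm (γ / 2) ^ 2 + 3 * winLip (γ / 2) ^ 2 + 1)))
  rw [lintegral_add_left' hm, lintegral_const_mul' _ _ ofReal_ne_top] at key
  refine le_self_add.trans (key.trans ?_); rw [add_comm, ← add_assoc]; gcongr
  · exact (neg_le_abs _).trans hb
  · rw [← ofReal_norm]; exact ofReal_le_ofReal (abs_re_le_norm _)

end

/-! ### Passage to the limit -/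

lemma le_mul_of_sq_le {x y c : ℝ≥0∞} (hc : 1 ≤ c) (h : x ^ 2 ≤ c * y ^ 2) : x ≤ c * y :=
  enorm_le_of_sq_le (h.trans (by
    rw [mul_pow]; exact mul_le_mul_left (le_self_pow₀ hc two_ne_zero) _))

lemma tendsto_zero_of_sq {f : ℕ → ℝ≥0∞} (h : Tendsto (fun n => f n ^ 2) atTop (nhds 0)) :
    Tendsto f atTop (nhds 0) := by
  have := ((continuous_rpow_const (y := 1 / 2)).tendsto 0).comp h
  rw [zero_rpow_of_pos num!] at this; refine this.congr fun n => ?_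
  rw [Function.comp_apply, ← ENNReal.rpow_natCast, ← ENNReal.rpow_mul]; norm_num

lemma IsTransportSolution.exists_source_limit (hs0 : 0 < s) (hs1 : s < 1) (hγ : 0 ≤ γ)
    (hF : IsTransportSolution s γ w T h F) (hS : ∀ t ∈ Ioo 0 T, ‖h t‖ ≤ S)
    {q : ℕ → ℤ³ → Ph → ℂ} (hq : ∀ n k, IsSym (q n k) Q)
    (hlim : ∀ k Y, Tendsto (fun n => q n k Y) atTop (nhds 0))
    {D : ℕ → L2xv →L[ℂ] L2xv} (hD : ∀ n u k, coefX k (D n u) = wickOp (q n k) (coefX k u)) :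
    ∃ b : ℕ → ℝ → ℝ≥0∞, (∀ n, AEMeasurable (b n) (volT T)) ∧
      (∀ n, ∀ᵐ t ∂volT T, ‖F t (D n (h t))‖ₑ ≤ b n t) ∧
      Tendsto (fun n => ∫⁻ t in Ioo 0 T, b n t) atTop (nhds 0) := by
  obtain ⟨m₀, m₁, h0, h1, i0, i1, hb⟩ := hF.source_bound
  have hm : ∀ n, AEStronglyMeasurable (fun t => D n (h t)) (volT T) := fun n =>
    (D n).continuous.comp_aestronglyMeasurable hF.meas
  have hN := fun n => aemeasurable_norms hs0.le hγ w (hm n)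
  have hN0 := aemeasurable_norms hs0.le hγ w hF.meas
  have hfin : ∀ᵐ t ∂volT T, tripleNorm s γ (h t) < ⊤ ∧ weightNorm w (h t) < ⊤ := by
    filter_upwards [ae_lt_top' (f := fun t => (tripleNorm s γ (h t) + weightNorm w (h t)) ^ 2)
      ((hN0.1.add hN0.2).pow_const 2) hF.energy.ne] with t ht
    rw [pow_lt_top_iff, add_lt_top] at ht; simpa using ht
  set c₁ := 2 * symC (-(γ / 2)) (γ / 2) Q; set c₂ := symC (-w) w Q; set c₀ := symC 0 0 Q
  have hc₁ : 1 ≤ c₁ := (one_le_symC _ _ _).trans (le_mul_of_one_le_left' one_le_two)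
  have hct : c₁ + c₂ ≠ ⊤ := by simp [c₁, c₂, symC, mul_eq_top]
  have hc0 : c₀ * ofR S ≠ ⊤ := mul_ne_top ofReal_ne_top ofReal_ne_top
  have hb1 := fun n t => le_mul_of_sq_le hc₁
    (tripleNorm_sq_diagonal_le (hq n) (hD n) hs0 hs1 γ (h t))
  have hb2 := fun n t => le_mul_of_sq_le (one_le_symC _ _ _)
    (weightNorm_sq_diagonal_le (hq n) (hD n) w (h t))
  have hb0 := fun n t => le_mul_of_sq_le (one_le_symC _ _ _)
    (enorm_sq_diagonal_le (hq n) (hD n) (h t))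
  refine ⟨fun n t => m₀ t * ‖D n (h t)‖ₑ +
    m₁ t * (tripleNorm s γ (D n (h t)) + weightNorm w (D n (h t))), fun n =>
    (h0.coe_nnreal_ennreal.mul (hm n).enorm).add
      (h1.coe_nnreal_ennreal.mul ((hN n).1.add (hN n).2)), fun n => ?_, ?_⟩
  · filter_upwards [hb, hfin] with t ht hf
    exact ht _ ((hb1 n t).trans_lt (mul_lt_top (by simp [c₁, symC, mul_lt_top_iff]) hf.1))
      ((hb2 n t).trans_lt (mul_lt_top ofReal_lt_top hf.2))
  · rw [← lintegral_zero (μ := volT T)]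
    refine tendsto_lintegral_of_dominated_convergence' (fun t => c₀ * ofR S * m₀ t +
      (c₁ + c₂) * ((m₁ t : ℝ≥0∞) ^ 2 + (tripleNorm s γ (h t) + weightNorm w (h t)) ^ 2))
      (fun n => (h0.coe_nnreal_ennreal.mul (hm n).enorm).add
        (h1.coe_nnreal_ennreal.mul ((hN n).1.add (hN n).2))) (fun n => ?_) ?_ ?_
    · filter_upwards [ae_restrict_mem measurableSet_Ioo] with t ht
      have hS' : ‖h t‖ₑ ≤ ofR S := by rw [← ofReal_norm]; exact ofReal_le_ofReal (hS t ht)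
      refine add_le_add ?_ ?_
      · rw [mul_comm]; gcongr; exact (hb0 n t).trans (by gcongr)
      · set N := tripleNorm s γ (h t) + weightNorm w (h t)
        have e1 : tripleNorm s γ (D n (h t)) + weightNorm w (D n (h t)) ≤ (c₁ + c₂) * N := by
          refine (add_le_add (hb1 n t) (hb2 n t)).trans ?_
          refine (add_le_add (mul_le_mul_right le_self_add c₁)
            (mul_le_mul_right le_add_self c₂)).trans_eq (add_mul _ _ _).symm
        refine (mul_le_mul_right e1 _).trans ?_; rw [mul_left_comm]; refine mul_le_mul_right ?_ _
        rcases le_total (m₁ t : ℝ≥0∞) N with h | h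
        · exact (mul_le_mul_left h _).trans ((sq N).symm.trans_le le_add_self)
        · exact (mul_le_mul_right h _).trans ((sq _).symm.trans_le le_self_add)
    · rw [lintegral_add_left' (h0.coe_nnreal_ennreal.const_mul _), lintegral_const_mul' _ _ hc0,
        lintegral_const_mul' _ _ hct, lintegral_add_left' (h1.coe_nnreal_ennreal.pow_const 2)]
      exact add_ne_top.2 ⟨mul_ne_top hc0 i0.ne, mul_ne_top hct (add_ne_top.2 ⟨i1.ne, hF.energy.ne⟩)⟩
    · filter_upwards [hfin] with t ht
      have l0 := tendsto_zero_of_sq (tendsto_norm_diagonal hq hlim hD (h t))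
      have l1 := tendsto_zero_of_sq (tendsto_tripleNorm_diagonal hq hlim hD hs0 hs1 γ ht.1)
      have l2 := tendsto_zero_of_sq (tendsto_weightNorm_diagonal hq hlim hD w ht.2)
      have := (ENNReal.Tendsto.const_mul (a := m₀ t) l0 (.inr coe_ne_top)).add
        (ENNReal.Tendsto.const_mul (a := m₁ t) (l1.add l2) (.inr coe_ne_top))
      simpa using this

lemma measurable_lowDensity_term (s γ : ℝ) (k : ℤ³) (u : L2xv) :
    Measurable fun Y : Ph => ofR (jb Y.1 ^ (γ / (1 + 2 * s)) *
      jb (freq k) ^ (2 * s / (1 + 2 * s))) * ‖winFun (wwin 0) (coefX k u) Y‖ₑ ^ 2 :=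
  ((((continuous_jb_rpow _).comp continuous_fst).mul continuous_const).measurable.ennreal_ofReal).mul
    ((stronglyMeasurable_winFun (isWin_wwin 0) _).measurable.enorm.pow_const 2)

lemma measurable_ofReal_velCut (n : ℕ) : Measurable fun Y : Ph => ofR (velCut n Y.1) :=
  ((continuous_velCut n).comp continuous_fst).measurable.ennreal_ofReal

lemma aemeasurable_lintegral_lowDensity (hs : 0 < s) (hγ : 0 ≤ γ) (n : ℕ)
    (J : Finset ℤ³) {μ : Measure ℝ} (hm : AEStronglyMeasurable h μ) :
    AEMeasurable (fun t => ∫⁻ Y, lowDensity s γ n J (h t) Y) μ := by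
  set q : ℤ³ → Ph → ℂ := fun k Y => (√(velCut n Y.1 * (jb Y.1 ^ (γ / (1 + 2 * s)) *
    jb (freq k) ^ (2 * s / (1 + 2 * s)))) : ℂ) with hq
  have hqm : ∀ k, Measurable (q k) := fun k => by
    have h1 : Continuous fun Y : Ph => velCut n Y.1 := (continuous_velCut n).comp continuous_fst
    have h2 : Continuous fun Y : Ph => jb Y.1 ^ (γ / (1 + 2 * s)) :=
      (continuous_jb_rpow _).comp continuous_fst
    exact (continuous_ofReal.comp (h1.mul (h2.mul continuous_const)).sqrt).measurable
  have hqb : ∀ k Y, ‖q k Y‖ ≤ √(exp (2 * (n + 1)) ^ (γ / (1 + 2 * s)) *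
      jb (freq k) ^ (2 * s / (1 + 2 * s))) := fun k Y => by
    rw [hq, norm_real, norm_of_nonneg (sqrt_nonneg _)]; refine sqrt_le_sqrt ?_
    have h1 := (jb_rpow_pos (2 * s / (1 + 2 * s)) (freq k)).le; have h2 := jb_pos Y.1
    rcases le_or_gt (exp (2 * (n + 1))) (jb Y.1) with h | h
    · rw [velCut_eq_zero h, zero_mul]; positivity
    · refine (mul_le_of_le_one_left pos! (velCut_le_one n _)).trans ?_; gcongr
  have e : ∀ t, ∫⁻ Y, lowDensity s γ n J (h t) Y =
      ∑ k ∈ J, ‖mulOp volume (q k) (winOp (wwin 0) (coefX k (h t)))‖ₑ ^ 2 := fun t => by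
    simp only [lowDensity, mul_sum]
    refine (lintegral_finsetSum J (f := fun k (Y : Ph) => ofR (velCut n Y.1) *
      (ofR (jb Y.1 ^ (γ / (1 + 2 * s)) * jb (freq k) ^ (2 * s / (1 + 2 * s))) *
        ‖winFun (wwin 0) (coefX k (h t)) Y‖ₑ ^ 2)) fun k _ => (measurable_ofReal_velCut n).mul
      (measurable_lowDensity_term s γ k (h t))).trans ?_
    refine sum_congr rfl fun k _ => ?_; rw [enorm_sq_mulOp (hqm k) (hqb k)]
    refine lintegral_congr_ae ?_
    filter_upwards [coeFn_winOp (isWin_wwin 0) (coefX k (h t))] with Y hY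
    have h1 := (jb_rpow_pos (2 * s / (1 + 2 * s)) (freq k)).le; have h2 := jb_pos Y.1
    have h3 := velCut_nonneg n Y.1
    rw [hY, ← mul_assoc, ← ofReal_mul h3, ← ofReal_norm_sq (q k Y), norm_real,
      norm_of_nonneg (sqrt_nonneg _), sq_sqrt pos!]
  simp_rw [e]
  exact aemeasurable_fun_sum J fun k _ => ((((mulOp volume (q k)).comp (winOp (wwin 0))).comp
    (coefX k)).continuous.comp_aestronglyMeasurable hm).enorm.pow_const 2

lemma weightDxSq_le_liminf (hs : 0 < s) (hγ : 0 ≤ γ) {J : ℕ → Finset ℤ³}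
    (hJ : Tendsto J atTop atTop) (u : L2xv) :
    weightDxSq (γ / (2 * (1 + 2 * s))) (s / (1 + 2 * s)) u ≤
      liminf (fun n => ∫⁻ Y, lowDensity s γ n (J n) u Y) atTop := by
  set X : ℤ³ → Ph → ℝ≥0∞ := fun k Y => ofR (jb Y.1 ^ (γ / (1 + 2 * s)) *
    jb (freq k) ^ (2 * s / (1 + 2 * s))) * ‖winFun (wwin 0) (coefX k u) Y‖ₑ ^ 2
  have hX := fun k => measurable_lowDensity_term s γ k u
  have h1 : weightDxSq (γ / (2 * (1 + 2 * s))) (s / (1 + 2 * s)) u ≤ ∫⁻ Y, ∑' k, X k Y := by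
    rw [weightDxSq_eq, lintegral_tsum fun k => (hX k).aemeasurable]
    refine ENNReal.tsum_le_tsum fun k => ?_
    rw [show 2 * (γ / (2 * (1 + 2 * s))) = γ / (1 + 2 * s) by field_simp,
      show 2 * (s / (1 + 2 * s)) = 2 * s / (1 + 2 * s) by ring]
    refine (mul_le_mul_right (lintegral_weight_le_winFun pos! _) _).trans_eq ?_
    rw [← lintegral_const_mul' _ _ ofReal_ne_top]; refine lintegral_congr fun Y => ?_
    rw [mul_comm (jb Y.1 ^ _), ofReal_mul (jb_rpow_pos _ _).le, mul_assoc]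
  have h2 : ∀ Y, ∑' k, X k Y = liminf (fun n => lowDensity s γ n (J n) u Y) atTop := fun Y => by
    have l1 := (ENNReal.continuous_ofReal.tendsto _).comp (tendsto_velCut Y.1)
    rw [ofReal_one] at l1
    have := ENNReal.Tendsto.mul l1 (.inl one_ne_zero)
      ((ENNReal.summable (f := fun k => X k Y)).hasSum.comp hJ) (.inr one_ne_top)
    rw [one_mul] at this; exact this.liminf_eq.symm
  refine h1.trans ?_; simp_rw [h2]
  exact lintegral_liminf_le fun n => (measurable_ofReal_velCut n).mul
    (Finset.measurable_fun_sum (J n) fun k _ => hX k)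

lemma wick_congr_ae (q : Vel → Vel → ℝ) (h : f =ᵐ[volume] g) : wick q f = wick q g := by
  funext v; refine integral_congr_ae ?_; filter_upwards [h] with v' h'; rw [h']

lemma IsTransportSolution.lintegral_weightDxSq_le (hs0 : 0 < s)
    (hs1 : s < 1) (hγ : 0 ≤ γ) (hχ : IsCutoff χ) (hM0 : 0 ≤ M)
    (hM : ∀ r, |r * deriv χ r| ≤ M) (hQ0 : 0 ≤ Q) (hQ : ∀ k, IsSym (psiY s γ χ k) Q)
    (hQn : ∀ n k, IsSym (psiCut s γ χ n k) Q) {P : L2xv →L[ℂ] L2xv}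
    (hP : ∀ u k, coefX k (P u) = wickOp (psiY s γ χ k) (coefX k u)) (hT : 0 < T) (hF : IsTransportSolution s γ w T h F)
    (hS : ∀ t ∈ Ioo 0 T, ‖h t‖ ≤ S) :
    ∫⁻ t in Ioo 0 T, weightDxSq (γ / (2 * (1 + 2 * s))) (s / (1 + 2 * s)) (h t) ≤
      ofR ((symC 0 0 Q).toReal * S ^ 2) +
      ofR ((M + 2) * (domNorm (γ / 2) ^ 2 + 3 * winLip (γ / 2) ^ 2 + 1)) *
        (∫⁻ t in Ioo 0 T, tripleNorm s γ (h t) ^ 2) + ∫⁻ t in Ioo 0 T, ‖F t (P (h t))‖ₑ := by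
  classical
  obtain ⟨J, hJ⟩ := exists_seq_tendsto (atTop : Filter (Finset ℤ³))
  set q : ℕ → ℤ³ → Ph → ℂ := fun n k => if k ∈ J n then psiCut s γ χ n k else
    fun _ => 0 with hq
  have hqs : ∀ n k, IsSym (q n k) Q := fun n k => by
    simp only [hq]
    split_ifs
    exacts [hQn n k, isSym_zero hQ0]
  choose D hD using fun n => exists_diagonal_wick (hqs n)
  have hDP : ∀ n u k, coefX k ((D n - P) u) =
      wickOp (fun Y => q n k Y - psiY s γ χ k Y) (coefX k u) := fun n u k => by
    rw [sub_apply, map_sub, hD, hP, wickOp_sub (hqs n k) (hQ k)]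
  have hDs : ∀ n u, D n u = ∑ k ∈ J n, modeOp k (wickOp (psiCut s γ χ n k) (coefX k u)) :=
    fun n u => ext_coefX fun l => by
    have h0 := wickOp_sub (isSym_zero hQ0) (isSym_zero hQ0) (coefX l u)
    simp only [sub_self] at h0
    rw [hD, map_sum]
    simp only [coefX_modeOp, hq]
    rw [sum_ite_eq]
    split_ifs <;> simp [← h0]
  have hlim : ∀ k Y, Tendsto (fun n => q n k Y - psiY s γ χ k Y) atTop (nhds 0) :=
    fun k Y => by
    have h1 := ((tendsto_velCut Y.1).mul_const (psi s γ χ k Y.1 Y.2)).ofReal.sub_const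
      (psiY s γ χ k Y)
    rw [one_mul, psiY, sub_self] at h1
    refine h1.congr' ?_
    filter_upwards [hJ.eventually_ge_atTop {k}] with n hn
    simp only [hq, if_pos (Finset.singleton_subset_iff.1 hn), psiCut, psiY]
  have hfin : symC 0 0 Q ≠ ⊤ := ofReal_ne_top
  have hK : ∀ n u, ‖D n u‖ ≤ (symC 0 0 Q).toReal * ‖u‖ := fun n u => by
    have := toReal_mono (mul_ne_top hfin (by simp))
      (le_mul_of_sq_le (one_le_symC _ _ _) (enorm_sq_diagonal_le (hqs n) (hD n) u))
    simpa using this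
  obtain ⟨b, hbm, hb, hb0⟩ := hF.exists_source_limit hs0 hs1 hγ hS
    (fun n k => (hqs n k).sub (hQ k)) hlim hDP
  set A := ofR ((symC 0 0 Q).toReal * S ^ 2) +
      ofR ((M + 2) * (domNorm (γ / 2) ^ 2 + 3 * winLip (γ / 2) ^ 2 + 1)) *
        (∫⁻ t in Ioo 0 T, tripleNorm s γ (h t) ^ 2)
  have key : ∀ n, ∫⁻ t in Ioo 0 T, ∫⁻ Y, lowDensity s γ n (J n) (h t) Y ≤
      A + (∫⁻ t in Ioo 0 T, ‖F t (P (h t))‖ₑ) + ∫⁻ t in Ioo 0 T, b n t := fun n => by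
    refine (hF.lintegral_lowDensity_le hs0 hs1 hγ hχ hM0 hM n (J n) hT hS (hDs n)
      toReal_nonneg (hK n)).trans ?_
    rw [add_assoc A, ← lintegral_add_right' _ (hbm n)]
    refine add_le_add le_rfl ?_
    refine lintegral_mono_ae ?_
    filter_upwards [hb n] with t ht
    have : F t (D n (h t)) = F t (P (h t)) + F t ((D n - P) (h t)) := by
      rw [← map_add, sub_apply, add_sub_cancel]
    rw [this]
    exact (enorm_add_le _ _).trans (by gcongr)
  refine (lintegral_mono fun t => weightDxSq_le_liminf hs0 hγ hJ (h t)).trans <|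
    (lintegral_liminf_le' fun n =>
      aemeasurable_lintegral_lowDensity hs0 hγ n (J n) hF.meas).trans ?_
  refine (liminf_le_liminf (.of_forall key)).trans_eq ?_
  have := hb0.const_add (A + ∫⁻ t in Ioo 0 T, ‖F t (P (h t))‖ₑ)
  rw [add_zero] at this
  exact this.liminf_eq

end

end KineticHypo

open KineticHypo

theorem mainTheorem4 (s γ : ℝ) (hs0 : 0 < s) (hs1 : s < 1) (hγ : 0 ≤ γ)
    (χ : ℝ → ℝ) (hχ : ContDiff ℝ ∞ χ) (hχ01 : ∀ r, χ r ∈ Set.Icc (0 : ℝ) 1)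
    (hχ1 : ∀ r ∈ Set.Icc (-1 : ℝ) 1, χ r = 1) (hχ2 : tsupport χ ⊆ Set.Icc (-2 : ℝ) 2) :
    ∃ (P : L2xv →L[ℂ] L2xv) (C : ℝ≥0), (∀ (u : L2xv) (k : Fin 3 → ℤ),
        fourierX (P u) k =ᵐ[volume] wick (psi s γ χ k) (fourierX u k)) ∧
      (∀ u : L2xv, ‖P u‖ ≤ C * ‖u‖) ∧
      (∀ u : L2xv, tripleNorm s γ (P u) ≤ C * tripleNorm s γ u) ∧
      ∀ (w T : ℝ) (h : ℝ → L2xv) (F : ℝ → L2xv →ₗ⋆[ℂ] ℂ), 0 < T → IsTransportSolution s γ w T h F →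
        (∫⁻ t in Set.Ioo 0 T, weightDxSq (γ / (2 * (1 + 2 * s))) (s / (1 + 2 * s)) (h t)) ≤
          C * (⨆ t ∈ Set.Icc 0 T, ‖h t‖ₑ) ^ 2 +
          C * (∫⁻ t in Set.Ioo 0 T, tripleNorm s γ (h t) ^ 2) +
          (∫⁻ t in Set.Ioo 0 T, ‖F t (P (h t))‖ₑ) := by
  have hX : IsCutoff χ := ⟨hχ, hχ01, hχ1, hχ2⟩
  obtain ⟨M, hM0, hM⟩ := exists_bound_mul_deriv hχ hX.hasCompactSupport
  obtain ⟨Q, hQ4, hQ, hQn⟩ := exists_isSym hs0 hγ hX; obtain ⟨P, hP⟩ := exists_diagonal_wick hQ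
  set c₀ := symC 0 0 Q with hc₀; set c₁ := 2 * symC (-(γ / 2)) (γ / 2) Q with hc₁
  set c₂ := ENNReal.ofReal ((M + 2) * (domNorm (γ / 2) ^ 2 + 3 * winLip (γ / 2) ^ 2 + 1)) with hc₂
  have hfin : c₀ + c₁ + c₂ ≠ ⊤ := by simp [hc₀, hc₁, hc₂, symC, ENNReal.mul_eq_top]
  have h1 : 1 ≤ c₁ := (one_le_symC _ _ _).trans (le_mul_of_one_le_left' one_le_two)
  obtain ⟨C, hC⟩ : ∃ C : ℝ≥0, (C : ℝ≥0∞) = c₀ + c₁ + c₂ := ⟨_, ENNReal.coe_toNNReal hfin⟩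
  have hC0 : c₀ ≤ C := hC ▸ le_self_add.trans le_self_add
  have hC1 : c₁ ≤ C := hC ▸ le_add_self.trans le_self_add; have hC2 : c₂ ≤ C := hC ▸ le_add_self
  refine ⟨P, C, fun u k => ?_, fun u => ?_, fun u => ?_, fun w T h F hT hF => ?_⟩
  · rw [← wick_congr_ae _ (coeFn_coefX k u)]; refine (coeFn_coefX k (P u)).symm.trans ?_; rw [hP]
    exact (wick_ae_eq (isLocSym_psi hs0 hγ hX) _).symm
  · have := ENNReal.toReal_mono (ENNReal.mul_ne_top ENNReal.coe_ne_top (by simp))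
      ((le_mul_of_sq_le (one_le_symC _ _ _) (enorm_sq_diagonal_le hQ hP u)).trans
        (mul_le_mul_left hC0 _))
    simpa using this
  · exact (le_mul_of_sq_le h1 (tripleNorm_sq_diagonal_le hQ hP hs0 hs1 γ u)).trans
      (mul_le_mul_left hC1 _)
  · set S := ⨆ t ∈ Set.Icc 0 T, ‖h t‖ₑ with hS; rcases eq_or_ne S ⊤ with hS' | hS'
    · rw [hS', ENNReal.top_pow two_ne_zero, ENNReal.mul_top, top_add, top_add]
      · exact le_top
      · exact (zero_lt_one.trans_le (h1.trans hC1)).ne'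
    have hh : ∀ t ∈ Set.Ioo 0 T, ‖h t‖ ≤ S.toReal := fun t ht => by
      rw [← toReal_enorm]
      exact ENNReal.toReal_mono hS' (le_iSup₂ (f := fun t _ => ‖h t‖ₑ) t (Set.Ioo_subset_Icc_self ht))
    refine (hF.lintegral_weightDxSq_le hs0 hs1 hγ hX hM0 hM (by linarith) hQ hQn hP hT hh).trans ?_
    rw [ENNReal.ofReal_mul ENNReal.toReal_nonneg, ENNReal.ofReal_toReal (show symC 0 0 Q ≠ ⊤ from ENNReal.ofReal_ne_top),
      ENNReal.ofReal_pow ENNReal.toReal_nonneg, ENNReal.ofReal_toReal hS']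
    gcongr
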